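/- **Setup.** Let $d,m\ge 1$, let $X\in\mathbb R^{d\times m}$, $Y\in\mathbb R^{1\times m}$, and consider the two-layer linear network with weights $W=(W_2,W_1)$, $W_1\in\mathbb R^{d\times d}$, $W_2=[w_{21},\dots,w_{2d}]\in\mathbb R^{1\times d}$, with the loss $L(W)=\frac1{2m}\|W_2W_1X-Y\|_F^2$. Put $\Lambda=\frac1mXX^\top$ and $A=\frac1mYX^\top\in\mathbb R^{1\times d}$. Assume that $\Lambda=I_d$ and that $a_{\rm lo}\le A_j\le a_{\rm hi}$ for all $j$, with constants $a_{\rm lo},a_{\rm hi}>0$, and let $\bar L(W)=\frac12\|W_2W_1-A\|^2$. For a weight vector $W$ and $k=1,2$ let $R_{{\rm med},k}(W)$ be the largest absolute value divided by the median absolute value among the diagonal entries of the Hessian of $L$ at $W$ with respect to $W_k$ ($d^2$ entries for $k=1$, $d$ entries for $k=2$). At time $0$ the entries of the weights are independent, with $w_{2i}\sim N(0,d^{-2\alpha})$ and $W_1[i,j]\sim N(0,d^{-4\alpha})$. At step $t$ an algorithm uses the gradient $\tilde g^{(t)}$, at $W^{(t)}$, of the loss on a random mini-batch; the noise level of the mini-batches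 is $\sigma\geq 0$ if at every step the batch versions of $A$ and $\Lambda$ are unbiased and all their entries have variance at most $\sigma^2$. All operations on weights below are entrywise. * *SGD with momentum (SGD+M)*: $u^{(0)}=0$, $u^{(t+1)}=\beta u^{(t)}+\tilde g^{(t)}$, $W^{(t+1)}=W^{(t)}-\eta\,u^{(t+1)}$. * *Adam*: $m^{(0)}=v^{(0)}=0$, $m^{(t+1)}=\beta_1m^{(t)}+(1-\beta_1)\tilde g^{(t)}$, $v^{(t+1)}=\beta_2v^{(t)}+(1-\beta_2)\,\tilde g^{(t)}\odot\tilde g^{(t)}$, $W^{(t+1)}=W^{(t)}-\eta_t\,\dfrac{m^{(t+1)}}{\sqrt{v^{(t+1)}}+\xi}$, where $\eta_t=\eta\,\dfrac{\sqrt{1-\beta_2^{t+1}}}{1-\beta_1^{t+1}}$. **Statement.** Let $p>0$, $\alpha\ge 4(p+2)$ and $\alpha\ge\frac{p+4}3$, $\beta,\beta_1\in(0,1)$, $\beta_2=\beta_1^2$, and let $C_S,C_A>0$. There are constants $\kappa,c,K>0$ and $k_0,d_0\in\mathbb N$, depending only on $p,\alpha,\beta,\beta_1,a_{\rm lo},a_{\rm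 hi},C_S,C_A$, such that the following holds for all $d\ge d_0$ and all data as above. Run SGD+M with learning rate $\eta_S$ and noise level $\sigma_S$, and Adam with learning rate $\eta_A$, parameter $\xi$ and noise level $\sigma_A$, each from an initialization as above, where for some $\epsilon$ $$0<\epsilon<d^{-p},\qquad 0<\eta_S\le C_S\,\frac{\epsilon}{d^{7\alpha/4+4}},\qquad 0\le\sigma_S\le\frac{\eta_S^{3/2}}{d^{\alpha/2+1}},$$ $$0<\eta_A\le \frac{C_A}{d^{3\alpha}},\qquad 0<\xi\le\sqrt{\frac{\eta_A}{d^{3\alpha-1}}},\qquad 0\le\sigma_A\le\frac{\eta_A^{3/2}\xi^2}{d^{13/4}}.$$ Then with probability at least $1-d^{-\kappa}$ there are times $T_{{\rm SGD},1}\le T_{{\rm SGD},2}$ and $T_{{\rm Adam},1}\le T_{{\rm Adam},2}$ such that, for both algorithms, $cd\le\bar L\le Kd$ at the first time and $\bar L\le K(\log d)^{k_0}d^{-p}$ at the second time, and such that for all $t\in[T_{{\rm SGD},1},T_{{\rm SGD},2}]$, all $t'\in[T_{{\rm Adam},1},T_{{\rm Adam},2}]$ and $k=1,2$ $$R_{{\rm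 med},k}\big(W^{(t)}_{\rm SGD}\big)\ge c\log d,\qquad \Big|R_{{\rm med},k}\big(W^{(t')}_{\rm Adam}\big)-1\Big|\le K(\log d)^{k_0}\Big(\eta_A^{1/4}+d^{-(\frac\alpha2-\frac14)}\Big).$$ In particular both bounds hold together for all such $t,t'$ with $\bar L\big(W^{(t)}_{\rm SGD}\big)=\bar L\big(W^{(t')}_{\rm Adam}\big)$, whatever the common value of the loss (which, in these intervals, is meant to range over $[\tilde\Omega(d^{-p}),\Theta(d)]$): at equal loss the SGD+M ratio is $\Omega(\log d)$, while the Adam ratio is $1\pm\tilde{\mathcal O}\big(\eta_A^{1/4}+d^{-(\frac\alpha2-\frac14)}\big)=1\pm o(1)$. -/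

import Mathlib

open MeasureTheory ProbabilityTheory
open scoped Matrix

noncomputable section

namespace DiagGeometry

/-! ### The two-layer linear network -/

/-- Index set of the weights of a network with input and hidden dimension `d` and one output:
`Sum.inl (i, j)` is the entry `W₁[i, j]`, `Sum.inr i` is the entry `w₂ᵢ` of the row vector `W₂`. -/
abbrev Idx (d : ℕ) : Type := (Fin d × Fin d) ⊕ Fin d

/-- The weights `W = (W₂, W₁)`, as one vector; its algebraic operations are entry-wise. -/
abbrev Params (d : ℕ) : Type := Idx d → ℝ

/-- The first layer `W₁`, a `d × d` matrix. -/
def layer1 {d : ℕ} (w : Params d) : Matrix (Fin d) (Fin d) ℝ :=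
  Matrix.of fun i j => w (Sum.inl (i, j))

/-- The second layer `W₂`, a row vector of length `d`. -/
def layer2 {d : ℕ} (w : Params d) : Fin d → ℝ := fun i => w (Sum.inr i)

/-- The row vector `W₂ W₁`. -/
def endToEnd {d : ℕ} (w : Params d) : Fin d → ℝ := layer2 w ᵥ* layer1 w

/-- The square loss `L(W) = 1/(2m) ‖W₂ W₁ X - Y‖²` on the data `X` (columns are inputs) with
labels `Y`. -/
def loss {d m : ℕ} (X : Matrix (Fin d) (Fin m) ℝ) (Y : Fin m → ℝ) (w : Params d) : ℝ :=
  1 / (2 * (m : ℝ)) * ∑ k, ((endToEnd w ᵥ* X) k - Y k) ^ 2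

/-- `Λ = (1/m) X Xᵀ`. -/
def covXX {d m : ℕ} (X : Matrix (Fin d) (Fin m) ℝ) : Matrix (Fin d) (Fin d) ℝ :=
  (1 / (m : ℝ)) • (X * Xᵀ)

/-- `A = (1/m) Y Xᵀ`, a row vector. -/
def corrYX {d m : ℕ} (X : Matrix (Fin d) (Fin m) ℝ) (Y : Fin m → ℝ) : Fin d → ℝ :=
  (1 / (m : ℝ)) • (Y ᵥ* Xᵀ)

/-- The shifted loss `½ ‖W₂ W₁ - A‖²`. -/
def lossBar {d : ℕ} (A : Fin d → ℝ) (w : Params d) : ℝ :=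
  1 / 2 * ∑ j, (endToEnd w j - A j) ^ 2

/-- The inputs of the mini-batch whose `k`-th example is the data point number `B k`. -/
def batchX {d m b : ℕ} (X : Matrix (Fin d) (Fin m) ℝ) (B : Fin b → Fin m) :
    Matrix (Fin d) (Fin b) ℝ := X.submatrix id B

/-- The labels of the mini-batch. -/
def batchY {m b : ℕ} (Y : Fin m → ℝ) (B : Fin b → Fin m) : Fin b → ℝ := fun k => Y (B k)

/-- The gradient: all first partial derivatives. -/
def grad {d : ℕ} (f : Params d → ℝ) (w : Params d) : Params d :=
  fun i => deriv (fun s : ℝ => f (w + Pi.single i s)) 0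

/-- The mini-batch gradient, that is the gradient of the loss on the mini-batch. -/
def batchGrad {d m b : ℕ} (X : Matrix (Fin d) (Fin m) ℝ) (Y : Fin m → ℝ) (B : Fin b → Fin m) :
    Params d → Params d :=
  grad (loss (batchX X B) (batchY Y B))

/-- The diagonal of the Hessian: all unmixed second partial derivatives. -/
def hessDiag {d : ℕ} (f : Params d → ℝ) (w : Params d) : Params d :=
  fun i => iteratedDeriv 2 (fun s : ℝ => f (w + Pi.single i s)) 0

/-! ### Uniformity of the diagonal of the Hessian -/

/-- The median of a finite family of reals (the mean of the two middle values when their number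
is even). -/
def median {ι : Type*} [Fintype ι] (f : ι → ℝ) : ℝ :=
  (((Finset.univ.val.map f).sort (· ≤ ·)).getD ((Fintype.card ι - 1) / 2) 0 +
    ((Finset.univ.val.map f).sort (· ≤ ·)).getD (Fintype.card ι / 2) 0) / 2

/-- Largest absolute value over median absolute value. -/
def maxOverMedian {ι : Type*} [Fintype ι] (D : ι → ℝ) : ℝ :=
  (⨆ i, |D i|) / median fun i => |D i|

/-- `R_med` for the Hessian of `f` with respect to the first layer `W₁` (`d²` diagonal entries). -/
def RMed1 {d : ℕ} (f : Params d → ℝ) (w : Params d) : ℝ :=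
  maxOverMedian fun ij : Fin d × Fin d => hessDiag f w (Sum.inl ij)

/-- `R_med` for the Hessian of `f` with respect to the second layer `W₂` (`d` diagonal entries). -/
def RMed2 {d : ℕ} (f : Params d → ℝ) (w : Params d) : ℝ :=
  maxOverMedian fun i : Fin d => hessDiag f w (Sum.inr i)

/-! ### The two algorithms

`g t` is the stochastic gradient used at step `t`. -/

/-- SGD with momentum: the pair `(W, u)` after `t` steps, where `u⁽⁰⁾ = 0`,
`u⁽ᵗ⁺¹⁾ = β u⁽ᵗ⁾ + g̃⁽ᵗ⁾` and `W⁽ᵗ⁺¹⁾ = W⁽ᵗ⁾ - η u⁽ᵗ⁺¹⁾`,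
that is `W⁽ᵗ⁺¹⁾ = W⁽ᵗ⁾ - η ∑_{τ ≤ t} β^{t-τ} g̃(τ)`. -/
def sgdmState {d : ℕ} (β η : ℝ) (g : ℕ → Params d → Params d) (w₀ : Params d) :
    ℕ → Params d × Params d
  | 0 => (w₀, 0)
  | t + 1 =>
    let w := (sgdmState β η g w₀ t).1
    let u := (sgdmState β η g w₀ t).2
    let uNew := β • u + g t w
    (w - η • uNew, uNew)

/-- The iterates of SGD with momentum. -/
def sgdm {d : ℕ} (β η : ℝ) (g : ℕ → Params d → Params d) (w₀ : Params d) (t : ℕ) : Params d :=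
  (sgdmState β η g w₀ t).1

/-- Adam: the triple `(W, m, v)` after `t` steps, where `m⁽⁰⁾ = v⁽⁰⁾ = 0`,
`m⁽ᵗ⁺¹⁾ = β₁ m⁽ᵗ⁾ + (1 - β₁) g̃⁽ᵗ⁾`, `v⁽ᵗ⁺¹⁾ = β₂ v⁽ᵗ⁾ + (1 - β₂) g̃⁽ᵗ⁾ ⊙ g̃⁽ᵗ⁾`,
`W⁽ᵗ⁺¹⁾ = W⁽ᵗ⁾ - ηₜ m⁽ᵗ⁺¹⁾ / (√v⁽ᵗ⁺¹⁾ + ξ)` and `ηₜ = η √(1 - β₂ᵗ⁺¹) / (1 - β₁ᵗ⁺¹)`. -/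
def adamState {d : ℕ} (β₁ β₂ η ξ : ℝ) (g : ℕ → Params d → Params d) (w₀ : Params d) :
    ℕ → Params d × Params d × Params d
  | 0 => (w₀, 0, 0)
  | t + 1 =>
    let w := (adamState β₁ β₂ η ξ g w₀ t).1
    let m := (adamState β₁ β₂ η ξ g w₀ t).2.1
    let v := (adamState β₁ β₂ η ξ g w₀ t).2.2
    let ηt := η * (√(1 - β₂ ^ (t + 1)) / (1 - β₁ ^ (t + 1)))
    let mNew := fun i => β₁ * m i + (1 - β₁) * g t w i
    let vNew := fun i => β₂ * v i + (1 - β₂) * (g t w i * g t w i)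
    (fun i => w i - ηt * (mNew i / (√(vNew i) + ξ)), mNew, vNew)

/-- The iterates of Adam. -/
def adam {d : ℕ} (β₁ β₂ η ξ : ℝ) (g : ℕ → Params d → Params d) (w₀ : Params d) (t : ℕ) :
    Params d :=
  (adamState β₁ β₂ η ξ g w₀ t).1

/-! ### The assumptions -/

/-- The data are whitened, and the coordinates of `A` are positive and `Θ(1)`, with the constants
`aLo` and `aHi`. -/
structure DataSetup {d m : ℕ} (aLo aHi : ℝ) (X : Matrix (Fin d) (Fin m) ℝ) (Y : Fin m → ℝ) :
    Prop where
  whitened : covXX X = 1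
  coord_lower : ∀ j, aLo ≤ corrYX X Y j
  coord_upper : ∀ j, corrYX X Y j ≤ aHi

/-- Variance of the initialization: `d^{-4α}` for the entries of `W₁`, `d^{-2α}` for those
of `W₂`. -/
def initVar (d : ℕ) (α : ℝ) : Idx d → NNReal
  | Sum.inl _ => ((d : ℝ) ^ (-(4 * α))).toNNReal
  | Sum.inr _ => ((d : ℝ) ^ (-(2 * α))).toNNReal

/-- The initial weights are independent centred Gaussians with the variances `initVar d α`. -/
structure GaussianInit {Ω : Type*} [MeasurableSpace Ω] (μ : Measure Ω) {d : ℕ} (α : ℝ)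
    (w₀ : Ω → Params d) : Prop where
  measurable : Measurable w₀
  law : ∀ i, μ.map (fun ω => w₀ ω i) = gaussianReal 0 (initVar d α i)
  indep : iIndepFun (fun (i : Idx d) (ω : Ω) => w₀ ω i) μ

/-- The large-batch assumption on the random mini-batches `B 0, B 1, …`: the batch versions of
`A` and `Λ` are unbiased and each of their entries has variance at most `σ²`. -/
structure LargeBatch {Ω : Type*} [MeasurableSpace Ω] (μ : Measure Ω) {d m b : ℕ}
    (X : Matrix (Fin d) (Fin m) ℝ) (Y : Fin m → ℝ) (σ : ℝ) (B : ℕ → Ω → Fin b → Fin m) :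
    Prop where
  measurable : ∀ t, Measurable (B t)
  mean_corr : ∀ t j, ∫ ω, corrYX (batchX X (B t ω)) (batchY Y (B t ω)) j ∂μ = corrYX X Y j
  mean_cov : ∀ t i j, ∫ ω, covXX (batchX X (B t ω)) i j ∂μ = covXX X i j
  var_corr : ∀ t j,
    ∫ ω, (corrYX (batchX X (B t ω)) (batchY Y (B t ω)) j - corrYX X Y j) ^ 2 ∂μ ≤ σ ^ 2
  var_cov : ∀ t i j, ∫ ω, (covXX (batchX X (B t ω)) i j - covXX X i j) ^ 2 ∂μ ≤ σ ^ 2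

end DiagGeometry

end

open MeasureTheory ProbabilityTheory
open scoped Matrix

noncomputable section

namespace DiagGeometry

/-! ### Exponential moving sums and the Adam update direction -/

/-! Since the data are whitened, the loss is quadratic along each coordinate line, and the diagonal
Hessian entry is `w₂ᵢ²` for `W₁[i, j]` and `∑ⱼ W₁[i, j]²` for `w₂ᵢ`. Both ratios therefore compare
the sizes of the hidden units. The theorem holds because SGD+M preserves the relative sizes that the
units have at initialization, whereas Adam erases them.

SGD+M. A hidden unit is a row `(w₂ᵢ, W₁[i, ·])`, and all rows are driven by the same linear map,
determined by the current residual. By linearity (`rowMomentum_add_smul`), row `i` is `zᵢ φₜ` plus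
the evolution of its first-layer initialization, which stays negligible; here `zᵢ` is its initial
second-layer weight and `φₜ` is common to all rows. The diagonal is thus comparable to `zᵢ²`, and
for `d` Gaussians the maximum of `zᵢ²` over its median is of order `log d` (`ratio_lower`,
`le_measureReal_le_abs`). The work is to follow `φₜ` until the loss is small. The velocity-corrected
position performs plain gradient descent up to a small error, and in the plane spanned by the
second-layer entry and the direction `u` of `A` it has a growing and a decaying coordinate
(`planar_step`). The growing one increases exponentially until the residual falls below `f₀ =
d^(-p/2)` (`exists_time`), while the decaying coordinate, the part transversal to `u` and the
remainders of the rows stay relatively small.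

Adam. After flipping the signs of rows so that the second layer starts positive, every gradient soon
becomes positive and varies slowly, so every update is nearly `η`. All weights then grow at the same
speed, and the initial values become negligible (`growth`). Afterwards the coordinates `Pⱼ` of the
product `W₂W₁`, close to `d(ηt)²`, reach their targets `Aⱼ` at different times. The second layer
keeps growing at speed `η` while one coordinate is still unfinished, but column `j` of the first
layer starts to oscillate after its crossing, where its updates are no longer close to `±η`.

The decisive point is that the oscillation is common to all rows: the gradients in column `j` are
`xᵢ rⱼ` with `xᵢ` close to `ηt`, hence almost proportional to one reference sequence, and Adam is
nearly invariant under scaling of its gradients. `abs_adamU_sub_le` quantifies this; its error is a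
sum of update sizes along the reference sequence. A single update may be as large as the square root
of the time, but `sum_emaRatio_le` bounds the sum by the number of steps through an amortized
argument with a potential: a large update makes the residual jump, and the jump enlarges the
denominator of later updates. The argument uses `β₂ = β₁²` repeatedly.

Probability enters only through the initialization and the closeness of all mini-batches to the
data. Given these events, `sgdm_nonuniform` and `adam_uniform` are deterministic, and a union bound
finishes the proof. -/

/-- The exponential moving sum `∑_{s ≤ t} b^(t-s) g s`. -/
def ema (b : ℝ) (g : ℕ → ℝ) : ℕ → ℝ
  | 0 => g 0
  | t + 1 => b * ema b g t + g (t + 1)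

@[simp] lemma ema_zero (b : ℝ) (g : ℕ → ℝ) : ema b g 0 = g 0 := rfl

lemma ema_succ (b : ℝ) (g : ℕ → ℝ) (t : ℕ) : ema b g (t + 1) = b * ema b g t + g (t + 1) := rfl

lemma ema_add (b : ℝ) (f g : ℕ → ℝ) (t : ℕ) :
    ema b (fun s => f s + g s) t = ema b f t + ema b g t := by
  induction t with
  | zero => rfl
  | succ t ih => simp only [ema_succ, ih]; ring

lemma ema_sub (b : ℝ) (f g : ℕ → ℝ) (t : ℕ) :
    ema b (fun s => f s - g s) t = ema b f t - ema b g t := by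
  induction t with
  | zero => rfl
  | succ t ih => simp only [ema_succ, ih]; ring

lemma ema_const_mul (b a : ℝ) (g : ℕ → ℝ) (t : ℕ) :
    ema b (fun s => a * g s) t = a * ema b g t := by
  induction t with
  | zero => rfl
  | succ t ih => simp only [ema_succ, ih]; ring

lemma ema_neg (b : ℝ) (g : ℕ → ℝ) (t : ℕ) : ema b (fun s => - g s) t = - ema b g t := by
  induction t with
  | zero => rfl
  | succ t ih => simp only [ema_succ, ih]; ring

lemma ema_mono {b : ℝ} (hb : 0 ≤ b) {f g : ℕ → ℝ} {t : ℕ} (h : ∀ s ≤ t, f s ≤ g s) :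
    ema b f t ≤ ema b g t := by
  induction t with
  | zero => exact h 0 le_rfl
  | succ t ih =>
    rw [ema_succ, ema_succ]
    have := ih fun s hs => h s (by omega)
    have := h (t + 1) le_rfl
    gcongr

lemma abs_ema_le {b : ℝ} (hb : 0 ≤ b) (g : ℕ → ℝ) (t : ℕ) :
    |ema b g t| ≤ ema b (fun s => |g s|) t := by
  induction t with
  | zero => exact le_rfl
  | succ t ih =>
    rw [ema_succ, ema_succ]
    refine (abs_add_le _ _).trans ?_
    rw [abs_mul, abs_of_nonneg hb]
    gcongr

lemma ema_nonneg {b : ℝ} (hb : 0 ≤ b) {g : ℕ → ℝ} (hg : ∀ s, 0 ≤ g s) (t : ℕ) :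
    0 ≤ ema b g t := by
  induction t with
  | zero => exact hg 0
  | succ t ih => rw [ema_succ]; have := hg (t + 1); positivity

lemma one_le_ema_one {b : ℝ} (hb : 0 ≤ b) (t : ℕ) : 1 ≤ ema b (fun _ => 1) t := by
  cases t with
  | zero => exact le_rfl
  | succ t =>
    rw [ema_succ]
    have := ema_nonneg hb (g := fun _ => 1) (fun _ => zero_le_one) t
    nlinarith

lemma ema_one_le {b : ℝ} (hb : 0 ≤ b) (hb1 : b < 1) (t : ℕ) :
    ema b (fun _ => 1) t ≤ 1 / (1 - b) := by
  have h : 0 < 1 - b := by linarith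
  induction t with
  | zero => rw [le_div_iff₀ h]; simp; linarith
  | succ t ih =>
    rw [ema_succ, le_div_iff₀ h]
    rw [le_div_iff₀ h] at ih
    nlinarith

lemma ema_one_eq {b : ℝ} (hb1 : b < 1) (t : ℕ) :
    ema b (fun _ => 1) t = (1 - b ^ (t + 1)) / (1 - b) := by
  have h : 1 - b ≠ 0 := by linarith
  induction t with
  | zero => simp [h]
  | succ t ih => rw [ema_succ, ih]; field_simp; ring

lemma ema_lag_succ (b : ℝ) (t : ℕ) :
    ema b (fun s => ((t + 1 : ℕ) : ℝ) - s) (t + 1)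
      = b * (ema b (fun s => (t : ℝ) - s) t + ema b (fun _ => 1) t) := by
  rw [ema_succ, ← ema_add]
  have : (fun s : ℕ => ((t + 1 : ℕ) : ℝ) - s) = fun s : ℕ => ((t : ℝ) - s) + 1 := by
    funext s; push_cast; ring
  rw [this]; push_cast; ring

/-- The first moment of the geometric weights; with the second moment below it turns a bound on the
change of a sequence per step into closeness of its moving sum to a multiple of the last value. -/
lemma ema_lag_le {b : ℝ} (hb : 0 ≤ b) (hb1 : b < 1) (t : ℕ) :
    ema b (fun s => (t : ℝ) - s) t ≤ 1 / (1 - b) ^ 2 := by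
  have h : 0 < 1 - b := by linarith
  induction t with
  | zero => simp; positivity
  | succ t ih =>
    rw [ema_lag_succ]
    have h2 := ema_one_le hb hb1 t
    calc b * (ema b (fun s => (t : ℝ) - s) t + ema b (fun _ => 1) t)
        ≤ b * (1 / (1 - b) ^ 2 + 1 / (1 - b)) := by gcongr
      _ ≤ 1 / (1 - b) ^ 2 := by
        rw [div_add_div _ _ (by positivity) (by positivity), mul_div_assoc', div_le_div_iff₀
          (by positivity) (by positivity)]
        nlinarith [pow_pos h 3, pow_pos h 4, pow_pos h 5, mul_nonneg hb hb,
          mul_nonneg (pow_pos h 3).le (sq_nonneg (1 - b))]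

lemma ema_lag_sq_le {b : ℝ} (hb : 0 ≤ b) (hb1 : b < 1) (t : ℕ) :
    ema b (fun s => ((t : ℝ) - s) ^ 2) t ≤ 2 / (1 - b) ^ 3 := by
  have h : 0 < 1 - b := by linarith
  induction t with
  | zero => simp; positivity
  | succ t ih =>
    have e : ema b (fun s => (((t + 1 : ℕ) : ℝ) - s) ^ 2) (t + 1)
      = b * (ema b (fun s => ((t : ℝ) - s) ^ 2) t + 2 * ema b (fun s => (t : ℝ) - s) t
          + ema b (fun _ => 1) t) := by
      rw [ema_succ, ← ema_const_mul b 2, ← ema_add, ← ema_add]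
      have : (fun s : ℕ => (((t + 1 : ℕ) : ℝ) - s) ^ 2)
          = fun s : ℕ => ((t : ℝ) - s) ^ 2 + 2 * ((t : ℝ) - s) + 1 := by
        funext s; push_cast; ring
      rw [this]; push_cast; ring
    rw [e]
    have h1 := ema_lag_le hb hb1 t
    have h2 := ema_one_le hb hb1 t
    calc _ ≤ b * (2 / (1 - b) ^ 3 + 2 * (1 / (1 - b) ^ 2) + 1 / (1 - b)) := by gcongr
      _ = b * (2 + 2 * (1 - b) + (1 - b) ^ 2) / (1 - b) ^ 3 := by field_simp
      _ ≤ 2 / (1 - b) ^ 3 := by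
        gcongr
        nlinarith [sq_nonneg (1 - b), pow_pos h 3]

/-- Cauchy–Schwarz applied to the terms `b^(t-s) g s`, whose squares carry exactly the weights of
the moving sum with rate `b ^ 2`. This is one place where `β₂ = β₁²` is essential: it bounds an Adam
update by the square root of the time, whatever the gradients are. -/
lemma ema_sq_le (b : ℝ) (g : ℕ → ℝ) (t : ℕ) :
    ema b g t ^ 2 ≤ (t + 1) * ema (b ^ 2) (fun s => g s ^ 2) t := by
  induction t with
  | zero => simp
  | succ t ih =>
    rw [ema_succ, ema_succ]
    set M := ema b g t
    set Q := ema (b ^ 2) (fun s => g s ^ 2) t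
    have ht : (0 : ℝ) < t + 1 := by positivity
    have h1 : (b * M + g (t + 1)) ^ 2 * (t + 1)
        ≤ (t + 2) * (b ^ 2 * M ^ 2) + (t + 2) * (t + 1) * g (t + 1) ^ 2 := by
      -- The square whose nonnegativity is Cauchy–Schwarz for `t + 1` old terms and one new term.
      nlinarith [sq_nonneg (b * M - (t + 1) * g (t + 1))]
    have h2 : b ^ 2 * M ^ 2 ≤ b ^ 2 * ((t + 1) * Q) := by gcongr
    have h3 : (b * M + g (t + 1)) ^ 2 * (t + 1)
        ≤ ((t + 2) * (b ^ 2 * Q + g (t + 1) ^ 2)) * (t + 1) := by nlinarith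
    have := le_of_mul_le_mul_right h3 ht
    push_cast; linarith

lemma ema_sq_nonneg {b : ℝ} (g : ℕ → ℝ) (t : ℕ) : 0 ≤ ema (b ^ 2) (fun s => g s ^ 2) t :=
  ema_nonneg (sq_nonneg b) (fun s => sq_nonneg (g s)) t

/-- Direction of the bias-corrected Adam update with `β₁ = b`, `β₂ = b²`. -/
def adamU (b ξ : ℝ) (g : ℕ → ℝ) (t : ℕ) : ℝ :=
  (ema b g t / ema b (fun _ => 1) t) /
    (√(ema (b ^ 2) (fun s => g s ^ 2) t / ema (b ^ 2) (fun _ => 1) t) + ξ / √(1 - b ^ (2 * (t + 1))))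

/-- The size of the exponential moving sum relative to the exponential moving root of squares. -/
def emaRatio (b ξ : ℝ) (g : ℕ → ℝ) (t : ℕ) : ℝ :=
  |ema b g t| / (√(ema (b ^ 2) (fun s => g s ^ 2) t) + ξ)

lemma emaRatio_nonneg {b ξ : ℝ} (hξ : 0 ≤ ξ) (g : ℕ → ℝ) (t : ℕ) : 0 ≤ emaRatio b ξ g t := by
  unfold emaRatio; positivity

lemma adamU_neg (b ξ : ℝ) (g : ℕ → ℝ) (t : ℕ) :
    adamU b ξ (fun s => - g s) t = - adamU b ξ g t := by
  unfold adamU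
  rw [ema_neg]
  simp only [neg_sq]
  ring

section
variable {b : ℝ} (hb : 0 < b) (hb1 : b < 1)
include hb hb1

lemma one_sub_sq_ge : 1 - b ≤ 1 - b ^ 2 := by nlinarith

lemma ema_sq_one_le (t : ℕ) : ema (b ^ 2) (fun _ => 1) t ≤ 1 / (1 - b) := by
  have h : 0 < 1 - b := by linarith
  refine (ema_one_le (sq_nonneg b) (by nlinarith) t).trans ?_
  exact one_div_le_one_div_of_le h (one_sub_sq_ge hb hb1)

lemma sqrt_ema_sq_one_le (t : ℕ) : √(ema (b ^ 2) (fun _ => 1) t) ≤ 1 / (1 - b) := by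
  have h : 0 < 1 - b := by linarith
  have h1 : 1 ≤ 1 / (1 - b) := by rw [le_div_iff₀ h]; linarith
  rw [Real.sqrt_le_left (by positivity)]
  refine (ema_sq_one_le hb hb1 t).trans ?_
  nlinarith

lemma bias_le {ξ : ℝ} (hξ : 0 ≤ ξ) (t : ℕ) :
    ξ / √(1 - b ^ (2 * (t + 1))) ≤ ξ / (1 - b) := by
  have h : 0 < 1 - b := by linarith
  have h2 : b ^ (2 * (t + 1)) ≤ b := by
    calc b ^ (2 * (t + 1)) ≤ b ^ 1 := pow_le_pow_of_le_one hb.le hb1.le (by omega)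
      _ = b := pow_one b
  have h3 : 1 - b ≤ √(1 - b ^ (2 * (t + 1))) := by
    apply Real.le_sqrt_of_sq_le
    nlinarith
  gcongr

lemma le_bias {ξ : ℝ} (hξ : 0 ≤ ξ) (t : ℕ) : ξ ≤ ξ / √(1 - b ^ (2 * (t + 1))) := by
  have h2 : b ^ (2 * (t + 1)) < 1 := pow_lt_one₀ hb.le hb1 (by omega)
  rw [le_div_iff₀ (Real.sqrt_pos.2 (by linarith))]
  have : √(1 - b ^ (2 * (t + 1))) ≤ 1 := by
    rw [Real.sqrt_le_left zero_le_one]; have := pow_pos hb (2 * (t + 1)); linarith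
  nlinarith

/-- Both sides of the comparison of the normalised denominator with the plain one. -/
lemma adam_denom_ge {ξ : ℝ} (hξ : 0 ≤ ξ) (g : ℕ → ℝ) (t : ℕ) :
    (1 - b) * (√(ema (b ^ 2) (fun s => g s ^ 2) t) + ξ) ≤
      √(ema (b ^ 2) (fun s => g s ^ 2) t / ema (b ^ 2) (fun _ => 1) t)
        + ξ / √(1 - b ^ (2 * (t + 1))) := by
  have h : 0 < 1 - b := by linarith
  have h1 := le_bias hb hb1 hξ t
  have h2 := sqrt_ema_sq_one_le hb hb1 t
  have h3 : 0 < √(ema (b ^ 2) (fun _ => 1) t) :=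
    Real.sqrt_pos.2 (by linarith [one_le_ema_one (sq_nonneg b) t])
  rw [Real.sqrt_div' _ (by linarith [one_le_ema_one (sq_nonneg b) t]), mul_add]
  have h4 : (1 - b) * √(ema (b ^ 2) (fun s => g s ^ 2) t) ≤
      √(ema (b ^ 2) (fun s => g s ^ 2) t) / √(ema (b ^ 2) (fun _ => 1) t) := by
    rw [le_div_iff₀ h3]
    rw [le_div_iff₀ h] at h2
    nlinarith [Real.sqrt_nonneg (ema (b ^ 2) (fun s => g s ^ 2) t)]
  nlinarith

lemma adam_denom_le {ξ : ℝ} (hξ : 0 ≤ ξ) (g : ℕ → ℝ) (t : ℕ) :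
      √(ema (b ^ 2) (fun s => g s ^ 2) t / ema (b ^ 2) (fun _ => 1) t)
        + ξ / √(1 - b ^ (2 * (t + 1))) ≤
      (√(ema (b ^ 2) (fun s => g s ^ 2) t) + ξ) / (1 - b) := by
  have h : 0 < 1 - b := by linarith
  have h1 := bias_le hb hb1 hξ t
  have h3 : 1 ≤ √(ema (b ^ 2) (fun _ => 1) t) :=
    Real.one_le_sqrt.2 (one_le_ema_one (sq_nonneg b) t)
  rw [Real.sqrt_div' _ (by linarith [one_le_ema_one (sq_nonneg b) t]), add_div]
  have h0 := Real.sqrt_nonneg (ema (b ^ 2) (fun s => g s ^ 2) t)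
  have h4 : √(ema (b ^ 2) (fun s => g s ^ 2) t) / √(ema (b ^ 2) (fun _ => 1) t) ≤
      √(ema (b ^ 2) (fun s => g s ^ 2) t) / (1 - b) := by
    apply div_le_div_of_nonneg_left h0 h; linarith
  linarith

/-- The bias corrections change numerator and denominator only by constant factors, so the update
and `emaRatio` are comparable; the lower bound is `ratio_le_abs_adamU`. Long sums are estimated for
`emaRatio`, because the uncorrected moving sums obey simple recursions. -/
lemma abs_adamU_le_ratio {ξ : ℝ} (hξ : 0 < ξ) (g : ℕ → ℝ) (t : ℕ) :
    |adamU b ξ g t| ≤ emaRatio b ξ g t / (1 - b) := by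
  have h : 0 < 1 - b := by linarith
  have h1 := adam_denom_ge hb hb1 hξ.le g t
  have h2 := one_le_ema_one hb.le t
  have h0 := Real.sqrt_nonneg (ema (b ^ 2) (fun s => g s ^ 2) t)
  have h5 : 0 < (1 - b) * (√(ema (b ^ 2) (fun s => g s ^ 2) t) + ξ) := by positivity
  unfold adamU emaRatio
  rw [abs_div, abs_div, abs_of_pos (h5.trans_le h1), abs_of_pos (by linarith : 0 < ema b (fun _ => 1) t)]
  calc _ ≤ |ema b g t| / ((1 - b) * (√(ema (b ^ 2) (fun s => g s ^ 2) t) + ξ)) := by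
        apply div_le_div₀ (abs_nonneg _) _ h5 h1
        exact div_le_self (abs_nonneg _) h2
    _ = _ := by field_simp

lemma ratio_le_abs_adamU {ξ : ℝ} (hξ : 0 < ξ) (g : ℕ → ℝ) (t : ℕ) :
    (1 - b) ^ 2 * emaRatio b ξ g t ≤ |adamU b ξ g t| := by
  have h : 0 < 1 - b := by linarith
  have h1 := adam_denom_ge hb hb1 hξ.le g t
  have h1' := adam_denom_le hb hb1 hξ.le g t
  have h2 := one_le_ema_one hb.le t
  have h2' := ema_one_le hb.le hb1 t
  have h0 := Real.sqrt_nonneg (ema (b ^ 2) (fun s => g s ^ 2) t)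
  have h5 : 0 < (1 - b) * (√(ema (b ^ 2) (fun s => g s ^ 2) t) + ξ) := by positivity
  unfold adamU emaRatio
  rw [abs_div, abs_div, abs_of_pos (h5.trans_le h1), abs_of_pos (by linarith : 0 < ema b (fun _ => 1) t)]
  calc _ = (|ema b g t| / (1 / (1 - b))) / ((√(ema (b ^ 2) (fun s => g s ^ 2) t) + ξ) / (1 - b)) := by
        field_simp
    _ ≤ _ := by
        apply div_le_div₀ (by positivity) _ (h5.trans_le h1) h1'
        exact div_le_div_of_nonneg_left (abs_nonneg _) (by linarith) h2'

lemma emaRatio_le_sqrt {ξ : ℝ} (hξ : 0 < ξ) (g : ℕ → ℝ) (t : ℕ) :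
    emaRatio b ξ g t ≤ √(t + 1) := by
  unfold emaRatio
  have h0 := Real.sqrt_nonneg (ema (b ^ 2) (fun s => g s ^ 2) t)
  rw [div_le_iff₀ (by positivity)]
  have : |ema b g t| ≤ √(t + 1) * √(ema (b ^ 2) (fun s => g s ^ 2) t) := by
    rw [← Real.sqrt_mul (by positivity)]
    exact Real.abs_le_sqrt (ema_sq_le b g t)
  nlinarith [Real.sqrt_nonneg ((t : ℝ) + 1)]

lemma abs_adamU_le_sqrt {ξ : ℝ} (hξ : 0 < ξ) (g : ℕ → ℝ) (t : ℕ) :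
    |adamU b ξ g t| ≤ √(t + 1) / (1 - b) := by
  have h : 0 < 1 - b := by linarith
  refine (abs_adamU_le_ratio hb hb1 hξ g t).trans ?_
  have := emaRatio_le_sqrt hb hb1 hξ g t
  gcongr

lemma abs_ema_sub_le {g : ℕ → ℝ} {t : ℕ} {L : ℝ}
    (hL : ∀ s ≤ t, |g s - g t| ≤ ((t : ℝ) - s) * L) (hL0 : 0 ≤ L) :
    |ema b g t - g t * ema b (fun _ => 1) t| ≤ L / (1 - b) ^ 2 := by
  have e : ema b g t - g t * ema b (fun _ => 1) t = ema b (fun s => g s - g t) t := by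
    rw [ema_sub, ← ema_const_mul]; simp
  rw [e]
  calc _ ≤ ema b (fun s => |g s - g t|) t := abs_ema_le hb.le _ t
    _ ≤ ema b (fun s => L * ((t : ℝ) - s)) t := ema_mono hb.le fun s hs => by
        rw [mul_comm]; exact hL s hs
    _ = L * ema b (fun s => (t : ℝ) - s) t := ema_const_mul _ _ _ _
    _ ≤ L * (1 / (1 - b) ^ 2) := by gcongr; exact ema_lag_le hb.le hb1 t
    _ = _ := by ring

/-- If the gradient is positive and changes by a small fraction per step, the Adam update is close
to one. -/
lemma adamU_sub_one_le {g : ℕ → ℝ} {t : ℕ} {L ξ ρ : ℝ}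
    (hL : ∀ s ≤ t, |g s - g t| ≤ ((t : ℝ) - s) * L) (hL0 : 0 ≤ L) (hg : 0 < g t)
    (hLρ : L ≤ ρ * g t) (hξ : 0 < ξ) (hξρ : ξ ≤ ρ * g t) (hρ : ρ ≤ 1) :
    |adamU b ξ g t - 1| ≤ 6 / (1 - b) ^ 4 * ρ := by
  have hu : 0 < 1 - b := by linarith
  have hu1 : 1 - b ≤ 1 := by linarith
  set u := 1 - b with hu_def
  have hρ0 : 0 < ρ := by
    by_contra hcon
    push Not at hcon
    nlinarith
  set c := ema b (fun _ => 1) t with hc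
  have hc1 : 1 ≤ c := one_le_ema_one hb.le t
  set c2 := ema (b ^ 2) (fun _ => 1) t with hc2
  have hc21 : 1 ≤ c2 := one_le_ema_one (sq_nonneg b) t
  have hc2u : c2 ≤ 1 / u := ema_sq_one_le hb hb1 t
  set Q := ema (b ^ 2) (fun s => g s ^ 2) t with hQ
  set M := ema b g t with hM
  have hM1 : |M / c - g t| ≤ ρ * g t / u ^ 2 := by
    have := abs_ema_sub_le hb hb1 hL hL0
    have e : M / c - g t = (M - g t * c) / c := by field_simp
    rw [e, abs_div, abs_of_pos (by linarith : 0 < c)]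
    calc |M - g t * c| / c ≤ |M - g t * c| := div_le_self (abs_nonneg _) hc1
      _ ≤ L / u ^ 2 := this
      _ ≤ _ := by gcongr
  have hb2 : b ^ 2 < 1 := by nlinarith
  have hub : u ≤ 1 - b ^ 2 := one_sub_sq_ge hb hb1
  have hQ1 : |Q - g t ^ 2 * c2| ≤ 4 * ρ * g t ^ 2 / u ^ 3 := by
    have e : Q - g t ^ 2 * c2 = ema (b ^ 2) (fun s => g s ^ 2 - g t ^ 2) t := by
      rw [ema_sub, hQ, hc2, ← ema_const_mul]; simp
    rw [e]
    calc _ ≤ ema (b ^ 2) (fun s => |g s ^ 2 - g t ^ 2|) t := abs_ema_le (sq_nonneg b) _ t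
      _ ≤ ema (b ^ 2) (fun s => 2 * L * g t * ((t : ℝ) - s) + L ^ 2 * ((t : ℝ) - s) ^ 2) t := by
          refine ema_mono (sq_nonneg b) fun s hs => ?_
          have h1 := hL s hs
          have e2 : g s ^ 2 - g t ^ 2 = (g s - g t) * (2 * g t + (g s - g t)) := by ring
          have hs0 : (0 : ℝ) ≤ (t : ℝ) - s := by
            have : (s : ℝ) ≤ t := by exact_mod_cast hs
            linarith
          rw [e2, abs_mul]
          calc _ ≤ (((t : ℝ) - s) * L) * (2 * g t + ((t : ℝ) - s) * L) := by
                gcongr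
                refine (abs_add_le _ _).trans ?_
                rw [abs_of_pos (by linarith : 0 < 2 * g t)]
                linarith
            _ = _ := by ring
      _ = 2 * L * g t * ema (b ^ 2) (fun s => (t : ℝ) - s) t
          + L ^ 2 * ema (b ^ 2) (fun s => ((t : ℝ) - s) ^ 2) t := by
          rw [ema_add, ema_const_mul, ema_const_mul]
      _ ≤ 2 * L * g t * (1 / u ^ 2) + L ^ 2 * (2 / u ^ 3) := by
          gcongr
          · refine (ema_lag_le (sq_nonneg b) hb2 t).trans ?_
            gcongr
          · refine (ema_lag_sq_le (sq_nonneg b) hb2 t).trans ?_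
            gcongr
      _ ≤ 2 * (ρ * g t) * g t * (1 / u ^ 3) + (ρ * g t) ^ 2 * (2 / u ^ 3) := by
          have hu32 : u ^ 3 ≤ u ^ 2 := pow_le_pow_of_le_one hu.le hu1 (by norm_num)
          gcongr
      _ = (2 * ρ * g t ^ 2 + 2 * ρ ^ 2 * g t ^ 2) / u ^ 3 := by ring
      _ ≤ _ := by
          gcongr
          nlinarith [mul_nonneg (mul_nonneg hρ0.le (sub_nonneg.2 hρ)) (sq_nonneg (g t))]
  have hQ2 : |√(Q / c2) - g t| ≤ 4 * ρ * g t / u ^ 3 := by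
    have hQ0 : 0 ≤ Q / c2 := div_nonneg (ema_sq_nonneg g t) (by linarith)
    have e : √(Q / c2) - g t = (Q / c2 - g t ^ 2) / (√(Q / c2) + g t) := by
      rw [eq_div_iff (by positivity)]
      nlinarith [Real.sq_sqrt hQ0]
    have e2 : Q / c2 - g t ^ 2 = (Q - g t ^ 2 * c2) / c2 := by field_simp
    rw [e, abs_div, abs_of_pos (by positivity : 0 < √(Q / c2) + g t), e2, abs_div,
      abs_of_pos (by linarith : 0 < c2), div_le_iff₀ (by positivity)]
    calc _ ≤ |Q - g t ^ 2 * c2| := div_le_self (abs_nonneg _) hc21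
      _ ≤ 4 * ρ * g t ^ 2 / u ^ 3 := hQ1
      _ = 4 * ρ * g t / u ^ 3 * (0 + g t) := by ring
      _ ≤ _ := by gcongr; positivity
  set D := √(Q / c2) + ξ / √(1 - b ^ (2 * (t + 1))) with hD
  have hξ1 := le_bias hb hb1 hξ.le t
  have hξ2 := bias_le hb hb1 hξ.le t
  -- The moving sum of squares contains the last square with weight one, and the normalisation `c2`
  -- is at most `1 / u`.
  have hDlow : g t * u ≤ D := by
    have h1 : g t ^ 2 ≤ Q := by
      rw [hQ]
      cases t with
      | zero => simp
      | succ t =>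
        rw [ema_succ]
        have := ema_sq_nonneg (b := b) g t
        have : 0 ≤ b ^ 2 * ema (b ^ 2) (fun s => g s ^ 2) t := by positivity
        linarith
    have h2 : g t * u ≤ √(Q / c2) := by
      apply Real.le_sqrt_of_sq_le
      rw [le_div_iff₀ (by linarith)]
      have : u ^ 2 * c2 ≤ 1 := by
        rw [le_div_iff₀ hu] at hc2u
        nlinarith
      nlinarith [sq_nonneg (g t)]
    linarith
  have hDg : |D - g t| ≤ 5 * ρ * g t / u ^ 3 := by
    have e : D - g t = (√(Q / c2) - g t) + ξ / √(1 - b ^ (2 * (t + 1))) := by rw [hD]; ring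
    rw [e]
    refine (abs_add_le _ _).trans ?_
    rw [abs_of_nonneg (hξ.le.trans hξ1)]
    have h3 : ξ / (1 - b) ≤ ρ * g t / u ^ 3 := by
      have : u ^ 3 ≤ u := by
        calc u ^ 3 ≤ u ^ 1 := pow_le_pow_of_le_one hu.le hu1 (by norm_num)
          _ = u := pow_one u
      gcongr
    have e3 : 5 * ρ * g t / u ^ 3 = 4 * ρ * g t / u ^ 3 + ρ * g t / u ^ 3 := by ring
    linarith
  have hDpos : 0 < D := lt_of_lt_of_le (by positivity) hDlow
  have e : adamU b ξ g t - 1 = ((M / c - g t) - (D - g t)) / D := by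
    change M / c / D - 1 = _
    field_simp
    ring
  rw [e, abs_div, abs_of_pos hDpos, div_le_iff₀ hDpos]
  have h6 : ρ * g t / u ^ 2 ≤ ρ * g t / u ^ 3 := by
    have : u ^ 3 ≤ u ^ 2 := pow_le_pow_of_le_one hu.le hu1 (by norm_num)
    gcongr
  calc _ ≤ |M / c - g t| + |D - g t| := abs_sub _ _
    _ ≤ ρ * g t / u ^ 3 + 5 * ρ * g t / u ^ 3 := by linarith
    _ = 6 / u ^ 4 * ρ * (g t * u) := by field_simp; ring
    _ ≤ _ := by gcongr

/-- If the gradient has increments of constant sign and comparable size, the Adam update is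
bounded. -/
lemma abs_adamU_le_of_increments {g : ℕ → ℝ} {n : ℕ} {q ξ : ℝ} (hq : 0 < q) (hξ : 0 < ξ)
    (hlow : ∀ s < n, q / 2 ≤ g (s + 1) - g s) (hup : ∀ s < n, g (s + 1) - g s ≤ 2 * q) :
    |adamU b ξ g n| ≤ 12 / (b * (1 - b) ^ 3) := by
  have hu : 0 < 1 - b := by linarith
  set u := 1 - b with hu_def
  have hu1 : u ≤ 1 := by linarith
  refine (abs_adamU_le_ratio hb hb1 hξ g n).trans ?_
  suffices h : emaRatio b ξ g n ≤ 12 / (b * u ^ 2) by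
    calc _ ≤ 12 / (b * u ^ 2) / u := by gcongr
      _ = _ := by field_simp
  have hlip : ∀ k s, s + k = n → |g s - g n| ≤ ((n : ℝ) - s) * (2 * q) := by
    intro k
    induction k with
    | zero => intro s hs; have : s = n := by omega
              subst this; simp
    | succ k ih =>
      intro s hs
      have h1 := ih (s + 1) (by omega)
      have h2 := hlow s (by omega)
      have h3 := hup s (by omega)
      have e : g s - g n = (g (s + 1) - g n) - (g (s + 1) - g s) := by ring
      rw [e]
      refine (abs_sub _ _).trans ?_
      rw [abs_of_pos (by linarith : 0 < g (s + 1) - g s)]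
      push_cast at h1
      nlinarith
  have hM := abs_ema_sub_le hb hb1 (fun s hs => hlip (n - s) s (by omega)) (by positivity)
  have hM2 : |ema b g n| ≤ (|g n| + 2 * q) / u ^ 2 := by
    have h1 := ema_one_le hb.le hb1 n
    have h2 := one_le_ema_one hb.le n
    have : |ema b g n| ≤ |g n| * ema b (fun _ => 1) n + 2 * q / u ^ 2 := by
      have h3 := abs_add_le (ema b g n - g n * ema b (fun _ => 1) n) (g n * ema b (fun _ => 1) n)
      rw [sub_add_cancel, abs_mul, abs_of_pos (by linarith : 0 < ema b (fun _ => 1) n)] at h3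
      linarith
    refine this.trans ?_
    rw [add_div]
    gcongr
    rw [le_div_iff₀ (by positivity)]
    rw [le_div_iff₀ hu] at h1
    have : ema b (fun _ => 1) n * u ^ 2 ≤ 1 := by nlinarith
    nlinarith [abs_nonneg (g n)]
  unfold emaRatio
  set Q := ema (b ^ 2) (fun s => g s ^ 2) n with hQ
  have hQ0 : 0 ≤ √Q := Real.sqrt_nonneg Q
  rw [div_le_iff₀ (by positivity)]
  -- The second alternative serves `n = 0`, where there are no increments and the moving sum is a
  -- single term.
  suffices h : (|g n| + 2 * q) / u ^ 2 ≤ 12 / (b * u ^ 2) * √Q ∨ |ema b g n| ≤ √Q by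
    have h12 : 1 ≤ 12 / (b * u ^ 2) := by
      rw [le_div_iff₀ (by positivity)]; nlinarith [mul_pos hb hu]
    have hp : 0 ≤ 12 / (b * u ^ 2) * ξ := by positivity
    rcases h with h | h <;> nlinarith
  cases n with
  | zero => right; simp [hQ, Real.sqrt_sq_eq_abs]
  | succ n =>
    left
    have hQe : Q = b ^ 2 * ema (b ^ 2) (fun s => g s ^ 2) n + g (n + 1) ^ 2 := rfl
    have hpn : g n ^ 2 ≤ ema (b ^ 2) (fun s => g s ^ 2) n := by
      cases n with
      | zero => simp
      | succ n =>
        rw [ema_succ]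
        have := ema_sq_nonneg (b := b) g n
        have : 0 ≤ b ^ 2 * ema (b ^ 2) (fun s => g s ^ 2) n := by positivity
        linarith
    have h1 : |g (n + 1)| ≤ √Q := by
      apply Real.abs_le_sqrt; rw [hQe]
      have : 0 ≤ b ^ 2 * ema (b ^ 2) (fun s => g s ^ 2) n := by
        have := ema_sq_nonneg (b := b) g n
        positivity
      linarith
    have h2 : b * |g n| ≤ √Q := by
      have : |b * g n| ≤ √Q := by
        apply Real.abs_le_sqrt; rw [hQe]
        nlinarith [sq_nonneg (g (n + 1)), sq_nonneg b]
      rwa [abs_mul, abs_of_pos hb] at this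
    have h3 := hlow n (by omega)
    -- The gradient may pass through zero, but two consecutive values differ by at least `q / 2`, so
    -- they are not both small, and both enter `Q` with weights bounded below.
    have h4 : q / 2 ≤ |g (n + 1)| + |g n| := by
      have := abs_sub (g (n + 1)) (g n)
      have := le_abs_self (g (n + 1) - g n)
      linarith
    have e : 12 / (b * u ^ 2) * √Q = (12 * √Q / b) / u ^ 2 := by field_simp
    rw [e]
    gcongr
    rw [le_div_iff₀ hb]
    nlinarith [abs_nonneg (g n), abs_nonneg (g (n + 1))]

end

end DiagGeometry

namespace DiagGeometry

/-! ### Total variation of an oscillating Adam trajectory -/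

section
variable {b : ℝ} (hb : 0 < b) (hb1 : b < 1)
include hb hb1

set_option maxHeartbeats 1000000 in
/-- The amortized bound for the Adam update directions: if the steps of `f` are comparable with
the update directions `ū`, then the sum of `ū` over `n` steps is `O(n)`, even though single terms
can be as large as `√n`. -/
lemma sum_emaRatio_le {f : ℕ → ℝ} {ξ σ C c₁ C₂ R₀ : ℝ} {n₁ n : ℕ}
    (hξ : 0 < ξ) (hσ : 0 < σ) (hC : 0 ≤ C) (hc₁ : 0 < c₁) (hC₂ : 1 / (1 - b) ≤ C₂)
    (hR1 : 2 ≤ R₀) (hR2 : 2 * C₂ ≤ R₀) (hR3 : 4 * C ≤ c₁ * R₀)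
    (hR4 : 16 * C₂ * (2 * C + 1) ≤ c₁ * R₀ * (1 - b))
    (hf : f n₁ ≠ 0) (hstart : ema b (fun s => |f s|) n₁ ≤ C₂ * |f n₁|)
    (hup : ∀ k < n, |f (n₁ + k + 1) - f (n₁ + k)| ≤ σ * (C * (1 + emaRatio b ξ f (n₁ + k))))
    (hlow : ∀ k < n, σ * (c₁ * emaRatio b ξ f (n₁ + k) - C) ≤ |f (n₁ + k + 1) - f (n₁ + k)|) :
    ∑ k ∈ Finset.range n, emaRatio b ξ f (n₁ + k) ≤ 2 * (R₀ + 3) * n + 2 * C₂ ^ 2 := by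
  have hu : 0 < 1 - b := by linarith
  have hC20 : 0 < C₂ := lt_of_lt_of_le (by positivity) hC₂
  have hR0 : 0 < R₀ := by linarith
  set Q : ℕ → ℝ := ema (b ^ 2) (fun s => f s ^ 2) with hQ
  set S : ℕ → ℝ := ema b (fun s => |f s|) with hS
  set U : ℕ → ℝ := emaRatio b ξ f with hU
  have hU0 : ∀ t, 0 ≤ U t := fun t => emaRatio_nonneg hξ.le f t
  have hS0 : ∀ t, 0 ≤ S t := fun t => ema_nonneg hb.le (fun s => abs_nonneg _) t
  have hfQ : ∀ t, f t ^ 2 ≤ Q t := by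
    intro t
    cases t with
    | zero => simp [hQ]
    | succ t =>
      rw [hQ, ema_succ]
      have := ema_sq_nonneg (b := b) f t
      have : 0 ≤ b ^ 2 * ema (b ^ 2) (fun s => f s ^ 2) t := by positivity
      linarith
  have hfV : ∀ t, |f t| ≤ √(Q t) := fun t => Real.abs_le_sqrt (hfQ t)
  have hQpos : ∀ k, 0 < Q (n₁ + k) := by
    intro k
    induction k with
    | zero => exact lt_of_lt_of_le (by positivity) (hfQ n₁)
    | succ k ih =>
      change 0 < b ^ 2 * Q (n₁ + k) + f (n₁ + k + 1) ^ 2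
      positivity
  -- the potential
  set R : ℕ → ℝ := fun k => S (n₁ + k) ^ 2 / Q (n₁ + k) with hR
  have hRnn : ∀ k, 0 ≤ R k := fun k => div_nonneg (sq_nonneg _) (hQpos k).le
  have hSR : ∀ k, S (n₁ + k) ^ 2 = R k * Q (n₁ + k) := fun k =>
    (div_mul_cancel₀ _ (hQpos k).ne').symm
  -- Weighted Cauchy–Schwarz: the potential bounds the square of the update (up to the effect of
  -- `ξ`, which only helps) and can rise by at most one per step. A large update thus needs a long
  -- preparation.
  have hRstep : ∀ k, R (k + 1) ≤ R k + 1 := by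
    intro k
    change S (n₁ + k + 1) ^ 2 / Q (n₁ + k + 1) ≤ _
    have hQk1 : 0 < Q (n₁ + k + 1) := hQpos (k + 1)
    refine (div_le_iff₀ hQk1).2 ?_
    change (b * S (n₁ + k) + |f (n₁ + k + 1)|) ^ 2 ≤ (R k + 1) * (b ^ 2 * Q (n₁ + k) + f (n₁ + k + 1) ^ 2)
    rw [← sq_abs (f (n₁ + k + 1))]
    have h1 := hSR k
    have h2 := hQpos k
    have h3 := hRnn k
    set s := S (n₁ + k)
    set q := Q (n₁ + k)
    set x := |f (n₁ + k + 1)|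
    by_cases hx : R k = 0
    · rw [hx] at h1 ⊢
      have : s = 0 := by simpa using h1
      rw [this]
      nlinarith [mul_pos (pow_pos hb 2) h2]
    · have hRp : 0 < R k := lt_of_le_of_ne h3 (Ne.symm hx)
      have : (b * s + x) ^ 2 * R k ≤ ((R k + 1) * (b ^ 2 * q + x ^ 2)) * R k := by
        have e : ((R k + 1) * (b ^ 2 * q + x ^ 2)) * R k - (b * s + x) ^ 2 * R k
            = (b * s - R k * x) ^ 2 + (R k + 1) * b ^ 2 * (R k * q - s ^ 2) := by ring
        have : 0 ≤ (b * s - R k * x) ^ 2 := sq_nonneg _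
        rw [h1] at e
        nlinarith
      exact le_of_mul_le_mul_right this hRp
  -- the lagged sum of past updates
  let H : ℕ → ℝ := fun k => Nat.rec 0 (fun j h => b * (h + C * (1 + U (n₁ + j)))) k
  have hH0 : H 0 = 0 := rfl
  have hHs : ∀ k, H (k + 1) = b * (H k + C * (1 + U (n₁ + k))) := fun k => rfl
  have hHnn : ∀ k, 0 ≤ H k := by
    intro k
    induction k with
    | zero => exact le_rfl
    | succ k ih => rw [hHs]; have := hU0 (n₁ + k); positivity
  have hC21 : 1 ≤ C₂ * (1 - b) := by rwa [div_le_iff₀ hu] at hC₂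
  -- Past values of `|f|` exceed the present one by at most the intermediate increments, and these
  -- are controlled by past updates. `H` records the latter with geometric discounting.
  have hSH : ∀ k ≤ n, S (n₁ + k) ≤ C₂ * (|f (n₁ + k)| + σ * H k) := by
    intro k
    induction k with
    | zero => intro _; rw [hH0]; simpa using hstart
    | succ k ih =>
      intro hk
      have h1 := ih (by omega)
      have h2 := hup k (by omega)
      change b * S (n₁ + k) + |f (n₁ + k + 1)| ≤ C₂ * (|f (n₁ + k + 1)| + σ * H (k + 1))
      rw [hHs]
      have h3 : |f (n₁ + k)| ≤ |f (n₁ + k + 1)| + σ * (C * (1 + U (n₁ + k))) := by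
        have := abs_sub_abs_le_abs_sub (f (n₁ + k)) (f (n₁ + k + 1))
        rw [abs_sub_comm] at this
        linarith
      calc b * S (n₁ + k) + |f (n₁ + k + 1)|
          ≤ b * (C₂ * ((|f (n₁ + k + 1)| + σ * (C * (1 + U (n₁ + k)))) + σ * H k))
            + |f (n₁ + k + 1)| := by gcongr; exact h1.trans (by gcongr)
        _ ≤ b * (C₂ * ((|f (n₁ + k + 1)| + σ * (C * (1 + U (n₁ + k)))) + σ * H k))
            + (C₂ * (1 - b)) * |f (n₁ + k + 1)| := by
            have := mul_le_mul_of_nonneg_right hC21 (abs_nonneg (f (n₁ + k + 1)))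
            linarith
        _ = _ := by ring
  -- one step of the amortized estimate
  have hκ : ∀ k < n, U (n₁ + k) ≤ R₀ + 2 + (R k - R (k + 1))
      + (1 / (2 * C + 1)) * (1 - b) * H k := by
    intro k hk
    have hnn : 0 ≤ (1 / (2 * C + 1)) * (1 - b) * H k := by have := hHnn k; positivity
    -- Three cases: a moderate update costs a constant. A large one over a small denominator is paid
    -- by a drop of the potential `R`. A large one over a large denominator means that `S` is
    -- dominated by past increments, and is paid by `H`.
    by_cases hcase : U (n₁ + k) ≤ R₀
    · have := hRstep k; linarith
    push Not at hcase
    have hV0 : 0 < √(Q (n₁ + k)) := Real.sqrt_pos.2 (hQpos k)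
    have hVsq : √(Q (n₁ + k)) ^ 2 = Q (n₁ + k) := Real.sq_sqrt (hQpos k).le
    have hUS : U (n₁ + k) * √(Q (n₁ + k)) ≤ S (n₁ + k) := by
      have h1 : U (n₁ + k) ≤ S (n₁ + k) / √(Q (n₁ + k)) := by
        rw [hU]; unfold emaRatio
        apply div_le_div₀ (hS0 _) (abs_ema_le hb.le f _) hV0
        change √(Q (n₁ + k)) ≤ √(Q (n₁ + k)) + ξ
        linarith
      rwa [le_div_iff₀ hV0] at h1
    have hfv := hfV (n₁ + k)
    have hl := hlow k hk
    set u := U (n₁ + k) with hu_def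
    set V := √(Q (n₁ + k)) with hV_def
    have hu0 : 0 < u := by linarith
    by_cases hV : V ≤ c₁ * u * σ / 8
    · -- the next value is much larger than everything before
      have hbig : 4 * V ≤ |f (n₁ + k + 1)| := by
        have h1 := abs_sub (f (n₁ + k + 1)) (f (n₁ + k))
        have h2 : C ≤ c₁ * u / 4 := by
          have := mul_le_mul_of_nonneg_left hcase.le hc₁.le
          linarith
        have h3 : σ * (c₁ * u - c₁ * u / 4) ≤ σ * (c₁ * u - C) := by gcongr
        linarith
      have hR1' : R (k + 1) ≤ R k / 8 + 2 := by
        change S (n₁ + k + 1) ^ 2 / Q (n₁ + k + 1) ≤ _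
        have hQk1 : 0 < Q (n₁ + k + 1) := hQpos (k + 1)
        refine (div_le_iff₀ hQk1).2 ?_
        change (b * S (n₁ + k) + |f (n₁ + k + 1)|) ^ 2
          ≤ (R k / 8 + 2) * (b ^ 2 * Q (n₁ + k) + f (n₁ + k + 1) ^ 2)
        rw [← sq_abs (f (n₁ + k + 1))]
        have h1 := hSR k
        have h3 := hRnn k
        have hs := hS0 (n₁ + k)
        set s := S (n₁ + k)
        set x := |f (n₁ + k + 1)|
        have hx : 0 ≤ x := by linarith
        have h4 : s ^ 2 ≤ R k * (x ^ 2 / 16) := by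
          rw [h1, ← hVsq]
          have : V ^ 2 ≤ x ^ 2 / 16 := by
            have := pow_le_pow_left₀ (by positivity) hbig 2
            linarith
          gcongr
        have h5 : (b * s + x) ^ 2 ≤ 2 * s ^ 2 + 2 * x ^ 2 := by
          have : b * s ≤ s := mul_le_of_le_one_left hs (by linarith)
          have h0 : 0 ≤ b * s := by positivity
          linarith [sq_nonneg (b * s - x), pow_le_pow_left₀ h0 this 2]
        have h6 : 0 ≤ b ^ 2 * Q (n₁ + k) := by have := hQpos k; positivity
        have h7 : 0 ≤ (R k / 8 + 2) * (b ^ 2 * Q (n₁ + k)) := by positivity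
        linarith
      have hRu : u ^ 2 ≤ R k := by
        rw [hR]
        change u ^ 2 ≤ S (n₁ + k) ^ 2 / Q (n₁ + k)
        rw [le_div_iff₀ (hQpos k), ← hVsq, ← mul_pow]
        gcongr
      have h2u : 2 * u ≤ u * u := by gcongr; linarith
      linarith
    -- Here `u V ≤ C₂ (V + σ H)` together with `V > c₁ u σ / 8` and `u` large makes `u²` at most a
    -- constant times `H`; the largeness of `R₀` then brings `u` below the small multiple of `H`
    -- that can be charged.
    · push Not at hV
      have h1 := hSH k hk.le
      have h2 : u * V ≤ C₂ * (V + σ * H k) := hUS.trans (h1.trans (by gcongr))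
      have h3 : u * V / 2 ≤ C₂ * (σ * H k) := by
        have := mul_le_mul_of_nonneg_right (hR2.trans hcase.le) hV0.le
        linarith
      have h4 : u * (c₁ * u * σ / 8) / 2 ≤ C₂ * (σ * H k) := by
        refine le_trans ?_ h3
        gcongr
      have h5 : c₁ * u ^ 2 / 16 ≤ C₂ * H k := by
        refine le_of_mul_le_mul_left (a := σ) ?_ hσ
        calc σ * (c₁ * u ^ 2 / 16) = u * (c₁ * u * σ / 8) / 2 := by ring
          _ ≤ C₂ * (σ * H k) := h4
          _ = _ := by ring
      have h6 : c₁ * R₀ * u ≤ 16 * (C₂ * H k) := by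
        have h7 : c₁ * u * R₀ ≤ c₁ * u * u := mul_le_mul_of_nonneg_left hcase.le (by positivity)
        calc c₁ * R₀ * u = c₁ * u * R₀ := by ring
          _ ≤ c₁ * u * u := h7
          _ = 16 * (c₁ * u ^ 2 / 16) := by ring
          _ ≤ _ := by gcongr
      have hR0' : 0 ≤ R k - R (k + 1) + 1 := by have := hRstep k; linarith
      suffices h7 : u ≤ (1 / (2 * C + 1)) * (1 - b) * H k by linarith
      have hHk := hHnn k
      refine le_of_mul_le_mul_left (a := c₁ * R₀) ?_ (by positivity)
      calc c₁ * R₀ * u ≤ 16 * (C₂ * H k) := h6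
        _ = (16 * C₂ * (2 * C + 1)) * ((1 / (2 * C + 1)) * H k) := by field_simp
        _ ≤ (c₁ * R₀ * (1 - b)) * ((1 / (2 * C + 1)) * H k) := by gcongr
        _ = _ := by ring
  have hsum : ∀ m ≤ n, ∑ k ∈ Finset.range m, U (n₁ + k)
      ≤ 2 * (R₀ + 3) * m + 2 * R 0 - 2 * (R m + (1 / (2 * C + 1)) * H m) := by
    intro m
    induction m with
    | zero => intro _; simp [hH0]
    | succ m ih =>
      intro hm
      have h1 := ih (by omega)
      have h2 := hκ m (by omega)
      rw [Finset.sum_range_succ]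
      -- The charge to `H` telescopes up to the new contribution `C (1 + U)`. With the weight `1 /
      -- (2 C + 1)` this returns at most half of `U`, which the left side absorbs; hence the factors
      -- two in the bound.
      have h3 : (1 - b) * H m ≤ H m - H (m + 1) + C * (1 + U (n₁ + m)) := by
        rw [hHs]
        have : 0 ≤ C * (1 + U (n₁ + m)) := by have := hU0 (n₁ + m); positivity
        have := mul_nonneg hu.le this
        linarith
      have h4 : (1 / (2 * C + 1)) * (1 - b) * H m
          ≤ (1 / (2 * C + 1)) * H m - (1 / (2 * C + 1)) * H (m + 1) + (1 + U (n₁ + m)) / 2 := by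
        have h5 : (1 / (2 * C + 1)) * C ≤ 1 / 2 := by
          rw [div_mul_eq_mul_div, div_le_iff₀ (by positivity)]; linarith
        have h6 : 0 ≤ 1 + U (n₁ + m) := by have := hU0 (n₁ + m); linarith
        calc (1 / (2 * C + 1)) * (1 - b) * H m = (1 / (2 * C + 1)) * ((1 - b) * H m) := by ring
          _ ≤ (1 / (2 * C + 1)) * (H m - H (m + 1) + C * (1 + U (n₁ + m))) := by gcongr
          _ = (1 / (2 * C + 1)) * H m - (1 / (2 * C + 1)) * H (m + 1)
              + ((1 / (2 * C + 1)) * C) * (1 + U (n₁ + m)) := by ring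
          _ ≤ (1 / (2 * C + 1)) * H m - (1 / (2 * C + 1)) * H (m + 1)
              + (1 / 2) * (1 + U (n₁ + m)) := by gcongr
          _ = _ := by ring
      push_cast
      linarith
  have hend := hsum n le_rfl
  have hRn := hRnn n
  have hHn : 0 ≤ (1 / (2 * C + 1)) * H n := by have := hHnn n; positivity
  have hR0b : R 0 ≤ C₂ ^ 2 := by
    change S n₁ ^ 2 / Q n₁ ≤ _
    have hQ0 : 0 < Q n₁ := hQpos 0
    refine (div_le_iff₀ hQ0).2 ?_
    calc S n₁ ^ 2 ≤ (C₂ * |f n₁|) ^ 2 := by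
          have := hS0 n₁
          gcongr
      _ = C₂ ^ 2 * f n₁ ^ 2 := by rw [mul_pow, sq_abs]
      _ ≤ _ := by have := hfQ n₁; gcongr
  linarith

set_option maxHeartbeats 1000000 in
/-- Comparison of the Adam updates for a gradient sequence `f` and its multiple `λ f` by a slowly
varying factor `λ` close to one. -/
lemma abs_adamU_sub_le {f g lam : ℕ → ℝ} {ξ ε δ Sg : ℝ} {n₁ n : ℕ} (hξ : 0 < ξ)
    (hε0 : 0 ≤ ε) (hε : ε ≤ 1 / 32) (hδ : 0 ≤ δ)
    (hg : ∀ k ≤ n, g (n₁ + k) = lam (n₁ + k) * f (n₁ + k))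
    (hlam : ∀ k ≤ n, |lam (n₁ + k) - 1| ≤ ε)
    (hdlam : ∀ k < n, |lam (n₁ + k + 1) - lam (n₁ + k)| ≤ δ)
    (hf : f n₁ ≠ 0)
    (hM : |ema b g n₁ - lam n₁ * ema b f n₁| ≤ ε * (√(ema (b ^ 2) (fun s => f s ^ 2) n₁) + ξ))
    (hQ : |ema (b ^ 2) (fun s => g s ^ 2) n₁ - lam n₁ ^ 2 * ema (b ^ 2) (fun s => f s ^ 2) n₁|
      ≤ ε * ema (b ^ 2) (fun s => f s ^ 2) n₁)
    (hSg : δ * ∑ k ∈ Finset.range n, emaRatio b ξ f (n₁ + k) ≤ Sg * ε)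
    (hn : 3 * δ * n ≤ 9 * ε) :
    |adamU b ξ g (n₁ + n) - adamU b ξ f (n₁ + n)|
      ≤ 32 / (1 - b) ^ 2 * ε * (1 + Sg + emaRatio b ξ f (n₁ + n)) := by
  have hu : 0 < 1 - b := by linarith
  set Q : ℕ → ℝ := ema (b ^ 2) (fun s => f s ^ 2) with hQdef
  set Qg : ℕ → ℝ := ema (b ^ 2) (fun s => g s ^ 2) with hQgdef
  have hQpos : ∀ k, 0 < Q (n₁ + k) := by
    intro k
    induction k with
    | zero =>
      have : f n₁ ^ 2 ≤ Q n₁ := by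
        cases n₁ with
        | zero => simp [hQdef]
        | succ t =>
          rw [hQdef, ema_succ]
          have := ema_sq_nonneg (b := b) f t
          have : 0 ≤ b ^ 2 * ema (b ^ 2) (fun s => f s ^ 2) t := by positivity
          linarith
      exact lt_of_lt_of_le (by positivity) this
    | succ k ih =>
      change 0 < b ^ 2 * Q (n₁ + k) + f (n₁ + k + 1) ^ 2
      positivity
  -- As the second rate is `b ^ 2`, the denominator loses at most a factor `b` per step, the same
  -- factor that multiplies the old error of the moving sum. Relative errors therefore only add up.
  have hQstep : ∀ k, b * √(Q (n₁ + k)) ≤ √(Q (n₁ + k + 1)) := by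
    intro k
    apply Real.le_sqrt_of_sq_le
    rw [mul_pow, Real.sq_sqrt (hQpos k).le]
    change _ ≤ b ^ 2 * Q (n₁ + k) + f (n₁ + k + 1) ^ 2
    have := sq_nonneg (f (n₁ + k + 1))
    linarith
  have hlamn : ∀ k ≤ n, |lam (n₁ + k)| ≤ 3 / 2 := by
    intro k hk
    have h1 := hlam k hk
    have h2 := abs_add_le (lam (n₁ + k) - 1) 1
    rw [sub_add_cancel, abs_one] at h2
    linarith
  -- the moving sums
  have hMn : ∀ m ≤ n, |ema b g (n₁ + m) - lam (n₁ + m) * ema b f (n₁ + m)|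
      ≤ (ε + δ * ∑ k ∈ Finset.range m, emaRatio b ξ f (n₁ + k)) * (√(Q (n₁ + m)) + ξ) := by
    intro m
    induction m with
    | zero => intro _; simpa using hM
    | succ m ih =>
      intro hm
      have h1 := ih (by omega)
      have h2 := hdlam m (by omega)
      have h3 := hg (m + 1) hm
      rw [Finset.sum_range_succ]
      -- The new gradient cancels, because it is exactly `lam` times `f`; only the change of `lam`
      -- acts on the old moving sum. Its relative size is `δ` times `emaRatio`, which is why the sum
      -- of these ratios has to be bounded.
      have e : ema b g (n₁ + (m + 1)) - lam (n₁ + (m + 1)) * ema b f (n₁ + (m + 1))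
          = b * ((ema b g (n₁ + m) - lam (n₁ + m) * ema b f (n₁ + m))
              - (lam (n₁ + m + 1) - lam (n₁ + m)) * ema b f (n₁ + m)) := by
        change b * ema b g (n₁ + m) + g (n₁ + (m + 1)) - lam (n₁ + m + 1) *
          (b * ema b f (n₁ + m) + f (n₁ + m + 1)) = _
        rw [h3]
        change b * ema b g (n₁ + m) + lam (n₁ + m + 1) * f (n₁ + m + 1) - lam (n₁ + m + 1) *
          (b * ema b f (n₁ + m) + f (n₁ + m + 1)) = _
        ring
      have hV0 := Real.sqrt_nonneg (Q (n₁ + m))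
      have h4 : |ema b f (n₁ + m)| = emaRatio b ξ f (n₁ + m) * (√(Q (n₁ + m)) + ξ) := by
        change _ = |ema b f (n₁ + m)| / (√(Q (n₁ + m)) + ξ) * (√(Q (n₁ + m)) + ξ)
        field_simp
      have hs0 : 0 ≤ ∑ k ∈ Finset.range m, emaRatio b ξ f (n₁ + k) :=
        Finset.sum_nonneg fun k _ => emaRatio_nonneg hξ.le f _
      have hr0 := emaRatio_nonneg (b := b) hξ.le f (n₁ + m)
      rw [e, abs_mul, abs_of_pos hb]
      calc _ ≤ b * (|ema b g (n₁ + m) - lam (n₁ + m) * ema b f (n₁ + m)|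
              + |lam (n₁ + m + 1) - lam (n₁ + m)| * |ema b f (n₁ + m)|) := by
            rw [← abs_mul]; gcongr; exact abs_sub _ _
        _ ≤ b * ((ε + δ * ∑ k ∈ Finset.range m, emaRatio b ξ f (n₁ + k)) * (√(Q (n₁ + m)) + ξ)
              + δ * (emaRatio b ξ f (n₁ + m) * (√(Q (n₁ + m)) + ξ))) := by
            rw [← h4]; gcongr
        _ = (ε + δ * (∑ k ∈ Finset.range m, emaRatio b ξ f (n₁ + k) + emaRatio b ξ f (n₁ + m)))
              * (b * √(Q (n₁ + m)) + b * ξ) := by ring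
        _ ≤ _ := by
            gcongr
            · exact hQstep m
            · exact mul_le_of_le_one_left hξ.le hb1.le
  have hQn : ∀ m ≤ n, |Qg (n₁ + m) - lam (n₁ + m) ^ 2 * Q (n₁ + m)|
      ≤ (ε + 3 * δ * m) * Q (n₁ + m) := by
    intro m
    induction m with
    | zero => intro _; simpa using hQ
    | succ m ih =>
      intro hm
      have h1 := ih (by omega)
      have h2 := hdlam m (by omega)
      have h3 := hg (m + 1) hm
      have h5 := hlamn m (by omega)
      have h6 := hlamn (m + 1) hm
      have e : Qg (n₁ + (m + 1)) - lam (n₁ + (m + 1)) ^ 2 * Q (n₁ + (m + 1))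
          = b ^ 2 * ((Qg (n₁ + m) - lam (n₁ + m) ^ 2 * Q (n₁ + m))
              - ((lam (n₁ + m + 1) - lam (n₁ + m)) * (lam (n₁ + m + 1) + lam (n₁ + m)))
                * Q (n₁ + m)) := by
        change b ^ 2 * Qg (n₁ + m) + g (n₁ + (m + 1)) ^ 2 - lam (n₁ + m + 1) ^ 2 *
          (b ^ 2 * Q (n₁ + m) + f (n₁ + m + 1) ^ 2) = _
        rw [h3]
        change b ^ 2 * Qg (n₁ + m) + (lam (n₁ + m + 1) * f (n₁ + m + 1)) ^ 2
          - lam (n₁ + m + 1) ^ 2 * (b ^ 2 * Q (n₁ + m) + f (n₁ + m + 1) ^ 2) = _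
        ring
      -- With `|lam| ≤ 3 / 2` the square of `lam` changes by at most `3 * δ` per step.
      have h7 : |lam (n₁ + m + 1) + lam (n₁ + m)| ≤ 3 := by
        refine (abs_add_le _ _).trans ?_
        change |lam (n₁ + (m + 1))| + |lam (n₁ + m)| ≤ 3
        linarith
      have hq := hQpos m
      rw [e, abs_mul, abs_of_pos (by positivity : 0 < b ^ 2)]
      calc _ ≤ b ^ 2 * (|Qg (n₁ + m) - lam (n₁ + m) ^ 2 * Q (n₁ + m)|
              + |lam (n₁ + m + 1) - lam (n₁ + m)| * |lam (n₁ + m + 1) + lam (n₁ + m)|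
                * Q (n₁ + m)) := by
            gcongr
            refine (abs_sub _ _).trans ?_
            rw [abs_mul, abs_mul, abs_of_pos hq]
        _ ≤ b ^ 2 * ((ε + 3 * δ * m) * Q (n₁ + m) + δ * 3 * Q (n₁ + m)) := by gcongr
        _ = (ε + 3 * δ * (m + 1 : ℕ)) * (b ^ 2 * Q (n₁ + m)) := by push_cast; ring
        _ ≤ _ := by
            gcongr
            change _ ≤ b ^ 2 * Q (n₁ + m) + f (n₁ + m + 1) ^ 2
            have := sq_nonneg (f (n₁ + m + 1))
            linarith
  -- the quotient
  have hMe := hMn n le_rfl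
  have hQe := hQn n le_rfl
  have hl := hlam n le_rfl
  have hln := hlamn n le_rfl
  have hr0 := emaRatio_nonneg (b := b) hξ.le f (n₁ + n)
  have hSg0 : 0 ≤ Sg * ε := le_trans (mul_nonneg hδ
    (Finset.sum_nonneg fun k _ => emaRatio_nonneg hξ.le f _)) hSg
  set Mf := ema b f (n₁ + n) with hMf
  set Mg := ema b g (n₁ + n) with hMg
  set q := Q (n₁ + n) with hq
  set qg := Qg (n₁ + n) with hqg
  set l := lam (n₁ + n) with hl_def
  set r := emaRatio b ξ f (n₁ + n) with hr
  have hq0 : 0 < q := hQpos n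
  have hV0 : 0 < √q := Real.sqrt_pos.2 hq0
  have h4 : |Mf| = r * (√q + ξ) := by
    change _ = |Mf| / (√q + ξ) * (√q + ξ)
    field_simp
  have hM1 : |Mg - Mf| ≤ ε * (1 + Sg + r) * (√q + ξ) := by
    have e : Mg - Mf = (Mg - l * Mf) + (l - 1) * Mf := by ring
    rw [e]
    refine (abs_add_le _ _).trans ?_
    rw [abs_mul, h4]
    calc _ ≤ (ε + Sg * ε) * (√q + ξ) + ε * (r * (√q + ξ)) := by
          gcongr
          exact hMe.trans (by gcongr)
      _ = _ := by ring
  have hq1 : |qg - q| ≤ 13 * ε * q := by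
    have e : qg - q = (qg - l ^ 2 * q) + (l - 1) * (l + 1) * q := by ring
    rw [e]
    refine (abs_add_le _ _).trans ?_
    have h5 : |l + 1| ≤ 3 := by
      refine (abs_add_le _ _).trans ?_
      rw [abs_one]; linarith
    rw [abs_mul, abs_mul, abs_of_pos hq0]
    calc _ ≤ (ε + 9 * ε) * q + ε * 3 * q := by
          gcongr
          exact hQe.trans (by gcongr)
      _ = _ := by ring
  set c := ema b (fun _ => 1) (n₁ + n) with hc
  have hc1 : 1 ≤ c := one_le_ema_one hb.le _
  set c2 := ema (b ^ 2) (fun _ => 1) (n₁ + n) with hc2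
  have hc21 : 1 ≤ c2 := one_le_ema_one (sq_nonneg b) _
  set ξt := ξ / √(1 - b ^ (2 * (n₁ + n + 1))) with hξt
  have hξt0 : ξ ≤ ξt := le_bias hb hb1 hξ.le _
  have hDf : (1 - b) * (√q + ξ) ≤ √(q / c2) + ξt := adam_denom_ge hb hb1 hξ.le f (n₁ + n)
  set Df := √(q / c2) + ξt with hDf_def
  set Dg := √(qg / c2) + ξt with hDg_def
  have hDf0 : 0 < Df := lt_of_lt_of_le (by positivity) hDf
  have hqg0 : 0 ≤ qg := ema_sq_nonneg g _
  have hDD : |Dg - Df| ≤ 13 * ε * Df := by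
    have e : Dg - Df = √(qg / c2) - √(q / c2) := by rw [hDg_def, hDf_def]; ring
    have hs : 0 < √(q / c2) := Real.sqrt_pos.2 (by positivity)
    have e2 : √(qg / c2) - √(q / c2) = ((qg - q) / c2) / (√(qg / c2) + √(q / c2)) := by
      rw [eq_div_iff (by positivity)]
      have h1 := Real.sq_sqrt (by positivity : 0 ≤ qg / c2)
      have h2 := Real.sq_sqrt (by positivity : 0 ≤ q / c2)
      linear_combination h1 - h2
    rw [e, e2, abs_div, abs_div, abs_of_pos (by linarith : 0 < c2),
      abs_of_pos (by positivity : 0 < √(qg / c2) + √(q / c2)), div_le_iff₀ (by positivity)]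
    have h2 := Real.sq_sqrt (by positivity : 0 ≤ q / c2)
    calc |qg - q| / c2 ≤ 13 * ε * q / c2 := by gcongr
      _ = 13 * ε * √(q / c2) * √(q / c2) := by rw [mul_assoc _ (√(q / c2)), ← sq, h2]; ring
      _ ≤ 13 * ε * Df * (√(qg / c2) + √(q / c2)) := by
          have h3 : √(q / c2) ≤ Df := by linarith
          have h4 : √(q / c2) ≤ √(qg / c2) + √(q / c2) := by
            linarith [Real.sqrt_nonneg (qg / c2)]
          gcongr
  have hDg2 : Df / 2 ≤ Dg := by
    have := (abs_le.1 hDD).1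
    have := mul_le_mul_of_nonneg_right hε hDf0.le
    linarith
  have hDg0 : 0 < Dg := by linarith
  have e : adamU b ξ g (n₁ + n) - adamU b ξ f (n₁ + n)
      = ((Mg - Mf) - Mf * (Dg - Df) / Df) / (c * Dg) := by
    change Mg / c / Dg - Mf / c / Df = _
    have hc0 : c ≠ 0 := by linarith
    field_simp
    ring
  rw [e, abs_div, abs_of_pos (by positivity : 0 < c * Dg), div_le_iff₀ (by positivity)]
  have h9 : √q + ξ ≤ Df / (1 - b) := by rw [le_div_iff₀ hu]; linarith
  calc _ ≤ |Mg - Mf| + |Mf * (Dg - Df) / Df| := abs_sub _ _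
    _ ≤ ε * (1 + Sg + r) * (√q + ξ) + r * (√q + ξ) * (13 * ε * Df) / Df := by
        rw [abs_div, abs_mul, abs_of_pos hDf0, h4]
        gcongr
    _ = ε * (1 + Sg + 14 * r) * (√q + ξ) := by field_simp; ring
    _ ≤ 16 * (ε * (1 + Sg + r)) * (Df / (1 - b)) := by
        have h10 : ε * (1 + Sg + 14 * r) ≤ 16 * (ε * (1 + Sg + r)) := by
          linarith [mul_nonneg hε0 hr0]
        have h11 : 0 ≤ 16 * (ε * (1 + Sg + r)) := by
          linarith [mul_nonneg hε0 hr0]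
        have : 0 ≤ √q + ξ := by positivity
        exact mul_le_mul h10 h9 this h11
    _ ≤ 32 / (1 - b) ^ 2 * ε * (1 + Sg + r) * (c * Dg) := by
        have h11 : 0 ≤ ε * (1 + Sg + r) := by linarith [mul_nonneg hε0 hr0]
        have h12 : Df / (1 - b) ≤ 2 * (c * Dg) / (1 - b) := by
          have : Df ≤ 2 * (c * Dg) := by
            have := mul_le_mul_of_nonneg_right hc1 hDg0.le
            linarith
          gcongr
        have h13 : 2 * (c * Dg) / (1 - b) ≤ 2 * (c * Dg) / (1 - b) ^ 2 := by
          have : (1 - b) ^ 2 ≤ 1 - b := by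
            rw [sq]; exact mul_le_of_le_one_left hu.le (by linarith)
          gcongr
        calc _ ≤ 16 * (ε * (1 + Sg + r)) * (2 * (c * Dg) / (1 - b) ^ 2) := by
              gcongr 16 * _ * ?_
              exact h12.trans h13
          _ = _ := by field_simp; ring

end

end DiagGeometry

namespace DiagGeometry

/-! ### Adam on the two-layer network: the growth phase -/

/-- Adam on the two-layer linear network after normalising the signs of the rows: `x` is the second
layer, `y` the first one and `r` the negative residual of the mini-batch, which is known
approximately up to time `T`. The large constant `K` and the small number `h` measure all other
quantities. -/
structure AdamRun {d : ℕ} (b K h D η ξ : ℝ) (T : ℕ) (A : Fin d → ℝ) (x : ℕ → Fin d → ℝ)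
    (y : ℕ → Fin d → Fin d → ℝ) (r : ℕ → Fin d → ℝ) : Prop where
  b_pos : 0 < b
  b_lt : b < 1
  hK : 100 ≤ K
  inv_le : 1 / (1 - b) ≤ K
  sign_le : 6 / (1 - b) ^ 4 ≤ K
  incr_le : 12 / (b * (1 - b) ^ 3) ≤ K
  h_pos : 0 < h
  hKh : K ^ 40 * h ≤ 1
  one_le_D : 1 ≤ D
  hDh : D * h ≤ 1
  hdD : (d : ℝ) = D ^ 2
  η_pos : 0 < η
  η_le : η ≤ h ^ 46
  ξ_pos : 0 < ξ
  ξ_le : ξ ≤ h ^ 40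
  A_lower : ∀ j, 1 / K ≤ A j
  A_upper : ∀ j, A j ≤ K
  x_succ : ∀ t i, x (t + 1) i = x t i + η * adamU b ξ (fun s => ∑ j, r s j * y s i j) t
  y_succ : ∀ t i j, y (t + 1) i j = y t i j + η * adamU b ξ (fun s => x s i * r s j) t
  resid : ∀ t ≤ T, ∀ j, |r t j - (A j - ∑ i, x t i * y t i j)|
    ≤ η / d * (1 + ∑ k, |∑ i, x t i * y t i k|)
  x_lower : ∀ i, h ^ 20 ≤ x 0 i
  x_upper : ∀ i, x 0 i ≤ h ^ 14
  y_init : ∀ i j, |y 0 i j| ≤ h ^ 28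

/-- One power of `h` pays for any constant. All exponents of `h` below leave at least one such power
to spare, so constants never have to be optimized. -/
lemma pow_mul_pow_le {K h : ℝ} (hK : 1 ≤ K) (hh : 0 < h) (hKh : K ^ 40 * h ≤ 1) {a : ℕ}
    (n : ℕ) (ha : a ≤ 40) : K ^ a * h ^ (n + 1) ≤ h ^ n := by
  have h1 : K ^ a ≤ K ^ 40 := pow_le_pow_right₀ hK ha
  calc K ^ a * h ^ (n + 1) = (K ^ a * h) * h ^ n := by ring
    _ ≤ (K ^ 40 * h) * h ^ n := by gcongr
    _ ≤ 1 * h ^ n := by gcongr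
    _ = h ^ n := one_mul _

/-- A sequence whose increments are close to `η`, closer and closer as time grows. -/
lemma displacement {a : ℕ → ℝ} {η c θ₁ θ₂ ρ₁ ρ₂ : ℝ} {n : ℕ} (hη : 0 ≤ η) (hc : 0 ≤ c)
    (hθ₁ : 0 ≤ θ₁) (hρ₁ : 0 ≤ ρ₁) (hρ₂ : 0 ≤ ρ₂) (hθ₂ : 0 ≤ θ₂)
    (h1 : ∀ m < n, η * m < θ₁ → |a (m + 1) - a m - η| ≤ c * η)
    (h2 : ∀ m < n, θ₁ ≤ η * m → |a (m + 1) - a m - η| ≤ ρ₁ * η)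
    (h3 : ∀ m < n, θ₂ ≤ η * m → |a (m + 1) - a m - η| ≤ ρ₂ * η) :
    |a n - a 0 - η * n| ≤ c * (θ₁ + η) + ρ₁ * (η * n) ∧
    |a n - a 0 - η * n| ≤ c * (θ₁ + η) + ρ₁ * (θ₂ + η) + ρ₂ * (η * n) := by
  have e : ∀ m : ℕ, a (m + 1) - a 0 - η * (m + 1 : ℕ)
      = (a m - a 0 - η * m) + (a (m + 1) - a m - η) := fun m => by push_cast; ring
  have hA : ∀ m ≤ n, η * m < θ₁ + η → |a m - a 0 - η * m| ≤ c * (η * m) := by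
    intro m
    induction m with
    | zero => intro _ _; simp
    | succ m ih =>
      intro hm hlt
      push_cast at hlt
      have := ih (by omega) (by linarith)
      have := h1 m (by omega) (by linarith)
      rw [e]
      refine (abs_add_le _ _).trans ?_
      push_cast
      linarith
  have hB : ∀ m ≤ n, |a m - a 0 - η * m| ≤ c * (θ₁ + η) + ρ₁ * (η * m) := by
    intro m
    induction m with
    | zero => intro _; simp; positivity
    | succ m ih =>
      intro hm
      by_cases hlt : η * m < θ₁
      · have h4 : η * ((m + 1 : ℕ) : ℝ) < θ₁ + η := by push_cast; linarith
        have h5 := hA (m + 1) hm h4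
        have h6 : c * (η * ((m + 1 : ℕ) : ℝ)) ≤ c * (θ₁ + η) := by gcongr
        have : 0 ≤ ρ₁ * (η * ((m + 1 : ℕ) : ℝ)) := by positivity
        linarith
      · push Not at hlt
        have := ih (by omega)
        have := h2 m (by omega) hlt
        rw [e]
        refine (abs_add_le _ _).trans ?_
        push_cast
        linarith
  refine ⟨hB n le_rfl, ?_⟩
  have hC : ∀ m ≤ n, |a m - a 0 - η * m| ≤ c * (θ₁ + η) + ρ₁ * (θ₂ + η) + ρ₂ * (η * m) := by
    intro m
    induction m with
    | zero => intro _; simp; positivity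
    | succ m ih =>
      intro hm
      by_cases hlt : η * m < θ₂
      · have h5 := hB (m + 1) hm
        have h6 : ρ₁ * (η * ((m + 1 : ℕ) : ℝ)) ≤ ρ₁ * (θ₂ + η) := by
          push_cast; gcongr; linarith
        have : 0 ≤ ρ₂ * (η * ((m + 1 : ℕ) : ℝ)) := by positivity
        linarith
      · push Not at hlt
        have := ih (by omega)
        have := h3 m (by omega) hlt
        rw [e]
        refine (abs_add_le _ _).trans ?_
        push_cast
        linarith
  exact hC n le_rfl

lemma abs_sub_le_of_steps {g : ℕ → ℝ} {L : ℝ} {n : ℕ}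
    (h : ∀ s < n, |g (s + 1) - g s| ≤ L) : ∀ t ≤ n, ∀ s ≤ t, |g s - g t| ≤ ((t : ℝ) - s) * L := by
  intro t
  induction t with
  | zero => intro _ s hs; have : s = 0 := by omega
            subst this; simp
  | succ t ih =>
    intro ht s hs
    rcases Nat.lt_or_ge t s with hlt | hle
    · have : s = t + 1 := by omega
      subst this; simp
    · have h1 := ih (by omega) s hle
      have h2 := h t (by omega)
      have e : g s - g (t + 1) = (g s - g t) - (g (t + 1) - g t) := by ring
      rw [e]
      refine (abs_sub _ _).trans ?_
      push_cast
      linarith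

/-! ### A priori bounds for weights, residuals and gradient increments along Adam. -/

namespace AdamRun

variable {d : ℕ} {b K h D η ξ : ℝ} {T : ℕ} {A : Fin d → ℝ} {x : ℕ → Fin d → ℝ}
  {y : ℕ → Fin d → Fin d → ℝ} {r : ℕ → Fin d → ℝ}

/-- The end-to-end vector. -/
def prodVec (x : ℕ → Fin d → ℝ) (y : ℕ → Fin d → Fin d → ℝ) (t : ℕ) (j : Fin d) : ℝ :=
  ∑ i, x t i * y t i j

variable (H : AdamRun b K h D η ξ T A x y r)
include H

lemma K_pos : 0 < K := by have := H.hK; linarith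
lemma one_le_K : 1 ≤ K := by have := H.hK; linarith
lemma D_pos : 0 < D := by have := H.one_le_D; linarith

lemma pow_le {a : ℕ} (n : ℕ) (ha : a ≤ 40) : K ^ a * h ^ (n + 1) ≤ h ^ n :=
  pow_mul_pow_le H.one_le_K H.h_pos H.hKh n ha

lemma h_le : h ≤ 1 / K := by
  have h1 := H.pow_le (a := 1) 0 (by norm_num)
  rw [le_div_iff₀ H.K_pos]
  simp at h1
  linarith

lemma h_le' : h ≤ 1 / 100 := by
  have h1 := H.h_le
  have h2 : 1 / K ≤ 1 / 100 := one_div_le_one_div_of_le (by norm_num) H.hK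
  linarith

lemma h_le_inv_D : h ≤ 1 / D := by
  rw [le_div_iff₀ H.D_pos, mul_comm]; exact H.hDh

lemma d_pos : (0 : ℝ) < d := by rw [H.hdD]; have := H.D_pos; positivity

lemma sqrt_η_le : √η ≤ h ^ 23 := by
  rw [Real.sqrt_le_left (by have := H.h_pos; positivity)]
  calc η ≤ h ^ 46 := H.η_le
    _ = (h ^ 23) ^ 2 := by ring

/-- Cauchy–Schwarz bounds the update by `√(t+1) / (1-b)`, and on the time scale `η (t+1) ≤ 1` this
gives a step of order `√η`. The bound needs nothing about the gradient, so it remains available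
during the oscillation. -/
lemma abs_step_le {g : ℕ → ℝ} {t : ℕ} (ht : η * (t + 1) ≤ 1) :
    |η * adamU b ξ g t| ≤ K * h ^ 23 := by
  have h1 := abs_adamU_le_sqrt H.b_pos H.b_lt H.ξ_pos g t
  have hη := H.η_pos
  have hu : 0 < 1 - b := by linarith [H.b_lt]
  rw [abs_mul, abs_of_pos hη]
  calc η * |adamU b ξ g t| ≤ η * (√(t + 1) / (1 - b)) := by gcongr
    _ = √η * √(η * (t + 1)) * (1 / (1 - b)) := by
        rw [Real.sqrt_mul hη.le]
        have := Real.mul_self_sqrt hη.le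
        calc _ = (√η * √η) * (√(t + 1) / (1 - b)) := by rw [this]
          _ = _ := by ring
    _ ≤ h ^ 23 * 1 * K := by
        have := H.h_pos
        gcongr
        · exact H.sqrt_η_le
        · exact Real.sqrt_le_one.mpr ht
        · exact H.inv_le
    _ = _ := by ring

/-- A bound on all weights up to time `n`. -/
def Bdd (K D : ℝ) (x : ℕ → Fin d → ℝ) (y : ℕ → Fin d → Fin d → ℝ) (n : ℕ) : Prop :=
  ∀ s ≤ n, ∀ i, |x s i| ≤ K ^ 4 / D ∧ ∀ j, |y s i j| ≤ K ^ 4 / D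

lemma abs_prod_le {n : ℕ} (hB : Bdd K D x y n) {s : ℕ} (hs : s ≤ n) (j : Fin d) :
    |prodVec x y s j| ≤ K ^ 8 := by
  have hD := H.D_pos
  have hK := H.K_pos
  calc |prodVec x y s j| ≤ ∑ i, |x s i * y s i j| := Finset.abs_sum_le_sum_abs _ _
    _ ≤ ∑ _i : Fin d, K ^ 4 / D * (K ^ 4 / D) := by
        gcongr with i
        rw [abs_mul]
        have := hB s hs i
        exact mul_le_mul this.1 (this.2 j) (abs_nonneg _) (by positivity)
    _ = K ^ 8 := by
        rw [Finset.sum_const, Finset.card_univ, Fintype.card_fin, nsmul_eq_mul, H.hdD]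
        field_simp

/-- The batch error `η / d` per entry is summed over `d` bounded coordinates of the product, which
leaves an error of order `η` in each residual. -/
lemma noise_le {n : ℕ} (hB : Bdd K D x y n) {s : ℕ} (hs : s ≤ n) (hsT : s ≤ T) (j : Fin d) :
    |r s j - (A j - prodVec x y s j)| ≤ 2 * K ^ 8 * η := by
  have hd := H.d_pos
  have hη := H.η_pos
  have hK := H.one_le_K
  refine (H.resid s hsT j).trans ?_
  have h1 : ∑ k, |∑ i, x s i * y s i k| ≤ d * K ^ 8 := by
    calc _ ≤ ∑ _k : Fin d, K ^ 8 := by gcongr with k; exact H.abs_prod_le hB hs k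
      _ = d * K ^ 8 := by simp
  have hd1 : (1 : ℝ) ≤ d := by rw [H.hdD]; have := H.one_le_D; nlinarith
  have hK8 : 1 ≤ K ^ 8 := one_le_pow₀ hK
  rw [div_mul_eq_mul_div, div_le_iff₀ hd]
  have h2 : 1 + ∑ k, |∑ i, x s i * y s i k| ≤ 2 * K ^ 8 * d := by nlinarith
  calc _ ≤ η * (2 * K ^ 8 * d) := by gcongr
    _ = _ := by ring

lemma η_small : 2 * K ^ 8 * η ≤ h ^ 40 := by
  have h1 := H.pow_le (a := 9) 45 (by norm_num)
  have hh := H.h_pos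
  have hK := H.hK
  have hK0 := H.K_pos
  have h2 : h ^ 45 ≤ h ^ 40 := pow_le_pow_of_le_one hh.le (by linarith [H.h_le']) (by norm_num)
  calc 2 * K ^ 8 * η ≤ K * K ^ 8 * h ^ 46 := by
        have := H.η_le
        have := H.η_pos
        gcongr
        linarith
    _ = K ^ 9 * h ^ (45 + 1) := by ring
    _ ≤ h ^ 40 := h1.trans h2

lemma abs_resid_le {n : ℕ} (hB : Bdd K D x y n) {s : ℕ} (hs : s ≤ n) (hsT : s ≤ T) (j : Fin d) :
    |r s j| ≤ K ^ 9 := by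
  have h1 := H.noise_le hB hs hsT j
  have h2 := H.abs_prod_le hB hs j
  have h3 := H.A_lower j
  have h4 := H.A_upper j
  have h5 := H.η_small
  have hK := H.hK
  have hh := H.h_pos
  have h6 : h ^ 40 ≤ 1 := pow_le_one₀ hh.le (by linarith [H.h_le'])
  have h7 : 0 < 1 / K := by have := H.K_pos; positivity
  have h8 : K ≤ K ^ 8 := by
    calc K = K ^ 1 := (pow_one K).symm
      _ ≤ K ^ 8 := pow_le_pow_right₀ H.one_le_K (by norm_num)
  have h9 : K ^ 9 = K * K ^ 8 := by ring
  rw [abs_le] at h1 h2 ⊢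
  constructor <;> nlinarith

/-- Crude Lipschitz bounds, all from `abs_step_le`. They make it possible to apply `adamU_near_one`:
a gradient much larger than `h ^ 23` (up to constants) changes by a small fraction per step. -/
lemma steps {n : ℕ} (hB : Bdd K D x y n) (hT : n ≤ T) (hn : η * (n + 1) ≤ 1) {s : ℕ}
    (hs : s < n) :
    (∀ i, |x (s + 1) i - x s i| ≤ K * h ^ 23) ∧ (∀ i j, |y (s + 1) i j - y s i j| ≤ K * h ^ 23) ∧
    (∀ j, |prodVec x y (s + 1) j - prodVec x y s j| ≤ D * K ^ 6 * h ^ 23) ∧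
    (∀ j, |r (s + 1) j - r s j| ≤ D * K ^ 7 * h ^ 23) ∧
    (∀ i j, |x (s + 1) i * r (s + 1) j - x s i * r s j| ≤ K ^ 12 * h ^ 23) ∧
    (∀ i, |∑ j, r (s + 1) j * y (s + 1) i j - ∑ j, r s j * y s i j|
      ≤ D ^ 2 * (K ^ 12 * h ^ 23)) := by
  have hD := H.D_pos
  have hD1 := H.one_le_D
  have hK := H.hK
  have hK0 := H.K_pos
  have hK1 := H.one_le_K
  have hh := H.h_pos
  have hη := H.η_pos
  have hs1 : η * ((s : ℝ) + 1) ≤ 1 := by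
    refine le_trans ?_ hn
    have : (s : ℝ) ≤ n := by exact_mod_cast hs.le
    gcongr
  have hx : ∀ i, |x (s + 1) i - x s i| ≤ K * h ^ 23 := by
    intro i
    rw [H.x_succ, add_sub_cancel_left]
    exact H.abs_step_le hs1
  have hy : ∀ i j, |y (s + 1) i j - y s i j| ≤ K * h ^ 23 := by
    intro i j
    rw [H.y_succ, add_sub_cancel_left]
    exact H.abs_step_le hs1
  have hDh22 : D * h ^ 23 ≤ h ^ 22 := by
    calc D * h ^ 23 = (D * h) * h ^ 22 := by ring
      _ ≤ 1 * h ^ 22 := by gcongr; exact H.hDh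
      _ = _ := one_mul _
  have hP : ∀ j, |prodVec x y (s + 1) j - prodVec x y s j| ≤ D * K ^ 6 * h ^ 23 := by
    intro j
    unfold prodVec
    rw [← Finset.sum_sub_distrib]
    calc _ ≤ ∑ i, |x (s + 1) i * y (s + 1) i j - x s i * y s i j| := Finset.abs_sum_le_sum_abs _ _
      _ ≤ ∑ _i : Fin d, 2 * (K * h ^ 23 * (K ^ 4 / D)) := by
          gcongr with i
          have e : x (s + 1) i * y (s + 1) i j - x s i * y s i j
              = (x (s + 1) i - x s i) * y (s + 1) i j + x s i * (y (s + 1) i j - y s i j) := by ring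
          rw [e]
          refine (abs_add_le _ _).trans ?_
          rw [abs_mul, abs_mul]
          have h1 := (hB (s + 1) hs i).2 j
          have h2 := (hB s hs.le i).1
          have h3 : |x (s + 1) i - x s i| * |y (s + 1) i j| ≤ K * h ^ 23 * (K ^ 4 / D) :=
            mul_le_mul (hx i) h1 (abs_nonneg _) (by positivity)
          have h4 : |x s i| * |y (s + 1) i j - y s i j| ≤ (K ^ 4 / D) * (K * h ^ 23) :=
            mul_le_mul h2 (hy i j) (abs_nonneg _) (by positivity)
          linarith
      _ = D * (2 * K ^ 5) * h ^ 23 := by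
          rw [Finset.sum_const, Finset.card_univ, Fintype.card_fin, nsmul_eq_mul, H.hdD]
          field_simp
      _ ≤ D * (K * K ^ 5) * h ^ 23 := by gcongr; linarith
      _ = _ := by ring
  have hr : ∀ j, |r (s + 1) j - r s j| ≤ D * K ^ 7 * h ^ 23 := by
    intro j
    have h1 := H.noise_le hB (s := s + 1) hs (by omega) j
    have h2 := H.noise_le hB hs.le (by omega) j
    have h3 := hP j
    have h4 : 2 * K ^ 8 * η ≤ D * K ^ 6 * h ^ 23 := by
      have h5 := H.η_small
      have h6 : h ^ 40 ≤ h ^ 23 :=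
        pow_le_pow_of_le_one hh.le (by linarith [H.h_le']) (by norm_num)
      have h7 : 1 ≤ D * K ^ 6 := one_le_mul_of_one_le_of_one_le hD1 (one_le_pow₀ hK1)
      have h8 : h ^ 23 ≤ D * K ^ 6 * h ^ 23 := by
        have : 0 < h ^ 23 := by positivity
        nlinarith
      linarith
    have e : r (s + 1) j - r s j = (r (s + 1) j - (A j - prodVec x y (s + 1) j))
        - (r s j - (A j - prodVec x y s j)) - (prodVec x y (s + 1) j - prodVec x y s j) := by ring
    rw [e]
    refine (abs_sub _ _).trans ?_
    have h9 := abs_sub (r (s + 1) j - (A j - prodVec x y (s + 1) j))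
        (r s j - (A j - prodVec x y s j))
    have h10 : 3 * (D * K ^ 6 * h ^ 23) ≤ K * (D * K ^ 6 * h ^ 23) := by gcongr; linarith
    have e2 : D * K ^ 7 * h ^ 23 = K * (D * K ^ 6 * h ^ 23) := by ring
    linarith
  refine ⟨hx, hy, hP, hr, ?_, ?_⟩
  · intro i j
    have e : x (s + 1) i * r (s + 1) j - x s i * r s j
        = (x (s + 1) i - x s i) * r (s + 1) j + x s i * (r (s + 1) j - r s j) := by ring
    rw [e]
    refine (abs_add_le _ _).trans ?_
    rw [abs_mul, abs_mul]
    have h1 := H.abs_resid_le hB (s := s + 1) hs (by omega) j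
    have h2 := (hB s hs.le i).1
    have h3 : |x (s + 1) i - x s i| * |r (s + 1) j| ≤ K * h ^ 23 * K ^ 9 :=
      mul_le_mul (hx i) h1 (abs_nonneg _) (by positivity)
    have h4 : |x s i| * |r (s + 1) j - r s j| ≤ (K ^ 4 / D) * (D * K ^ 7 * h ^ 23) :=
      mul_le_mul h2 (hr j) (abs_nonneg _) (by positivity)
    have e4 : (K ^ 4 / D) * (D * K ^ 7 * h ^ 23) = K ^ 11 * h ^ 23 := by field_simp
    have h5 : K * h ^ 23 * K ^ 9 ≤ K ^ 11 * h ^ 23 := by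
      calc _ = K ^ 10 * h ^ 23 := by ring
        _ ≤ _ := by gcongr; norm_num
    have h6 : 2 * (K ^ 11 * h ^ 23) ≤ K * (K ^ 11 * h ^ 23) := by gcongr; linarith
    have e6 : K ^ 12 * h ^ 23 = K * (K ^ 11 * h ^ 23) := by ring
    linarith
  · intro i
    rw [← Finset.sum_sub_distrib]
    calc _ ≤ ∑ j, |r (s + 1) j * y (s + 1) i j - r s j * y s i j| := Finset.abs_sum_le_sum_abs _ _
      _ ≤ ∑ _j : Fin d, (K ^ 12 * h ^ 23) := by
          gcongr with j
          have e : r (s + 1) j * y (s + 1) i j - r s j * y s i j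
              = (r (s + 1) j - r s j) * y s i j + r (s + 1) j * (y (s + 1) i j - y s i j) := by
            ring
          rw [e]
          refine (abs_add_le _ _).trans ?_
          rw [abs_mul, abs_mul]
          have h1 := H.abs_resid_le hB (s := s + 1) hs (by omega) j
          have h2 := (hB s hs.le i).2 j
          have h3 : |r (s + 1) j| * |y (s + 1) i j - y s i j| ≤ K ^ 9 * (K * h ^ 23) :=
            mul_le_mul h1 (hy i j) (abs_nonneg _) (by positivity)
          have h4 : |r (s + 1) j - r s j| * |y s i j| ≤ (D * K ^ 7 * h ^ 23) * (K ^ 4 / D) :=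
            mul_le_mul (hr j) h2 (abs_nonneg _) (by positivity)
          have e4 : (D * K ^ 7 * h ^ 23) * (K ^ 4 / D) = K ^ 11 * h ^ 23 := by field_simp
          have h5 : K ^ 9 * (K * h ^ 23) ≤ K ^ 11 * h ^ 23 := by
            calc _ = K ^ 10 * h ^ 23 := by ring
              _ ≤ _ := by gcongr; norm_num
          have h6 : 2 * (K ^ 11 * h ^ 23) ≤ K * (K ^ 11 * h ^ 23) := by gcongr; linarith
          have e6 : K ^ 12 * h ^ 23 = K * (K ^ 11 * h ^ 23) := by ring
          linarith
      _ = _ := by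
          rw [Finset.sum_const, Finset.card_univ, Fintype.card_fin, nsmul_eq_mul, H.hdD]

/-- The Adam update is within `ρ` of one if the gradient is positive and large compared to its
change per step. -/
lemma adamU_near_one {g : ℕ → ℝ} {n t : ℕ} {L ρ : ℝ} (hg : ∀ s < n, |g (s + 1) - g s| ≤ L)
    (hL0 : 0 ≤ L) (ht : t ≤ n) (hgt : 0 < g t) (hρ : ρ ≤ 1) (hL : K * L ≤ ρ * g t)
    (hξ : K * ξ ≤ ρ * g t) : |adamU b ξ g t - 1| ≤ ρ := by
  have hK := H.K_pos
  have h1 := adamU_sub_one_le H.b_pos H.b_lt (L := L) (ξ := ξ) (ρ := ρ / K)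
    (abs_sub_le_of_steps hg t ht) hL0 hgt
    (by rw [div_mul_eq_mul_div, le_div_iff₀ hK]; linarith) H.ξ_pos
    (by rw [div_mul_eq_mul_div, le_div_iff₀ hK]; linarith)
    (by rw [div_le_iff₀ hK]; have := H.hK; linarith)
  have hρ0 : 0 ≤ ρ := by
    by_contra hcon
    push Not at hcon
    have : 0 ≤ K * L := by positivity
    nlinarith
  refine h1.trans ?_
  calc _ ≤ K * (ρ / K) := by gcongr; exact H.sign_le
    _ = ρ := by field_simp

end AdamRun

end DiagGeometry

namespace DiagGeometry

/-! ### The growth phase: a bootstrap between positions and speeds. -/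

namespace AdamRun

variable {d : ℕ} {b K h D η ξ : ℝ} {T : ℕ} {A : Fin d → ℝ} {x : ℕ → Fin d → ℝ}
  {y : ℕ → Fin d → Fin d → ℝ} {r : ℕ → Fin d → ℝ}

/-- Bounds for the weights in the growth phase. -/
def GrowthInv (h η : ℝ) (x : ℕ → Fin d → ℝ) (y : ℕ → Fin d → Fin d → ℝ) (n : ℕ) : Prop :=
  (∀ i, h ^ 20 / 2 + η * n / 2 ≤ x n i ∧ x n i ≤ 2 * h ^ 14 + 2 * (η * n) ∧
    |x n i - η * n| ≤ 3 * h ^ 13 + h ^ 10 * (η * n)) ∧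
  ∀ i j, |y n i j - η * n| ≤ h ^ 28 + h * (η * n) ∧
    |y n i j - η * n| ≤ 3 * h ^ 13 + h ^ 10 * (η * n)

/-- Bounds for the steps in the growth phase. -/
def GrowthVel (K h η : ℝ) (x : ℕ → Fin d → ℝ) (y : ℕ → Fin d → Fin d → ℝ) (m : ℕ) : Prop :=
  (∀ i, (η * m < h ^ 21 → |x (m + 1) i - x m i - η| ≤ 2 * K * η) ∧
    (h ^ 21 ≤ η * m → |x (m + 1) i - x m i - η| ≤ h * η) ∧
    (h ^ 12 ≤ η * m → |x (m + 1) i - x m i - η| ≤ h ^ 10 * η)) ∧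
  ∀ i j, |y (m + 1) i j - y m i j - η| ≤ h * η ∧
    (h ^ 12 ≤ η * m → |y (m + 1) i j - y m i j - η| ≤ h ^ 10 * η)

variable (H : AdamRun b K h D η ξ T A x y r)
include H

lemma h_pow_le {m n : ℕ} (hmn : n ≤ m) : h ^ m ≤ h ^ n :=
  pow_le_pow_of_le_one H.h_pos.le (by linarith [H.h_le']) hmn

/-- Integration of the speeds over three regimes. Before time `h ^ 21` a second-layer step is
controlled only up to a constant factor, which displaces `x` by at most `h ^ 20 / 25`, small against
its initial size `h ^ 20`; so `x` stays positive. For `y` the uncontrolled regime is empty (`c = 0`,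
`θ₁ = 0`), since its gradient is positive from the start. Up to time `h ^ 12` the error is of order
`h ^ 13`, after it the relative speed error is `h ^ 10`. -/
lemma growthInv_of_vel {n : ℕ} (hV : ∀ m < n, GrowthVel K h η x y m) :
    GrowthInv h η x y n := by
  have hh := H.h_pos
  have hη := H.η_pos
  have hη46 := H.η_le
  have hK := H.hK
  have hK0 := H.K_pos
  have hn0 : 0 ≤ η * n := by positivity
  have hη21 : η ≤ h ^ 21 := hη46.trans (H.h_pow_le (by norm_num))
  have hη12 : η ≤ h ^ 12 := hη46.trans (H.h_pow_le (by norm_num))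
  have hK21 : K * (100 * h ^ 21) ≤ h ^ 20 := by
    calc K * (100 * h ^ 21) ≤ K * (K * h ^ 21) := by gcongr
      _ = K ^ 2 * h ^ (20 + 1) := by ring
      _ ≤ h ^ 20 := H.pow_le 20 (by norm_num)
  have hc : 2 * K * (h ^ 21 + η) ≤ h ^ 20 / 25 := by
    have : 2 * K * (h ^ 21 + η) ≤ 2 * K * (h ^ 21 + h ^ 21) := by gcongr
    linarith
  have h14 : h ^ 20 ≤ h ^ 14 := H.h_pow_le (by norm_num)
  have h13' : h ^ 14 ≤ h ^ 13 / 100 := by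
    calc h ^ 14 = h ^ 13 * h := by ring
      _ ≤ h ^ 13 * (1 / 100) := by gcongr; exact H.h_le'
      _ = _ := by ring
  have hh12 : h * (h ^ 12 + η) ≤ 2 * h ^ 13 := by
    calc h * (h ^ 12 + η) ≤ h * (h ^ 12 + h ^ 12) := by gcongr
      _ = 2 * h ^ 13 := by ring
  have hh1 := H.h_le'
  have hhn : h * (η * n) ≤ 1 / 100 * (η * n) := by gcongr
  have h28 : h ^ 28 ≤ h ^ 14 := H.h_pow_le (by norm_num)
  refine ⟨fun i => ?_, fun i j => ?_⟩
  · obtain ⟨h1, h2⟩ := displacement (a := fun m => x m i) (η := η) (c := 2 * K) (θ₁ := h ^ 21)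
      (θ₂ := h ^ 12) (ρ₁ := h) (ρ₂ := h ^ 10) (n := n) hη.le (by positivity) (by positivity)
      hh.le (by positivity) (by positivity) (fun m hm => ((hV m hm).1 i).1)
      (fun m hm => ((hV m hm).1 i).2.1) (fun m hm => ((hV m hm).1 i).2.2)
    have h3 := H.x_lower i
    have h4 := H.x_upper i
    have h20 : 0 < h ^ 20 := by positivity
    rw [abs_le] at h1 h2
    refine ⟨by linarith [h1.1], by linarith [h1.2], ?_⟩
    rw [abs_le]
    constructor <;> linarith [h2.1, h2.2]
  · obtain ⟨h1, h2⟩ := displacement (a := fun m => y m i j) (η := η) (c := 0) (θ₁ := 0)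
      (θ₂ := h ^ 12) (ρ₁ := h) (ρ₂ := h ^ 10) (n := n) hη.le le_rfl le_rfl
      hh.le (by positivity) (by positivity)
      (fun m _ hlt => absurd hlt (not_lt.2 (by positivity)))
      (fun m hm _ => ((hV m hm).2 i j).1) (fun m hm => ((hV m hm).2 i j).2)
    have h3 := H.y_init i j
    rw [abs_le] at h1 h2 h3
    constructor
    · rw [abs_le]
      constructor <;> linarith [h1.1, h1.2, h3.1, h3.2]
    · rw [abs_le]
      constructor <;> linarith [h2.1, h2.2, h3.1, h3.2]

lemma growth_bounds {n : ℕ} (hn : η * n ≤ 1 / (8 * K * D)) (hI : GrowthInv h η x y n) :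
    (∀ i, 0 < x n i ∧ x n i ≤ 3 / (8 * K * D)) ∧ ∀ i j, |y n i j| ≤ 2 / (8 * K * D) := by
  have hh := H.h_pos
  have hη := H.η_pos
  have hK := H.hK
  have hK0 := H.K_pos
  have hD := H.D_pos
  have hn0 : 0 ≤ η * n := by positivity
  have h14 : 2 * h ^ 14 ≤ 1 / (8 * K * D) := by
    have h1 : 16 * h ^ 12 ≤ 1 := by
      calc 16 * h ^ 12 ≤ 16 * h ^ 1 := by gcongr 16 * ?_; exact H.h_pow_le (by norm_num)
        _ ≤ 1 := by linarith [H.h_le']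
    calc 2 * h ^ 14 = (16 * h ^ 12) * (h * h) / 8 := by ring
      _ ≤ 1 * (1 / K * (1 / D)) / 8 := by
          gcongr
          · exact H.h_le
          · exact H.h_le_inv_D
      _ = _ := by field_simp
  have e3 : 3 / (8 * K * D) = 1 / (8 * K * D) + 2 * (1 / (8 * K * D)) := by ring
  have e2 : 2 / (8 * K * D) = 2 * (1 / (8 * K * D)) := by ring
  refine ⟨fun i => ⟨?_, ?_⟩, fun i j => ?_⟩
  · have := (hI.1 i).1
    have : 0 < h ^ 20 := by positivity
    linarith
  · have := (hI.1 i).2.1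
    linarith
  · have h1 := (hI.2 i j).1
    have h2 := abs_add_le (y n i j - η * n) (η * n)
    rw [sub_add_cancel, abs_of_nonneg hn0] at h2
    have h28 : h ^ 28 ≤ h ^ 14 := H.h_pow_le (by norm_num)
    have hhn : h * (η * n) ≤ 1 / 100 * (η * n) := by gcongr; exact H.h_le'
    linarith

lemma growth_bdd {n : ℕ} (hn : η * n ≤ 1 / (8 * K * D)) (hI : ∀ m ≤ n, GrowthInv h η x y m) :
    Bdd K D x y n := by
  have hK := H.hK
  have hK0 := H.K_pos
  have hD := H.D_pos
  have hη := H.η_pos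
  intro m hm i
  have hm' : η * m ≤ 1 / (8 * K * D) := by
    refine le_trans ?_ hn
    have : (m : ℝ) ≤ n := by exact_mod_cast hm
    gcongr
  obtain ⟨h1, h2⟩ := H.growth_bounds hm' (hI m hm)
  have h3 : 3 / (8 * K * D) ≤ K ^ 4 / D := by
    rw [div_le_div_iff₀ (by positivity) hD]
    have : 3 ≤ K ^ 4 * (8 * K) := by
      have : 1 ≤ K ^ 4 := one_le_pow₀ H.one_le_K
      nlinarith
    nlinarith
  have h4 : 2 / (8 * K * D) ≤ 3 / (8 * K * D) := by gcongr; norm_num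
  refine ⟨?_, fun j => (h2 i j).trans (h4.trans h3)⟩
  rw [abs_of_pos (h1 i).1]
  exact (h1 i).2.trans h3

/-- At the end of the phase each weight is at most `3 / (8KD)`, so the `D²` products sum to a small
fraction of the target and the residual is still `A` up to one percent. -/
lemma growth_resid {n : ℕ} (hT : n ≤ T) (hn : η * n ≤ 1 / (8 * K * D))
    (hI : ∀ m ≤ n, GrowthInv h η x y m) (j : Fin d) :
    |prodVec x y n j| ≤ 1 / (800 * K) ∧ |r n j - A j| ≤ A j / 100 := by
  have hK := H.hK
  have hK0 := H.K_pos
  have hD := H.D_pos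
  have hB := H.growth_bdd hn hI
  obtain ⟨h1, h2⟩ := H.growth_bounds hn (hI n le_rfl)
  have hP : |prodVec x y n j| ≤ 1 / (800 * K) := by
    calc |prodVec x y n j| ≤ ∑ i, |x n i * y n i j| := Finset.abs_sum_le_sum_abs _ _
      _ ≤ ∑ _i : Fin d, 3 / (8 * K * D) * (2 / (8 * K * D)) := by
          gcongr with i
          rw [abs_mul, abs_of_pos (h1 i).1]
          exact mul_le_mul (h1 i).2 (h2 i j) (abs_nonneg _) (by positivity)
      _ = 6 / (64 * K ^ 2) := by
          rw [Finset.sum_const, Finset.card_univ, Fintype.card_fin, nsmul_eq_mul, H.hdD]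
          field_simp; norm_num
      _ ≤ _ := by
          rw [div_le_div_iff₀ (by positivity) (by positivity)]
          nlinarith
  refine ⟨hP, ?_⟩
  have h3 := H.noise_le hB le_rfl hT j
  have h4 := H.η_small
  have h5 : h ^ 40 ≤ 1 / (800 * K) := by
    calc h ^ 40 ≤ h ^ 3 := H.h_pow_le (by norm_num)
      _ = h * h * h := by ring
      _ ≤ (1 / 100) * (1 / 100) * (1 / K) := by
          have := H.h_pos
          gcongr
          · exact H.h_le'
          · exact H.h_le'
          · exact H.h_le
      _ ≤ _ := by
          rw [← one_div_mul_one_div]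
          have : 0 < 1 / K := by positivity
          nlinarith
  have h6 := H.A_lower j
  have e : 1 / (800 * K) = (1 / K) / 800 := by field_simp
  rw [e] at hP h5
  rw [abs_le] at h3 hP ⊢
  constructor <;> linarith [h3.1, h3.2, hP.1, hP.2]

/-- The gradient `xᵢ rⱼ` of a first-layer entry is positive because `x` is, and exceeds its change
per step by a large factor. The second-layer gradient `∑ⱼ rⱼ yᵢⱼ` becomes positive only after `y`
has outgrown its initialization. Before that, only the regularity of its increments is used. -/
lemma growthVel_of_inv {n : ℕ} (hT : n ≤ T) (hn : η * n ≤ 1 / (8 * K * D))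
    (hI : ∀ m ≤ n, GrowthInv h η x y m) (hV : ∀ m < n, GrowthVel K h η x y m) :
    GrowthVel K h η x y n := by
  have hh := H.h_pos
  have hη := H.η_pos
  have hK := H.hK
  have hK0 := H.K_pos
  have hK1 := H.one_le_K
  have hD := H.D_pos
  have hD1 := H.one_le_D
  have hd := H.d_pos
  have hn0 : 0 ≤ η * n := by positivity
  have hB := H.growth_bdd hn hI
  have hn1 : η * (n + 1) ≤ 1 := by
    have h1 : 1 / (8 * K * D) ≤ 1 / 8 := by
      apply one_div_le_one_div_of_le (by norm_num)
      nlinarith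
    have h2 : η ≤ h := by
      calc η ≤ h ^ 46 := H.η_le
        _ ≤ h ^ 1 := H.h_pow_le (by norm_num)
        _ = h := pow_one h
    linarith [H.h_le']
  have hmn : ∀ m ≤ n, η * m ≤ 1 / (8 * K * D) := fun m hm => by
    refine le_trans ?_ hn
    have : (m : ℝ) ≤ n := by exact_mod_cast hm
    gcongr
  have hsteps := fun s (hs : s < n) => H.steps hB hT hn1 hs
  have hres : ∀ m ≤ n, ∀ j, |r m j - A j| ≤ A j / 100 := fun m hm j =>
    (H.growth_resid (hm.trans hT) (hmn m hm) (fun k hk => hI k (hk.trans hm)) j).2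
  have hrlow : ∀ m ≤ n, ∀ j, 1 / (2 * K) ≤ r m j := fun m hm j => by
    have h1 := hres m hm j
    have h2 := H.A_lower j
    have e : 1 / (2 * K) = (1 / K) / 2 := by field_simp
    rw [abs_le] at h1
    rw [e]
    linarith [h1.1]
  have hmulη : ∀ {a : ℝ} {c : ℝ}, |a - 1| ≤ c → |η * a - η| ≤ c * η := by
    intro a c hac
    have e : η * a - η = (a - 1) * η := by ring
    rw [e, abs_mul, abs_of_pos hη]
    gcongr
  have hξ := H.ξ_le
  have hξ0 := H.ξ_pos
  have hh1 : h ≤ 1 := by linarith [H.h_le']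
  refine ⟨fun i => ?_, fun i j => ?_⟩
  · -- second layer
    have ex : x (n + 1) i - x n i - η = η * adamU b ξ (fun s => ∑ j, r s j * y s i j) n - η := by
      rw [H.x_succ]; ring
    have hG : h ^ 21 ≤ η * n → D ^ 2 * (η * n / (4 * K)) ≤ ∑ j, r n j * y n i j := by
      intro hle
      calc D ^ 2 * (η * n / (4 * K)) = ∑ _j : Fin d, 1 / (2 * K) * (η * n / 2) := by
            rw [Finset.sum_const, Finset.card_univ, Fintype.card_fin, nsmul_eq_mul, H.hdD]
            field_simp; norm_num
        _ ≤ _ := by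
            refine Finset.sum_le_sum fun j _ => mul_le_mul (hrlow n le_rfl j) ?_ (by positivity)
              ((by positivity : (0 : ℝ) ≤ 1 / (2 * K)).trans (hrlow n le_rfl j))
            · have h1 := ((hI n le_rfl).2 i j).1
              rw [abs_le] at h1
              have h28 : h ^ 28 ≤ h ^ 22 := H.h_pow_le (by norm_num)
              have h22 : h ^ 22 ≤ h ^ 21 / 100 := by
                calc h ^ 22 = h ^ 21 * h := by ring
                  _ ≤ h ^ 21 * (1 / 100) := by gcongr; exact H.h_le'
                  _ = _ := by ring
              have hhn : h * (η * n) ≤ 1 / 100 * (η * n) := by gcongr; exact H.h_le'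
              linarith [h1.1]
    -- From time `θ` on the gradient is at least of order `D² θ / K`, against a change per step of
    -- order `D² K¹² h²³`. Accuracy `ρ` thus needs `ρ θ` of order `h²²`, as for the pairs `(h, h²¹)`
    -- and `(h¹⁰, h¹²)`.
    have key : ∀ {ρ θ : ℝ}, ρ ≤ 1 → 0 ≤ ρ → 0 < θ → h ^ 21 ≤ θ → 4 * K ^ 14 * h ^ 23 ≤ ρ * θ →
        θ ≤ η * n → |x (n + 1) i - x n i - η| ≤ ρ * η := by
      intro ρ θ hρ hρ0 hθ hθ21 hle hθn
      rw [ex]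
      apply hmulη
      have hGn := hG (hθ21.trans hθn)
      have h0 : 0 < D ^ 2 * (η * n / (4 * K)) := by
        have : 0 < η * n := hθ.trans_le hθn
        positivity
      have hρG : ρ * (D ^ 2 * (θ / (4 * K))) ≤ ρ * ∑ j, r n j * y n i j := by
        gcongr
        refine le_trans ?_ hGn
        gcongr
      refine H.adamU_near_one (g := fun s => ∑ j, r s j * y s i j) (n := n)
        (L := D ^ 2 * (K ^ 12 * h ^ 23)) (fun s hs => (hsteps s hs).2.2.2.2.2 i) (by positivity)
        le_rfl (h0.trans_le hGn) hρ ?_ ?_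
      · refine le_trans ?_ hρG
        calc K * (D ^ 2 * (K ^ 12 * h ^ 23)) = D ^ 2 * ((4 * K ^ 14 * h ^ 23) / (4 * K)) := by
              field_simp
          _ ≤ D ^ 2 * ((ρ * θ) / (4 * K)) := by gcongr
          _ = _ := by ring
      · refine le_trans ?_ hρG
        have h40 : ξ ≤ 1 * (K ^ 12 * h ^ 23) := by
          calc ξ ≤ h ^ 40 := hξ
            _ ≤ h ^ 23 := H.h_pow_le (by norm_num)
            _ ≤ 1 * (K ^ 12 * h ^ 23) := by
              rw [one_mul]
              have : 1 ≤ K ^ 12 := one_le_pow₀ hK1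
              have : 0 < h ^ 23 := by positivity
              nlinarith
        have hD2 : 1 ≤ D ^ 2 := one_le_pow₀ hD1
        calc K * ξ ≤ K * (D ^ 2 * (K ^ 12 * h ^ 23)) := by
              gcongr
              refine h40.trans ?_
              gcongr
          _ = D ^ 2 * ((4 * K ^ 14 * h ^ 23) / (4 * K)) := by field_simp
          _ ≤ D ^ 2 * ((ρ * θ) / (4 * K)) := by gcongr
          _ = _ := by ring
    refine ⟨fun hlt => ?_, fun hle => ?_, fun hle => ?_⟩
    · -- the gradient grows linearly
      set q := η * ∑ j, A j with hq
      have hA0 : ∀ j, 0 < A j := fun j => lt_of_lt_of_le (by positivity) (H.A_lower j)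
      haveI : Nonempty (Fin d) := ⟨i⟩
      have hq0 : 0 < q := mul_pos hη (Finset.sum_pos (fun j _ => hA0 j) Finset.univ_nonempty)
      -- The summands may have either sign, but each increases by nearly `η * A j`: `y` moves at
      -- speed `η`, and the change of the residual is multiplied by a tiny `y`.
      have hinc : ∀ s < n, ∀ j,
          |(r (s + 1) j * y (s + 1) i j - r s j * y s i j) - η * A j| ≤ η * A j / 2 := by
        intro s hs j
        have hs1 : s + 1 ≤ n := hs
        have hsη : η * s < h ^ 21 := by
          refine lt_of_le_of_lt ?_ hlt
          have : (s : ℝ) ≤ n := by exact_mod_cast hs.le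
          gcongr
        have hsη1 : η * (s + 1 : ℕ) < h ^ 21 := by
          refine lt_of_le_of_lt ?_ hlt
          have : ((s + 1 : ℕ) : ℝ) ≤ n := by exact_mod_cast hs1
          gcongr
        have hysmall : ∀ m ≤ n, ∀ i' j', |y m i' j'| ≤ 2 * h ^ 21 := by
          intro m hm i' j'
          have hmη : η * m < h ^ 21 := by
            refine lt_of_le_of_lt ?_ hlt
            have : (m : ℝ) ≤ n := by exact_mod_cast hm
            gcongr
          have hmη0 : 0 ≤ η * m := by positivity
          have h1 := ((hI m hm).2 i' j').1
          have h2 := abs_add_le (y m i' j' - η * m) (η * m)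
          rw [sub_add_cancel, abs_of_nonneg hmη0] at h2
          have h28 : h ^ 28 ≤ h ^ 22 := H.h_pow_le (by norm_num)
          have h22 : h ^ 22 ≤ h ^ 21 / 100 := by
            calc h ^ 22 = h ^ 21 * h := by ring
              _ ≤ h ^ 21 * (1 / 100) := by gcongr; exact H.h_le'
              _ = _ := by ring
          have hhn : h * (η * m) ≤ 1 / 100 * (η * m) := by gcongr; exact H.h_le'
          linarith
        have hxsmall : ∀ i', |x s i'| ≤ 4 * h ^ 14 := by
          intro i'
          have h1 := (hI s hs.le).1 i'
          have h20 : 0 ≤ h ^ 20 := by positivity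
          have hs0 : 0 ≤ η * s := by positivity
          rw [abs_of_nonneg (by linarith [h1.1])]
          have : h ^ 21 ≤ h ^ 14 := H.h_pow_le (by norm_num)
          linarith [h1.2.1]
        have hdP : |prodVec x y (s + 1) j - prodVec x y s j| ≤ η := by
          unfold prodVec
          rw [← Finset.sum_sub_distrib]
          calc _ ≤ ∑ i', |x (s + 1) i' * y (s + 1) i' j - x s i' * y s i' j| :=
                Finset.abs_sum_le_sum_abs _ _
            _ ≤ ∑ _i' : Fin d, h ^ 2 * η := by
                gcongr with i'
                have e : x (s + 1) i' * y (s + 1) i' j - x s i' * y s i' j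
                  = (x (s + 1) i' - x s i') * y (s + 1) i' j
                    + x s i' * (y (s + 1) i' j - y s i' j) := by ring
                rw [e]
                refine (abs_add_le _ _).trans ?_
                rw [abs_mul, abs_mul]
                have h1 : |x (s + 1) i' - x s i'| ≤ 3 * K * η := by
                  have := ((hV s hs).1 i').1 hsη
                  have h2 := abs_add_le (x (s + 1) i' - x s i' - η) η
                  rw [sub_add_cancel, abs_of_pos hη] at h2
                  nlinarith
                have h2 : |y (s + 1) i' j - y s i' j| ≤ 2 * η := by
                  have := ((hV s hs).2 i' j).1
                  have h2 := abs_add_le (y (s + 1) i' j - y s i' j - η) η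
                  rw [sub_add_cancel, abs_of_pos hη] at h2
                  nlinarith
                have h3 := mul_le_mul h1 (hysmall (s + 1) hs1 i' j) (abs_nonneg _) (by positivity)
                have h4 := mul_le_mul (hxsmall i') h2 (abs_nonneg _) (by positivity)
                have h5 : K * h ^ 21 ≤ h ^ 3 := by
                  calc K * h ^ 21 = K ^ 1 * h ^ (20 + 1) := by ring
                    _ ≤ h ^ 20 := H.pow_le 20 (by norm_num)
                    _ ≤ h ^ 3 := H.h_pow_le (by norm_num)
                have h6 : h ^ 14 ≤ h ^ 3 := H.h_pow_le (by norm_num)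
                have h7 : 14 * h ^ 3 ≤ h ^ 2 := by
                  calc 14 * h ^ 3 = h ^ 2 * (14 * h) := by ring
                    _ ≤ h ^ 2 * 1 := by gcongr; linarith [H.h_le']
                    _ = h ^ 2 := mul_one _
                calc _ ≤ 3 * K * η * (2 * h ^ 21) + 4 * h ^ 14 * (2 * η) := add_le_add h3 h4
                  _ = (6 * (K * h ^ 21) + 8 * h ^ 14) * η := by ring
                  _ ≤ h ^ 2 * η := by gcongr; linarith
            _ = (D * h) ^ 2 * η := by
                rw [Finset.sum_const, Finset.card_univ, Fintype.card_fin, nsmul_eq_mul, H.hdD]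
                ring
            _ ≤ 1 ^ 2 * η := by
                gcongr
                exact H.hDh
            _ = η := by ring
        have hdr : |r (s + 1) j - r s j| * |y s i j| ≤ η * A j / 100 := by
          have h1 := H.noise_le hB hs1 (hs1.trans hT) j
          have h2 := H.noise_le hB hs.le (hs.le.trans hT) j
          have e : r (s + 1) j - r s j = (r (s + 1) j - (A j - prodVec x y (s + 1) j))
            - (r s j - (A j - prodVec x y s j)) - (prodVec x y (s + 1) j - prodVec x y s j) := by
            ring
          have h3 : |r (s + 1) j - r s j| ≤ 5 * K ^ 8 * η := by
            rw [e]
            refine (abs_sub _ _).trans ?_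
            have h9 := abs_sub (r (s + 1) j - (A j - prodVec x y (s + 1) j))
              (r s j - (A j - prodVec x y s j))
            have : 1 ≤ K ^ 8 := one_le_pow₀ hK1
            nlinarith
          have h4 := mul_le_mul h3 (hysmall s hs.le i j) (abs_nonneg _) (by positivity)
          refine h4.trans ?_
          have h5 : 10 * K ^ 8 * h ^ 21 ≤ 1 / K / 100 := by
            calc 10 * K ^ 8 * h ^ 21 ≤ K * K ^ 8 * h ^ 21 := by gcongr; linarith
              _ = K ^ 9 * h ^ (20 + 1) := by ring
              _ ≤ h ^ 20 := H.pow_le 20 (by norm_num)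
              _ ≤ h ^ 2 := H.h_pow_le (by norm_num)
              _ = h * h := by ring
              _ ≤ (1 / K) * (1 / 100) := by
                  gcongr
                  · exact H.h_le
                  · exact H.h_le'
              _ = _ := by ring
          have h6 := H.A_lower j
          calc 5 * K ^ 8 * η * (2 * h ^ 21) = η * (10 * K ^ 8 * h ^ 21) := by ring
            _ ≤ η * (1 / K / 100) := by gcongr
            _ ≤ η * (A j / 100) := by gcongr
            _ = _ := by ring
        have h1 := hres (s + 1) hs1 j
        have h2 := ((hV s hs).2 i j).1
        have hAj := hA0 j
        have e : (r (s + 1) j * y (s + 1) i j - r s j * y s i j) - η * A j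
            = r (s + 1) j * (y (s + 1) i j - y s i j - η) + (r (s + 1) j - A j) * η
              + (r (s + 1) j - r s j) * y s i j := by ring
        rw [e]
        refine (abs_add_le _ _).trans ?_
        have h3 := abs_add_le (r (s + 1) j * (y (s + 1) i j - y s i j - η)) ((r (s + 1) j - A j) * η)
        rw [abs_mul, abs_mul, abs_of_pos hη] at h3
        rw [abs_mul (r (s + 1) j - r s j)]
        have h4 : |r (s + 1) j| ≤ 2 * A j := by
          have := abs_add_le (r (s + 1) j - A j) (A j)
          rw [sub_add_cancel, abs_of_pos hAj] at this
          linarith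
        have h5 : |r (s + 1) j| * |y (s + 1) i j - y s i j - η| ≤ 2 * A j * (1 / 100 * η) := by
          refine mul_le_mul h4 (h2.trans ?_) (abs_nonneg _) (by positivity)
          gcongr
          exact H.h_le'
        have h6 : |r (s + 1) j - A j| * η ≤ A j / 100 * η := by gcongr
        have h7 : 0 < η * A j := by positivity
        linarith
      have hsum : ∀ s < n, |(∑ j, r (s + 1) j * y (s + 1) i j - ∑ j, r s j * y s i j) - q|
          ≤ q / 2 := by
        intro s hs
        have e : (∑ j, r (s + 1) j * y (s + 1) i j - ∑ j, r s j * y s i j) - q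
            = ∑ j, ((r (s + 1) j * y (s + 1) i j - r s j * y s i j) - η * A j) := by
          rw [Finset.sum_sub_distrib, Finset.sum_sub_distrib, hq, Finset.mul_sum]
        rw [e]
        calc _ ≤ ∑ j, |(r (s + 1) j * y (s + 1) i j - r s j * y s i j) - η * A j| :=
              Finset.abs_sum_le_sum_abs _ _
          _ ≤ ∑ j, η * A j / 2 := Finset.sum_le_sum fun j _ => hinc s hs j
          _ = q / 2 := by rw [← Finset.sum_div, ← Finset.mul_sum]
      have hU := abs_adamU_le_of_increments H.b_pos H.b_lt
        (g := fun s => ∑ j, r s j * y s i j) (n := n) hq0 H.ξ_pos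
        (fun s hs => by have := (abs_le.1 (hsum s hs)).1; linarith)
        (fun s hs => by have := (abs_le.1 (hsum s hs)).2; linarith)
      rw [ex]
      have e : η * adamU b ξ (fun s => ∑ j, r s j * y s i j) n - η
          = (adamU b ξ (fun s => ∑ j, r s j * y s i j) n - 1) * η := by ring
      rw [e, abs_mul, abs_of_pos hη]
      gcongr
      refine (abs_sub _ _).trans ?_
      rw [abs_one]
      have := H.incr_le
      linarith
    · refine key hh1 hh.le (by positivity) le_rfl ?_ hle
      calc 4 * K ^ 14 * h ^ 23 ≤ K * K ^ 14 * h ^ 23 := by gcongr; linarith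
        _ = K ^ 15 * h ^ (22 + 1) := by ring
        _ ≤ h ^ 22 := H.pow_le 22 (by norm_num)
        _ = h * h ^ 21 := by ring
    · refine key (pow_le_one₀ hh.le hh1) (by positivity) (by positivity)
        (H.h_pow_le (by norm_num)) ?_ hle
      calc 4 * K ^ 14 * h ^ 23 ≤ K * K ^ 14 * h ^ 23 := by gcongr; linarith
        _ = K ^ 15 * h ^ (22 + 1) := by ring
        _ ≤ h ^ 22 := H.pow_le 22 (by norm_num)
        _ = h ^ 10 * h ^ 12 := by ring
  · -- first layer
    have ey : y (n + 1) i j - y n i j - η = η * adamU b ξ (fun s => x s i * r s j) n - η := by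
      rw [H.y_succ]; ring
    have hxn := ((hI n le_rfl).1 i).1
    have hrn := hrlow n le_rfl j
    have key : ∀ {ρ θ : ℝ}, ρ ≤ 1 → 0 ≤ ρ → 0 < θ → 4 * K ^ 14 * h ^ 23 ≤ ρ * θ →
        θ / 2 ≤ x n i → |y (n + 1) i j - y n i j - η| ≤ ρ * η := by
      intro ρ θ hρ hρ0 hθ hle hθn
      rw [ey]
      apply hmulη
      have hg : θ / 2 * (1 / (2 * K)) ≤ x n i * r n j := by
        gcongr
        linarith
      have hρg : ρ * (θ / 2 * (1 / (2 * K))) ≤ ρ * (x n i * r n j) := by gcongr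
      refine H.adamU_near_one (g := fun s => x s i * r s j) (n := n)
        (L := K ^ 12 * h ^ 23) (fun s hs => (hsteps s hs).2.2.2.2.1 i j) (by positivity)
        le_rfl (lt_of_lt_of_le (by positivity) hg) hρ ?_ ?_
      · refine le_trans ?_ hρg
        calc K * (K ^ 12 * h ^ 23) = (4 * K ^ 14 * h ^ 23) / (4 * K) := by
              field_simp
          _ ≤ (ρ * θ) / (4 * K) := by gcongr
          _ = _ := by field_simp; norm_num
      · refine le_trans ?_ hρg
        have h40 : ξ ≤ (K ^ 12 * h ^ 23) := by
          calc ξ ≤ h ^ 40 := hξ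
            _ ≤ h ^ 23 := H.h_pow_le (by norm_num)
            _ ≤ (K ^ 12 * h ^ 23) := by
              have : 1 ≤ K ^ 12 := one_le_pow₀ hK1
              have : 0 < h ^ 23 := by positivity
              nlinarith
        calc K * ξ ≤ K * (K ^ 12 * h ^ 23) := by gcongr
          _ = (4 * K ^ 14 * h ^ 23) / (4 * K) := by field_simp
          _ ≤ (ρ * θ) / (4 * K) := by gcongr
          _ = _ := by field_simp; norm_num
    constructor
    · refine key (θ := h ^ 20) hh1 hh.le (by positivity) ?_ (by linarith)
      calc 4 * K ^ 14 * h ^ 23 ≤ K * K ^ 14 * h ^ 23 := by gcongr; linarith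
        _ = K ^ 15 * h ^ (22 + 1) := by ring
        _ ≤ h ^ 22 := H.pow_le 22 (by norm_num)
        _ ≤ h ^ 21 := H.h_pow_le (by norm_num)
        _ = h * h ^ 20 := by ring
    · intro hle
      have h20 : 0 < h ^ 20 := by positivity
      refine key (θ := h ^ 12) (pow_le_one₀ hh.le hh1) (by positivity) (by positivity) ?_
        (by linarith)
      calc 4 * K ^ 14 * h ^ 23 ≤ K * K ^ 14 * h ^ 23 := by gcongr; linarith
        _ = K ^ 15 * h ^ (22 + 1) := by ring
        _ ≤ h ^ 22 := H.pow_le 22 (by norm_num)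
        _ = h ^ 10 * h ^ 12 := by ring

/-- The growth phase: all weights grow at the same speed until the product reaches a small
constant. -/
theorem growth {n₁ : ℕ} (hT : n₁ ≤ T) (hn : η * n₁ ≤ 1 / (8 * K * D)) :
    ∀ n ≤ n₁, GrowthInv h η x y n := by
  have hη := H.η_pos
  have hmn : ∀ m ≤ n₁, η * m ≤ 1 / (8 * K * D) := fun m hm => by
    refine le_trans ?_ hn
    have : (m : ℝ) ≤ n₁ := by exact_mod_cast hm
    gcongr
  -- Strong induction: the earlier speeds give the positions up to `n`, and these give the speed at
  -- `n`.
  have hV : ∀ n < n₁, GrowthVel K h η x y n := by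
    intro n
    induction n using Nat.strong_induction_on with
    | _ n ih =>
      intro hlt
      have hV' : ∀ m < n, GrowthVel K h η x y m := fun m hm => ih m hm (by omega)
      exact H.growthVel_of_inv (by omega) (hmn n hlt.le)
        (fun m hm => H.growthInv_of_vel fun k hk => hV' k (by omega)) hV'
  exact fun n hn => H.growthInv_of_vel fun m hm => hV m (by omega)

end AdamRun

end DiagGeometry

namespace DiagGeometry

/-! ### Adam on the two-layer network: the fitting phase -/

namespace AdamRun

variable {d : ℕ} {b K h D η ξ : ℝ} {T : ℕ} {A : Fin d → ℝ} {x : ℕ → Fin d → ℝ}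
  {y : ℕ → Fin d → Fin d → ℝ} {r : ℕ → Fin d → ℝ} {n₁ : ℕ}

/-- The invariants of the phase in which the coordinates of the product reach their targets one
after the other; `n₁` is its starting time. -/
structure FitInv (K h D η : ℝ) (n₁ : ℕ) (A : Fin d → ℝ) (x : ℕ → Fin d → ℝ)
    (y : ℕ → Fin d → Fin d → ℝ) (t : ℕ) : Prop where
  layer2 : ∀ i, |x t i - η * t| ≤ 2 * h ^ 10 * (η * t)
  rows : ∀ i i' j, |y t i j - y t i' j| ≤ h ^ 8 / D
  upper : ∀ j, prodVec x y t j ≤ A j + K ^ 4 * h ^ 9 * ((t : ℝ) / n₁) ^ 2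
  lower : ∀ j, 1 / K ^ 4 ≤ prodVec x y t j
  crossed : ∀ j, (∀ i, |y t i j - η * t| ≤ 2 * h ^ 10 * (η * t)) ∨
    (A j - 3 * h ^ 9 ≤ d * (η * t) ^ 2 ∧ A j - 2 * h ^ 9 ≤ prodVec x y t j)

/-- The reference gradient sequence of the coordinate `j`. -/
def refGrad (η : ℝ) (r : ℕ → Fin d → ℝ) (j : Fin d) (s : ℕ) : ℝ := η * s * r s j

/-- The properties of the steps in the same phase. -/
structure FitVel (b K h η ξ : ℝ) (A : Fin d → ℝ) (x : ℕ → Fin d → ℝ)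
    (y : ℕ → Fin d → Fin d → ℝ) (r : ℕ → Fin d → ℝ) (m : ℕ) : Prop where
  layer2 : ∀ i, |x (m + 1) i - x m i - η| ≤ h ^ 10 * η
  up : ∀ j, prodVec x y m j ≤ A j - h ^ 9 → ∀ i, |y (m + 1) i j - y m i j - η| ≤ h ^ 10 * η
  down : ∀ j, A j + h ^ 9 ≤ prodVec x y m j → ∀ i, |y (m + 1) i j - y m i j + η| ≤ h ^ 10 * η
  rows : ∀ i j, |adamU b ξ (fun s => x s i * r s j) m - adamU b ξ (refGrad η r j) m|
    ≤ K ^ 3 * h ^ 9 * (1 + emaRatio b ξ (refGrad η r j) m)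

variable (H : AdamRun b K h D η ξ T A x y r)

section bounds

variable (hn₁ : 1 / (16 * K * D) ≤ η * n₁)
include H hn₁

lemma n₁_pos : (0 : ℝ) < n₁ := by
  have h1 : 0 < 1 / (16 * K * D) := by
    have := H.K_pos; have := H.D_pos; positivity
  have hη := H.η_pos
  by_contra hcon
  push Not at hcon
  nlinarith

variable {t : ℕ} (hnt : n₁ ≤ t) (ht : η * t ≤ 2 * K / D)
include hnt ht

lemma le_time : 1 / (16 * K * D) ≤ η * t := by
  refine hn₁.trans ?_
  have : (n₁ : ℝ) ≤ t := by exact_mod_cast hnt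
  have := H.η_pos
  gcongr

lemma h_le_time : h / (16 * K) ≤ η * t := by
  refine le_trans ?_ (H.le_time hn₁ hnt ht)
  have hK := H.K_pos
  have hD := H.D_pos
  have := H.hDh
  rw [div_le_div_iff₀ (by positivity) (by positivity)]
  nlinarith

lemma time_ratio_le : (t : ℝ) / n₁ ≤ 32 * K ^ 2 := by
  have hn := H.n₁_pos hn₁
  have hη := H.η_pos
  have hK := H.K_pos
  have hD := H.D_pos
  rw [div_le_iff₀ hn]
  have h1 : 2 * K / D = 32 * K ^ 2 * (1 / (16 * K * D)) := by field_simp; norm_num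
  have h2 : η * t ≤ η * (32 * K ^ 2 * n₁) := by
    calc η * t ≤ 32 * K ^ 2 * (1 / (16 * K * D)) := h1 ▸ ht
      _ ≤ 32 * K ^ 2 * (η * n₁) := by gcongr
      _ = _ := by ring
  exact le_of_mul_le_mul_left h2 hη

variable (hI : FitInv K h D η n₁ A x y t)
include hI

lemma fit_x (i : Fin d) : η * t * (1 - 2 * h ^ 10) ≤ x t i ∧ x t i ≤ η * t * (1 + 2 * h ^ 10) := by
  have h1 := hI.layer2 i
  rw [abs_le] at h1
  constructor <;> linarith [h1.1, h1.2]

omit hn₁ hnt ht hI in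
lemma h10_le : 2 * h ^ 10 ≤ 1 / 100 := by
  have h1 : h ^ 10 ≤ h ^ 2 := H.h_pow_le (by norm_num)
  have h2 := H.h_le'
  have h3 := H.h_pos
  nlinarith

lemma fit_x' (i : Fin d) : η * t / 2 ≤ x t i ∧ x t i ≤ 2 * (η * t) := by
  have h1 := H.fit_x hn₁ hnt ht hI i
  have h2 := H.h10_le
  have h3 : 0 < η * t := lt_of_lt_of_le (by have := H.K_pos; have := H.D_pos; positivity)
    (H.le_time hn₁ hnt ht)
  constructor <;> nlinarith [h1.1, h1.2]

/-- The factor `(t / n₁)²` in the invariant stays below a power of `K` up to the horizon, so the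
overshoot remains far below `h²`. -/
lemma fit_over (j : Fin d) : prodVec x y t j ≤ A j + h ^ 8 / 2 := by
  refine (hI.upper j).trans ?_
  have h1 := H.time_ratio_le hn₁ hnt ht
  have hn := H.n₁_pos hn₁
  have hh := H.h_pos
  have hK := H.hK
  have hK0 := H.K_pos
  have h2 : ((t : ℝ) / n₁) ^ 2 ≤ (32 * K ^ 2) ^ 2 := by
    have : 0 ≤ (t : ℝ) / n₁ := by positivity
    gcongr
  have h3 : K ^ 4 * h ^ 9 * ((t : ℝ) / n₁) ^ 2 ≤ h ^ 8 / 2 := by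
    calc K ^ 4 * h ^ 9 * ((t : ℝ) / n₁) ^ 2 ≤ K ^ 4 * h ^ 9 * (32 * K ^ 2) ^ 2 := by gcongr
      _ = (2048 * K ^ 8 * h ^ 9) / 2 := by ring
      _ ≤ (K ^ 2 * K ^ 8 * h ^ 9) / 2 := by gcongr; nlinarith
      _ = (K ^ 10 * h ^ (8 + 1)) / 2 := by ring
      _ ≤ h ^ 8 / 2 := by gcongr; exact H.pow_le 8 (by norm_num)
  linarith

lemma fit_prod_le (j : Fin d) : prodVec x y t j ≤ 2 * K := by
  have h1 := H.fit_over hn₁ hnt ht hI j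
  have h2 := H.A_upper j
  have h3 : h ^ 8 ≤ 1 := pow_le_one₀ H.h_pos.le (by linarith [H.h_le'])
  linarith [H.hK]

lemma fit_sum_x : D / (32 * K) ≤ ∑ i, x t i ∧ ∑ i, x t i ≤ 4 * K * D := by
  have hη := H.le_time hn₁ hnt ht
  have hK := H.K_pos
  have hD := H.D_pos
  constructor
  · calc D / (32 * K) = ∑ _i : Fin d, (1 / (16 * K * D)) / 2 := by
          rw [Finset.sum_const, Finset.card_univ, Fintype.card_fin, nsmul_eq_mul, H.hdD]
          field_simp; norm_num
      _ ≤ ∑ i, x t i := by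
          gcongr with i
          have := (H.fit_x' hn₁ hnt ht hI i).1
          linarith
  · calc ∑ i, x t i ≤ ∑ _i : Fin d, 2 * (2 * K / D) := by
          gcongr with i
          have := (H.fit_x' hn₁ hnt ht hI i).2
          linarith
      _ = 4 * K * D := by
          rw [Finset.sum_const, Finset.card_univ, Fintype.card_fin, nsmul_eq_mul, H.hdD]
          field_simp; norm_num

/-- The rows nearly agree, so the product is `(∑ x) yᵢⱼ` up to a small error. Dividing by `∑ x`,
which is of order `D`, locates every entry of the first layer although an oscillating column is not
followed step by step. -/
lemma fit_y (i j : Fin d) : 1 / (K ^ 6 * D) ≤ y t i j ∧ y t i j ≤ K ^ 3 / D := by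
  have hK := H.hK
  have hK0 := H.K_pos
  have hD := H.D_pos
  have hh := H.h_pos
  obtain ⟨hX1, hX2⟩ := H.fit_sum_x hn₁ hnt ht hI
  have hX0 : 0 < ∑ i, x t i := lt_of_lt_of_le (by positivity) hX1
  have hx0 : ∀ i, 0 ≤ x t i := fun i => by
    have h1 := (H.fit_x' hn₁ hnt ht hI i).1
    have : 0 ≤ η * t := by have := H.η_pos; positivity
    linarith
  have h8 : h ^ 8 ≤ 1 / K ^ 6 := by
    rw [le_div_iff₀ (by positivity)]
    have := H.pow_le (a := 6) 7 (by norm_num)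
    have h7 : h ^ 7 ≤ 1 := pow_le_one₀ hh.le (by linarith [H.h_le'])
    calc h ^ 8 * K ^ 6 = K ^ 6 * h ^ (7 + 1) := by ring
      _ ≤ h ^ 7 := this
      _ ≤ 1 := h7
  have hP : |prodVec x y t j - (∑ i', x t i') * y t i j| ≤ (∑ i', x t i') * (h ^ 8 / D) := by
    unfold prodVec
    rw [Finset.sum_mul, Finset.sum_mul, ← Finset.sum_sub_distrib]
    refine (Finset.abs_sum_le_sum_abs _ _).trans ?_
    gcongr with i'
    rw [← mul_sub, abs_mul, abs_of_nonneg (hx0 i')]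
    have := hI.rows i' i j
    have := hx0 i'
    gcongr
  rw [abs_le] at hP
  constructor
  · have h1 := hI.lower j
    have h2 : 1 / K ^ 4 ≤ (∑ i', x t i') * (y t i j + h ^ 8 / D) := by linarith [hP.2]
    have h3 : 0 < y t i j + h ^ 8 / D := by
      by_contra hcon
      push Not at hcon
      have : 0 < 1 / K ^ 4 := by positivity
      nlinarith
    have h4 : 1 / K ^ 4 ≤ (4 * K * D) * (y t i j + h ^ 8 / D) := h2.trans (by gcongr)
    have h5 : 1 / K ^ 4 / (4 * K * D) ≤ y t i j + h ^ 8 / D := by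
      rw [div_le_iff₀ (by positivity)]; linarith
    have h6 : h ^ 8 / D ≤ 1 / K ^ 6 / D := by gcongr
    have h7 : 1 / K ^ 4 / (4 * K * D) = (K / 4) * (1 / K ^ 6 / D) := by field_simp
    have h9 : 0 < 1 / K ^ 6 / D := by positivity
    have h10 : 1 / (K ^ 6 * D) = 1 / K ^ 6 / D := by field_simp
    rw [h10]
    nlinarith
  · have h1 := H.fit_prod_le hn₁ hnt ht hI j
    have h2 : (∑ i', x t i') * (y t i j - h ^ 8 / D) ≤ 2 * K := by linarith [hP.1]
    have h6 : h ^ 8 / D ≤ 1 / D := by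
      gcongr; exact pow_le_one₀ hh.le (by linarith [H.h_le'])
    have h3 : y t i j - h ^ 8 / D ≤ 64 * K ^ 2 / D := by
      by_contra hcon
      push Not at hcon
      have h5 : (D / (32 * K)) * (64 * K ^ 2 / D) < (∑ i', x t i') * (y t i j - h ^ 8 / D) := by
        have : 0 < 64 * K ^ 2 / D := by positivity
        calc _ ≤ (∑ i', x t i') * (64 * K ^ 2 / D) := by gcongr
          _ < _ := by gcongr
      have h7 : (D / (32 * K)) * (64 * K ^ 2 / D) = 2 * K := by field_simp; norm_num
      linarith
    have h7 : 64 * K ^ 2 / D + 1 / D ≤ K ^ 3 / D := by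
      rw [← add_div]
      gcongr
      nlinarith [sq_nonneg K]
    linarith

lemma fit_bdd_half (i : Fin d) : |x t i| ≤ K ^ 4 / D / 2 ∧ ∀ j, |y t i j| ≤ K ^ 4 / D / 2 := by
  have hK := H.hK
  have hK0 := H.K_pos
  have hD := H.D_pos
  have h0 : 0 ≤ η * t := by have := H.η_pos; positivity
  have h3 : K ^ 3 / D ≤ K ^ 4 / D / 2 := by
    rw [div_div, div_le_div_iff₀ hD (by positivity)]
    have : 0 < K ^ 3 * D := by positivity
    nlinarith
  refine ⟨?_, fun j => ?_⟩
  · have h1 := H.fit_x' hn₁ hnt ht hI i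
    rw [abs_of_nonneg (by linarith)]
    refine le_trans ?_ h3
    have h4 : 2 * (2 * K / D) ≤ K ^ 3 / D := by
      rw [← mul_div_assoc]
      gcongr
      nlinarith [sq_nonneg K]
    linarith
  · have h1 := H.fit_y hn₁ hnt ht hI i j
    rw [abs_of_nonneg (le_trans (by positivity) h1.1)]
    exact h1.2.trans h3

end bounds

/-- The standing assumptions on the times in this phase. -/
structure FitTimes (K D η : ℝ) (T n₁ n₂ : ℕ) : Prop where
  lower : 1 / (16 * K * D) ≤ η * n₁
  upper : η * n₁ ≤ 1 / (8 * K * D)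
  horizon : η * n₂ ≤ 2 * K / D
  le_T : n₂ + 1 ≤ T
  K_le_D : 4 * K ≤ D

variable {n₂ : ℕ} (hT : FitTimes K D η T n₁ n₂)
include H hT

lemma FitTimes.time_le {t : ℕ} (ht : t ≤ n₂) : η * t ≤ 2 * K / D := by
  refine le_trans ?_ hT.horizon
  have : (t : ℝ) ≤ n₂ := by exact_mod_cast ht
  have := H.η_pos
  gcongr

lemma FitTimes.le_one {t : ℕ} (ht : t ≤ n₂) : η * ((t + 1 : ℕ) + 1) ≤ 1 := by
  have h1 := FitTimes.time_le H hT ht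
  have h2 : 2 * K / D ≤ 1 / 2 := by
    rw [div_le_div_iff₀ H.D_pos (by norm_num)]
    linarith [hT.K_le_D]
  have h3 : η ≤ h := by
    calc η ≤ h ^ 46 := H.η_le
      _ ≤ h ^ 1 := H.h_pow_le (by norm_num)
      _ = h := pow_one h
  push_cast
  linarith [H.h_le']

/-- The growth phase covers the times before `n₁`. Afterwards the invariants give half of the
required bound, and the other half pays for the step to `n + 1`, where they are not yet known. -/
lemma fit_bdd {n : ℕ} (hn₁n : n₁ ≤ n) (hn : n ≤ n₂)
    (hI : ∀ t, n₁ ≤ t → t ≤ n → FitInv K h D η n₁ A x y t) : Bdd K D x y (n + 1) := by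
  have hG := H.growth (n₁ := n₁) (by have := hT.le_T; omega) hT.upper
  have hBG := H.growth_bdd hT.upper hG
  intro s hs i
  have hD := H.D_pos
  have hK := H.K_pos
  have hh := H.h_pos
  have hhalf : ∀ t, n₁ ≤ t → t ≤ n → ∀ i, |x t i| ≤ K ^ 4 / D / 2 ∧ ∀ j, |y t i j| ≤ K ^ 4 / D / 2 :=
    fun t h1 h2 => H.fit_bdd_half hT.lower h1 (FitTimes.time_le H hT (h2.trans hn)) (hI t h1 h2)
  have h0 : 0 < K ^ 4 / D := by positivity
  rcases Nat.lt_or_ge s n₁ with hlt | hge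
  · exact hBG s hlt.le i
  · rcases Nat.lt_or_ge n s with hlt2 | hle2
    · have hsn : s = n + 1 := by omega
      subst hsn
      have hstep : K * h ^ 23 ≤ K ^ 4 / D / 2 := by
        have h1 : K * h ^ 23 ≤ h ^ 22 := by simpa using H.pow_le (a := 1) 22 (by norm_num)
        have h2 : h ^ 22 ≤ h * (1 / 100) := by
          calc h ^ 22 ≤ h ^ 2 := H.h_pow_le (by norm_num)
            _ = h * h := by ring
            _ ≤ h * (1 / 100) := by gcongr; exact H.h_le'
        have h3 := H.h_le_inv_D
        have h4 : 1 / D ≤ K ^ 4 / D := by gcongr; exact one_le_pow₀ H.one_le_K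
        linarith
      have hle1 : η * ((n : ℝ) + 1) ≤ 1 := by
        have := FitTimes.le_one H hT hn
        push_cast at this
        have := H.η_pos
        linarith
      obtain ⟨h1, h2⟩ := hhalf n hn₁n le_rfl i
      refine ⟨?_, fun j => ?_⟩
      · rw [H.x_succ]
        have := H.abs_step_le (g := fun s => ∑ j, r s j * y s i j) hle1
        exact (abs_add_le _ _).trans (by linarith)
      · rw [H.y_succ]
        have := H.abs_step_le (g := fun s => x s i * r s j) hle1
        exact (abs_add_le _ _).trans (by linarith [h2 j])
    · obtain ⟨h1, h2⟩ := hhalf s hge hle2 i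
      exact ⟨by linarith, fun j => by linarith [h2 j]⟩

section steps

variable {n : ℕ} (hn₁n : n₁ ≤ n) (hn : n ≤ n₂)
  (hI : ∀ t, n₁ ≤ t → t ≤ n → FitInv K h D η n₁ A x y t)
include hn₁n hn hI

lemma fit_steps {s : ℕ} (hs : s < n + 1) :
    (∀ i, |x (s + 1) i - x s i| ≤ K * h ^ 23) ∧ (∀ i j, |y (s + 1) i j - y s i j| ≤ K * h ^ 23) ∧
    (∀ j, |prodVec x y (s + 1) j - prodVec x y s j| ≤ D * K ^ 6 * h ^ 23) ∧
    (∀ j, |r (s + 1) j - r s j| ≤ D * K ^ 7 * h ^ 23) ∧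
    (∀ i j, |x (s + 1) i * r (s + 1) j - x s i * r s j| ≤ K ^ 12 * h ^ 23) ∧
    (∀ i, |∑ j, r (s + 1) j * y (s + 1) i j - ∑ j, r s j * y s i j|
      ≤ D ^ 2 * (K ^ 12 * h ^ 23)) :=
  H.steps (H.fit_bdd hT hn₁n hn hI) (by have := hT.le_T; omega) (FitTimes.le_one H hT hn) hs

lemma fit_noise {s : ℕ} (hs : s ≤ n + 1) (j : Fin d) :
    |r s j - (A j - prodVec x y s j)| ≤ 2 * K ^ 8 * η :=
  H.noise_le (H.fit_bdd hT hn₁n hn hI) hs (by have := hT.le_T; omega) j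

lemma fit_noise' {s : ℕ} (hs : s ≤ n + 1) (j : Fin d) :
    |r s j - (A j - prodVec x y s j)| ≤ h ^ 40 :=
  (H.fit_noise hT hn₁n hn hI hs j).trans H.η_small

/-- One unfinished coordinate suffices: it contributes at least `h² / (2 K⁶ D)` to the gradient,
while each of the `D²` others contributes at least `- h⁸ K³ / D` thanks to the bound on the
overshoot, and `(D h)² ≤ 1`. -/
lemma fitVel_layer2 (hex : ∃ j, prodVec x y n j < A j - h ^ 2) (i : Fin d) :
    |x (n + 1) i - x n i - η| ≤ h ^ 10 * η := by
  obtain ⟨j₀, hj₀⟩ := hex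
  have hη := H.η_pos
  have hh := H.h_pos
  have hK := H.hK
  have hK0 := H.K_pos
  have hD := H.D_pos
  have hD1 := H.one_le_D
  have hIn := hI n hn₁n le_rfl
  have htn := FitTimes.time_le H hT hn
  have h40_8 : h ^ 40 ≤ h ^ 8 / 2 := by
    calc h ^ 40 ≤ h ^ 9 := H.h_pow_le (by norm_num)
      _ = h ^ 8 * h := by ring
      _ ≤ h ^ 8 * (1 / 2) := by gcongr; linarith [H.h_le']
      _ = _ := by ring
  have h40_2 : h ^ 40 ≤ h ^ 2 / 2 := by
    refine h40_8.trans ?_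
    have : h ^ 8 ≤ h ^ 2 := H.h_pow_le (by norm_num)
    linarith
  have hterm : ∀ j, - (h ^ 8 * (K ^ 3 / D)) ≤ r n j * y n i j := by
    intro j
    have h1 := H.fit_y hT.lower hn₁n htn hIn i j
    have h2 := (abs_le.1 (H.fit_noise' hT hn₁n hn hI (s := n) (by omega) j)).1
    have h3 := H.fit_over hT.lower hn₁n htn hIn j
    have h4 : - h ^ 8 ≤ r n j := by linarith
    have h5 : 0 < y n i j := lt_of_lt_of_le (by positivity) h1.1
    calc - (h ^ 8 * (K ^ 3 / D)) = (- h ^ 8) * (K ^ 3 / D) := by ring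
      _ ≤ (- h ^ 8) * y n i j := by
          apply mul_le_mul_of_nonpos_left h1.2
          have : 0 < h ^ 8 := by positivity
          linarith
      _ ≤ _ := by gcongr
  have hG : h ^ 2 / (4 * K ^ 6 * D) ≤ ∑ j, r n j * y n i j := by
    rw [← Finset.add_sum_erase _ _ (Finset.mem_univ j₀)]
    have h1 : - (h ^ 6 * (K ^ 3 / D)) ≤ ∑ j ∈ Finset.univ.erase j₀, r n j * y n i j := by
      calc - (h ^ 6 * (K ^ 3 / D)) ≤ - (D ^ 2 * (h ^ 8 * (K ^ 3 / D))) := by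
            rw [neg_le_neg_iff]
            have : D ^ 2 * (h ^ 8 * (K ^ 3 / D)) = (D * h) ^ 2 * (h ^ 6 * (K ^ 3 / D)) := by ring
            rw [this]
            have h2 : (D * h) ^ 2 ≤ 1 := pow_le_one₀ (by positivity) H.hDh
            have : 0 ≤ h ^ 6 * (K ^ 3 / D) := by positivity
            nlinarith
        _ = ∑ _j : Fin d, - (h ^ 8 * (K ^ 3 / D)) := by
            rw [Finset.sum_const, Finset.card_univ, Fintype.card_fin, nsmul_eq_mul, H.hdD]; ring
        _ ≤ ∑ _j ∈ Finset.univ.erase j₀, - (h ^ 8 * (K ^ 3 / D)) := by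
            rw [← Finset.add_sum_erase _ _ (Finset.mem_univ j₀)]
            have : 0 < h ^ 8 * (K ^ 3 / D) := by positivity
            linarith
        _ ≤ _ := Finset.sum_le_sum fun j _ => hterm j
    have h2 : h ^ 2 / 2 * (1 / (K ^ 6 * D)) ≤ r n j₀ * y n i j₀ := by
      have h3 := (abs_le.1 (H.fit_noise' hT hn₁n hn hI (s := n) (by omega) j₀)).1
      have h4 := H.fit_y hT.lower hn₁n htn hIn i j₀
      have h5 : h ^ 2 / 2 ≤ r n j₀ := by linarith
      have h6 : 0 ≤ h ^ 2 / 2 := by positivity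
      exact mul_le_mul h5 h4.1 (by positivity) (h6.trans h5)
    have h3 : h ^ 6 * (K ^ 3 / D) ≤ h ^ 2 / (4 * K ^ 6 * D) := by
      have h4 : 4 * K ^ 9 * h ^ 4 ≤ 1 := by
        calc 4 * K ^ 9 * h ^ 4 ≤ K * K ^ 9 * h ^ 4 := by gcongr; linarith
          _ = K ^ 10 * h ^ (3 + 1) := by ring
          _ ≤ h ^ 3 := H.pow_le 3 (by norm_num)
          _ ≤ 1 := pow_le_one₀ hh.le (by linarith [H.h_le'])
      calc h ^ 6 * (K ^ 3 / D) = (4 * K ^ 9 * h ^ 4) * (h ^ 2 / (4 * K ^ 6 * D)) := by field_simp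
        _ ≤ 1 * (h ^ 2 / (4 * K ^ 6 * D)) := by gcongr
        _ = _ := one_mul _
    have e : h ^ 2 / 2 * (1 / (K ^ 6 * D)) = h ^ 2 / (4 * K ^ 6 * D) + h ^ 2 / (4 * K ^ 6 * D) := by
      field_simp; norm_num
    linarith
  have hD2 : D ^ 2 * (K ^ 12 * h ^ 23) ≤ K ^ 12 * h ^ 21 := by
    calc D ^ 2 * (K ^ 12 * h ^ 23) = (D * h) ^ 2 * (K ^ 12 * h ^ 21) := by ring
      _ ≤ 1 * (K ^ 12 * h ^ 21) := by
          gcongr; exact pow_le_one₀ (by positivity) H.hDh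
      _ = _ := one_mul _
  have hbig : K * (K ^ 12 * h ^ 21) ≤ h ^ 10 * (h ^ 2 / (4 * K ^ 6 * D)) := by
    have h1 : K ^ 20 * h ^ 21 ≤ h ^ 20 := H.pow_le 20 (by norm_num)
    calc K * (K ^ 12 * h ^ 21) = (4 * K ^ 19 * h ^ 21) / (4 * K ^ 6) := by field_simp
      _ ≤ (K * K ^ 19 * h ^ 21) / (4 * K ^ 6) := by gcongr; linarith
      _ = (K ^ 20 * h ^ 21) / (4 * K ^ 6) := by ring
      _ ≤ h ^ 20 / (4 * K ^ 6) := by gcongr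
      _ ≤ (h ^ 12 * h) / (4 * K ^ 6) := by
          gcongr
          calc h ^ 20 ≤ h ^ 13 := H.h_pow_le (by norm_num)
            _ = _ := by ring
      _ ≤ (h ^ 12 * (1 / D)) / (4 * K ^ 6) := by gcongr; exact H.h_le_inv_D
      _ = _ := by field_simp
  have hU := H.adamU_near_one (g := fun s => ∑ j, r s j * y s i j) (n := n + 1) (t := n)
    (L := D ^ 2 * (K ^ 12 * h ^ 23)) (ρ := h ^ 10)
    (fun s hs => (H.fit_steps hT hn₁n hn hI hs).2.2.2.2.2 i) (by positivity) (by omega)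
    (lt_of_lt_of_le (by positivity) hG) (pow_le_one₀ hh.le (by linarith [H.h_le']))
    (by
      calc K * (D ^ 2 * (K ^ 12 * h ^ 23)) ≤ K * (K ^ 12 * h ^ 21) := by gcongr
        _ ≤ h ^ 10 * (h ^ 2 / (4 * K ^ 6 * D)) := hbig
        _ ≤ _ := by gcongr)
    (by
      calc K * ξ ≤ K * (K ^ 12 * h ^ 21) := by
            gcongr
            calc ξ ≤ h ^ 40 := H.ξ_le
              _ ≤ h ^ 21 := H.h_pow_le (by norm_num)
              _ ≤ K ^ 12 * h ^ 21 := by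
                have : 1 ≤ K ^ 12 := one_le_pow₀ H.one_le_K
                have : 0 < h ^ 21 := by positivity
                nlinarith
        _ ≤ h ^ 10 * (h ^ 2 / (4 * K ^ 6 * D)) := hbig
        _ ≤ _ := by gcongr)
  have e : x (n + 1) i - x n i - η = (adamU b ξ (fun s => ∑ j, r s j * y s i j) n - 1) * η := by
    rw [H.x_succ]; ring
  rw [e, abs_mul, abs_of_pos hη]
  gcongr

/-- Outside a band of half-width `h ^ 9` around the target the residual has a definite sign and
exceeds its change per step by far, so the updates are close to `±1`. Inside the band nothing is
claimed. -/
lemma fitVel_layer1 (i j : Fin d) :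
    (prodVec x y n j ≤ A j - h ^ 9 → |y (n + 1) i j - y n i j - η| ≤ h ^ 10 * η) ∧
    (A j + h ^ 9 ≤ prodVec x y n j → |y (n + 1) i j - y n i j + η| ≤ h ^ 10 * η) := by
  have hη := H.η_pos
  have hh := H.h_pos
  have hK := H.hK
  have hK0 := H.K_pos
  have hD := H.D_pos
  have hIn := hI n hn₁n le_rfl
  have htn := FitTimes.time_le H hT hn
  have hx := (H.fit_x' hT.lower hn₁n htn hIn i).1
  have hht := H.h_le_time hT.lower hn₁n htn
  have hnoise := abs_le.1 (H.fit_noise' hT hn₁n hn hI (s := n) (by omega) j)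
  have h40 : h ^ 40 ≤ h ^ 9 / 2 := by
    calc h ^ 40 ≤ h ^ 10 := H.h_pow_le (by norm_num)
      _ = h ^ 9 * h := by ring
      _ ≤ h ^ 9 * (1 / 2) := by gcongr; linarith [H.h_le']
      _ = _ := by ring
  have hx0 : h / (32 * K) ≤ x n i := by
    have e : h / (32 * K) = h / (16 * K) / 2 := by field_simp; norm_num
    linarith
  have hbig : K * (K ^ 12 * h ^ 23) ≤ h ^ 10 * (h / (32 * K) * (h ^ 9 / 2)) := by
    calc K * (K ^ 12 * h ^ 23) = 64 * K ^ 14 * h ^ 23 / (64 * K) := by field_simp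
      _ ≤ K * K ^ 14 * h ^ 23 / (64 * K) := by gcongr; linarith
      _ = K ^ 15 * h ^ (22 + 1) / (64 * K) := by ring
      _ ≤ h ^ 22 / (64 * K) := by gcongr; exact H.pow_le 22 (by norm_num)
      _ ≤ h ^ 20 / (64 * K) :=
          div_le_div_of_nonneg_right (H.h_pow_le (by norm_num)) (by positivity)
      _ = _ := by field_simp; norm_num
  have hξ : K * ξ ≤ h ^ 10 * (h / (32 * K) * (h ^ 9 / 2)) := by
    refine le_trans ?_ hbig
    gcongr
    calc ξ ≤ h ^ 40 := H.ξ_le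
      _ ≤ h ^ 23 := H.h_pow_le (by norm_num)
      _ ≤ K ^ 12 * h ^ 23 := by
        have : 1 ≤ K ^ 12 := one_le_pow₀ H.one_le_K
        have : 0 < h ^ 23 := by positivity
        nlinarith
  have hxp : 0 < h / (32 * K) := by positivity
  constructor
  · intro hle
    have hr : h ^ 9 / 2 ≤ r n j := by linarith [hnoise.1]
    have hg : h / (32 * K) * (h ^ 9 / 2) ≤ x n i * r n j :=
      mul_le_mul hx0 hr (by positivity) (by linarith)
    have hU := H.adamU_near_one (g := fun s => x s i * r s j) (n := n + 1) (t := n)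
      (L := K ^ 12 * h ^ 23) (ρ := h ^ 10)
      (fun s hs => (H.fit_steps hT hn₁n hn hI hs).2.2.2.2.1 i j) (by positivity) (by omega)
      (lt_of_lt_of_le (by positivity) hg) (pow_le_one₀ hh.le (by linarith [H.h_le']))
      (hbig.trans (by gcongr)) (hξ.trans (by gcongr))
    have e : y (n + 1) i j - y n i j - η = (adamU b ξ (fun s => x s i * r s j) n - 1) * η := by
      rw [H.y_succ]; ring
    rw [e, abs_mul, abs_of_pos hη]
    gcongr
  · intro hle
    have hr : h ^ 9 / 2 ≤ - r n j := by linarith [hnoise.2]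
    have hg : h / (32 * K) * (h ^ 9 / 2) ≤ -(x n i * r n j) := by
      rw [← mul_neg]
      exact mul_le_mul hx0 hr (by positivity) (by linarith)
    have hU := H.adamU_near_one (g := fun s => -(x s i * r s j)) (n := n + 1) (t := n)
      (L := K ^ 12 * h ^ 23) (ρ := h ^ 10)
      (fun s hs => by
        have e : -(x (s + 1) i * r (s + 1) j) - -(x s i * r s j)
          = -(x (s + 1) i * r (s + 1) j - x s i * r s j) := by ring
        rw [e, abs_neg]
        exact (H.fit_steps hT hn₁n hn hI hs).2.2.2.2.1 i j) (by positivity) (by omega)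
      (lt_of_lt_of_le (by positivity) hg) (pow_le_one₀ hh.le (by linarith [H.h_le']))
      (hbig.trans (by gcongr)) (hξ.trans (by gcongr))
    rw [adamU_neg] at hU
    have hy := H.y_succ n i j
    have e : y (n + 1) i j - y n i j + η = -((-adamU b ξ (fun s => x s i * r s j) n - 1) * η) := by
      rw [hy]; generalize adamU b ξ (fun s => x s i * r s j) n = U; ring
    rw [e, abs_neg, abs_mul, abs_of_pos hη]
    gcongr

end steps

end AdamRun

end DiagGeometry

namespace DiagGeometry

/-! ### The reference gradient of a column and the average size of its updates. -/

namespace AdamRun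

variable {d : ℕ} {b K h D η ξ : ℝ} {T : ℕ} {A : Fin d → ℝ} {x : ℕ → Fin d → ℝ}
  {y : ℕ → Fin d → Fin d → ℝ} {r : ℕ → Fin d → ℝ} {n₁ n₂ : ℕ}

variable (H : AdamRun b K h D η ξ T A x y r) (hT : FitTimes K D η T n₁ n₂)
  {n : ℕ} (hn₁n : n₁ ≤ n) (hn : n ≤ n₂)
  (hI : ∀ t, n₁ ≤ t → t ≤ n → FitInv K h D η n₁ A x y t)
include H hT hn₁n hn hI

/-- The change of the reference gradient in one step. -/
lemma refGrad_incr {m : ℕ} (hm₁ : n₁ ≤ m) (hmn : m ≤ n) (hV : FitVel b K h η ξ A x y r m)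
    (j : Fin d) :
    |refGrad η r j (m + 1) - refGrad η r j m
      + η * m * (η * ((∑ i, x m i) * adamU b ξ (refGrad η r j) m))|
      ≤ η * (2 * K ^ 9 + h ^ 8 * emaRatio b ξ (refGrad η r j) m) := by
  have hη := H.η_pos
  have hh := H.h_pos
  have hK := H.hK
  have hK0 := H.K_pos
  have hK1 := H.one_le_K
  have hD := H.D_pos
  have htm := FitTimes.time_le H hT (hmn.trans hn)
  have hIm := hI m hm₁ hmn
  have hB := H.fit_bdd hT hn₁n hn hI
  have hηm0 : 0 ≤ η * m := by positivity
  set ρ := emaRatio b ξ (refGrad η r j) m with hρ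
  have hρ0 : 0 ≤ ρ := emaRatio_nonneg H.ξ_pos.le _ _
  set U := adamU b ξ (refGrad η r j) m with hU
  set e := (r (m + 1) j - (A j - prodVec x y (m + 1) j)) - (r m j - (A j - prodVec x y m j)) with he
  set S₁ := ∑ i, (x (m + 1) i - x m i) * y (m + 1) i j with hS₁
  set S₂ := ∑ i, x m i * (adamU b ξ (fun s => x s i * r s j) m - U) with hS₂
  -- The change of the product splits into the motion of the second layer (`S₁`), the reference
  -- update applied to all rows (the main term), and the deviation of the single rows from it
  -- (`S₂`).
  have hP : prodVec x y (m + 1) j - prodVec x y m j = S₁ + η * ((∑ i, x m i) * U) + η * S₂ := by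
    rw [hS₁, hS₂, Finset.sum_mul, Finset.mul_sum, Finset.mul_sum, ← Finset.sum_add_distrib,
      ← Finset.sum_add_distrib]
    unfold prodVec
    rw [← Finset.sum_sub_distrib]
    refine Finset.sum_congr rfl fun i _ => ?_
    have : y (m + 1) i j = y m i j + η * adamU b ξ (fun s => x s i * r s j) m := H.y_succ m i j
    rw [this]
    ring
  have hx0 : ∀ i, 0 ≤ x m i := fun i => by
    linarith [(H.fit_x' hT.lower hm₁ htm hIm i).1]
  have hS₁' : |S₁| ≤ 2 * K ^ 4 * D * η := by
    calc |S₁| ≤ ∑ i, |(x (m + 1) i - x m i) * y (m + 1) i j| := Finset.abs_sum_le_sum_abs _ _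
      _ ≤ ∑ _i : Fin d, 2 * η * (K ^ 4 / D) := by
          gcongr with i
          rw [abs_mul]
          refine mul_le_mul ?_ ((hB (m + 1) (by omega) i).2 j) (abs_nonneg _) (by positivity)
          have h1 := hV.layer2 i
          have h2 : h ^ 10 * η ≤ 1 * η := by
            gcongr; exact pow_le_one₀ hh.le (by linarith [H.h_le'])
          rw [abs_le] at h1 ⊢
          constructor <;> linarith [h1.1, h1.2]
      _ = 2 * K ^ 4 * D * η := by
          rw [Finset.sum_const, Finset.card_univ, Fintype.card_fin, nsmul_eq_mul, H.hdD]
          field_simp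
  have hS₂' : |S₂| ≤ 4 * K * D * (K ^ 3 * h ^ 9 * (1 + ρ)) := by
    calc |S₂| ≤ ∑ i, |x m i * (adamU b ξ (fun s => x s i * r s j) m - U)| :=
          Finset.abs_sum_le_sum_abs _ _
      _ ≤ ∑ i, x m i * (K ^ 3 * h ^ 9 * (1 + ρ)) := by
          refine Finset.sum_le_sum fun i _ => ?_
          rw [abs_mul, abs_of_nonneg (hx0 i)]
          exact mul_le_mul_of_nonneg_left (hV.rows i j) (hx0 i)
      _ = (∑ i, x m i) * (K ^ 3 * h ^ 9 * (1 + ρ)) := by rw [Finset.sum_mul]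
      _ ≤ _ := by gcongr; exact (H.fit_sum_x hT.lower hm₁ htm hIm).2
  have he' : |e| ≤ 4 * K ^ 8 * η := by
    have h1 := H.fit_noise hT hn₁n hn hI (s := m + 1) (by omega) j
    have h2 := H.fit_noise hT hn₁n hn hI (s := m) (by omega) j
    refine (abs_sub _ _).trans ?_
    linarith
  have hr : |r (m + 1) j| ≤ K ^ 9 :=
    H.abs_resid_le hB (by omega) (by have := hT.le_T; omega) j
  have key : refGrad η r j (m + 1) - refGrad η r j m + η * m * (η * ((∑ i, x m i) * U))
      = η * r (m + 1) j + η * m * e - η * m * S₁ - η * m * (η * S₂) := by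
    have e1 : r (m + 1) j = r m j + e - (prodVec x y (m + 1) j - prodVec x y m j) := by
      rw [he]; ring
    have e2 : refGrad η r j (m + 1) - refGrad η r j m = η * r (m + 1) j
      + η * m * (r (m + 1) j - r m j) := by
      unfold refGrad; push_cast; ring
    have e3 : r (m + 1) j - r m j = e - (S₁ + η * ((∑ i, x m i) * U) + η * S₂) := by
      rw [← hP]; linarith
    rw [e2, e3]; ring
  rw [key]
  have b1 : |η * r (m + 1) j| ≤ η * K ^ 9 := by
    rw [abs_mul, abs_of_pos hη]; gcongr
  have hηm1 : η * m ≤ 1 := by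
    have h1 := FitTimes.le_one H hT (hmn.trans hn)
    push_cast at h1; linarith
  have b2 : |η * m * e| ≤ η * (4 * K ^ 8) := by
    rw [abs_mul, abs_of_nonneg hηm0]
    calc η * m * |e| ≤ 1 * (4 * K ^ 8 * η) := by gcongr
      _ = _ := by ring
  have b3 : |η * m * S₁| ≤ η * (4 * K ^ 5) := by
    rw [abs_mul, abs_of_nonneg hηm0]
    calc η * m * |S₁| ≤ 2 * K / D * (2 * K ^ 4 * D * η) := by gcongr
      _ = _ := by field_simp; norm_num
  have b4 : |η * m * (η * S₂)| ≤ η * (h ^ 8 * (1 + ρ)) := by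
    rw [abs_mul, abs_mul η S₂, abs_of_nonneg hηm0, abs_of_pos hη]
    calc η * m * (η * |S₂|) ≤ 2 * K / D * (η * (4 * K * D * (K ^ 3 * h ^ 9 * (1 + ρ)))) := by gcongr
      _ = η * (8 * K ^ 5 * h ^ 9 * (1 + ρ)) := by field_simp; norm_num
      _ ≤ η * (K * K ^ 5 * h ^ 9 * (1 + ρ)) := by gcongr; linarith
      _ = η * (K ^ 6 * h ^ (8 + 1) * (1 + ρ)) := by ring
      _ ≤ _ := by gcongr; exact H.pow_le 8 (by norm_num)
  have hfin : η * K ^ 9 + η * (4 * K ^ 8) + η * (4 * K ^ 5) + η * (h ^ 8 * (1 + ρ))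
      ≤ η * (2 * K ^ 9 + h ^ 8 * ρ) := by
    have h1 : h ^ 8 ≤ 1 := pow_le_one₀ hh.le (by linarith [H.h_le'])
    have h2 : K ^ 5 ≤ K ^ 8 := pow_le_pow_right₀ hK1 (by norm_num)
    have h3 : 1 ≤ K ^ 8 := one_le_pow₀ hK1
    have h4 : 100 * K ^ 8 ≤ K ^ 9 := by
      calc 100 * K ^ 8 ≤ K * K ^ 8 := by gcongr
        _ = _ := by ring
    have : K ^ 9 + 4 * K ^ 8 + 4 * K ^ 5 + h ^ 8 * (1 + ρ) ≤ 2 * K ^ 9 + h ^ 8 * ρ := by linarith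
    have := mul_le_mul_of_nonneg_left this hη.le
    linarith
  have t1 := abs_sub (η * r (m + 1) j + η * m * e - η * m * S₁) (η * m * (η * S₂))
  have t2 := abs_sub (η * r (m + 1) j + η * m * e) (η * m * S₁)
  have t3 := abs_add_le (η * r (m + 1) j) (η * m * e)
  linarith

/-- Since `η m ∑ x` lies between `1 / (512 K²)` and `8 K²`, the increments of the reference gradient
are comparable with `η` times its own update. This feedback is the hypothesis of `sum_emaRatio_le`:
a large update forces a large jump of the next gradient. -/
lemma refGrad_incr_bounds {m : ℕ} (hm₁ : n₁ ≤ m) (hmn : m ≤ n)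
    (hV : FitVel b K h η ξ A x y r m) (j : Fin d) :
    |refGrad η r j (m + 1) - refGrad η r j m|
      ≤ η * (K ^ 10 * (1 + emaRatio b ξ (refGrad η r j) m)) ∧
    η * (1 / K ^ 6 * emaRatio b ξ (refGrad η r j) m - K ^ 10)
      ≤ |refGrad η r j (m + 1) - refGrad η r j m| := by
  have h0 := H.refGrad_incr hT hn₁n hn hI hm₁ hmn hV j
  have hη := H.η_pos
  have hh := H.h_pos
  have hK := H.hK
  have hK0 := H.K_pos
  have hK1 := H.one_le_K
  have hD := H.D_pos
  have htm := FitTimes.time_le H hT (hmn.trans hn)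
  have htl := H.le_time hT.lower hm₁ htm
  have hIm := hI m hm₁ hmn
  have hu : 0 < 1 - b := by linarith [H.b_lt]
  obtain ⟨hX1, hX2⟩ := H.fit_sum_x hT.lower hm₁ htm hIm
  have hU1 := abs_adamU_le_ratio H.b_pos H.b_lt H.ξ_pos (refGrad η r j) m
  have hU2 := ratio_le_abs_adamU H.b_pos H.b_lt H.ξ_pos (refGrad η r j) m
  set ρ := emaRatio b ξ (refGrad η r j) m with hρ
  have hρ0 : 0 ≤ ρ := emaRatio_nonneg H.ξ_pos.le _ _
  set U := adamU b ξ (refGrad η r j) m with hU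
  set X := ∑ i, x m i
  have hX0 : 0 ≤ X := le_trans (by positivity) hX1
  set W := η * m * (η * (X * U)) with hW
  have hηm0 : 0 ≤ η * m := by positivity
  have hWabs : |W| = η * (η * m * X * |U|) := by
    rw [hW, abs_mul, abs_mul η (X * U), abs_mul X U, abs_of_nonneg hηm0, abs_of_pos hη, abs_of_nonneg hX0]
    ring
  have hinv : 1 / K ≤ 1 - b := by
    rw [div_le_iff₀ hK0]
    have := H.inv_le
    rwa [div_le_iff₀ hu, mul_comm] at this
  have hUup : |U| ≤ K * ρ := by
    calc |U| ≤ ρ / (1 - b) := hU1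
      _ = 1 / (1 - b) * ρ := by ring
      _ ≤ K * ρ := by gcongr; exact H.inv_le
  have hUlow : 1 / K ^ 2 * ρ ≤ |U| := by
    refine le_trans ?_ hU2
    calc 1 / K ^ 2 * ρ = (1 / K) ^ 2 * ρ := by ring
      _ ≤ _ := by gcongr
  have hWup : |W| ≤ η * (8 * K ^ 3 * ρ) := by
    rw [hWabs]
    calc η * (η * m * X * |U|) ≤ η * (2 * K / D * (4 * K * D) * (K * ρ)) := by gcongr
      _ = _ := by field_simp; ring
  have hWlow : η * (1 / (512 * K ^ 4) * ρ) ≤ |W| := by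
    rw [hWabs]
    calc η * (1 / (512 * K ^ 4) * ρ)
        = η * (1 / (16 * K * D) * (D / (32 * K)) * (1 / K ^ 2 * ρ)) := by field_simp; ring
      _ ≤ _ := by gcongr
  set F := refGrad η r j (m + 1) - refGrad η r j m
  have hK9 : 2 * K ^ 9 ≤ K ^ 10 := by
    calc 2 * K ^ 9 ≤ K * K ^ 9 := by gcongr; linarith
      _ = _ := by ring
  have hh8 : h ^ 8 ≤ 1 := pow_le_one₀ hh.le (by linarith [H.h_le'])
  constructor
  · have t1 := abs_sub (F + W) W
    rw [add_sub_cancel_right] at t1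
    have h3 : 8 * K ^ 3 + 1 ≤ K ^ 10 := by
      have h4 : K ^ 3 ≤ K ^ 9 := pow_le_pow_right₀ hK1 (by norm_num)
      have h5 : 1 ≤ K ^ 9 := one_le_pow₀ hK1
      have h6 : K ^ 10 = K * K ^ 9 := by ring
      nlinarith
    have h5 : 8 * K ^ 3 * ρ + 2 * K ^ 9 + h ^ 8 * ρ ≤ K ^ 10 * (1 + ρ) := by
      have h6 := mul_le_mul_of_nonneg_right h3 hρ0
      have h7 := mul_le_mul_of_nonneg_right hh8 hρ0
      linarith
    have := mul_le_mul_of_nonneg_left h5 hη.le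
    linarith
  · have t1 := abs_sub (F + W) F
    rw [add_sub_cancel_left] at t1
    have h3 : 1 / K ^ 6 + h ^ 8 ≤ 1 / (512 * K ^ 4) := by
      have h4 : h ^ 8 ≤ 1 / K ^ 6 := by
        rw [le_div_iff₀ (by positivity)]
        calc h ^ 8 * K ^ 6 = K ^ 6 * h ^ (7 + 1) := by ring
          _ ≤ h ^ 7 := H.pow_le 7 (by norm_num)
          _ ≤ 1 := pow_le_one₀ hh.le (by linarith [H.h_le'])
      have h5 : 2 * (1 / K ^ 6) ≤ 1 / (512 * K ^ 4) := by
        rw [← mul_div_assoc, div_le_div_iff₀ (by positivity) (by positivity)]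
        have : 1024 ≤ K ^ 2 := by nlinarith
        have h7 : 0 < K ^ 4 := by positivity
        have h6 : K ^ 6 = K ^ 2 * K ^ 4 := by ring
        rw [h6]
        nlinarith
      linarith
    have h5 : 1 / K ^ 6 * ρ - K ^ 10 ≤ 1 / (512 * K ^ 4) * ρ - 2 * K ^ 9 - h ^ 8 * ρ := by
      have := mul_le_mul_of_nonneg_right h3 hρ0
      linarith
    have := mul_le_mul_of_nonneg_left h5 hη.le
    linarith

/-- The reference gradient at the beginning of the phase. -/
lemma refGrad_start (j : Fin d) :
    h / (32 * K ^ 2) ≤ refGrad η r j n₁ ∧ refGrad η r j n₁ ≤ K ∧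
    ∀ s < n₁, |refGrad η r j (s + 1) - refGrad η r j s| ≤ K ^ 9 * h ^ 23 := by
  have hη := H.η_pos
  have hh := H.h_pos
  have hK := H.hK
  have hK0 := H.K_pos
  have hK1 := H.one_le_K
  have hD := H.D_pos
  have hD1 := H.one_le_D
  have hTn : n₁ ≤ T := by have := hT.le_T; omega
  have hG := H.growth (n₁ := n₁) hTn hT.upper
  have hr := (H.growth_resid hTn hT.upper hG j).2
  have hA1 := H.A_lower j
  have hA2 := H.A_upper j
  have ht0 := H.h_le_time hT.lower (le_refl n₁) (FitTimes.time_le H hT (hn₁n.trans hn))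
  rw [abs_le] at hr
  have h1K : 0 < 1 / K := by positivity
  have hup1 : η * n₁ ≤ 1 / 8 := by
    refine hT.upper.trans ?_
    apply one_div_le_one_div_of_le (by norm_num)
    nlinarith
  refine ⟨?_, ?_, fun s hs => ?_⟩
  · calc h / (32 * K ^ 2) = h / (16 * K) * (1 / (2 * K)) := by field_simp; norm_num
      _ ≤ η * n₁ * r n₁ j := by
          have : 1 / (2 * K) ≤ r n₁ j := by
            have e : 1 / (2 * K) = 1 / K / 2 := by field_simp
            rw [e]; linarith [hr.1]
          gcongr
  · unfold refGrad
    have h1 : r n₁ j ≤ 2 * K := by linarith [hr.2]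
    have h2 : 0 ≤ η * n₁ := by positivity
    calc η * n₁ * r n₁ j ≤ 1 / 8 * (2 * K) := by
          apply mul_le_mul hup1 h1 _ (by norm_num)
          linarith [hr.1]
      _ ≤ K := by linarith
  · have hst := (H.fit_steps hT hn₁n hn hI (s := s) (by omega)).2.2.2.1 j
    have hrs : |r (s + 1) j| ≤ K ^ 9 :=
      H.abs_resid_le (H.fit_bdd hT hn₁n hn hI) (by omega) (by omega) j
    have e : refGrad η r j (s + 1) - refGrad η r j s
        = η * r (s + 1) j + η * s * (r (s + 1) j - r s j) := by
      unfold refGrad; push_cast; ring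
    rw [e]
    refine (abs_add_le _ _).trans ?_
    have hs0 : 0 ≤ η * s := by positivity
    have hsl : η * s ≤ 1 / (8 * K * D) := by
      refine le_trans ?_ hT.upper
      have : (s : ℝ) ≤ n₁ := by exact_mod_cast hs.le
      gcongr
    rw [abs_mul, abs_mul, abs_of_pos hη, abs_of_nonneg hs0]
    have b1 : η * |r (s + 1) j| ≤ h ^ 23 / 2 * K ^ 9 := by
      have : η ≤ h ^ 23 / 2 := by
        calc η ≤ h ^ 46 := H.η_le
          _ ≤ h ^ 24 := H.h_pow_le (by norm_num)
          _ = h ^ 23 * h := by ring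
          _ ≤ h ^ 23 * (1 / 2) := by gcongr; linarith [H.h_le']
          _ = _ := by ring
      gcongr
    have b2 : η * s * |r (s + 1) j - r s j| ≤ h ^ 23 / 2 * K ^ 9 := by
      calc _ ≤ 1 / (8 * K * D) * (D * K ^ 7 * h ^ 23) := by gcongr
        _ = K ^ 6 * h ^ 23 / 8 := by field_simp
        _ ≤ K ^ 9 * h ^ 23 / 2 := by gcongr <;> norm_num
        _ = _ := by ring
    linarith

/-- The updates along the reference gradient have bounded average size. -/
lemma sum_refRatio_le (j : Fin d) {N : ℕ} (hN : n₁ + N ≤ n + 1)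
    (hV : ∀ m, n₁ ≤ m → m < n₁ + N → FitVel b K h η ξ A x y r m) :
    ∑ k ∈ Finset.range N, emaRatio b ξ (refGrad η r j) (n₁ + k) ≤ K ^ 24 * n₁ := by
  have hη := H.η_pos
  have hh := H.h_pos
  have hK := H.hK
  have hK0 := H.K_pos
  have hK1 := H.one_le_K
  have hu : 0 < 1 - b := by linarith [H.b_lt]
  have hinv : 1 / K ≤ 1 - b := by
    rw [div_le_iff₀ hK0]
    have := H.inv_le
    rwa [div_le_iff₀ hu, mul_comm] at this
  obtain ⟨hf1, hf2, hf3⟩ := H.refGrad_start hT hn₁n hn hI j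
  have hf0 : 0 < refGrad η r j n₁ := lt_of_lt_of_le (by positivity) hf1
  have hpow : ∀ {a c : ℕ}, a ≤ c → K ^ a ≤ K ^ c := fun hac => pow_le_pow_right₀ hK1 hac
  have hstart : ema b (fun s => |refGrad η r j s|) n₁ ≤ K ^ 2 * |refGrad η r j n₁| := by
    have h1 := abs_ema_sub_le H.b_pos H.b_lt (g := fun s => |refGrad η r j s|) (t := n₁)
      (L := K ^ 9 * h ^ 23) (abs_sub_le_of_steps (n := n₁)
        (fun s hs => (abs_abs_sub_abs_le _ _).trans (hf3 s hs)) n₁ le_rfl) (by positivity)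
    have h2 := ema_one_le H.b_pos.le H.b_lt n₁
    have h3 := h2.trans H.inv_le
    have h4 := (abs_le.1 h1).2
    have h5 : K ^ 9 * h ^ 23 / (1 - b) ^ 2 ≤ K * |refGrad η r j n₁| := by
      rw [abs_of_pos hf0]
      calc K ^ 9 * h ^ 23 / (1 - b) ^ 2 = K ^ 9 * h ^ 23 * (1 / (1 - b)) ^ 2 := by
            rw [div_pow, one_pow, mul_one_div]
        _ ≤ K ^ 9 * h ^ 23 * K ^ 2 := by
            have := H.inv_le
            gcongr
        _ = (K ^ 11 * h ^ (22 + 1)) := by ring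
        _ ≤ h ^ 22 := H.pow_le 22 (by norm_num)
        _ ≤ h / (32 * K ^ 2) := by
            rw [le_div_iff₀ (by positivity)]
            calc h ^ 22 * (32 * K ^ 2) ≤ h ^ 22 * (K * K ^ 2) := by gcongr; linarith
              _ = K ^ 3 * h ^ (21 + 1) := by ring
              _ ≤ h ^ 21 := H.pow_le 21 (by norm_num)
              _ ≤ h ^ 1 := H.h_pow_le (by norm_num)
              _ = h := pow_one h
        _ ≤ 1 * refGrad η r j n₁ := by linarith
        _ ≤ K * refGrad η r j n₁ := by gcongr
    have h6 : |refGrad η r j n₁| * ema b (fun _ => 1) n₁ ≤ |refGrad η r j n₁| * K := by gcongr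
    have h7 : 0 ≤ |refGrad η r j n₁| := abs_nonneg _
    have h8 : 2 * K ≤ K ^ 2 := by nlinarith
    nlinarith
  -- With `C = K¹⁰`, `c₁ = K⁻⁶`, `C₂ = K²` the strongest requirement on `R₀` is of order `K¹⁹`, and
  -- `K²⁰` leaves room for the numerical factor.
  have main := sum_emaRatio_le H.b_pos H.b_lt (f := refGrad η r j) (ξ := ξ) (σ := η) (C := K ^ 10)
    (c₁ := 1 / K ^ 6) (C₂ := K ^ 2) (R₀ := K ^ 20) (n₁ := n₁) (n := N) H.ξ_pos hη (by positivity)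
    (by positivity) (H.inv_le.trans (by nlinarith))
    (by have := hpow (show 1 ≤ 20 by norm_num); linarith)
    (by calc 2 * K ^ 2 ≤ K * K ^ 2 := by gcongr; linarith
          _ = K ^ 3 := by ring
          _ ≤ K ^ 20 := hpow (by norm_num))
    (by
      have e : 1 / K ^ 6 * K ^ 20 = K ^ 14 := by field_simp
      rw [e]
      calc 4 * K ^ 10 ≤ K * K ^ 10 := by gcongr; linarith
        _ = K ^ 11 := by ring
        _ ≤ K ^ 14 := hpow (by norm_num))
    (by
      have e : 1 / K ^ 6 * K ^ 20 = K ^ 14 := by field_simp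
      rw [e]
      have h1 : 1 ≤ K ^ 10 := one_le_pow₀ hK1
      calc 16 * K ^ 2 * (2 * K ^ 10 + 1) ≤ 16 * K ^ 2 * (2 * K ^ 10 + K ^ 10) := by gcongr
        _ = 48 * K ^ 12 := by ring
        _ ≤ K * K ^ 12 := by gcongr; linarith
        _ = K ^ 14 * (1 / K) := by field_simp
        _ ≤ _ := by gcongr)
    hf0.ne' hstart
    (fun k hk => (H.refGrad_incr_bounds hT hn₁n hn hI (m := n₁ + k) (by omega) (by omega)
      (hV _ (by omega) (by omega)) j).1)
    (fun k hk => (H.refGrad_incr_bounds hT hn₁n hn hI (m := n₁ + k) (by omega) (by omega)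
      (hV _ (by omega) (by omega)) j).2)
  have hn₁0 := H.n₁_pos hT.lower
  have hn₁1 : (1 : ℝ) ≤ n₁ := by
    have : 0 < n₁ := by exact_mod_cast hn₁0
    exact_mod_cast this
  have hNn : (N : ℝ) ≤ 32 * K ^ 2 * n₁ := by
    have h1 := H.time_ratio_le hT.lower hn₁n (FitTimes.time_le H hT hn)
    rw [div_le_iff₀ hn₁0] at h1
    have h2 : (n₁ : ℝ) + N ≤ n + 1 := by exact_mod_cast hN
    linarith
  refine main.trans ?_
  have h20 : 1 ≤ K ^ 20 := one_le_pow₀ hK1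
  calc 2 * (K ^ 20 + 3) * N + 2 * (K ^ 2) ^ 2
      ≤ 2 * (K ^ 20 + 3 * K ^ 20) * (32 * K ^ 2 * n₁) + 2 * (K ^ 2) ^ 2 * n₁ := by
        refine add_le_add ?_ ?_
        · gcongr; linarith
        · have : 0 ≤ 2 * (K ^ 2) ^ 2 := by positivity
          nlinarith
    _ = (256 * K ^ 22 + 2 * K ^ 4) * n₁ := by ring
    _ ≤ K ^ 24 * n₁ := by
        gcongr
        have h1 : K ^ 4 ≤ K ^ 22 := hpow (by norm_num)
        have h2 : K ^ 24 = K ^ 2 * K ^ 22 := by ring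
        have h3 : 258 ≤ K ^ 2 := by nlinarith
        have : 0 < K ^ 22 := by positivity
        nlinarith

end AdamRun

end DiagGeometry

namespace DiagGeometry

/-! ### Rows of a column move together: comparison with the reference gradient. -/

namespace AdamRun

variable {d : ℕ} {b K h D η ξ : ℝ} {T : ℕ} {A : Fin d → ℝ} {x : ℕ → Fin d → ℝ}
  {y : ℕ → Fin d → Fin d → ℝ} {r : ℕ → Fin d → ℝ} {n₁ n₂ : ℕ}

variable (H : AdamRun b K h D η ξ T A x y r) (hT : FitTimes K D η T n₁ n₂)
  {n : ℕ} (hn₁n : n₁ ≤ n) (hn : n ≤ n₂)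
  (hI : ∀ t, n₁ ≤ t → t ≤ n → FitInv K h D η n₁ A x y t)
include H hT hn₁n hn hI

/-- The moments of the gradient of a first-layer entry at the beginning of the phase. -/
lemma start_moments (i j : Fin d) {c : ℝ} (hc : |c| ≤ 2)
    (hgf : x n₁ i * r n₁ j = c * refGrad η r j n₁) :
    |ema b (fun s => x s i * r s j) n₁ - c * ema b (refGrad η r j) n₁|
      ≤ h ^ 9 * (√(ema (b ^ 2) (fun s => refGrad η r j s ^ 2) n₁) + ξ) ∧
    |ema (b ^ 2) (fun s => (x s i * r s j) ^ 2) n₁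
        - c ^ 2 * ema (b ^ 2) (fun s => refGrad η r j s ^ 2) n₁|
      ≤ h ^ 9 * ema (b ^ 2) (fun s => refGrad η r j s ^ 2) n₁ := by
  have hη := H.η_pos
  have hh := H.h_pos
  have hK := H.hK
  have hK0 := H.K_pos
  have hK1 := H.one_le_K
  have hD := H.D_pos
  have hD1 := H.one_le_D
  have hu : 0 < 1 - b := by linarith [H.b_lt]
  have hb := H.b_pos
  have hb1 := H.b_lt
  have hh1 : h ≤ 1 := by linarith [H.h_le']
  have hB := H.fit_bdd hT hn₁n hn hI
  have hTn : n + 1 ≤ T := by have := hT.le_T; omega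
  obtain ⟨hf1, hf2, hf3⟩ := H.refGrad_start hT hn₁n hn hI j
  set f := refGrad η r j with hf
  set g : ℕ → ℝ := fun s => x s i * r s j with hg
  have hf0 : 0 < f n₁ := lt_of_lt_of_le (by positivity) hf1
  have hpow : ∀ {a c : ℕ}, a ≤ c → K ^ a ≤ K ^ c := fun hac => pow_le_pow_right₀ hK1 hac
  have hfh2 : h ^ 2 ≤ f n₁ := by
    refine le_trans ?_ hf1
    rw [le_div_iff₀ (by positivity)]
    calc h ^ 2 * (32 * K ^ 2) ≤ h ^ 2 * (K * K ^ 2) := by gcongr; linarith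
      _ = (K ^ 3 * h ^ (0 + 1)) * h := by ring
      _ ≤ h ^ 0 * h := by gcongr; exact H.pow_le 0 (by norm_num)
      _ = h := by ring
  have hg3 : ∀ s < n₁, |g (s + 1) - g s| ≤ K ^ 12 * h ^ 23 := fun s hs =>
    (H.fit_steps hT hn₁n hn hI (s := s) (by omega)).2.2.2.2.1 i j
  have hgb : ∀ s ≤ n₁, |g s| ≤ K ^ 13 := by
    intro s hs
    rw [hg]
    simp only
    rw [abs_mul]
    calc |x s i| * |r s j| ≤ K ^ 4 / D * K ^ 9 := by
          refine mul_le_mul (hB s (by omega) i).1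
            (H.abs_resid_le hB (by omega) (by omega) j) (abs_nonneg _) (by positivity)
      _ ≤ K ^ 4 / 1 * K ^ 9 := by gcongr
      _ = K ^ 13 := by ring
  have hfb : ∀ s ≤ n₁, |f s| ≤ K ^ 13 := by
    intro s hs
    have hsT : η * s ≤ 1 := by
      have h1 := FitTimes.le_one H hT (t := s) (by omega)
      push_cast at h1; linarith
    have hs0 : 0 ≤ η * s := by positivity
    rw [hf]
    unfold refGrad
    rw [abs_mul, abs_of_nonneg hs0]
    calc η * s * |r s j| ≤ 1 * K ^ 9 := by
          gcongr; exact H.abs_resid_le hB (by omega) (by omega) j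
      _ ≤ K ^ 13 := by rw [one_mul]; exact hpow (by norm_num)
  have hsq : ∀ {u v L : ℝ}, |u| ≤ K ^ 13 → |v| ≤ K ^ 13 → |u - v| ≤ L →
      |u ^ 2 - v ^ 2| ≤ 2 * K ^ 13 * L := by
    intro u v L hu hv huv
    have e : u ^ 2 - v ^ 2 = (u + v) * (u - v) := by ring
    rw [e, abs_mul]
    have h1 := abs_add_le u v
    gcongr
    linarith
  have hinv2 : 1 / (1 - b) ^ 2 ≤ K ^ 2 := by
    have e : 1 / (1 - b) ^ 2 = (1 / (1 - b)) ^ 2 := by rw [div_pow, one_pow]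
    rw [e]
    have := H.inv_le
    gcongr
  have hinv2' : 1 / (1 - b ^ 2) ^ 2 ≤ K ^ 2 := by
    refine le_trans ?_ hinv2
    have := one_sub_sq_ge hb hb1
    gcongr
  have hlast : f n₁ ^ 2 ≤ ema (b ^ 2) (fun s => f s ^ 2) n₁ := by
    cases n₁ with
    | zero => exact le_rfl
    | succ k =>
      rw [ema_succ]
      have := ema_sq_nonneg (b := b) f k
      have : 0 ≤ b ^ 2 * ema (b ^ 2) (fun s => f s ^ 2) k := by positivity
      linarith
  have hL : K ^ 28 * h ^ 23 ≤ h ^ 22 := H.pow_le 22 (by norm_num)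
  constructor
  · have h1 := abs_ema_sub_le hb hb1 (abs_sub_le_of_steps hg3 n₁ le_rfl) (by positivity)
    have h2 := abs_ema_sub_le hb hb1 (abs_sub_le_of_steps hf3 n₁ le_rfl) (by positivity)
    -- Before the phase both sequences hardly change within the memory of the averages, so each
    -- average is its last value times the total weight. The last values are exactly proportional
    -- with factor `c`.
    have e : ema b g n₁ - c * ema b f n₁ = (ema b g n₁ - g n₁ * ema b (fun _ => 1) n₁)
        - c * (ema b f n₁ - f n₁ * ema b (fun _ => 1) n₁) := by
      have : g n₁ = c * f n₁ := hgf
      rw [this]; ring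
    have hrt : f n₁ ≤ √(ema (b ^ 2) (fun s => f s ^ 2) n₁) := Real.le_sqrt_of_sq_le hlast
    rw [e]
    refine (abs_sub _ _).trans ?_
    rw [abs_mul]
    have h3 : |c| * |ema b f n₁ - f n₁ * ema b (fun _ => 1) n₁|
        ≤ 2 * (K ^ 9 * h ^ 23 / (1 - b) ^ 2) := by gcongr
    have h4 : K ^ 12 * h ^ 23 / (1 - b) ^ 2 ≤ K ^ 14 * h ^ 23 := by
      calc _ = K ^ 12 * h ^ 23 * (1 / (1 - b) ^ 2) := by rw [mul_one_div]
        _ ≤ K ^ 12 * h ^ 23 * K ^ 2 := by gcongr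
        _ = _ := by ring
    have h5 : K ^ 9 * h ^ 23 / (1 - b) ^ 2 ≤ K ^ 14 * h ^ 23 := by
      refine le_trans ?_ h4
      have := hpow (show 9 ≤ 12 by norm_num)
      gcongr
    have h6 : 3 * (K ^ 14 * h ^ 23) ≤ h ^ 22 := by
      calc 3 * (K ^ 14 * h ^ 23) ≤ K * (K ^ 14 * h ^ 23) := by gcongr; linarith
        _ = K ^ 15 * h ^ (22 + 1) := by ring
        _ ≤ h ^ 22 := H.pow_le 22 (by norm_num)
    have h7 : h ^ 22 ≤ h ^ 9 * (√(ema (b ^ 2) (fun s => f s ^ 2) n₁) + ξ) := by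
      calc h ^ 22 ≤ h ^ 11 := H.h_pow_le (by norm_num)
        _ = h ^ 9 * h ^ 2 := by ring
        _ ≤ _ := by
          have := H.ξ_pos
          gcongr
          linarith
    linarith
  · have hb2 : 0 < b ^ 2 := by positivity
    have hb21 : b ^ 2 < 1 := by nlinarith
    have h1 := abs_ema_sub_le hb2 hb21 (g := fun s => g s ^ 2) (t := n₁)
      (L := 2 * K ^ 13 * (K ^ 12 * h ^ 23))
      (abs_sub_le_of_steps (n := n₁) (fun s hs => hsq (hgb (s + 1) hs) (hgb s hs.le) (hg3 s hs))
        n₁ le_rfl) (by positivity)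
    have h2 := abs_ema_sub_le hb2 hb21 (g := fun s => f s ^ 2) (t := n₁)
      (L := 2 * K ^ 13 * (K ^ 9 * h ^ 23))
      (abs_sub_le_of_steps (n := n₁) (fun s hs => hsq (hfb (s + 1) hs) (hfb s hs.le) (hf3 s hs))
        n₁ le_rfl) (by positivity)
    have e : ema (b ^ 2) (fun s => g s ^ 2) n₁ - c ^ 2 * ema (b ^ 2) (fun s => f s ^ 2) n₁
        = (ema (b ^ 2) (fun s => g s ^ 2) n₁ - g n₁ ^ 2 * ema (b ^ 2) (fun _ => 1) n₁)
        - c ^ 2 * (ema (b ^ 2) (fun s => f s ^ 2) n₁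
          - f n₁ ^ 2 * ema (b ^ 2) (fun _ => 1) n₁) := by
      have : g n₁ = c * f n₁ := hgf
      rw [this]; ring
    change |ema (b ^ 2) (fun s => g s ^ 2) n₁ - _| ≤ _
    rw [e]
    refine (abs_sub _ _).trans ?_
    rw [abs_mul]
    have hc2 : |c ^ 2| ≤ 4 := by
      rw [abs_pow]
      calc |c| ^ 2 ≤ 2 ^ 2 := by gcongr
        _ = 4 := by norm_num
    have h3 : |c ^ 2| * |ema (b ^ 2) (fun s => f s ^ 2) n₁
          - f n₁ ^ 2 * ema (b ^ 2) (fun _ => 1) n₁|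
        ≤ 4 * (2 * K ^ 13 * (K ^ 9 * h ^ 23) / (1 - b ^ 2) ^ 2) := by gcongr
    have h4 : 2 * K ^ 13 * (K ^ 12 * h ^ 23) / (1 - b ^ 2) ^ 2 ≤ 2 * K ^ 27 * h ^ 23 := by
      calc _ = 2 * K ^ 13 * (K ^ 12 * h ^ 23) * (1 / (1 - b ^ 2) ^ 2) := by rw [mul_one_div]
        _ ≤ 2 * K ^ 13 * (K ^ 12 * h ^ 23) * K ^ 2 := by gcongr
        _ = _ := by ring
    have h5 : 2 * K ^ 13 * (K ^ 9 * h ^ 23) / (1 - b ^ 2) ^ 2 ≤ 2 * K ^ 27 * h ^ 23 := by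
      refine le_trans ?_ h4
      have := hpow (show 9 ≤ 12 by norm_num)
      gcongr
    have h6 : 10 * (K ^ 27 * h ^ 23) ≤ h ^ 22 := by
      calc 10 * (K ^ 27 * h ^ 23) ≤ K * (K ^ 27 * h ^ 23) := by gcongr; linarith
        _ = K ^ 28 * h ^ 23 := by ring
        _ ≤ h ^ 22 := hL
    have h7 : h ^ 22 ≤ h ^ 9 * ema (b ^ 2) (fun s => f s ^ 2) n₁ := by
      calc h ^ 22 ≤ h ^ 13 := H.h_pow_le (by norm_num)
        _ = h ^ 9 * (h ^ 2) ^ 2 := by ring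
        _ ≤ h ^ 9 * f n₁ ^ 2 := by gcongr
        _ ≤ _ := by gcongr
    linarith

/-- The normalised rows of the first layer move together. -/
lemma fitVel_rows (hV : ∀ m, n₁ ≤ m → m < n → FitVel b K h η ξ A x y r m) (i j : Fin d) :
    |adamU b ξ (fun s => x s i * r s j) n - adamU b ξ (refGrad η r j) n|
      ≤ K ^ 3 * h ^ 9 * (1 + emaRatio b ξ (refGrad η r j) n) := by
  have hη := H.η_pos
  have hh := H.h_pos
  have hK := H.hK
  have hK0 := H.K_pos
  have hK1 := H.one_le_K
  have hu : 0 < 1 - b := by linarith [H.b_lt]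
  have hh1 : h ≤ 1 := by linarith [H.h_le']
  have hn₁0 := H.n₁_pos hT.lower
  have hh10 : 3 * h ^ 10 ≤ h ^ 9 := by
    calc 3 * h ^ 10 = 3 * h * h ^ 9 := by ring
      _ ≤ 1 * h ^ 9 := by gcongr; linarith [H.h_le']
      _ = _ := one_mul _
  have hs0 : ∀ s, n₁ ≤ s → (0 : ℝ) < s := fun s hs =>
    lt_of_lt_of_le hn₁0 (by exact_mod_cast hs)
  have hlam : ∀ s, n₁ ≤ s → s ≤ n → |x s i / (η * s) - 1| ≤ 2 * h ^ 10 := by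
    intro s h1 h2
    have hs := hs0 s h1
    have h3 := (hI s h1 h2).layer2 i
    have e : x s i / (η * s) - 1 = (x s i - η * s) / (η * s) := by field_simp
    rw [e, abs_div, abs_of_pos (by positivity : 0 < η * (s : ℝ)), div_le_iff₀ (by positivity)]
    exact h3
  obtain ⟨N, hN⟩ := Nat.exists_eq_add_of_le hn₁n
  obtain ⟨hf1, -, -⟩ := H.refGrad_start hT hn₁n hn hI j
  have hf0 : 0 < refGrad η r j n₁ := lt_of_lt_of_le (by positivity) hf1
  have hgf : ∀ s, n₁ ≤ s → x s i * r s j = x s i / (η * s) * refGrad η r j s := by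
    intro s h1
    have hs := hs0 s h1
    unfold refGrad
    field_simp
  have hstart := H.start_moments hT hn₁n hn hI i j (c := x n₁ i / (η * n₁))
    (by
      have h1 := hlam n₁ le_rfl hn₁n
      have h2 := H.h10_le
      rw [abs_le] at h1 ⊢
      constructor <;> linarith [h1.1, h1.2]) (hgf n₁ le_rfl)
  have hsum := H.sum_refRatio_le hT hn₁n hn hI j (N := N) (by omega)
    (fun m h1 h2 => hV m h1 (by omega))
  -- The factor `xᵢ / (η s)` changes by at most `3 h¹⁰ / n₁` per step. Against a sum of update sizes
  -- of at most `K²⁴ n₁` this accumulates to at most `3 K²⁴ h¹⁰ ≤ h⁹`, so `Sg = 1` suffices.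
  have main := abs_adamU_sub_le H.b_pos H.b_lt (f := refGrad η r j)
    (g := fun s => x s i * r s j) (lam := fun s => x s i / (η * s)) (ξ := ξ) (ε := h ^ 9)
    (δ := 3 * h ^ 10 / n₁) (Sg := 1) (n₁ := n₁) (n := N) H.ξ_pos (by positivity)
    (by
      calc h ^ 9 ≤ h ^ 2 := H.h_pow_le (by norm_num)
        _ = h * h := by ring
        _ ≤ 1 / 100 * (1 / 100) := by gcongr <;> exact H.h_le'
        _ ≤ _ := by norm_num) (by positivity)
    (fun k _ => hgf _ (by omega))
    (fun k hk => (hlam _ (by omega) (by omega)).trans (by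
      have : 0 ≤ h ^ 10 := by positivity
      linarith))
    (fun k hk => by
      have hv := (hV (n₁ + k) (by omega) (by omega)).layer2 i
      have hl := hlam (n₁ + k) (by omega) (by omega)
      have hs := hs0 (n₁ + k) (by omega)
      set s := n₁ + k with hs_def
      have hs1 : (0 : ℝ) < ((s + 1 : ℕ) : ℝ) := by positivity
      -- The derivative of a quotient in discrete form: the step of `x` is `η` up to `h¹⁰ η` and the
      -- quotient is one up to `2 h¹⁰`, hence the factor three.
      have e : x (s + 1) i / (η * ((s + 1 : ℕ) : ℝ)) - x s i / (η * s)
          = ((x (s + 1) i - x s i - η) - η * (x s i / (η * s) - 1)) / (η * ((s + 1 : ℕ) : ℝ)) := by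
        push_cast
        field_simp
        ring
      rw [e, abs_div, abs_of_pos (by positivity : 0 < η * ((s + 1 : ℕ) : ℝ))]
      have hb : |x (s + 1) i - x s i - η - η * (x s i / (η * s) - 1)| ≤ η * (3 * h ^ 10) := by
        refine (abs_sub _ _).trans ?_
        rw [abs_mul, abs_of_pos hη]
        have : η * |x s i / (η * s) - 1| ≤ η * (2 * h ^ 10) := by gcongr
        linarith
      calc _ ≤ η * (3 * h ^ 10) / (η * ((s + 1 : ℕ) : ℝ)) := by gcongr
        _ = 3 * h ^ 10 / ((s + 1 : ℕ) : ℝ) := by field_simp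
        _ ≤ 3 * h ^ 10 / n₁ := by
          have : (n₁ : ℝ) ≤ ((s + 1 : ℕ) : ℝ) := by exact_mod_cast (by omega)
          gcongr)
    hf0.ne' hstart.1 hstart.2
    (by
      calc 3 * h ^ 10 / n₁ * ∑ k ∈ Finset.range N, emaRatio b ξ (refGrad η r j) (n₁ + k)
          ≤ 3 * h ^ 10 / n₁ * (K ^ 24 * n₁) := by gcongr
        _ = 3 * K ^ 24 * h ^ 10 := by field_simp
        _ ≤ K * K ^ 24 * h ^ 10 := by gcongr; linarith
        _ = K ^ 25 * h ^ (9 + 1) := by ring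
        _ ≤ h ^ 9 := H.pow_le 9 (by norm_num)
        _ = _ := (one_mul _).symm)
    (by
      have h1 := H.time_ratio_le hT.lower hn₁n (FitTimes.time_le H hT hn)
      have h2 : (N : ℝ) ≤ n := by exact_mod_cast (by omega)
      calc 3 * (3 * h ^ 10 / n₁) * N ≤ 3 * (3 * h ^ 10 / n₁) * n := by gcongr
        _ = 9 * h ^ 10 * ((n : ℝ) / n₁) := by ring
        _ ≤ 9 * h ^ 10 * (32 * K ^ 2) := by gcongr
        _ ≤ 9 * h ^ 10 * (K * K ^ 2) := by gcongr; linarith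
        _ = 9 * (K ^ 3 * h ^ (9 + 1)) := by ring
        _ ≤ 9 * h ^ 9 := by gcongr; exact H.pow_le 9 (by norm_num))
  rw [← hN] at main
  refine main.trans ?_
  have hρ := emaRatio_nonneg H.ξ_pos.le (refGrad η r j) n (b := b)
  have hinv2 : 1 / (1 - b) ^ 2 ≤ K ^ 2 := by
    have e : 1 / (1 - b) ^ 2 = (1 / (1 - b)) ^ 2 := by rw [div_pow, one_pow]
    rw [e]
    have := H.inv_le
    gcongr
  calc 32 / (1 - b) ^ 2 * h ^ 9 * (1 + 1 + emaRatio b ξ (refGrad η r j) n)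
      = 32 * (1 / (1 - b) ^ 2) * h ^ 9 * (1 + 1 + emaRatio b ξ (refGrad η r j) n) := by
        rw [mul_one_div]
    _ ≤ 32 * K ^ 2 * h ^ 9 * (2 * (1 + emaRatio b ξ (refGrad η r j) n)) := by
        gcongr
        linarith
    _ = 64 * K ^ 2 * h ^ 9 * (1 + emaRatio b ξ (refGrad η r j) n) := by ring
    _ ≤ K * K ^ 2 * h ^ 9 * (1 + emaRatio b ξ (refGrad η r j) n) := by gcongr; linarith
    _ = _ := by ring

end AdamRun

end DiagGeometry

namespace DiagGeometry

/-! ### Closing the induction for the fitting phase. -/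

namespace AdamRun

variable {d : ℕ} {b K h D η ξ : ℝ} {T : ℕ} {A : Fin d → ℝ} {x : ℕ → Fin d → ℝ}
  {y : ℕ → Fin d → Fin d → ℝ} {r : ℕ → Fin d → ℝ} {n₁ n₂ : ℕ}

variable (H : AdamRun b K h D η ξ T A x y r)
include H

lemma small_const {c : ℝ} (hc : c ≤ K) : c * K ^ 2 * h ^ 10 ≤ h ^ 9 := by
  have hK := H.hK
  have hh := H.h_pos
  calc c * K ^ 2 * h ^ 10 ≤ K * K ^ 2 * h ^ 10 := by gcongr
    _ = K ^ 3 * h ^ (9 + 1) := by ring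
    _ ≤ h ^ 9 := H.pow_le 9 (by norm_num)

lemma h9_le : h ^ 9 ≤ 1 / (100 * K) := by
  have hh := H.h_pos
  have hK := H.K_pos
  calc h ^ 9 ≤ h ^ 2 := H.h_pow_le (by norm_num)
    _ = h * h := by ring
    _ ≤ 1 / 100 * (1 / K) := by
      gcongr
      · exact H.h_le'
      · exact H.h_le
    _ = _ := by field_simp

lemma sq_time_le {t : ℕ} (ht : η * t ≤ 2 * K / D) : d * (η * t) ^ 2 ≤ 4 * K ^ 2 := by
  have hη := H.η_pos
  have hD := H.D_pos
  have hK := H.K_pos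
  rw [H.hdD]
  calc D ^ 2 * (η * t) ^ 2 ≤ D ^ 2 * (2 * K / D) ^ 2 := by gcongr
    _ = _ := by field_simp; norm_num

/-- As long as a column has not reached its band, its entries and the second layer both equal `ηt`
up to a relative `2 h¹⁰`, and each of the `d` products is close to `(ηt)²`. -/
lemma fit_uncrossed {t : ℕ} (ht : η * t ≤ 2 * K / D) (hI : FitInv K h D η n₁ A x y t) {j : Fin d}
    (hj : ∀ i, |y t i j - η * t| ≤ 2 * h ^ 10 * (η * t)) :
    |prodVec x y t j - d * (η * t) ^ 2| ≤ h ^ 9 := by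
  have hη := H.η_pos
  have hh := H.h_pos
  have hτ : 0 ≤ η * t := by positivity
  have h10 := H.h10_le
  have e : prodVec x y t j - d * (η * t) ^ 2 = ∑ i, (x t i * y t i j - (η * t) ^ 2) := by
    rw [Finset.sum_sub_distrib]
    simp [prodVec]
  rw [e]
  calc _ ≤ ∑ i, |x t i * y t i j - (η * t) ^ 2| := Finset.abs_sum_le_sum_abs _ _
    _ ≤ ∑ _i : Fin d, 6 * h ^ 10 * (η * t) ^ 2 := by
        gcongr with i
        have e : x t i * y t i j - (η * t) ^ 2
          = (x t i - η * t) * y t i j + η * t * (y t i j - η * t) := by ring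
        rw [e]
        refine (abs_add_le _ _).trans ?_
        rw [abs_mul, abs_mul, abs_of_nonneg hτ]
        have h1 := hI.layer2 i
        have h2 := hj i
        have h3 : |y t i j| ≤ 2 * (η * t) := by
          have h4 := abs_add_le (y t i j - η * t) (η * t)
          rw [sub_add_cancel, abs_of_nonneg hτ] at h4
          have h5 : 2 * h ^ 10 * (η * t) ≤ 1 / 100 * (η * t) := by gcongr
          linarith
        have h4 : |x t i - η * t| * |y t i j| ≤ 2 * h ^ 10 * (η * t) * (2 * (η * t)) :=
          mul_le_mul h1 h3 (abs_nonneg _) (by positivity)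
        have h5 : η * t * |y t i j - η * t| ≤ η * t * (2 * h ^ 10 * (η * t)) := by gcongr
        linarith
    _ = 6 * h ^ 10 * (d * (η * t) ^ 2) := by simp; ring
    _ ≤ 6 * h ^ 10 * (4 * K ^ 2) :=
        mul_le_mul_of_nonneg_left (H.sq_time_le ht) (by positivity)
    _ = 24 * K ^ 2 * h ^ 10 := by ring
    _ ≤ h ^ 9 := H.small_const (by linarith [H.hK])

variable (hT : FitTimes K D η T n₁ n₂)
include hT

/-- At the end of the growth phase the errors `3 h¹³ + h¹⁰ η n₁` are below `2 h¹⁰ η n₁`, because `η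
n₁` is at least of order `h / K`. No coordinate has crossed yet. -/
lemma fitInv_base (h12 : n₁ ≤ n₂) : FitInv K h D η n₁ A x y n₁ := by
  have hη := H.η_pos
  have hh := H.h_pos
  have hK := H.hK
  have hK0 := H.K_pos
  have hD := H.D_pos
  have hD1 := H.one_le_D
  have hTn : n₁ ≤ T := by have := hT.le_T; omega
  have hGi := H.growth hTn hT.upper
  have hG := hGi n₁ le_rfl
  have hP := (H.growth_resid hTn hT.upper hGi)
  have hn₁0 := H.n₁_pos hT.lower
  have htl := H.h_le_time hT.lower (le_refl n₁) (FitTimes.time_le H hT h12)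
  have h13 : 3 * h ^ 13 ≤ h ^ 10 * (η * n₁) := by
    calc 3 * h ^ 13 = h ^ 10 * (3 * (h * h) * h) := by ring
      _ ≤ h ^ 10 * (3 * (1 / 100 * (1 / K)) * h) := by
          gcongr
          · exact H.h_le'
          · exact H.h_le
      _ ≤ h ^ 10 * (h / (16 * K)) := by
          gcongr
          rw [div_eq_mul_one_div h]
          have e : 1 / (16 * K) = 1 / 16 * (1 / K) := by field_simp
          rw [e]
          have : 0 < 1 / K * h := by positivity
          nlinarith
      _ ≤ _ := by gcongr
  have hτ : 0 ≤ η * n₁ := by positivity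
  have hy : ∀ i j, |y n₁ i j - η * n₁| ≤ 2 * h ^ 10 * (η * n₁) := fun i j => by
    have := (hG.2 i j).2; linarith
  have hx : ∀ i, |x n₁ i - η * n₁| ≤ 2 * h ^ 10 * (η * n₁) := fun i => by
    have := (hG.1 i).2.2; linarith
  have h10 := H.h10_le
  have h10' : 2 * h ^ 10 * (η * n₁) ≤ 1 / 100 * (η * n₁) := by gcongr
  refine ⟨hx, fun i i' j => ?_, fun j => ?_, fun j => ?_, fun j => Or.inl fun i => hy i j⟩
  · have e : y n₁ i j - y n₁ i' j = (y n₁ i j - η * n₁) - (y n₁ i' j - η * n₁) := by ring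
    rw [e]
    refine (abs_sub _ _).trans ?_
    calc |y n₁ i j - η * n₁| + |y n₁ i' j - η * n₁| ≤ 4 * h ^ 10 * (η * n₁) := by
          linarith [hy i j, hy i' j]
      _ ≤ 4 * h ^ 10 * (1 / (8 * K * D)) := by gcongr; exact hT.upper
      _ = (h ^ 10 / (2 * K)) / D := by field_simp; norm_num
      _ ≤ h ^ 8 / D := by
          gcongr
          calc h ^ 10 / (2 * K) ≤ h ^ 10 / 1 := by gcongr; linarith
            _ = h ^ 10 := div_one _
            _ ≤ h ^ 8 := H.h_pow_le (by norm_num)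
  · have h1 := (abs_le.1 (hP j).1).2
    have h2 := H.A_lower j
    have h3 : 1 / (800 * K) ≤ 1 / K := by
      apply one_div_le_one_div_of_le hK0; linarith
    have : 0 ≤ K ^ 4 * h ^ 9 * ((n₁ : ℝ) / n₁) ^ 2 := by positivity
    linarith
  · unfold prodVec
    calc 1 / K ^ 4 ≤ 1 / (1024 * K ^ 2) := by
          apply one_div_le_one_div_of_le (by positivity)
          have : 1024 ≤ K ^ 2 := by nlinarith
          have e : K ^ 4 = K ^ 2 * K ^ 2 := by ring
          rw [e]
          gcongr
      _ = ∑ _i : Fin d, (1 / (16 * K * D) / 2) * (1 / (16 * K * D) / 2) := by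
          rw [Finset.sum_const, Finset.card_univ, Fintype.card_fin, nsmul_eq_mul, H.hdD]
          field_simp; norm_num
      _ ≤ _ := by
          have hl := hT.lower
          refine Finset.sum_le_sum fun i _ => ?_
          have h1 := (abs_le.1 (hx i)).1
          have h2 := (abs_le.1 (hy i j)).1
          have h3 : 1 / (16 * K * D) / 2 ≤ x n₁ i := by linarith
          have h4 : 1 / (16 * K * D) / 2 ≤ y n₁ i j := by linarith
          have h5 : 0 ≤ 1 / (16 * K * D) / 2 := by positivity
          exact mul_le_mul h3 h4 h5 (h5.trans h3)

section step

variable {n : ℕ} (hn₁n : n₁ ≤ n) (hn : n + 1 ≤ n₂)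
  (hI : ∀ t, n₁ ≤ t → t ≤ n → FitInv K h D η n₁ A x y t)
  (hV : ∀ m, n₁ ≤ m → m ≤ n → FitVel b K h η ξ A x y r m)
include hn₁n hn hI hV

/-- Below the band all weights involved are positive and all of them grow, so the product cannot
fall back. -/
lemma prodVec_mono {j : Fin d} (hj : prodVec x y n j ≤ A j - h ^ 9) :
    prodVec x y n j ≤ prodVec x y (n + 1) j := by
  have hη := H.η_pos
  have hh := H.h_pos
  have hIn := hI n hn₁n le_rfl
  have hVn := hV n hn₁n le_rfl
  have htn := FitTimes.time_le H hT (t := n) (by omega)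
  have h10 : h ^ 10 ≤ 1 := pow_le_one₀ hh.le (by linarith [H.h_le'])
  have h10' : h ^ 10 * η ≤ 1 * η := by gcongr
  unfold prodVec
  refine Finset.sum_le_sum fun i _ => ?_
  have h1 := (abs_le.1 (hVn.layer2 i)).1
  have h2 := (abs_le.1 (hVn.up j hj i)).1
  have h3 := (H.fit_x' hT.lower hn₁n htn hIn i).1
  have h4 := (H.fit_y hT.lower hn₁n htn hIn i j).1
  have h5 : 0 ≤ η * n := by positivity
  have h6 : 0 < 1 / (K ^ 6 * D) := by have := H.K_pos; have := H.D_pos; positivity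
  exact mul_le_mul (by linarith) (by linarith) (by linarith) (by linarith)

omit hV in
lemma prodVec_step (j : Fin d) :
    |prodVec x y (n + 1) j - prodVec x y n j| ≤ h ^ 9 / 2 := by
  have hh := H.h_pos
  refine ((H.fit_steps hT hn₁n (by omega) hI (s := n) (by omega)).2.2.1 j).trans ?_
  have hK := H.K_pos
  calc D * K ^ 6 * h ^ 23 = (D * h) * (K ^ 6 * h ^ (21 + 1)) := by ring
    _ ≤ 1 * h ^ 21 := by
        gcongr
        · exact H.hDh
        · exact H.pow_le 21 (by norm_num)
    _ ≤ h ^ 10 := by rw [one_mul]; exact H.h_pow_le (by norm_num)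
    _ = h ^ 9 * h := by ring
    _ ≤ h ^ 9 * (1 / 2) := by gcongr; linarith [H.h_le']
    _ = _ := by ring

set_option maxHeartbeats 800000 in
-- Above the band the column decreases at speed `η`, but the second layer still increases, so the
-- product `P` changes by about `η (∑ y - ∑ x)`, that is `(P - d (ηt)²) / t`. After the crossing `d
-- (ηt)²` is at least `A - 3 h⁹`, so the excess `E` satisfies `E' ≤ (E + 4 h⁹) / t`. It may grow,
-- but no faster than `t²`, which explains the form of the invariant.
lemma fit_upper_succ (j : Fin d) :
    prodVec x y (n + 1) j ≤ A j + K ^ 4 * h ^ 9 * (((n + 1 : ℕ) : ℝ) / n₁) ^ 2 := by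
  have hη := H.η_pos
  have hh := H.h_pos
  have hK := H.hK
  have hK0 := H.K_pos
  have hD := H.D_pos
  have hIn := hI n hn₁n le_rfl
  have hVn := hV n hn₁n le_rfl
  have htn := FitTimes.time_le H hT (t := n) (by omega)
  have hn₁0 := H.n₁_pos hT.lower
  have hnn : (n₁ : ℝ) ≤ n := by exact_mod_cast hn₁n
  have hn0 : (0 : ℝ) < n := by linarith
  have hstep := (abs_le.1 (H.prodVec_step hT hn₁n hn hI j)).2
  have hK4 : 4 ≤ K ^ 4 := by
    calc (4 : ℝ) ≤ K := by linarith
      _ = K ^ 1 := (pow_one K).symm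
      _ ≤ K ^ 4 := pow_le_pow_right₀ H.one_le_K (by norm_num)
  set U := K ^ 4 * h ^ 9 / (n₁ : ℝ) ^ 2 with hU
  have hU0 : 0 < U := by positivity
  have hUn : 4 * h ^ 9 ≤ U * n ^ 2 := by
    calc 4 * h ^ 9 ≤ K ^ 4 * h ^ 9 := by gcongr
      _ = U * n₁ ^ 2 := by rw [hU]; field_simp
      _ ≤ U * n ^ 2 := by gcongr
  have e1 : K ^ 4 * h ^ 9 * (((n + 1 : ℕ) : ℝ) / n₁) ^ 2 = U * ((n : ℝ) + 1) ^ 2 := by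
    rw [hU]; push_cast; field_simp
  have hUp : prodVec x y n j - A j ≤ U * n ^ 2 := by
    have h1 := hIn.upper j
    have e : K ^ 4 * h ^ 9 * ((n : ℝ) / n₁) ^ 2 = U * n ^ 2 := by rw [hU]; field_simp
    linarith
  rw [e1]
  rcases le_or_gt (prodVec x y n j) (A j + h ^ 9) with hle | hgt
  · have h2 : U * n ^ 2 ≤ U * ((n : ℝ) + 1) ^ 2 := by gcongr; linarith
    have h9 : 0 < h ^ 9 := by positivity
    linarith
  · set τ := η * (n : ℝ) with hτ
    have hτ0 : 0 < τ := by positivity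
    set P := prodVec x y n j with hP
    have h10 := H.h10_le
    set ε := h ^ 10 with hε
    have hε0 : 0 < ε := by positivity
    have hdτ : A j - 3 * h ^ 9 ≤ d * τ ^ 2 := by
      rcases hIn.crossed j with hunc | hcr
      · have := (abs_le.1 (H.fit_uncrossed htn hIn hunc)).2
        have h9 : 0 < h ^ 9 := by positivity
        linarith
      · exact hcr.1
    have hdτ2 := H.sq_time_le htn
    have hdown := hVn.down j hgt.le
    have hsum : prodVec x y (n + 1) j - P
        ≤ ∑ i, (η * ((1 + ε) / (τ * (1 - 2 * ε))) * (x n i * y n i j)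
          - η * (1 - ε) * (τ * (1 - 2 * ε))) := by
      rw [hP]
      unfold prodVec
      rw [← Finset.sum_sub_distrib]
      refine Finset.sum_le_sum fun i _ => ?_
      have h1 := abs_le.1 (hVn.layer2 i)
      have h2 := abs_le.1 (hdown i)
      have h3 := (H.fit_x hT.lower hn₁n htn hIn i).1
      have h4 : 0 < y n i j := lt_of_lt_of_le (by positivity)
        (H.fit_y hT.lower hn₁n htn hIn i j).1
      have h12 : 0 < τ * (1 - 2 * ε) := by
        have : 0 < 1 - 2 * ε := by linarith
        positivity
      have e : x (n + 1) i * y (n + 1) i j - x n i * y n i j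
        = (x (n + 1) i - x n i) * y n i j + x (n + 1) i * (y (n + 1) i j - y n i j) := by ring
      rw [e]
      have h5 : (x (n + 1) i - x n i) * y n i j ≤ (η * (1 + ε)) * y n i j := by
        gcongr
        linarith [h1.2]
      have h6 : (η * (1 + ε)) * y n i j
          -- The sum of the `y` is expressed through the product itself, using `x ≥ τ (1 - 2 ε)`.
          ≤ η * ((1 + ε) / (τ * (1 - 2 * ε))) * (x n i * y n i j) := by
        calc (η * (1 + ε)) * y n i j
            = η * ((1 + ε) / (τ * (1 - 2 * ε))) * ((τ * (1 - 2 * ε)) * y n i j) := by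
              obtain ⟨q, hq⟩ : ∃ q, q = τ * (1 - 2 * ε) := ⟨_, rfl⟩
              rw [← hq] at h12 ⊢
              field_simp
          _ ≤ _ := by gcongr
      have h7 : 0 ≤ x (n + 1) i - x n i := by
        have : ε * η ≤ 1 * η := by gcongr; linarith
        linarith [h1.1]
      have h8 : η * (1 - ε) * (τ * (1 - 2 * ε)) ≤ -(x (n + 1) i * (y (n + 1) i j - y n i j)) := by
        have h9 : η * (1 - ε) ≤ -(y (n + 1) i j - y n i j) := by linarith [h2.2]
        have h10 : τ * (1 - 2 * ε) ≤ x (n + 1) i := by linarith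
        have h11 : 0 ≤ η * (1 - ε) := by
          have : 0 ≤ 1 - ε := by linarith
          positivity
        calc _ ≤ -(y (n + 1) i j - y n i j) * x (n + 1) i :=
              mul_le_mul h9 h10 h12.le (h11.trans h9)
          _ = _ := by ring
      linarith
    have hPle := H.fit_prod_le hT.lower hn₁n htn hIn j
    have hP0 : 0 < P := lt_of_lt_of_le (by positivity) (hIn.lower j)
    have hsum2 : ∑ i, (η * ((1 + ε) / (τ * (1 - 2 * ε))) * (x n i * y n i j)
          - η * (1 - ε) * (τ * (1 - 2 * ε))) = η * ((1 + ε) / (τ * (1 - 2 * ε))) * P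
            - d * (η * (1 - ε) * (τ * (1 - 2 * ε))) := by
      rw [Finset.sum_sub_distrib, ← Finset.mul_sum]
      simp [hP, prodVec]
    have hfrac : (1 + ε) / (1 - 2 * ε) ≤ 1 + 4 * ε := by
      have : 0 < 1 - 2 * ε := by linarith
      rw [div_le_iff₀ this]
      nlinarith
    have hn' : τ * (1 / (n : ℝ)) = η := by rw [hτ]; field_simp
    have h1 : η * ((1 + ε) / (τ * (1 - 2 * ε))) * P ≤ (1 / n) * (P + 4 * ε * P) := by
      calc η * ((1 + ε) / (τ * (1 - 2 * ε))) * P = (1 / n) * ((1 + ε) / (1 - 2 * ε) * P) := by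
            rw [← hn']
            have : 1 - 2 * ε ≠ 0 := by linarith
            field_simp
        _ ≤ (1 / n) * ((1 + 4 * ε) * P) := by gcongr
        _ = _ := by ring
    have h2 : (1 / n) * (d * τ ^ 2 - 3 * ε * (d * τ ^ 2))
        ≤ d * (η * (1 - ε) * (τ * (1 - 2 * ε))) := by
      have : (1 - ε) * (1 - 2 * ε) ≥ 1 - 3 * ε := by nlinarith
      calc (1 / n) * (d * τ ^ 2 - 3 * ε * (d * τ ^ 2)) = (1 / n) * (d * τ ^ 2 * (1 - 3 * ε)) := by
            ring
        _ ≤ (1 / n) * (d * τ ^ 2 * ((1 - ε) * (1 - 2 * ε))) := by gcongr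
        _ = d * ((τ * (1 / n)) * (1 - ε) * (τ * (1 - 2 * ε))) := by ring
        _ = _ := by rw [hn']
    have h3 : P + 4 * ε * P - (d * τ ^ 2 - 3 * ε * (d * τ ^ 2)) ≤ (P - A j) + 4 * h ^ 9 := by
      have h4 : 4 * ε * P ≤ 4 * ε * (2 * K) := by gcongr
      have h5 : 3 * ε * (d * τ ^ 2) ≤ 3 * ε * (4 * K ^ 2) := by gcongr
      have h6 := H.small_const (c := 20) (by linarith)
      have h7 : ε * K ≤ ε * K ^ 2 := by
        rw [pow_two]
        exact mul_le_mul_of_nonneg_left (le_mul_of_one_le_left hK0.le H.one_le_K) hε0.le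
      linarith
    have h4 : prodVec x y (n + 1) j - P ≤ (1 / n) * ((P - A j) + 4 * h ^ 9) := by
      have h5 : (1 / (n : ℝ)) * (P + 4 * ε * P - (d * τ ^ 2 - 3 * ε * (d * τ ^ 2)))
          ≤ (1 / n) * ((P - A j) + 4 * h ^ 9) := by gcongr
      rw [mul_sub] at h5
      linarith
    have h5 : (1 / (n : ℝ)) * ((P - A j) + 4 * h ^ 9) ≤ (1 / n) * (2 * (U * n ^ 2)) := by
      gcongr; linarith
    have h6 : (1 / (n : ℝ)) * (2 * (U * n ^ 2)) = 2 * U * n := by field_simp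
    -- The room between consecutive squares is at least `2 U n`, the largest possible increase.
    have h7 : U * ((n : ℝ) + 1) ^ 2 = U * n ^ 2 + 2 * U * n + U := by ring
    linarith

/-- Both rows deviate from the reference update by a small multiple of its size. Summed over the
phase, the sizes are at most a constant times `n₁`, and `η n₁ ≤ 1 / (8KD)` turns this into half of
the allowed difference; the other half covers the difference at time `n₁`. -/
lemma fit_rows_succ (i i' j : Fin d) :
    |y (n + 1) i j - y (n + 1) i' j| ≤ h ^ 8 / D := by
  have hη := H.η_pos
  have hh := H.h_pos
  have hK := H.hK
  have hK0 := H.K_pos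
  have hD := H.D_pos
  have hn₁0 := H.n₁_pos hT.lower
  have hTn : n₁ ≤ T := by have := hT.le_T; omega
  obtain ⟨N, hN⟩ := Nat.exists_eq_add_of_le (show n₁ ≤ n + 1 by omega)
  set ρ : ℕ → ℝ := fun k => emaRatio b ξ (refGrad η r j) (n₁ + k) with hρ
  have htel : ∀ M ≤ N, |y (n₁ + M) i j - y (n₁ + M) i' j| ≤ |y n₁ i j - y n₁ i' j|
      + 2 * η * K ^ 3 * h ^ 9 * ∑ k ∈ Finset.range M, (1 + ρ k) := by
    intro M
    induction M with
    | zero => intro _; simp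
    | succ M ih =>
      intro hM
      have h1 := ih (by omega)
      have hVm := hV (n₁ + M) (by omega) (by omega)
      have h2 := hVm.rows i j
      have h3 := hVm.rows i' j
      rw [Finset.sum_range_succ, ← add_assoc]
      have e1 := H.y_succ (n₁ + M) i j
      have e2 := H.y_succ (n₁ + M) i' j
      set u₁ := adamU b ξ (fun s => x s i * r s j) (n₁ + M)
      set u₂ := adamU b ξ (fun s => x s i' * r s j) (n₁ + M)
      set u₀ := adamU b ξ (refGrad η r j) (n₁ + M)
      have e : y (n₁ + M + 1) i j - y (n₁ + M + 1) i' j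
          = (y (n₁ + M) i j - y (n₁ + M) i' j) + η * ((u₁ - u₀) - (u₂ - u₀)) := by
        rw [e1, e2]; ring
      rw [e]
      refine (abs_add_le _ _).trans ?_
      rw [abs_mul, abs_of_pos hη]
      have h4 : η * |(u₁ - u₀) - (u₂ - u₀)| ≤ η * (2 * (K ^ 3 * h ^ 9 * (1 + ρ M))) := by
        have := abs_sub (u₁ - u₀) (u₂ - u₀)
        gcongr
        change _ ≤ 2 * (K ^ 3 * h ^ 9 * (1 + emaRatio b ξ (refGrad η r j) (n₁ + M)))
        linarith
      linarith
  have h0 := htel N le_rfl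
  rw [← hN] at h0
  have hsum := H.sum_refRatio_le hT hn₁n (by omega) hI j (N := N) (by omega)
    (fun m h1 h2 => hV m h1 (by omega))
  have hNn : (N : ℝ) ≤ K ^ 24 * n₁ := by
    have h1 := H.time_ratio_le hT.lower hn₁n (FitTimes.time_le H hT (t := n) (by omega))
    rw [div_le_iff₀ hn₁0] at h1
    have h2 : N ≤ n := by
      have : 0 < n₁ := by exact_mod_cast hn₁0
      omega
    have h3 : (N : ℝ) ≤ n := by exact_mod_cast h2
    have h4 : 32 * K ^ 2 ≤ K ^ 24 := by
      calc 32 * K ^ 2 ≤ K * K ^ 2 := by gcongr; linarith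
        _ = K ^ 3 := by ring
        _ ≤ K ^ 24 := pow_le_pow_right₀ H.one_le_K (by norm_num)
    calc (N : ℝ) ≤ 32 * K ^ 2 * n₁ := h3.trans h1
      _ ≤ _ := by gcongr
  have hS : ∑ k ∈ Finset.range N, (1 + ρ k) ≤ 2 * (K ^ 24 * n₁) := by
    rw [Finset.sum_add_distrib]
    simp only [Finset.sum_const, Finset.card_range, nsmul_eq_mul, mul_one]
    linarith
  have hbase : |y n₁ i j - y n₁ i' j| ≤ h ^ 8 / (2 * D) := by
    have hG := (H.growth hTn hT.upper) n₁ le_rfl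
    have h1 := (hG.2 i j).2
    have h2 := (hG.2 i' j).2
    have e : y n₁ i j - y n₁ i' j = (y n₁ i j - η * n₁) - (y n₁ i' j - η * n₁) := by ring
    rw [e]
    refine (abs_sub _ _).trans ?_
    have h3 : h ^ 10 * (η * n₁) ≤ h ^ 10 * (1 / (8 * K * D)) := by gcongr; exact hT.upper
    have h4 : h ^ 10 * (1 / (8 * K * D)) ≤ h ^ 8 * (1 / (8 * D)) := by
      have : h ^ 10 ≤ h ^ 8 := H.h_pow_le (by norm_num)
      have : D ≤ K * D := by nlinarith
      gcongr ?_ * (1 / ?_)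
      linarith
    have h5 : h ^ 13 ≤ h ^ 8 * (1 / (100 * D)) := by
      calc h ^ 13 ≤ h ^ 10 := H.h_pow_le (by norm_num)
        _ = h ^ 8 * (h * h) := by ring
        _ ≤ h ^ 8 * (1 / 100 * (1 / D)) := by
          gcongr
          · exact H.h_le'
          · exact H.h_le_inv_D
        _ = _ := by field_simp
    have e2 : h ^ 8 * (1 / (100 * D)) = h ^ 8 / D / 100 := by field_simp
    have e3 : h ^ 8 * (1 / (8 * D)) = h ^ 8 / D / 8 := by field_simp
    have e4 : h ^ 8 / (2 * D) = h ^ 8 / D / 2 := by field_simp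
    have : 0 < h ^ 8 / D := by positivity
    rw [e4]
    linarith
  have hinc : 2 * η * K ^ 3 * h ^ 9 * ∑ k ∈ Finset.range N, (1 + ρ k) ≤ h ^ 8 / (2 * D) := by
    calc 2 * η * K ^ 3 * h ^ 9 * ∑ k ∈ Finset.range N, (1 + ρ k)
        ≤ 2 * η * K ^ 3 * h ^ 9 * (2 * (K ^ 24 * n₁)) := by gcongr
      _ = 4 * K ^ 27 * h ^ 9 * (η * n₁) := by ring
      _ ≤ 4 * K ^ 27 * h ^ 9 * (1 / (8 * K * D)) := by gcongr; exact hT.upper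
      _ = (K ^ 26 * h ^ (8 + 1)) / (2 * D) := by field_simp; ring
      _ ≤ h ^ 8 / (2 * D) := by gcongr; exact H.pow_le 8 (by norm_num)
  have e4 : h ^ 8 / (2 * D) + h ^ 8 / (2 * D) = h ^ 8 / D := by field_simp; ring
  linarith

/-- Below the band the product increases, and from inside or above it one step lowers the product by
at most `h⁹ / 2`. A coordinate that has entered the band thus never falls below `A - 2 h⁹`; an
uncrossed one that enters it has `d (ηt)²` close to `A` by `fit_uncrossed`. -/
lemma fitInv_succ : FitInv K h D η n₁ A x y (n + 1) := by
  have hη := H.η_pos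
  have hh := H.h_pos
  have hK := H.hK
  have hK0 := H.K_pos
  have hIn := hI n hn₁n le_rfl
  have hVn := hV n hn₁n le_rfl
  have htn := FitTimes.time_le H hT (t := n) (by omega)
  have h9 : 0 < h ^ 9 := by positivity
  have hstep := fun j => abs_le.1 (H.prodVec_step hT hn₁n hn hI j)
  have hmono := fun j => H.prodVec_mono hT hn₁n hn hI hV (j := j)
  have hnear : ∀ {a a' : ℝ}, |a - η * n| ≤ 2 * h ^ 10 * (η * n) → |a' - a - η| ≤ h ^ 10 * η →
      |a' - η * ((n + 1 : ℕ) : ℝ)| ≤ 2 * h ^ 10 * (η * ((n + 1 : ℕ) : ℝ)) := by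
    intro a a' h1 h2
    have e : a' - η * ((n + 1 : ℕ) : ℝ) = (a - η * n) + (a' - a - η) := by push_cast; ring
    rw [e]
    refine (abs_add_le _ _).trans ?_
    push_cast
    have : 0 < h ^ 10 * η := by positivity
    linarith
  refine ⟨fun i => hnear (hIn.layer2 i) (hVn.layer2 i),
    fun i i' j => H.fit_rows_succ hT hn₁n hn hI hV i i' j,
    fun j => H.fit_upper_succ hT hn₁n hn hI hV j, fun j => ?_, fun j => ?_⟩
  · rcases le_or_gt (prodVec x y n j) (A j - h ^ 9) with hle | hgt
    · exact (hIn.lower j).trans (hmono j hle)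
    · have h1 := (hstep j).1
      have h2 := H.A_lower j
      have h3 := H.h9_le
      have h4 : 1 / K ^ 4 ≤ 1 / K / 2 := by
        rw [div_div]
        apply one_div_le_one_div_of_le (by positivity)
        have e : K ^ 4 = K * K ^ 3 := by ring
        rw [e]
        gcongr
        calc (2 : ℝ) ≤ K := by linarith
          _ = K ^ 1 := (pow_one K).symm
          _ ≤ K ^ 3 := pow_le_pow_right₀ H.one_le_K (by norm_num)
      have e : 1 / (100 * K) = 1 / K / 100 := by field_simp
      have : 0 < 1 / K := by positivity
      linarith
  · have hτ : d * (η * n) ^ 2 ≤ d * (η * ((n + 1 : ℕ) : ℝ)) ^ 2 := by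
      gcongr; exact_mod_cast Nat.le_succ n
    have hPnext : A j - h ^ 9 < prodVec x y n j → A j - 2 * h ^ 9 ≤ prodVec x y (n + 1) j := by
      intro hgt
      linarith [(hstep j).1]
    rcases hIn.crossed j with hunc | hcr
    · rcases le_or_gt (prodVec x y n j) (A j - h ^ 9) with hle | hgt
      · exact Or.inl fun i => hnear (hunc i) (hVn.up j hle i)
      · refine Or.inr ⟨?_, hPnext hgt⟩
        have := (abs_le.1 (H.fit_uncrossed htn hIn hunc)).2
        linarith
    · refine Or.inr ⟨hcr.1.trans hτ, ?_⟩
      rcases le_or_gt (prodVec x y n j) (A j - h ^ 9) with hle | hgt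
      · exact hcr.2.trans (hmono j hle)
      · exact hPnext hgt

end step

/-- The order matters: the comparison of rows at time `n` uses the properties of the steps before
`n`, and the invariants at `n + 1` use those up to `n`. An unfinished coordinate is required at each
step to keep the second layer growing. -/
lemma fit_induction (n : ℕ) (hn₁n : n₁ ≤ n) (hn : n ≤ n₂)
    (hex : ∀ m, n₁ ≤ m → m < n → ∃ j, prodVec x y m j < A j - h ^ 2) :
    (∀ t, n₁ ≤ t → t ≤ n → FitInv K h D η n₁ A x y t) ∧
    (∀ m, n₁ ≤ m → m < n → FitVel b K h η ξ A x y r m) := by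
  induction n, hn₁n using Nat.le_induction with
  | base =>
    refine ⟨fun t h1 h2 => ?_, fun m h1 h2 => by omega⟩
    obtain rfl : t = n₁ := by omega
    exact H.fitInv_base hT hn
  | succ n hn₁n ih =>
    obtain ⟨hI, hV⟩ := ih (by omega) fun m h1 h2 => hex m h1 (by omega)
    have hVn : FitVel b K h η ξ A x y r n :=
      ⟨fun i => H.fitVel_layer2 hT hn₁n (by omega) hI (hex n hn₁n (by omega)) i,
        fun j hj i => (H.fitVel_layer1 hT hn₁n (by omega) hI i j).1 hj,
        fun j hj i => (H.fitVel_layer1 hT hn₁n (by omega) hI i j).2 hj,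
        fun i j => H.fitVel_rows hT hn₁n (by omega) hI hV i j⟩
    have hV' : ∀ m, n₁ ≤ m → m ≤ n → FitVel b K h η ξ A x y r m := fun m h1 h2 => by
      rcases Nat.lt_or_ge m n with hlt | hge
      · exact hV m h1 hlt
      · obtain rfl : m = n := by omega
        exact hVn
    refine ⟨fun t h1 h2 => ?_, fun m h1 h2 => hV' m h1 (by omega)⟩
    rcases Nat.lt_or_ge n t with hlt | hge
    · obtain rfl : t = n + 1 := by omega
      exact H.fitInv_succ hT hn₁n hn hI hV'
    · exact hI t h1 hge

/-- Up to the time at which all coordinates have reached their targets, the weights are uniform. -/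
theorem exists_fit (h12 : n₁ ≤ n₂) (hlast : K / D ≤ η * n₂) :
    ∃ N, n₁ ≤ N ∧ N ≤ n₂ ∧ (∀ j, A j - h ^ 2 ≤ prodVec x y N j) ∧
      ∀ t, n₁ ≤ t → t ≤ N → FitInv K h D η n₁ A x y t := by
  classical
  have hh := H.h_pos
  -- The alternative `n₂ ≤ N` makes the minimum exist before it is known that all coordinates
  -- finish.
  have hex : ∃ N, n₁ ≤ N ∧ ((∀ j, A j - h ^ 2 ≤ prodVec x y N j) ∨ n₂ ≤ N) :=
    ⟨n₂, h12, Or.inr le_rfl⟩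
  have hspec := Nat.find_spec hex
  have hmin := fun m hm => Nat.find_min hex (m := m) hm
  have hle : Nat.find hex ≤ n₂ := Nat.find_min' hex ⟨h12, Or.inr le_rfl⟩
  set N := Nat.find hex with hNdef
  have hfit := (H.fit_induction hT N hspec.1 hle fun m h1 h2 => by
    have := hmin m h2
    push Not at this
    exact (this h1).1).1
  refine ⟨N, hspec.1, hle, ?_, hfit⟩
  rcases hspec.2 with hdone | hge
  · exact hdone
  · have hNn : N = n₂ := le_antisymm hle hge
    intro j
    have hIN := hfit N hspec.1 le_rfl
    have h9 : 2 * h ^ 9 ≤ h ^ 2 := by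
      calc 2 * h ^ 9 = 2 * h * h ^ 8 := by ring
        _ ≤ 1 * h ^ 8 := by gcongr; linarith [H.h_le']
        _ ≤ h ^ 2 := by rw [one_mul]; exact H.h_pow_le (by norm_num)
    rcases hIN.crossed j with hunc | hcr
    · have h1 := (abs_le.1 (H.fit_uncrossed (FitTimes.time_le H hT hle) hIN hunc)).1
      have hK := H.hK
      -- At the horizon an uncrossed coordinate would already be near `d (ηN)² ≥ K²`, beyond every
      -- target.
      have h2 : K ^ 2 ≤ d * (η * N) ^ 2 := by
        rw [hNn, H.hdD]
        have hD := H.D_pos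
        calc K ^ 2 = D ^ 2 * (K / D) ^ 2 := by field_simp
          _ ≤ _ := by
            have := H.K_pos
            gcongr
      have h3 := H.A_upper j
      have h4 : 0 < h ^ 9 := by positivity
      nlinarith
    · linarith [hcr.2]

end AdamRun

end DiagGeometry

namespace DiagGeometry

/-! ### The median -/

section median

variable {ι : Type*} [Fintype ι]

lemma countP_sort (f : ι → ℝ) (p : ℝ → Prop) [DecidablePred p] :
    ((Finset.univ.val.map f).sort (· ≤ ·)).countP (fun x => decide (p x))
      = (Finset.univ.filter fun i => p (f i)).card := by
  have h : Multiset.countP p ((Finset.univ.val.map f).sort (· ≤ ·) : Multiset ℝ)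
      = (Finset.univ.filter fun i => p (f i)).card := by
    rw [Multiset.sort_eq, Multiset.countP_map]
    rfl
  rwa [Multiset.coe_countP] at h

/-- If the entry with index `k ≤ card / 2` exceeded `B`, so would all entries after it, which are at
least half of the family. -/
lemma sort_getD_le {f : ι → ℝ} {B : ℝ} {k : ℕ} (hk : k ≤ Fintype.card ι / 2)
    (h : 2 * (Finset.univ.filter fun i => B < f i).card < Fintype.card ι) :
    ((Finset.univ.val.map f).sort (· ≤ ·)).getD k 0 ≤ B := by
  set l := (Finset.univ.val.map f).sort (· ≤ ·) with hl
  have hlen : l.length = Fintype.card ι := by simp [hl]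
  have hpw : l.Pairwise (· ≤ ·) := Multiset.pairwise_sort _ _
  -- The count hypothesis makes the family nonempty, so the index is in range and the default value
  -- `0` plays no role.
  have hkl : k < l.length := by omega
  rw [List.getD_eq_getElem _ _ hkl]
  by_contra hcon
  push Not at hcon
  have h1 := countP_sort f (fun x => B < x)
  rw [← hl] at h1
  have h2 : (l.drop k).countP (fun x => decide (B < x)) = (l.drop k).length := by
    rw [List.countP_eq_length]
    intro x hx
    obtain ⟨i, hi, rfl⟩ := List.getElem_of_mem hx
    rw [List.getElem_drop]
    rw [List.length_drop] at hi
    have : l[k] ≤ l[k + i] := by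
      rcases Nat.eq_zero_or_pos i with rfl | hpos
      · simp
      · exact List.pairwise_iff_getElem.1 hpw k (k + i) hkl (by omega) (by omega)
    simpa using lt_of_lt_of_le hcon this
  have h3 := (List.drop_sublist k l).countP_le (p := fun x => decide (B < x))
  rw [List.length_drop] at h2
  omega

lemma le_sort_getD {f : ι → ℝ} {B : ℝ} {k : ℕ} (hk : (Fintype.card ι - 1) / 2 ≤ k)
    (hk' : k < Fintype.card ι)
    (h : 2 * (Finset.univ.filter fun i => f i < B).card < Fintype.card ι) :
    B ≤ ((Finset.univ.val.map f).sort (· ≤ ·)).getD k 0 := by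
  set l := (Finset.univ.val.map f).sort (· ≤ ·) with hl
  have hlen : l.length = Fintype.card ι := by simp [hl]
  have hpw : l.Pairwise (· ≤ ·) := Multiset.pairwise_sort _ _
  have hkl : k < l.length := by omega
  rw [List.getD_eq_getElem _ _ hkl]
  by_contra hcon
  push Not at hcon
  have h1 := countP_sort f (fun x => x < B)
  rw [← hl] at h1
  have h2 : (l.take (k + 1)).countP (fun x => decide (x < B)) = (l.take (k + 1)).length := by
    rw [List.countP_eq_length]
    intro x hx
    obtain ⟨i, hi, rfl⟩ := List.getElem_of_mem hx
    rw [List.getElem_take]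
    rw [List.length_take] at hi
    have : l[i] ≤ l[k] := by
      rcases Nat.lt_or_ge i k with hlt | hge
      · exact List.pairwise_iff_getElem.1 hpw i k (by omega) hkl hlt
      · have : i = k := by omega
        subst this; exact le_rfl
    simpa using lt_of_le_of_lt this hcon
  have h3 := (List.take_sublist (k + 1) l).countP_le (p := fun x => decide (x < B))
  rw [List.length_take] at h2
  omega

lemma median_le {f : ι → ℝ} {B : ℝ}
    (h : 2 * (Finset.univ.filter fun i => B < f i).card < Fintype.card ι) : median f ≤ B := by
  have h1 := sort_getD_le (k := (Fintype.card ι - 1) / 2) (by omega) h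
  have h2 := sort_getD_le (k := Fintype.card ι / 2) le_rfl h
  unfold median
  linarith

lemma le_median {f : ι → ℝ} {B : ℝ}
    (h : 2 * (Finset.univ.filter fun i => f i < B).card < Fintype.card ι) : B ≤ median f := by
  have h1 := le_sort_getD (k := (Fintype.card ι - 1) / 2) le_rfl (by omega) h
  have h2 := le_sort_getD (k := Fintype.card ι / 2) (by omega) (by omega) h
  unfold median
  linarith

/-- The bound from above on the median gives the estimate. The one from below is there to make the
median positive, so that the division is meaningful. -/
lemma le_maxOverMedian {D : ι → ℝ} {B b M : ℝ} (hb : 0 < b) {i₀ : ι} (hM : M ≤ |D i₀|)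
    (hup : 2 * (Finset.univ.filter fun i => B < |D i|).card < Fintype.card ι)
    (hlow : 2 * (Finset.univ.filter fun i => |D i| < b).card < Fintype.card ι) :
    M / B ≤ maxOverMedian D := by
  have h1 := median_le hup
  have h2 := le_median hlow
  have h3 : |D i₀| ≤ ⨆ i, |D i| := le_ciSup (Set.finite_range fun i => |D i|).bddAbove i₀
  have h4 : 0 < B := lt_of_lt_of_le hb (h2.trans h1)
  unfold maxOverMedian
  calc M / B ≤ (⨆ i, |D i|) / B := by gcongr; linarith
    _ ≤ _ := by
      have : 0 ≤ ⨆ i, |D i| := (abs_nonneg _).trans h3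
      gcongr
      linarith

lemma abs_maxOverMedian_sub_one_le [Nonempty ι] {D : ι → ℝ} {lo hi : ℝ} (hlo : 0 < lo)
    (h1 : ∀ i, lo ≤ |D i|) (h2 : ∀ i, |D i| ≤ hi) : |maxOverMedian D - 1| ≤ (hi - lo) / lo := by
  have hc : 0 < Fintype.card ι := Fintype.card_pos
  have h3 : median (fun i => |D i|) ≤ hi := median_le (by
    have : (Finset.univ.filter fun i => hi < |D i|) = ∅ :=
      Finset.filter_eq_empty_iff.2 fun i _ => not_lt.2 (h2 i)
    simpa [this] using hc)
  have h4 : lo ≤ median (fun i => |D i|) := le_median (by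
    have : (Finset.univ.filter fun i => |D i| < lo) = ∅ :=
      Finset.filter_eq_empty_iff.2 fun i _ => not_lt.2 (h1 i)
    simpa [this] using hc)
  have h5 : (⨆ i, |D i|) ≤ hi := ciSup_le h2
  obtain ⟨i₀⟩ := ‹Nonempty ι›
  have h6 : lo ≤ ⨆ i, |D i| :=
    (h1 i₀).trans (le_ciSup (Set.finite_range fun i => |D i|).bddAbove i₀)
  unfold maxOverMedian
  set md := median fun i => |D i|
  have hmd : 0 < md := by linarith
  have e : (⨆ i, |D i|) / md - 1 = ((⨆ i, |D i|) - md) / md := by field_simp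
  rw [e, abs_div, abs_of_pos hmd]
  have h7 : |(⨆ i, |D i|) - md| ≤ hi - lo := by
    rw [abs_le]; constructor <;> linarith
  have : 0 ≤ hi - lo := by linarith
  calc _ ≤ (hi - lo) / md := by gcongr
    _ ≤ _ := by gcongr

end median

/-! ### The gradient and the diagonal of the Hessian -/

section calculus

variable {d m : ℕ}

lemma quadratic_deriv (a b c : ℝ) :
    deriv (fun s : ℝ => a + s * b + s ^ 2 / 2 * c) 0 = b ∧
    iteratedDeriv 2 (fun s : ℝ => a + s * b + s ^ 2 / 2 * c) 0 = c := by
  have h1 : ∀ s : ℝ, HasDerivAt (fun s : ℝ => a + s * b + s ^ 2 / 2 * c) (b + s * c) s := by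
    intro s
    have h2 := (((hasDerivAt_id s).mul_const b).const_add a).add
      ((((hasDerivAt_id s).pow 2).div_const 2).mul_const c)
    refine h2.congr_deriv ?_
    simp
  have h3 : deriv (fun s : ℝ => a + s * b + s ^ 2 / 2 * c) = fun s => b + s * c :=
    funext fun s => (h1 s).deriv
  refine ⟨by rw [h3]; simp, ?_⟩
  rw [iteratedDeriv_succ, iteratedDeriv_one, h3]
  have h4 : HasDerivAt (fun s : ℝ => b + s * c) c 0 := by
    simpa using ((hasDerivAt_id (0 : ℝ)).mul_const c).const_add b
  exact h4.deriv

lemma endToEnd_apply (w : Params d) (j : Fin d) :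
    endToEnd w j = ∑ i, w (Sum.inr i) * w (Sum.inl (i, j)) := by
  simp [endToEnd, Matrix.vecMul, dotProduct, layer1, layer2]

lemma endToEnd_add_inl (w : Params d) (i j : Fin d) (s : ℝ) :
    endToEnd (w + Pi.single (Sum.inl (i, j)) s)
      = fun l => endToEnd w l + s * (if l = j then w (Sum.inr i) else 0) := by
  funext l
  rw [endToEnd_apply, endToEnd_apply]
  have h : ∀ k, (w + Pi.single (Sum.inl (i, j)) s : Params d) (Sum.inr k)
      * (w + Pi.single (Sum.inl (i, j)) s : Params d) (Sum.inl (k, l))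
      = w (Sum.inr k) * w (Sum.inl (k, l))
        + (if k = i then (if l = j then s * w (Sum.inr i) else 0) else 0) := by
    intro k
    by_cases hk : k = i
    · by_cases hl : l = j
      · subst hk hl; simp; ring
      · simp [Pi.single_apply, hl]
    · simp [Pi.single_apply, hk]
  rw [Finset.sum_congr rfl fun k _ => h k, Finset.sum_add_distrib]
  by_cases hl : l = j <;> simp [hl]

lemma endToEnd_add_inr (w : Params d) (i : Fin d) (s : ℝ) :
    endToEnd (w + Pi.single (Sum.inr i) s)
      = fun l => endToEnd w l + s * w (Sum.inl (i, l)) := by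
  funext l
  rw [endToEnd_apply, endToEnd_apply]
  have h : ∀ k, (w + Pi.single (Sum.inr i) s : Params d) (Sum.inr k)
      * (w + Pi.single (Sum.inr i) s : Params d) (Sum.inl (k, l))
      = w (Sum.inr k) * w (Sum.inl (k, l)) + (if k = i then s * w (Sum.inl (i, l)) else 0) := by
    intro k
    by_cases hk : k = i
    · subst hk; simp; ring
    · simp [Pi.single_apply, hk]
  rw [Finset.sum_congr rfl fun k _ => h k, Finset.sum_add_distrib]
  simp

/-- The negative residual `(1/m) (Y - W₂ W₁ X) Xᵀ`. -/
def negResid (X : Matrix (Fin d) (Fin m) ℝ) (Y : Fin m → ℝ) (w : Params d) (j : Fin d) : ℝ :=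
  corrYX X Y j - ∑ k, endToEnd w k * covXX X k j

/-- The end-to-end vector is affine along every coordinate line, so the loss is an explicit
quadratic polynomial there; its coefficients give the gradient and the diagonal of the Hessian at
once. -/
lemma loss_perturb (X : Matrix (Fin d) (Fin m) ℝ) (Y : Fin m → ℝ) (w w' : Params d) (s : ℝ)
    (v : Fin d → ℝ) (h : endToEnd w' = fun l => endToEnd w l + s * v l) :
    loss X Y w' = loss X Y w + s * (-∑ j, negResid X Y w j * v j)
      + s ^ 2 / 2 * ∑ j, ∑ k, v j * v k * covXX X j k := by
  have e1 : ∑ j, negResid X Y w j * v j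
      = (1 / (m : ℝ)) * ∑ k, (Y k - (endToEnd w ᵥ* X) k) * (v ᵥ* X) k := by
    simp only [negResid, corrYX, covXX, Matrix.vecMul, dotProduct, Pi.smul_apply, smul_eq_mul,
      Matrix.smul_apply, Matrix.mul_apply, Matrix.transpose_apply, sub_mul, Finset.sum_sub_distrib,
      mul_sub, Finset.mul_sum, Finset.sum_mul]
    congr 1
    · rw [Finset.sum_comm]
      exact Finset.sum_congr rfl fun _ _ => Finset.sum_congr rfl fun _ _ => by ring
    · rw [Finset.sum_comm' (t' := Finset.univ) (s' := fun _ => Finset.univ) (by simp)]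
      rw [Finset.sum_congr rfl fun k _ => Finset.sum_comm, Finset.sum_comm]
      refine Finset.sum_congr rfl fun _ _ => ?_
      rw [Finset.sum_comm]
      exact Finset.sum_congr rfl fun _ _ => Finset.sum_congr rfl fun _ _ => by ring
  have e2 : ∑ j, ∑ k, v j * v k * covXX X j k = (1 / (m : ℝ)) * ∑ k, (v ᵥ* X) k ^ 2 := by
    simp only [covXX, Matrix.vecMul, dotProduct, smul_eq_mul, pow_two,
      Matrix.smul_apply, Matrix.mul_apply, Matrix.transpose_apply, Finset.mul_sum, Finset.sum_mul]
    rw [Finset.sum_congr rfl fun j _ => Finset.sum_comm, Finset.sum_comm]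
    refine Finset.sum_congr rfl fun _ _ => ?_
    rw [Finset.sum_comm]
    exact Finset.sum_congr rfl fun _ _ => Finset.sum_congr rfl fun _ _ => by ring
  have e3 : ∀ k, (endToEnd w' ᵥ* X) k = (endToEnd w ᵥ* X) k + s * (v ᵥ* X) k := by
    intro k
    rw [h]
    simp only [Matrix.vecMul, dotProduct, add_mul, Finset.sum_add_distrib, Finset.mul_sum]
    congr 1
    exact Finset.sum_congr rfl fun _ _ => by ring
  rw [e1, e2]
  unfold loss
  simp only [e3, Finset.mul_sum]
  rw [← Finset.sum_neg_distrib, Finset.mul_sum, ← Finset.sum_add_distrib,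
    ← Finset.sum_add_distrib]
  refine Finset.sum_congr rfl fun k _ => ?_
  have : 1 / (2 * (m : ℝ)) = 1 / (m : ℝ) / 2 := by rw [div_div, mul_comm]
  rw [this]
  ring

lemma grad_loss_inl (X : Matrix (Fin d) (Fin m) ℝ) (Y : Fin m → ℝ) (w : Params d) (i j : Fin d) :
    grad (loss X Y) w (Sum.inl (i, j)) = -(w (Sum.inr i) * negResid X Y w j) := by
  unfold grad
  rw [funext fun s => loss_perturb X Y w _ s _ (endToEnd_add_inl w i j s), (quadratic_deriv _ _ _).1]
  simp [mul_comm]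

lemma grad_loss_inr (X : Matrix (Fin d) (Fin m) ℝ) (Y : Fin m → ℝ) (w : Params d) (i : Fin d) :
    grad (loss X Y) w (Sum.inr i) = -∑ j, negResid X Y w j * w (Sum.inl (i, j)) := by
  unfold grad
  rw [funext fun s => loss_perturb X Y w _ s _ (endToEnd_add_inr w i s), (quadratic_deriv _ _ _).1]

lemma hessDiag_loss_inl {X : Matrix (Fin d) (Fin m) ℝ} (hX : covXX X = 1) (Y : Fin m → ℝ)
    (w : Params d) (i j : Fin d) :
    hessDiag (loss X Y) w (Sum.inl (i, j)) = w (Sum.inr i) ^ 2 := by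
  unfold hessDiag
  rw [funext fun s => loss_perturb X Y w _ s _ (endToEnd_add_inl w i j s), (quadratic_deriv _ _ _).2,
    hX]
  simp [Matrix.one_apply, pow_two]

lemma hessDiag_loss_inr {X : Matrix (Fin d) (Fin m) ℝ} (hX : covXX X = 1) (Y : Fin m → ℝ)
    (w : Params d) (i : Fin d) :
    hessDiag (loss X Y) w (Sum.inr i) = ∑ j, w (Sum.inl (i, j)) ^ 2 := by
  unfold hessDiag
  rw [funext fun s => loss_perturb X Y w _ s _ (endToEnd_add_inr w i s), (quadratic_deriv _ _ _).2,
    hX]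
  simp [Matrix.one_apply, pow_two]

/-- The residual on a mini-batch on which `Λ` and `A` are close to their values on all data. -/
lemma abs_negResid_sub_le {b : ℕ} {X : Matrix (Fin d) (Fin b) ℝ} {Y : Fin b → ℝ}
    {A : Fin d → ℝ} {ν : ℝ} (hΛ : ∀ i j, |covXX X i j - (1 : Matrix (Fin d) (Fin d) ℝ) i j| ≤ ν)
    (hA : ∀ j, |corrYX X Y j - A j| ≤ ν) (w : Params d) (j : Fin d) :
    |negResid X Y w j - (A j - endToEnd w j)| ≤ ν * (1 + ∑ k, |endToEnd w k|) := by
  have e : negResid X Y w j - (A j - endToEnd w j) = (corrYX X Y j - A j)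
      - ∑ k, endToEnd w k * (covXX X k j - (1 : Matrix (Fin d) (Fin d) ℝ) k j) := by
    simp only [negResid, mul_sub, Finset.sum_sub_distrib]
    simp [Matrix.one_apply]
    ring
  rw [e, mul_add, mul_one]
  refine (abs_sub _ _).trans (add_le_add (hA j) ?_)
  refine (Finset.abs_sum_le_sum_abs _ _).trans ?_
  rw [Finset.mul_sum]
  refine Finset.sum_le_sum fun k _ => ?_
  rw [abs_mul, mul_comm]
  exact mul_le_mul_of_nonneg_right (hΛ k j) (abs_nonneg _)

end calculus

end DiagGeometry

namespace DiagGeometry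

/-! ### Adam in terms of exponential moving sums -/

section adam

variable {d : ℕ} {b η ξ : ℝ} {g : ℕ → Params d → Params d} {w₀ : Params d}

lemma adamState_moments (hb1 : b < 1) (t : ℕ) (i : Idx d) :
    (adamState b (b ^ 2) η ξ g w₀ (t + 1)).2.1 i
      = (1 - b) * ema b (fun s => g s (adam b (b ^ 2) η ξ g w₀ s) i) t ∧
    (adamState b (b ^ 2) η ξ g w₀ (t + 1)).2.2 i
      = (1 - b ^ 2) * ema (b ^ 2) (fun s => g s (adam b (b ^ 2) η ξ g w₀ s) i ^ 2) t := by
  induction t with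
  | zero => simp [adamState, adam, pow_two]
  | succ t ih =>
    have e1 : (adamState b (b ^ 2) η ξ g w₀ (t + 1 + 1)).2.1 i
        = b * (adamState b (b ^ 2) η ξ g w₀ (t + 1)).2.1 i
          + (1 - b) * g (t + 1) (adam b (b ^ 2) η ξ g w₀ (t + 1)) i := rfl
    have e2 : (adamState b (b ^ 2) η ξ g w₀ (t + 1 + 1)).2.2 i
        = b ^ 2 * (adamState b (b ^ 2) η ξ g w₀ (t + 1)).2.2 i
          + (1 - b ^ 2) * (g (t + 1) (adam b (b ^ 2) η ξ g w₀ (t + 1)) i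
            * g (t + 1) (adam b (b ^ 2) η ξ g w₀ (t + 1)) i) := rfl
    rw [e1, e2, ih.1, ih.2, ema_succ, ema_succ]
    constructor <;> ring

/-- The factor in `ηₜ` is distributed over numerator and denominator: both moving sums become
weighted averages, and `ξ` is divided by `√(1 - β₂ᵗ⁺¹)`. -/
lemma adam_succ (hb : 0 < b) (hb1 : b < 1) (hξ : 0 < ξ) (t : ℕ) (i : Idx d) :
    adam b (b ^ 2) η ξ g w₀ (t + 1) i = adam b (b ^ 2) η ξ g w₀ t i
      - η * adamU b ξ (fun s => g s (adam b (b ^ 2) η ξ g w₀ s) i) t := by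
  have e : adam b (b ^ 2) η ξ g w₀ (t + 1) i = adam b (b ^ 2) η ξ g w₀ t i
      - η * (√(1 - (b ^ 2) ^ (t + 1)) / (1 - b ^ (t + 1)))
        * ((adamState b (b ^ 2) η ξ g w₀ (t + 1)).2.1 i
          / (√((adamState b (b ^ 2) η ξ g w₀ (t + 1)).2.2 i) + ξ)) := rfl
  obtain ⟨h1, h2⟩ := adamState_moments (η := η) (ξ := ξ) (g := g) (w₀ := w₀) hb1 t i
  rw [e, h1, h2]
  unfold adamU
  set M := ema b (fun s => g s (adam b (b ^ 2) η ξ g w₀ s) i) t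
  have hQ0 := ema_sq_nonneg (b := b) (fun s => g s (adam b (b ^ 2) η ξ g w₀ s) i) t
  set Q := ema (b ^ 2) (fun s => g s (adam b (b ^ 2) η ξ g w₀ s) i ^ 2) t
  have hb2 : b ^ 2 < 1 := by nlinarith
  rw [ema_one_eq hb1, ema_one_eq hb2, pow_mul]
  have hu : 0 < 1 - b := by linarith
  have hu2 : 0 < 1 - b ^ 2 := by linarith
  have hp : 0 < 1 - b ^ (t + 1) := by
    have := pow_lt_one₀ (n := t + 1) hb.le hb1 (by omega); linarith
  have hp2 : 0 < 1 - (b ^ 2) ^ (t + 1) := by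
    have := pow_lt_one₀ (n := t + 1) (sq_nonneg b) hb2 (by omega); linarith
  have hs := Real.sqrt_pos.2 hp2
  have hsq : √(Q / ((1 - (b ^ 2) ^ (t + 1)) / (1 - b ^ 2)))
      = √((1 - b ^ 2) * Q) / √(1 - (b ^ 2) ^ (t + 1)) := by
    rw [← Real.sqrt_div' _ hp2.le]
    congr 1
    field_simp
  rw [hsq, ← add_div]
  have h3 : 0 < √((1 - b ^ 2) * Q) + ξ := by positivity
  generalize √((1 - b ^ 2) * Q) + ξ = S at h3 ⊢
  generalize √(1 - (b ^ 2) ^ (t + 1)) = q at hs ⊢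
  field_simp

end adam

/-! ### The uniformity of the Hessian along Adam -/

lemma ratio_aux {δ : ℝ} (h0 : 0 ≤ δ) (h1 : δ ≤ 1 / 100) {Z : ℝ} (hZ : 0 < Z) :
    ((1 + δ) / (1 - δ) * Z - (1 - δ) / (1 + δ) * Z) / ((1 - δ) / (1 + δ) * Z) ≤ 8 * δ := by
  have h2 : 0 < 1 - δ := by linarith
  have h3 : 0 < 1 + δ := by linarith
  have e : ((1 + δ) / (1 - δ) * Z - (1 - δ) / (1 + δ) * Z) / ((1 - δ) / (1 + δ) * Z)
      = 4 * δ / (1 - δ) ^ 2 := by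
    field_simp
    ring
  rw [e, div_le_iff₀ (by positivity)]
  have h4 : 1 / 2 ≤ (1 - δ) ^ 2 := by nlinarith
  nlinarith

/-- A family whose members differ relatively by at most `δ` has maximum over median close to one. -/
lemma abs_maxOverMedian_sub_one_le_of_near {ι : Type*} [Fintype ι] [Nonempty ι] {D : ι → ℝ}
    {δ : ℝ} (h0 : 0 ≤ δ) (h1 : δ ≤ 1 / 100) (hpos : ∀ i, 0 < D i)
    (hnear : ∀ i i', |D i - D i'| ≤ δ * (D i + D i')) : |maxOverMedian D - 1| ≤ 8 * δ := by
  obtain ⟨i₀⟩ := ‹Nonempty ι›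
  have : Nonempty ι := ⟨i₀⟩
  have h2 : 0 < 1 - δ := by linarith
  have h3 : 0 < 1 + δ := by linarith
  have hZ := hpos i₀
  refine (abs_maxOverMedian_sub_one_le (lo := (1 - δ) / (1 + δ) * D i₀)
    (hi := (1 + δ) / (1 - δ) * D i₀) (by positivity) (fun i => ?_) (fun i => ?_)).trans
    (ratio_aux h0 h1 hZ)
  · rw [abs_of_pos (hpos i), div_mul_eq_mul_div, div_le_iff₀ h3]
    have := (abs_le.1 (hnear i i₀)).1
    linarith
  · rw [abs_of_pos (hpos i), div_mul_eq_mul_div, le_div_iff₀ h2]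
    have := (abs_le.1 (hnear i i₀)).2
    linarith

lemma floor_mul_bounds {z η : ℝ} (hη : 0 < η) (hz : η ≤ z) :
    z / 2 ≤ η * (⌊z / η⌋₊ : ℝ) ∧ η * (⌊z / η⌋₊ : ℝ) ≤ z := by
  have h1 : 1 ≤ z / η := by rwa [le_div_iff₀ hη, one_mul]
  have h2 := Nat.floor_le (show 0 ≤ z / η by linarith)
  have h3 := Nat.lt_floor_add_one (z / η)
  have h4 : (1 : ℝ) ≤ (⌊z / η⌋₊ : ℝ) := by
    exact_mod_cast (Nat.one_le_floor_iff _).2 h1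
  have h5 : η * (z / η) = z := by field_simp
  constructor
  · have h6 : z / η / 2 ≤ (⌊z / η⌋₊ : ℝ) := by linarith
    calc z / 2 = η * (z / η / 2) := by rw [← h5]; field_simp
      _ ≤ _ := by gcongr
  · calc _ ≤ η * (z / η) := by gcongr
      _ = z := h5

/-- The number of steps for which Adam is followed. -/
def adamHorizon (K D η : ℝ) : ℕ := ⌊2 * K / D / η⌋₊ + 1

set_option maxHeartbeats 1000000 in
-- The deterministic conclusion for Adam. The ratio for `W₁` is governed by the closeness of the
-- second-layer weights to `ηt`, the one for `W₂` by the closeness of the rows, which is `h⁸ / D`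
-- against entries of at least `1 / (K⁶ D)`.
theorem adam_uniform {d m bA : ℕ} {b K h D η ξ : ℝ} {X : Matrix (Fin d) (Fin m) ℝ} {Y : Fin m → ℝ}
    {B : ℕ → Fin bA → Fin m} {w₀ : Params d}
    (b_pos : 0 < b) (b_lt : b < 1) (hK : 100 ≤ K) (inv_le : 1 / (1 - b) ≤ K)
    (sign_le : 6 / (1 - b) ^ 4 ≤ K) (incr_le : 12 / (b * (1 - b) ^ 3) ≤ K)
    (h_pos : 0 < h) (hKh : K ^ 40 * h ≤ 1) (hKD : 4 * K ≤ D) (hDh : D * h ≤ 1)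
    (hdD : (d : ℝ) = D ^ 2) (η_pos : 0 < η) (η_le : η ≤ h ^ 46) (ξ_pos : 0 < ξ) (ξ_le : ξ ≤ h ^ 40)
    (hX : covXX X = 1) (A_lower : ∀ j, 1 / K ≤ corrYX X Y j) (A_upper : ∀ j, corrYX X Y j ≤ K)
    (hΛ : ∀ t ≤ adamHorizon K D η, ∀ i j,
      |covXX (batchX X (B t)) i j - (1 : Matrix (Fin d) (Fin d) ℝ) i j| ≤ η / d)
    (hA : ∀ t ≤ adamHorizon K D η, ∀ j,
      |corrYX (batchX X (B t)) (batchY Y (B t)) j - corrYX X Y j| ≤ η / d)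
    (hw1 : ∀ i, h ^ 20 ≤ |w₀ (Sum.inr i)|) (hw2 : ∀ i, |w₀ (Sum.inr i)| ≤ h ^ 14)
    (hv : ∀ i j, |w₀ (Sum.inl (i, j))| ≤ h ^ 28) :
    ∃ n₁ N : ℕ, n₁ ≤ N ∧
      (let W := adam b (b ^ 2) η ξ (fun t => batchGrad X Y (B t)) w₀
      (1 / (8 * K ^ 2) * d ≤ lossBar (corrYX X Y) (W n₁) ∧
        lossBar (corrYX X Y) (W n₁) ≤ 2 * K ^ 2 * d) ∧
      lossBar (corrYX X Y) (W N) ≤ d * h ^ 4 ∧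
      ∀ t, n₁ ≤ t → t ≤ N → |RMed1 (loss X Y) (W t) - 1| ≤ K ^ 7 * h ^ 8 ∧
        |RMed2 (loss X Y) (W t) - 1| ≤ K ^ 7 * h ^ 8) := by
  set W := adam b (b ^ 2) η ξ (fun t => batchGrad X Y (B t)) w₀ with hW
  set A := corrYX X Y with hAdef
  -- Flipping the sign of a whole row changes neither the product nor the squared weights, and Adam
  -- commutes with it because its update is odd in the gradient. The second layer may thus be taken
  -- positive initially.
  set sg : Fin d → ℝ := fun i => if 0 ≤ w₀ (Sum.inr i) then 1 else -1 with hsg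
  have hsg2 : ∀ i, sg i = 1 ∨ sg i = -1 := fun i => by
    simp only [hsg]; split_ifs <;> simp
  have hsgsq : ∀ i, sg i * sg i = 1 := fun i => by rcases hsg2 i with h | h <;> rw [h] <;> norm_num
  set x : ℕ → Fin d → ℝ := fun t i => sg i * W t (Sum.inr i) with hx
  set y : ℕ → Fin d → Fin d → ℝ := fun t i j => sg i * W t (Sum.inl (i, j)) with hy
  set r : ℕ → Fin d → ℝ := fun t j => negResid (batchX X (B t)) (batchY Y (B t)) (W t) j with hr
  set T := adamHorizon K D η with hTdef
  have hxy : ∀ t j, ∑ i, x t i * y t i j = endToEnd (W t) j := by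
    intro t j
    rw [endToEnd_apply]
    refine Finset.sum_congr rfl fun i _ => ?_
    simp only [hx, hy]
    calc _ = (sg i * sg i) * (W t (Sum.inr i) * W t (Sum.inl (i, j))) := by ring
      _ = _ := by rw [hsgsq, one_mul]
  have hsU : ∀ i (f : ℕ → ℝ) t, sg i * adamU b ξ f t = adamU b ξ (fun s => sg i * f s) t := by
    intro i f t
    rcases hsg2 i with h | h
    · simp [h]
    · simp only [h, neg_mul, one_mul, adamU_neg]
  have hK0 : 0 < K := by linarith
  have hD1 : 1 ≤ D := by linarith
  have hD0 : 0 < D := by linarith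
  have hx0 : ∀ i, x 0 i = |w₀ (Sum.inr i)| := by
    intro i
    simp only [hx, hsg]
    have : W 0 (Sum.inr i) = w₀ (Sum.inr i) := rfl
    rw [this]
    split_ifs with h
    · rw [abs_of_nonneg h, one_mul]
    · rw [abs_of_neg (not_le.1 h)]; ring
  have H : AdamRun b K h D η ξ T A x y r := by
    refine ⟨b_pos, b_lt, hK, inv_le, sign_le, incr_le, h_pos, hKh, hD1, hDh, hdD, η_pos, η_le,
      ξ_pos, ξ_le, A_lower, A_upper, fun t i => ?_, fun t i j => ?_, fun t ht j => ?_,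
      fun i => (hw1 i).trans_eq (hx0 i).symm, fun i => (hx0 i).trans_le (hw2 i), fun i j => ?_⟩
    · have h1 := adam_succ (η := η) (g := fun t => batchGrad X Y (B t)) (w₀ := w₀) b_pos b_lt ξ_pos
        t (Sum.inr i)
      have h2 : (fun s => batchGrad X Y (B s) (adam b (b ^ 2) η ξ (fun t => batchGrad X Y (B t)) w₀ s)
          (Sum.inr i)) = fun s => -∑ j, r s j * W s (Sum.inl (i, j)) := by
        funext s; exact grad_loss_inr _ _ _ _
      rw [h2, adamU_neg] at h1
      have h3 : (fun s => ∑ j, r s j * y s i j)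
          = fun s => sg i * ∑ j, r s j * W s (Sum.inl (i, j)) := by
        funext s
        rw [Finset.mul_sum]
        exact Finset.sum_congr rfl fun j _ => by simp only [hy]; ring
      rw [h3, ← hsU]
      change sg i * W (t + 1) (Sum.inr i) = sg i * W t (Sum.inr i) + _
      rw [hW, h1]
      ring
    · have h1 := adam_succ (η := η) (g := fun t => batchGrad X Y (B t)) (w₀ := w₀) b_pos b_lt ξ_pos
        t (Sum.inl (i, j))
      have h2 : (fun s => batchGrad X Y (B s) (adam b (b ^ 2) η ξ (fun t => batchGrad X Y (B t)) w₀ s)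
          (Sum.inl (i, j))) = fun s => -(W s (Sum.inr i) * r s j) := by
        funext s; exact grad_loss_inl _ _ _ _ _
      rw [h2, adamU_neg] at h1
      have h3 : (fun s => x s i * r s j) = fun s => sg i * (W s (Sum.inr i) * r s j) := by
        funext s; simp only [hx]; ring
      rw [h3, ← hsU]
      change sg i * W (t + 1) (Sum.inl (i, j)) = sg i * W t (Sum.inl (i, j)) + _
      rw [hW, h1]
      ring
    · simp only [hxy]
      exact abs_negResid_sub_le (hΛ t ht) (hA t ht) (W t) j
    · have : y 0 i j = sg i * w₀ (Sum.inl (i, j)) := rfl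
      rw [this, abs_mul]
      rcases hsg2 i with h | h <;> rw [h] <;> simpa using hv i j
  have hP : ∀ t j, AdamRun.prodVec x y t j = endToEnd (W t) j := hxy
  have hηsmall : η ≤ 1 / (8 * K * D) := by
    calc η ≤ h ^ 46 := η_le
      _ ≤ h ^ 3 := H.h_pow_le (by norm_num)
      _ = h * h * h := by ring
      _ ≤ 1 / 100 * (1 / K) * (1 / D) := by
        gcongr
        · exact H.h_le'
        · exact H.h_le
        · exact H.h_le_inv_D
      _ ≤ 1 / 8 * (1 / K) * (1 / D) := by gcongr; norm_num
      _ = _ := by field_simp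
  have hz12 : 1 / (8 * K * D) ≤ 2 * K / D := by
    rw [div_le_div_iff₀ (by positivity) hD0]
    have : 1 ≤ K * K := by nlinarith
    nlinarith
  obtain ⟨f1, f2⟩ := floor_mul_bounds η_pos hηsmall
  obtain ⟨f3, f4⟩ := floor_mul_bounds η_pos (hηsmall.trans hz12)
  -- The interval starts when the weights have a common size of order `1 / (KD)`, with the loss
  -- still of order `d`. Rounding down loses at most a factor two, as `η` is below the target time.
  set n₁ := ⌊1 / (8 * K * D) / η⌋₊ with hn₁
  set n₂ := ⌊2 * K / D / η⌋₊ with hn₂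
  have h12 : n₁ ≤ n₂ := Nat.floor_le_floor (by gcongr)
  have hT : AdamRun.FitTimes K D η T n₁ n₂ :=
    ⟨by convert f1 using 1; field_simp; norm_num, f2, f4, le_rfl, hKD⟩
  obtain ⟨N, hN1, hN2, hNP, hI⟩ := H.exists_fit hT h12 (by convert f3 using 1; field_simp)
  have hd0 := H.d_pos
  have hdn : 0 < d := by exact_mod_cast hd0
  have : Nonempty (Fin d) := ⟨⟨0, hdn⟩⟩
  refine ⟨n₁, N, hN1, ?_, ?_, fun t h1 h2 => ?_⟩
  · have hTn : n₁ ≤ T := by have := hT.le_T; omega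
    have hG := H.growth hTn hT.upper
    have hres := fun j => (H.growth_resid hTn hT.upper hG j).1
    have hE : ∀ j, 1 / (2 * K) ≤ A j - endToEnd (W n₁) j ∧ A j - endToEnd (W n₁) j ≤ 2 * K := by
      intro j
      have h3 := abs_le.1 (hres j)
      rw [hP] at h3
      have h4 := A_lower j
      have h5 := A_upper j
      have e1 : 1 / (800 * K) = 1 / K / 800 := by field_simp
      have e2 : 1 / (2 * K) = 1 / K / 2 := by field_simp
      have h6 : 0 < 1 / K := by positivity
      have h7 : 1 / K ≤ 1 := by rw [div_le_one hK0]; linarith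
      rw [e1] at h3
      rw [e2]
      constructor <;> linarith [h3.1, h3.2]
    unfold lossBar
    constructor
    · calc 1 / (8 * K ^ 2) * d = 1 / 2 * ∑ _j : Fin d, (1 / (2 * K)) ^ 2 := by
            rw [Finset.sum_const, Finset.card_univ, Fintype.card_fin, nsmul_eq_mul]
            field_simp; norm_num
        _ ≤ _ := by
            gcongr 1 / 2 * ?_
            refine Finset.sum_le_sum fun j _ => ?_
            rw [← neg_sq (endToEnd (W n₁) j - A j), neg_sub]
            have := (hE j).1
            gcongr
    · calc 1 / 2 * ∑ j, (endToEnd (W n₁) j - A j) ^ 2 ≤ 1 / 2 * ∑ _j : Fin d, (2 * K) ^ 2 := by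
            gcongr 1 / 2 * ?_
            refine Finset.sum_le_sum fun j _ => ?_
            rw [← neg_sq (endToEnd (W n₁) j - A j), neg_sub]
            have h3 := (hE j).1
            have h4 := (hE j).2
            have : 0 < 1 / (2 * K) := by positivity
            exact pow_le_pow_left₀ (by linarith) h4 2
        _ = _ := by
            rw [Finset.sum_const, Finset.card_univ, Fintype.card_fin, nsmul_eq_mul]
            ring
  · unfold lossBar
    have hlast := hI N hN1 le_rfl
    calc 1 / 2 * ∑ j, (endToEnd (W N) j - A j) ^ 2 ≤ 1 / 2 * ∑ _j : Fin d, (h ^ 2) ^ 2 := by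
          gcongr 1 / 2 * ?_
          refine Finset.sum_le_sum fun j _ => ?_
          have h3 := hNP j
          have h4 := H.fit_over hT.lower hN1 (AdamRun.FitTimes.time_le H hT hN2) hlast j
          rw [hP] at h3 h4
          have h5 : h ^ 8 ≤ h ^ 2 := H.h_pow_le (by norm_num)
          have h6 : 0 < h ^ 2 := by positivity
          rw [← sq_abs]
          have : |endToEnd (W N) j - A j| ≤ h ^ 2 := by
            rw [abs_le]; constructor <;> linarith
          gcongr
      _ = d * h ^ 4 / 2 := by
          rw [Finset.sum_const, Finset.card_univ, Fintype.card_fin, nsmul_eq_mul]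
          ring
      _ ≤ _ := by
          have : 0 < d * h ^ 4 := by positivity
          linarith
  · have hIt := hI t h1 h2
    have htn := AdamRun.FitTimes.time_le H hT (t := t) (h2.trans hN2)
    have hτ0 : 0 < η * t := lt_of_lt_of_le (by positivity) (H.le_time hT.lower h1 htn)
    have h10 := H.h10_le
    constructor
    · have hd1 : ∀ ij : Fin d × Fin d,
          hessDiag (loss X Y) (W t) (Sum.inl ij) = x t ij.1 ^ 2 := by
        intro ij
        rw [show ij = (ij.1, ij.2) from rfl, hessDiag_loss_inl hX]
        simp only [hx]
        rw [mul_pow, pow_two (sg _), hsgsq, one_mul]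
      have hpos : ∀ i, 0 < x t i := fun i => by
        linarith [(H.fit_x' hT.lower h1 htn hIt i).1]
      unfold RMed1
      simp only [hd1]
      refine (abs_maxOverMedian_sub_one_le_of_near (δ := 8 * h ^ 10) (by positivity) ?_
        (fun ij => by have := hpos ij.1; positivity) fun ij ij' => ?_).trans ?_
      · have : h ^ 10 ≤ h ^ 2 := H.h_pow_le (by norm_num)
        have := H.h_le'
        nlinarith
      · have e : x t ij.1 ^ 2 - x t ij'.1 ^ 2
          = (x t ij.1 + x t ij'.1) * (x t ij.1 - x t ij'.1) := by ring
        have h3 := abs_le.1 (hIt.layer2 ij.1)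
        have h4 := abs_le.1 (hIt.layer2 ij'.1)
        have h5 := hpos ij.1
        have h6 := hpos ij'.1
        have h7 : |x t ij.1 - x t ij'.1| ≤ 4 * h ^ 10 * (x t ij.1 + x t ij'.1) := by
          have h8 := (H.fit_x' hT.lower h1 htn hIt ij.1).1
          have h9 := (H.fit_x' hT.lower h1 htn hIt ij'.1).1
          have h11 : 4 * h ^ 10 * (η * t) ≤ 4 * h ^ 10 * (x t ij.1 + x t ij'.1) := by
            gcongr; linarith
          rw [abs_le]; constructor <;> linarith [h3.1, h3.2, h4.1, h4.2]
        rw [e, abs_mul, abs_of_pos (by linarith)]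
        calc _ ≤ (x t ij.1 + x t ij'.1) * (4 * h ^ 10 * (x t ij.1 + x t ij'.1)) := by gcongr
          _ ≤ 8 * h ^ 10 * (x t ij.1 ^ 2 + x t ij'.1 ^ 2) := by
            have : 0 ≤ h ^ 10 * (x t ij.1 - x t ij'.1) ^ 2 := by positivity
            linarith
      · calc 8 * (8 * h ^ 10) = 64 * h ^ 10 := by ring
          _ ≤ K ^ 7 * h ^ 8 := by
            gcongr ?_ * ?_
            · calc (64 : ℝ) ≤ K := by linarith
                _ = K ^ 1 := (pow_one K).symm
                _ ≤ K ^ 7 := pow_le_pow_right₀ H.one_le_K (by norm_num)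
            · exact H.h_pow_le (by norm_num)
    · have hd2 : ∀ i, hessDiag (loss X Y) (W t) (Sum.inr i) = ∑ j, y t i j ^ 2 := by
        intro i
        rw [hessDiag_loss_inr hX]
        refine Finset.sum_congr rfl fun j _ => ?_
        simp only [hy]
        rw [mul_pow, pow_two (sg _), hsgsq, one_mul]
      have hylow := fun i j => (H.fit_y hT.lower h1 htn hIt i j).1
      have hpos : ∀ i j, 0 < y t i j := fun i j => lt_of_lt_of_le (by positivity) (hylow i j)
      unfold RMed2
      simp only [hd2]
      refine (abs_maxOverMedian_sub_one_le_of_near (δ := K ^ 6 * h ^ 8) (by positivity) ?_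
        (fun i => Finset.sum_pos (fun j _ => by have := hpos i j; positivity)
          Finset.univ_nonempty) fun i i' => ?_).trans ?_
      · calc K ^ 6 * h ^ (7 + 1) ≤ h ^ 7 := H.pow_le 7 (by norm_num)
          _ ≤ h ^ 1 := H.h_pow_le (by norm_num)
          _ ≤ 1 / 100 := by rw [pow_one]; exact H.h_le'
      · rw [← Finset.sum_sub_distrib, ← Finset.sum_add_distrib, Finset.mul_sum]
        refine (Finset.abs_sum_le_sum_abs _ _).trans (Finset.sum_le_sum fun j _ => ?_)
        have h3 := hIt.rows i i' j
        have h4 := hylow i j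
        have h5 := hylow i' j
        have h6 := hpos i j
        have h7 := hpos i' j
        have e : y t i j ^ 2 - y t i' j ^ 2
          = (y t i j - y t i' j) * (y t i j + y t i' j) := by ring
        rw [e, abs_mul, abs_of_pos (by linarith : 0 < y t i j + y t i' j)]
        have e1 : h ^ 8 / D = K ^ 6 * h ^ 8 * (1 / (K ^ 6 * D)) := by field_simp
        rw [e1] at h3
        have h8 : 1 / (K ^ 6 * D) * (y t i j + y t i' j) ≤ y t i j ^ 2 + y t i' j ^ 2 := by
          have h9 := mul_le_mul_of_nonneg_right h4 h6.le
          have h11 := mul_le_mul_of_nonneg_right h5 h7.le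
          rw [mul_add, pow_two, pow_two]
          exact add_le_add h9 h11
        calc _ ≤ K ^ 6 * h ^ 8 * (1 / (K ^ 6 * D)) * (y t i j + y t i' j) := by gcongr
          _ = K ^ 6 * h ^ 8 * (1 / (K ^ 6 * D) * (y t i j + y t i' j)) := by ring
          _ ≤ _ := by gcongr
      · calc 8 * (K ^ 6 * h ^ 8) ≤ K * (K ^ 6 * h ^ 8) := by gcongr; linarith
          _ = _ := by ring

end DiagGeometry

namespace DiagGeometry

/-! ### Gradient descent with momentum on one row of the network -/

section momentum

variable {E : Type*} [NormedAddCommGroup E] [InnerProductSpace ℝ E]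

/-- The linear map by which the negative residual `G` acts on a row, that is on the pair of an entry
of the second layer and a row of the first one. -/
def rowOp (G : E) (x : ℝ × E) : ℝ × E := (inner ℝ G x.2, x.1 • G)

lemma rowOp_add (G : E) (x y : ℝ × E) : rowOp G (x + y) = rowOp G x + rowOp G y := by
  simp [rowOp, inner_add_right, add_smul]

lemma rowOp_smul (G : E) (a : ℝ) (x : ℝ × E) : rowOp G (a • x) = a • rowOp G x := by
  simp [rowOp, inner_smul_right, mul_smul]

lemma norm_rowOp_le (G : E) (x : ℝ × E) : ‖rowOp G x‖ ≤ ‖G‖ * ‖x‖ := by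
  rw [rowOp, Prod.norm_def]
  refine max_le ?_ ?_
  · refine (norm_inner_le_norm _ _).trans ?_
    have := norm_snd_le x
    gcongr
  · simp only [norm_smul]
    rw [mul_comm]
    have := norm_fst_le x
    gcongr

/-- Position and velocity after `t` steps of momentum with the residuals `G`. -/
def rowMomentum (β η : ℝ) (G : ℕ → E) (x₀ : ℝ × E) : ℕ → (ℝ × E) × (ℝ × E)
  | 0 => (x₀, 0)
  | t + 1 =>
    let s := rowMomentum β η G x₀ t
    let v := β • s.2 + η • rowOp (G t) s.1
    (s.1 + v, v)

/-- Once the residuals are given, the evolution of a row is linear in its initial value. The rows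
interact only through the residuals, which are the same for all of them. -/
lemma rowMomentum_add_smul (β η : ℝ) (G : ℕ → E) (z : ℝ) (x y : ℝ × E) (t : ℕ) :
    rowMomentum β η G (z • x + y) t
      = z • rowMomentum β η G x t + rowMomentum β η G y t := by
  induction t with
  | zero => simp [rowMomentum]
  | succ t ih =>
    simp only [rowMomentum, ih]
    simp only [Prod.smul_fst, Prod.fst_add, Prod.snd_add, Prod.smul_snd, rowOp_add, rowOp_smul]
    ext1 <;> simp only [Prod.smul_fst, Prod.fst_add, Prod.snd_add, Prod.smul_snd] <;> module

/-- The position corrected by the velocity, for which momentum is close to gradient descent. -/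
def corrected (β : ℝ) (s : (ℝ × E) × (ℝ × E)) : ℝ × E := s.1 + (β / (1 - β)) • s.2

/-- The weight `β / (1 - β)` is chosen so that the old velocity cancels: the corrected position
makes a plain gradient step of size `η / (1 - β)`, except that the gradient is taken at the
uncorrected position. -/
lemma corrected_succ {β : ℝ} (hβ : β < 1) (η : ℝ) (G : ℕ → E) (x₀ : ℝ × E) (t : ℕ) :
    corrected β (rowMomentum β η G x₀ (t + 1)) = corrected β (rowMomentum β η G x₀ t)
      + (η / (1 - β)) • rowOp (G t) (rowMomentum β η G x₀ t).1 := by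
  have h : 1 - β ≠ 0 := by linarith
  simp only [corrected, rowMomentum]
  set s := rowMomentum β η G x₀ t
  have e1 : (β / (1 - β)) * β = β / (1 - β) - β := by field_simp; ring
  have e2 : (β / (1 - β)) * η + η = η / (1 - β) := by field_simp; ring
  rw [← e2, smul_add, smul_smul, smul_smul, e1]
  module

/-- The velocity is a geometric average of past gradient steps, hence of relative size `4ηΓ / (1 -
β)`. This bound reproduces itself, because the position changes little per step; the error `e` comes
from evaluating the gradient at the uncorrected position. -/
lemma momentum_step {β η Γ μ : ℝ} (hβ0 : 0 ≤ β) (hβ : β < 1) (hη : 0 ≤ η)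
    (hμ : μ * (1 - β) = 4 * η * Γ) (hμ1 : μ ≤ 1 - β) (hμ0 : 0 ≤ μ) {G : ℕ → E} {x₀ : ℝ × E} {t : ℕ}
    (hG : ‖G t‖ ≤ Γ)
    (hv : ‖(rowMomentum β η G x₀ t).2‖ ≤ μ * ‖corrected β (rowMomentum β η G x₀ t)‖) :
    ‖(rowMomentum β η G x₀ (t + 1)).2‖ ≤ μ * ‖corrected β (rowMomentum β η G x₀ (t + 1))‖ ∧
    ‖(rowMomentum β η G x₀ t).1 - corrected β (rowMomentum β η G x₀ t)‖
      ≤ μ / (1 - β) * ‖corrected β (rowMomentum β η G x₀ t)‖ ∧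
    ∃ e : ℝ × E, ‖e‖ ≤ Γ * μ / (1 - β) * ‖corrected β (rowMomentum β η G x₀ t)‖ ∧
      corrected β (rowMomentum β η G x₀ (t + 1)) = corrected β (rowMomentum β η G x₀ t)
        + (η / (1 - β)) • (rowOp (G t) (corrected β (rowMomentum β η G x₀ t)) + e) := by
  have hsucc := corrected_succ hβ η G x₀ t
  have hvel : (rowMomentum β η G x₀ (t + 1)).2 = β • (rowMomentum β η G x₀ t).2
      + η • rowOp (G t) (rowMomentum β η G x₀ t).1 := rfl
  rw [hsucc, hvel]
  set s := rowMomentum β η G x₀ t with hs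
  have hu : 0 < 1 - β := by linarith
  have hΓ : 0 ≤ Γ := (norm_nonneg _).trans hG
  have hpos : s.1 = corrected β s + (-(β / (1 - β))) • s.2 := by
    simp [corrected]
  set Yc := corrected β s with hY
  have hdiff : ‖s.1 - Yc‖ ≤ μ / (1 - β) * ‖Yc‖ := by
    rw [hpos, add_sub_cancel_left, norm_smul, norm_neg, Real.norm_of_nonneg (by positivity)]
    calc β / (1 - β) * ‖s.2‖ ≤ 1 / (1 - β) * (μ * ‖Yc‖) := by gcongr
      _ = _ := by ring
  have hμ2 : μ / (1 - β) ≤ 1 := by rwa [div_le_one hu]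
  have hX : ‖s.1‖ ≤ 2 * ‖Yc‖ := by
    have h1 := norm_add_le (s.1 - Yc) Yc
    rw [sub_add_cancel] at h1
    have : μ / (1 - β) * ‖Yc‖ ≤ 1 * ‖Yc‖ := by gcongr
    linarith
  have hOp : ‖rowOp (G t) s.1‖ ≤ Γ * (2 * ‖Yc‖) :=
    (norm_rowOp_le _ _).trans (mul_le_mul hG hX (norm_nonneg _) hΓ)
  refine ⟨?_, hdiff, rowOp (G t) ((-(β / (1 - β))) • s.2), ?_, ?_⟩
  · have h1 : ‖β • s.2 + η • rowOp (G t) s.1‖ ≤ β * (μ * ‖Yc‖) + η * (Γ * (2 * ‖Yc‖)) := by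
      refine (norm_add_le _ _).trans ?_
      rw [norm_smul, norm_smul, Real.norm_of_nonneg hβ0, Real.norm_of_nonneg hη]
      gcongr
    have h2 : ‖Yc‖ - η / (1 - β) * (Γ * (2 * ‖Yc‖)) ≤ ‖Yc + (η / (1 - β)) • rowOp (G t) s.1‖ := by
      have h3 := norm_sub_le (Yc + (η / (1 - β)) • rowOp (G t) s.1) ((η / (1 - β)) • rowOp (G t) s.1)
      rw [add_sub_cancel_right, norm_smul, Real.norm_of_nonneg (by positivity)] at h3
      have h4 : η / (1 - β) * ‖rowOp (G t) s.1‖ ≤ η / (1 - β) * (Γ * (2 * ‖Yc‖)) := by gcongr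
      linarith
    refine h1.trans (le_trans ?_ (mul_le_mul_of_nonneg_left h2 hμ0))
    have h5 : μ * (η / (1 - β) * (Γ * (2 * ‖Yc‖))) ≤ η * Γ * (2 * ‖Yc‖) := by
      calc μ * (η / (1 - β) * (Γ * (2 * ‖Yc‖))) = μ / (1 - β) * (η * Γ * (2 * ‖Yc‖)) := by ring
        _ ≤ 1 * (η * Γ * (2 * ‖Yc‖)) := by gcongr
        _ = _ := one_mul _
    have h6 : μ * ‖Yc‖ - β * (μ * ‖Yc‖) = 4 * η * Γ * ‖Yc‖ := by rw [← hμ]; ring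
    rw [mul_sub]
    linarith
  · refine (norm_rowOp_le _ _).trans ?_
    rw [norm_smul, norm_neg, Real.norm_of_nonneg (by positivity)]
    calc ‖G t‖ * (β / (1 - β) * ‖s.2‖) ≤ Γ * (1 / (1 - β) * (μ * ‖Yc‖)) := by gcongr
      _ = _ := by ring
  · rw [← rowOp_add, ← hpos]

end momentum

/-! ### The dynamics of the direction of a row -/

section planar

variable {E : Type*} [NormedAddCommGroup E] [InnerProductSpace ℝ E]

/-- Growing coordinate of a row with respect to the direction `u`. -/
def growing (u : E) (x : ℝ × E) : ℝ := x.1 + inner ℝ u x.2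
/-- Decaying coordinate of a row with respect to the direction `u`. -/
def decaying (u : E) (x : ℝ × E) : ℝ := x.1 - inner ℝ u x.2
/-- Transversal component with respect to the direction `u`. -/
def transversal (u : E) (c : E) : E := c - (inner ℝ u c : ℝ) • u

variable {u : E} (hu : ‖u‖ = 1)

lemma transversal_add (c c' : E) : transversal u (c + c') = transversal u c + transversal u c' := by
  simp only [transversal, inner_add_right, add_smul]; abel

lemma transversal_smul (a : ℝ) (c : E) : transversal u (a • c) = a • transversal u c := by
  simp only [transversal, inner_smul_right, smul_sub, mul_smul]

include hu

lemma inner_transversal (c : E) : inner ℝ u (transversal u c) = (0 : ℝ) := by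
  simp [transversal, inner_sub_right, inner_smul_right, real_inner_self_eq_norm_sq, hu]

lemma transversal_self : transversal u u = 0 := by
  simp [transversal, real_inner_self_eq_norm_sq, hu]

lemma abs_inner_unit_le (c : E) : |inner ℝ u c| ≤ ‖c‖ := by
  have := abs_real_inner_le_norm u c
  rwa [hu, one_mul] at this

lemma norm_transversal_le (c : E) : ‖transversal u c‖ ≤ ‖c‖ := by
  have h1 : ‖transversal u c‖ ^ 2 = ‖c‖ ^ 2 - (inner ℝ u c : ℝ) ^ 2 := by
    rw [transversal, norm_sub_sq_real, inner_smul_right, norm_smul, hu, real_inner_comm,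
      Real.norm_eq_abs, mul_one, sq_abs]
    ring
  have h2 : ‖transversal u c‖ ^ 2 ≤ ‖c‖ ^ 2 := by
    rw [h1]; have := sq_nonneg (inner ℝ u c : ℝ); linarith
  exact (le_abs_self _).trans (abs_le_of_sq_le_sq h2 (norm_nonneg _))

lemma inner_decomp (G c : E) : inner ℝ G c
    = (inner ℝ u G : ℝ) * inner ℝ u c + inner ℝ (transversal u G) (transversal u c) := by
  have h1 : G = (inner ℝ u G : ℝ) • u + transversal u G := by simp [transversal]
  have h2 : c = (inner ℝ u c : ℝ) • u + transversal u c := by simp [transversal]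
  have h3 := inner_transversal hu G
  have h4 := inner_transversal hu c
  conv_lhs => rw [h1, h2]
  rw [inner_add_left, inner_add_right, inner_add_right, inner_smul_left, inner_smul_left,
    inner_smul_right, inner_smul_right, h4, real_inner_comm u (transversal u G), h3,
    real_inner_self_eq_norm_sq, hu]
  simp

lemma norm_le_decomp (c : E) : ‖c‖ ≤ |inner ℝ u c| + ‖transversal u c‖ := by
  have h1 : c = (inner ℝ u c : ℝ) • u + transversal u c := by simp [transversal]
  calc ‖c‖ = ‖(inner ℝ u c : ℝ) • u + transversal u c‖ := by rw [← h1]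
    _ ≤ _ := by
      refine (norm_add_le _ _).trans ?_
      rw [norm_smul, hu, mul_one, Real.norm_eq_abs]

/-- One step of the dynamics in the coordinates given by `u`. -/
lemma planar_step {N ω ε e η' : ℝ} {G : E} {x x' err : ℝ × E} (hη : 0 ≤ η')
    (hG : ‖G - (ω • u - (N * x.1) • x.2)‖ ≤ ε) (herr : ‖err‖ ≤ e)
    (hx : x' = x + η' • (rowOp G x + err)) (hN : 0 ≤ N) (hNx : η' * (N * x.1 ^ 2) ≤ 1) :
    |inner ℝ u G - (ω - N * (growing u x ^ 2 - decaying u x ^ 2) / 4)| ≤ ε ∧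
    ‖transversal u G‖ ≤ N * |x.1| * ‖transversal u x.2‖ + ε ∧
    |growing u x' - (1 + η' * inner ℝ u G) * growing u x|
      ≤ η' * ((N * |x.1| * ‖transversal u x.2‖ + ε) * ‖transversal u x.2‖ + 2 * e) ∧
    |decaying u x' - (1 - η' * inner ℝ u G) * decaying u x|
      ≤ η' * ((N * |x.1| * ‖transversal u x.2‖ + ε) * ‖transversal u x.2‖ + 2 * e) ∧
    ‖transversal u x'.2‖ ≤ ‖transversal u x.2‖ + η' * (|x.1| * ε + e) := by
  set eG := G - (ω • u - (N * x.1) • x.2) with heG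
  have hGe : G = ω • u - (N * x.1) • x.2 + eG := by rw [heG]; abel
  have h1 : inner ℝ u G = ω - N * x.1 * inner ℝ u x.2 + inner ℝ u eG := by
    conv_lhs => rw [hGe]
    rw [inner_add_right, inner_sub_right, inner_smul_right, inner_smul_right,
      real_inner_self_eq_norm_sq, hu]
    ring
  have h2 : transversal u G = (-(N * x.1)) • transversal u x.2 + transversal u eG := by
    conv_lhs => rw [hGe]
    rw [transversal_add, sub_eq_add_neg, ← neg_smul, transversal_add, transversal_smul,
      transversal_smul, transversal_self hu, smul_zero, zero_add]
  have h3 : ‖transversal u eG‖ ≤ ε := (norm_transversal_le hu _).trans hG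
  have h4 : ‖transversal u G‖ ≤ N * |x.1| * ‖transversal u x.2‖ + ε := by
    rw [h2]
    refine (norm_add_le _ _).trans (add_le_add ?_ h3)
    rw [norm_smul, norm_neg, norm_mul, Real.norm_of_nonneg hN, Real.norm_eq_abs]
  have h5 : |inner ℝ (transversal u G) (transversal u x.2)|
      ≤ (N * |x.1| * ‖transversal u x.2‖ + ε) * ‖transversal u x.2‖ :=
    (abs_real_inner_le_norm _ _).trans (by gcongr)
  have he1 : |err.1| ≤ e := (norm_fst_le err).trans herr
  have he2 : ‖err.2‖ ≤ e := (norm_snd_le err).trans herr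
  have he3 : |inner ℝ u err.2| ≤ e := (abs_inner_unit_le hu _).trans he2
  have hx1 : x'.1 = x.1 + η' * (inner ℝ G x.2 + err.1) := by rw [hx]; simp [rowOp]; ring
  have hx2 : x'.2 = x.2 + η' • (x.1 • G + err.2) := by rw [hx]; simp [rowOp]
  have hx2u : inner ℝ u x'.2 = inner ℝ u x.2
      + η' * (x.1 * inner ℝ u G + inner ℝ u err.2) := by
    rw [hx2, inner_add_right, inner_smul_right, inner_add_right, inner_smul_right]
  rw [inner_decomp hu] at hx1
  refine ⟨?_, h4, ?_, ?_, ?_⟩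
  · have e : inner ℝ u G - (ω - N * (growing u x ^ 2 - decaying u x ^ 2) / 4)
        = inner ℝ u eG := by
      rw [h1]; unfold growing decaying; ring
    rw [e]
    exact (abs_inner_unit_le hu _).trans hG
  · have e : growing u x' - (1 + η' * inner ℝ u G) * growing u x
        = η' * (inner ℝ (transversal u G) (transversal u x.2) + err.1 + inner ℝ u err.2) := by
      unfold growing; rw [hx1, hx2u]; ring
    rw [e, abs_mul, abs_of_nonneg hη]
    gcongr
    refine (abs_add_le _ _).trans ?_
    have := abs_add_le (inner ℝ (transversal u G) (transversal u x.2)) err.1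
    linarith
  · have e : decaying u x' - (1 - η' * inner ℝ u G) * decaying u x
        = η' * (inner ℝ (transversal u G) (transversal u x.2) + err.1 - inner ℝ u err.2) := by
      unfold decaying; rw [hx1, hx2u]; ring
    rw [e, abs_mul, abs_of_nonneg hη]
    gcongr
    refine (abs_sub _ _).trans ?_
    have := abs_add_le (inner ℝ (transversal u G) (transversal u x.2)) err.1
    linarith
  -- The feedback term `- N x₁ x₂` in the residual acts on the transversal part as a contraction, so
  -- only the errors can make it grow.
  · have ek : transversal u x'.2 = (1 - η' * (N * x.1 ^ 2)) • transversal u x.2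
        + η' • (x.1 • transversal u eG + transversal u err.2) := by
      rw [hx2, transversal_add, transversal_smul, transversal_add, transversal_smul, h2]
      module
    rw [ek]
    refine (norm_add_le _ _).trans ?_
    rw [norm_smul, norm_smul, Real.norm_of_nonneg hη, Real.norm_of_nonneg (by linarith)]
    have h6 : 0 ≤ η' * (N * x.1 ^ 2) := by positivity
    have h7 : (1 - η' * (N * x.1 ^ 2)) * ‖transversal u x.2‖ ≤ 1 * ‖transversal u x.2‖ := by
      gcongr; linarith
    have h8 : ‖x.1 • transversal u eG + transversal u err.2‖ ≤ |x.1| * ε + e := by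
      refine (norm_add_le _ _).trans (add_le_add ?_ ((norm_transversal_le hu _).trans he2))
      rw [norm_smul, Real.norm_eq_abs]
      gcongr
    have h9 : η' * ‖x.1 • transversal u eG + transversal u err.2‖ ≤ η' * (|x.1| * ε + e) := by
      gcongr
    linarith

end planar

end DiagGeometry

namespace DiagGeometry

/-! ### Gradient descent with momentum on the two-layer network -/

section sgd

variable {E : Type*} [NormedAddCommGroup E] [InnerProductSpace ℝ E] {ι : Type*} [Fintype ι]

/-- The smallness conditions on the parameters of gradient descent with momentum. -/
structure SGDParams (β η ω N ε f₀ Θ V₀ ν : ℝ) : Prop where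
  β_pos : 0 < β
  β_lt : β < 1
  η_pos : 0 < η
  one_le_ω : 1 ≤ ω
  N_pos : 0 < N
  hN : 1024 * N ≤ f₀
  hf₀ : f₀ ≤ 1 / 2
  ε_pos : 0 < ε
  one_le_Θ : 1 ≤ Θ
  small : 1024 * ω * ε * Θ ^ 2 ≤ 1
  small' : 64 * ω * ε * Θ ≤ f₀
  mom : 12 * η * ω / (1 - β) ≤ 1 - β
  mom' : 144 * η * ω ^ 2 / (1 - β) ^ 2 ≤ ε
  step : 6 * (η / (1 - β)) * ω ^ 2 ≤ f₀
  V₀_nonneg : 0 ≤ V₀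
  init : ω * (384 * (V₀ / √N) + 96 * (12 * η * ω / (1 - β) / (1 - β))) ≤ ε
  ν_nonneg : 0 ≤ ν
  noise : 36 * ω * ν ≤ ε

/-- The rows of the network under gradient descent with momentum, started from `(z i, v i)`. -/
structure SGDRun (β η ω N ε f₀ Θ V₀ ν : ℝ) (T : ℕ) (u : E) (z : ι → ℝ) (v : ι → E)
    (G : ℕ → E) : Prop extends SGDParams β η ω N ε f₀ Θ V₀ ν where
  hu : ‖u‖ = 1
  sum_z : ∑ i, z i ^ 2 = N
  sum_v : ∑ i, ‖v i‖ ^ 2 ≤ V₀ ^ 2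
  resid : ∀ t ≤ T, ‖G t - (ω • u - ∑ i, (rowMomentum β η G (z i, v i) t).1.1 •
      (rowMomentum β η G (z i, v i) t).1.2)‖
    ≤ ν * (1 + ‖∑ i, (rowMomentum β η G (z i, v i) t).1.1 •
      (rowMomentum β η G (z i, v i) t).1.2‖)

/-- The corrected position of the row started from `(1, 0)`. -/
def mainRow (β η : ℝ) (G : ℕ → E) (t : ℕ) : ℝ × E := corrected β (rowMomentum β η G (1, 0) t)

/-- The corrected position of the row started from `(0, v)`. -/
def restRow (β η : ℝ) (G : ℕ → E) (v : E) (t : ℕ) : ℝ × E :=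
  corrected β (rowMomentum β η G (0, v) t)

/-- The invariants of the dynamics. -/
structure SGDInv (β η ω N ε Θ : ℝ) (u : E) (v : ι → E) (G : ℕ → E) (t : ℕ) : Prop where
  one_le : 1 ≤ growing u (mainRow β η G t)
  upper : N * growing u (mainRow β η G t) ^ 2 ≤ 4 * ω
  decay : |decaying u (mainRow β η G t)|
    ≤ 1 + 8 * ε * (η / (1 - β) * t) * growing u (mainRow β η G t)
  trans : ‖transversal u (mainRow β η G t).2‖
    ≤ 8 * ε * (η / (1 - β) * t) * growing u (mainRow β η G t)
  rows : ∀ i, ‖restRow β η G (v i) t‖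
    ≤ ‖v i‖ * growing u (mainRow β η G t) * (1 + η / (1 - β) * t / Θ)
  vel : ‖(rowMomentum β η G (1, 0) t).2‖ ≤ 12 * η * ω / (1 - β) * ‖mainRow β η G t‖
  velRows : ∀ i, ‖(rowMomentum β η G (0, v i) t).2‖
    ≤ 12 * η * ω / (1 - β) * ‖restRow β η G (v i) t‖

lemma norm_position_sub_corrected_le {β μ : ℝ} (hβ0 : 0 ≤ β) (hβ : β < 1)
    {s : (ℝ × E) × (ℝ × E)} (hv : ‖s.2‖ ≤ μ * ‖corrected β s‖) :
    ‖s.1 - corrected β s‖ ≤ μ / (1 - β) * ‖corrected β s‖ := by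
  have hu : 0 < 1 - β := by linarith
  have e : s.1 - corrected β s = (-(β / (1 - β))) • s.2 := by simp [corrected]
  rw [e, norm_smul, norm_neg, Real.norm_of_nonneg (by positivity)]
  calc β / (1 - β) * ‖s.2‖ ≤ 1 / (1 - β) * (μ * ‖corrected β s‖) := by gcongr
    _ = _ := by ring

namespace SGDRun

variable {β η ω N ε f₀ Θ V₀ ν : ℝ} {T : ℕ} {u : E} {z : ι → ℝ} {v : ι → E} {G : ℕ → E}
  (H : SGDRun β η ω N ε f₀ Θ V₀ ν T u z v G)
include H

lemma one_sub_pos : 0 < 1 - β := by linarith [H.β_lt]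

lemma ω_pos : 0 < ω := by linarith [H.one_le_ω]

lemma f₀_pos : 0 < f₀ := by have := H.N_pos; have := H.hN; linarith

lemma ε_le : 1024 * ε ≤ 1 := by
  have h1 := H.small
  have h2 := H.one_le_ω
  have h3 := one_le_pow₀ H.one_le_Θ (n := 2)
  have h4 := H.ε_pos
  have h5 : 1 ≤ ω * Θ ^ 2 := one_le_mul_of_one_le_of_one_le h2 h3
  nlinarith

lemma δ_le : 8 * ε * Θ ≤ 1 / 128 := by
  have h1 := H.small
  have h2 := H.one_le_ω
  have h3 := H.one_le_Θ
  have h4 := H.ε_pos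
  have h5 : 1 ≤ ω * Θ := one_le_mul_of_one_le_of_one_le h2 h3
  have h6 : 0 < ε * Θ := by positivity
  nlinarith

lemma μ_nonneg : 0 ≤ 12 * η * ω / (1 - β) := by
  have := H.one_sub_pos; have := H.ω_pos; have := H.η_pos; positivity

lemma μ_div_le : 12 * η * ω / (1 - β) / (1 - β) ≤ 1 / 96 := by
  have h1 := H.init
  have h2 := H.one_le_ω
  have h3 := H.ε_le
  have h4 : 0 ≤ 384 * (V₀ / √N) := by have := H.V₀_nonneg; positivity
  have h5 : 0 ≤ 12 * η * ω / (1 - β) / (1 - β) :=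
    div_nonneg H.μ_nonneg H.one_sub_pos.le
  nlinarith

lemma V₀_le : V₀ / √N ≤ 1 / 384 := by
  have h1 := H.init
  have h2 := H.one_le_ω
  have h3 := H.ε_le
  have h4 : 0 ≤ V₀ / √N := by have := H.V₀_nonneg; positivity
  have h5 : 0 ≤ 12 * η * ω / (1 - β) / (1 - β) :=
    div_nonneg H.μ_nonneg H.one_sub_pos.le
  nlinarith

lemma V₀_le' : V₀ ≤ √N := by
  have h1 := H.V₀_le
  have h2 := Real.sqrt_pos.2 H.N_pos
  rw [div_le_iff₀ h2] at h1
  linarith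

/-- The splitting behind the lower bound: a multiple of one common trajectory, with the initial
second-layer weight as factor, plus a remainder started from the small first layer. -/
lemma row_eq (i : ι) (t : ℕ) : rowMomentum β η G (z i, v i) t
    = z i • rowMomentum β η G (1, 0) t + rowMomentum β η G (0, v i) t := by
  rw [← rowMomentum_add_smul]
  simp

section bounds

variable {t : ℕ} (hτ : η / (1 - β) * t ≤ Θ) (hI : SGDInv β η ω N ε Θ u v G t)
include hτ hI

lemma eτ_le : 8 * ε * (η / (1 - β) * t) ≤ 1 / 128 := by
  have := H.ε_pos
  calc 8 * ε * (η / (1 - β) * t) ≤ 8 * ε * Θ := by gcongr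
    _ ≤ _ := H.δ_le

lemma mainRow_bounds : |(mainRow β η G t).1| ≤ 2 * growing u (mainRow β η G t) ∧
    |inner ℝ u (mainRow β η G t).2| ≤ 3 / 2 * growing u (mainRow β η G t) ∧
    ‖mainRow β η G t‖ ≤ 2 * growing u (mainRow β η G t) := by
  have h1 := H.eτ_le hτ hI
  have h2 := hI.decay
  have h3 := hI.trans
  have h4 := hI.one_le
  set p := growing u (mainRow β η G t) with hp
  set q := decaying u (mainRow β η G t) with hq
  have h5 : 8 * ε * (η / (1 - β) * t) * p ≤ 1 / 128 * p := by gcongr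
  have e1 : (mainRow β η G t).1 = (p + q) / 2 := by rw [hp, hq]; unfold growing decaying; ring
  have e2 : inner ℝ u (mainRow β η G t).2 = (p - q) / 2 := by
    rw [hp, hq]; unfold growing decaying; ring
  have h6 := abs_le.1 h2
  have b1 : |(mainRow β η G t).1| ≤ 3 / 2 * p := by
    rw [e1, abs_le]; constructor <;> linarith [h6.1, h6.2]
  have b2 : |inner ℝ u (mainRow β η G t).2| ≤ 3 / 2 * p := by
    rw [e2, abs_le]; constructor <;> linarith [h6.1, h6.2]
  refine ⟨by linarith, b2, ?_⟩
  rw [Prod.norm_def]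
  refine max_le (by rw [Real.norm_eq_abs]; linarith) ?_
  have := norm_le_decomp H.hu (mainRow β η G t).2
  linarith

lemma position_bounds :
    ‖(rowMomentum β η G (1, 0) t).1 - mainRow β η G t‖
      ≤ 12 * η * ω / (1 - β) / (1 - β) * (2 * growing u (mainRow β η G t)) ∧
    ∀ i, ‖(rowMomentum β η G (0, v i) t).1‖ ≤ 4 * growing u (mainRow β η G t) * ‖v i‖ := by
  have hμ0 : 0 ≤ 12 * η * ω / (1 - β) / (1 - β) := div_nonneg H.μ_nonneg H.one_sub_pos.le
  have hp := hI.one_le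
  constructor
  · refine (norm_position_sub_corrected_le H.β_pos.le H.β_lt hI.vel).trans ?_
    have := (H.mainRow_bounds hτ hI).2.2
    unfold mainRow at *
    gcongr
  · intro i
    have h1 := norm_position_sub_corrected_le H.β_pos.le H.β_lt (hI.velRows i)
    have h2 := norm_add_le ((rowMomentum β η G (0, v i) t).1 - restRow β η G (v i) t)
      (restRow β η G (v i) t)
    rw [sub_add_cancel] at h2
    have h3 := hI.rows i
    have h4 : η / (1 - β) * t / Θ ≤ 1 := by
      rw [div_le_one (by linarith [H.one_le_Θ])]; exact hτ
    set p := growing u (mainRow β η G t)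
    have h5 : ‖v i‖ * p * (1 + η / (1 - β) * t / Θ) ≤ ‖v i‖ * p * 2 := by
      have : 0 ≤ ‖v i‖ * p := by positivity
      gcongr
      linarith
    have h6 : 12 * η * ω / (1 - β) / (1 - β) * ‖restRow β η G (v i) t‖
        ≤ 1 * ‖restRow β η G (v i) t‖ := by
      gcongr
      linarith [H.μ_div_le]
    change ‖(rowMomentum β η G (0, v i) t).1 - restRow β η G (v i) t‖ ≤ _ at h1
    unfold restRow at *
    linarith

/-- The product of the layers is `∑ zᵢ² = N` times that of the common trajectory, plus cross terms.
Cauchy–Schwarz bounds these by `√N V₀`, small against `N`; the rest is the cost of replacing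
positions by corrected ones. -/
lemma product_error : ‖∑ i, (rowMomentum β η G (z i, v i) t).1.1 •
      (rowMomentum β η G (z i, v i) t).1.2 - (N * (mainRow β η G t).1) • (mainRow β η G t).2‖
      ≤ ε / 2 := by
  obtain ⟨hd, hρ⟩ := H.position_bounds hτ hI
  obtain ⟨hb1, -, hb⟩ := H.mainRow_bounds hτ hI
  have hp1 := hI.one_le
  have hNp := hI.upper
  have hN := H.N_pos
  have hS := Real.sqrt_pos.2 hN
  set p := growing u (mainRow β η G t)
  set μ₁ := 12 * η * ω / (1 - β) / (1 - β) with hμ₁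
  have hμ0 : 0 ≤ μ₁ := div_nonneg H.μ_nonneg H.one_sub_pos.le
  have hμ1 := H.μ_div_le
  set φ := (rowMomentum β η G (1, 0) t).1 with hφ
  set φh := mainRow β η G t with hφh
  set ρ : ι → ℝ × E := fun i => (rowMomentum β η G (0, v i) t).1 with hρdef
  have hp0 : 0 < p := by linarith
  have hφn : ‖φ‖ ≤ 4 * p := by
    have h1 := norm_add_le (φ - φh) φh
    rw [sub_add_cancel] at h1
    have : μ₁ * (2 * p) ≤ 1 * (2 * p) := by gcongr; linarith
    linarith
  have hrow : ∀ i, (rowMomentum β η G (z i, v i) t).1.1 • (rowMomentum β η G (z i, v i) t).1.2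
      = (z i ^ 2 * φ.1) • φ.2 + ((z i * φ.1) • (ρ i).2 + ((ρ i).1 * z i) • φ.2
        + (ρ i).1 • (ρ i).2) := by
    intro i
    rw [H.row_eq i t]
    simp only [Prod.fst_add, Prod.smul_fst, Prod.snd_add, Prod.smul_snd]
    change (z i • φ.1 + (ρ i).1) • (z i • φ.2 + (ρ i).2) = _
    simp only [smul_eq_mul]
    module
  have hsum1 : ∑ i, (z i ^ 2 * φ.1) • φ.2 = (N * φ.1) • φ.2 := by
    rw [← Finset.sum_smul, ← Finset.sum_mul, H.sum_z]
  have hrest : ‖∑ i, ((z i * φ.1) • (ρ i).2 + ((ρ i).1 * z i) • φ.2 + (ρ i).1 • (ρ i).2)‖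
      ≤ 192 * ω * (V₀ / √N) := by
    have hterm : ∀ i, ‖(z i * φ.1) • (ρ i).2 + ((ρ i).1 * z i) • φ.2 + (ρ i).1 • (ρ i).2‖
        ≤ 32 * p ^ 2 * (|z i| * ‖v i‖) + 16 * p ^ 2 * ‖v i‖ ^ 2 := by
      intro i
      have h1 := hρ i
      have h2 : |(ρ i).1| ≤ 4 * p * ‖v i‖ := (norm_fst_le _).trans h1
      have h3 : ‖(ρ i).2‖ ≤ 4 * p * ‖v i‖ := (norm_snd_le _).trans h1
      have h4 : |φ.1| ≤ 4 * p := (norm_fst_le _).trans hφn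
      have h5 : ‖φ.2‖ ≤ 4 * p := (norm_snd_le _).trans hφn
      have t1 : ‖(z i * φ.1) • (ρ i).2‖ ≤ |z i| * (4 * p) * (4 * p * ‖v i‖) := by
        rw [norm_smul, Real.norm_eq_abs, abs_mul]; gcongr
      have t2 : ‖((ρ i).1 * z i) • φ.2‖ ≤ 4 * p * ‖v i‖ * |z i| * (4 * p) := by
        rw [norm_smul, Real.norm_eq_abs, abs_mul]; gcongr
      have t3 : ‖(ρ i).1 • (ρ i).2‖ ≤ 4 * p * ‖v i‖ * (4 * p * ‖v i‖) := by
        rw [norm_smul, Real.norm_eq_abs]; gcongr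
      refine (norm_add_le _ _).trans ?_
      have := norm_add_le ((z i * φ.1) • (ρ i).2) (((ρ i).1 * z i) • φ.2)
      linarith
    refine (norm_sum_le _ _).trans ((Finset.sum_le_sum fun i _ => hterm i).trans ?_)
    rw [Finset.sum_add_distrib, ← Finset.mul_sum, ← Finset.mul_sum]
    have hcs : ∑ i, |z i| * ‖v i‖ ≤ √N * V₀ := by
      refine (Real.sum_mul_le_sqrt_mul_sqrt _ _ _).trans ?_
      simp only [sq_abs]
      rw [H.sum_z]
      gcongr
      rw [Real.sqrt_le_left H.V₀_nonneg]
      exact H.sum_v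
    have hV := H.V₀_nonneg
    have hsq : √N * √N = N := Real.mul_self_sqrt hN.le
    have h1 : 32 * p ^ 2 * ∑ i, |z i| * ‖v i‖ ≤ 32 * p ^ 2 * (√N * V₀) := by gcongr
    have h2 : 16 * p ^ 2 * ∑ i, ‖v i‖ ^ 2 ≤ 16 * p ^ 2 * (√N * V₀) := by
      have h3 := H.sum_v
      have h4 : V₀ ^ 2 ≤ √N * V₀ := by rw [pow_two]; have := H.V₀_le'; gcongr
      have h5 := h3.trans h4
      gcongr
    have h6 : √N * V₀ = N * (V₀ / √N) := by
      rw [mul_div_assoc', eq_div_iff hS.ne']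
      calc √N * V₀ * √N = (√N * √N) * V₀ := by ring
        _ = _ := by rw [hsq]
    have h7 : 48 * p ^ 2 * (√N * V₀) ≤ 192 * ω * (V₀ / √N) := by
      rw [h6]
      have h8 : 0 ≤ V₀ / √N := by positivity
      calc 48 * p ^ 2 * (N * (V₀ / √N)) = 48 * (N * p ^ 2) * (V₀ / √N) := by ring
        _ ≤ 48 * (4 * ω) * (V₀ / √N) := by gcongr
        _ = _ := by ring
    linarith
  have hmain : ‖(N * φ.1) • φ.2 - (N * φh.1) • φh.2‖ ≤ 48 * ω * μ₁ := by
    have e : (N * φ.1) • φ.2 - (N * φh.1) • φh.2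
        = N • ((φ.1 - φh.1) • φ.2 + φh.1 • (φ.2 - φh.2)) := by module
    have h1 : |φ.1 - φh.1| ≤ μ₁ * (2 * p) := (norm_fst_le (φ - φh)).trans hd
    have h2 : ‖φ.2 - φh.2‖ ≤ μ₁ * (2 * p) := (norm_snd_le (φ - φh)).trans hd
    have h5 : ‖φ.2‖ ≤ 4 * p := (norm_snd_le _).trans hφn
    rw [e, norm_smul, Real.norm_of_nonneg hN.le]
    calc N * ‖(φ.1 - φh.1) • φ.2 + φh.1 • (φ.2 - φh.2)‖
        ≤ N * (μ₁ * (2 * p) * (4 * p) + 2 * p * (μ₁ * (2 * p))) := by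
          gcongr
          refine (norm_add_le _ _).trans ?_
          rw [norm_smul, norm_smul, Real.norm_eq_abs, Real.norm_eq_abs]
          gcongr
      _ = 12 * (N * p ^ 2) * μ₁ := by ring
      _ ≤ 12 * (4 * ω) * μ₁ := by gcongr
      _ = _ := by ring
  rw [Finset.sum_congr rfl fun i _ => hrow i, Finset.sum_add_distrib, hsum1]
  set R := ∑ i, ((z i * φ.1) • (ρ i).2 + ((ρ i).1 * z i) • φ.2 + (ρ i).1 • (ρ i).2)
  have e : (N * φ.1) • φ.2 + R - (N * φh.1) • φh.2
      = ((N * φ.1) • φ.2 - (N * φh.1) • φh.2) + R := by abel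
  rw [e]
  refine (norm_add_le _ _).trans ?_
  have := H.init
  linarith

lemma main_product_le : ‖(N * (mainRow β η G t).1) • (mainRow β η G t).2‖
    ≤ 4 * (N * growing u (mainRow β η G t) ^ 2) := by
  obtain ⟨hb1, -, hb⟩ := H.mainRow_bounds hτ hI
  have hN := H.N_pos
  set p := growing u (mainRow β η G t)
  have hp0 : 0 < p := by linarith [hI.one_le]
  rw [norm_smul, Real.norm_eq_abs, abs_mul, abs_of_pos hN]
  have h2 : ‖(mainRow β η G t).2‖ ≤ 2 * p := (norm_snd_le _).trans hb
  calc N * |(mainRow β η G t).1| * ‖(mainRow β η G t).2‖ ≤ N * (2 * p) * (2 * p) := by gcongr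
    _ = _ := by ring

lemma resid_error (htT : t ≤ T) :
    ‖G t - (ω • u - (N * (mainRow β η G t).1) • (mainRow β η G t).2)‖ ≤ ε := by
  have h1 := H.product_error hτ hI
  have h2 := H.resid t htT
  have h3 := H.main_product_le hτ hI
  set P := ∑ i, (rowMomentum β η G (z i, v i) t).1.1 • (rowMomentum β η G (z i, v i) t).1.2
  set M := (N * (mainRow β η G t).1) • (mainRow β η G t).2
  have h4 : ‖P‖ ≤ 17 * ω := by
    have h5 := norm_add_le (P - M) M
    rw [sub_add_cancel] at h5
    have := hI.upper
    have := H.ε_le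
    have := H.one_le_ω
    linarith
  have hω := H.one_le_ω
  have hν := H.ν_nonneg
  have h6 : ν * (1 + ‖P‖) ≤ ε / 2 := by
    have := H.noise
    calc ν * (1 + ‖P‖) ≤ ν * (ω + 17 * ω) := by gcongr
      _ = 36 * ω * ν / 2 := by ring
      _ ≤ _ := by linarith
  have e : G t - (ω • u - M) = (G t - (ω • u - P)) - (P - M) := by abel
  rw [e]
  refine (norm_sub_le _ _).trans ?_
  linarith

/-- The decaying coordinate is at most one plus a small multiple of the growing one. `N` is small
against `f₀`, and `N p²` is at most `4 ω`, so its contribution to the residual stays below the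
stopping threshold `f₀`. -/
lemma decaying_sq_le : N * decaying u (mainRow β η G t) ^ 2 ≤ f₀ / 64 := by
  have hε := H.ε_pos
  have hN := H.N_pos
  have hNp := hI.upper
  have h1 := hI.decay
  have hp1 := hI.one_le
  have hδ := H.δ_le
  have hΘ := H.one_le_Θ
  have hf := H.f₀_pos
  set q := decaying u (mainRow β η G t)
  set p := growing u (mainRow β η G t)
  have h2 : |q| ≤ 1 + 8 * ε * Θ * p := by
    refine h1.trans ?_
    gcongr
  have h3 : q ^ 2 ≤ (1 + 8 * ε * Θ * p) ^ 2 := by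
    rw [← sq_abs]
    gcongr
  have h4 : (1 + 8 * ε * Θ * p) ^ 2 ≤ 2 + 2 * (8 * ε * Θ * p) ^ 2 := by
    have := sq_nonneg (1 - 8 * ε * Θ * p)
    linarith
  have h5 : N * (2 + 2 * (8 * ε * Θ * p) ^ 2) = 2 * N + 128 * ε ^ 2 * Θ ^ 2 * (N * p ^ 2) := by
    ring
  have h6 : 128 * ε ^ 2 * Θ ^ 2 * (N * p ^ 2) ≤ 128 * ε ^ 2 * Θ ^ 2 * (4 * ω) := by gcongr
  have h7 : 128 * ε ^ 2 * Θ ^ 2 * (4 * ω) = 64 * ω * ε * Θ * (8 * ε * Θ) := by ring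
  have h8 : 64 * ω * ε * Θ * (8 * ε * Θ) ≤ f₀ * (1 / 128) := by
    have := H.small'
    gcongr
  have h10 : N * q ^ 2 ≤ N * (2 + 2 * (8 * ε * Θ * p) ^ 2) := by
    have := h3.trans h4
    gcongr
  have h11 := H.hN
  linarith

omit hτ hI in
lemma step_mul_le : η / (1 - β) * ω ≤ 1 / 12 := by
  have h1 := H.step
  have h2 := H.hf₀
  have hη := H.η_pos
  have hu := H.one_sub_pos
  have hω := H.one_le_ω
  have h3 : η / (1 - β) * ω ≤ η / (1 - β) * ω ^ 2 := by
    gcongr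
    nlinarith
  linarith

lemma transversal_le : ‖transversal u (mainRow β η G t).2‖
    ≤ 8 * ε * Θ * growing u (mainRow β η G t) := by
  have hε := H.ε_pos
  have hp1 := hI.one_le
  refine hI.trans.trans ?_
  gcongr

lemma step_main_le : η / (1 - β) * (N * (mainRow β η G t).1 ^ 2) ≤ 1 := by
  have hε := H.ε_pos
  have hN := H.N_pos
  have hη := H.η_pos
  have hu := H.one_sub_pos
  have hNp := hI.upper
  have hδ' := H.eτ_le hτ hI
  have hp1 := hI.one_le
  have hd := hI.decay
  have hst := H.step_mul_le
  have hη' : 0 < η / (1 - β) := by positivity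
  have e1 : (mainRow β η G t).1
      = (growing u (mainRow β η G t) + decaying u (mainRow β η G t)) / 2 := by
    unfold growing decaying; ring
  set p := growing u (mainRow β η G t)
  have h5 : 8 * ε * (η / (1 - β) * t) * p ≤ 1 / 128 * p := by gcongr
  have h2 : |(mainRow β η G t).1| ≤ 3 / 2 * p := by
    have h3 := abs_le.1 hd
    rw [e1, abs_le]; constructor <;> linarith [h3.1, h3.2]
  have h1 : (mainRow β η G t).1 ^ 2 ≤ 3 * p ^ 2 := by
    rw [← sq_abs]
    have h6 : |(mainRow β η G t).1| ^ 2 ≤ (3 / 2 * p) ^ 2 := by gcongr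
    have : 0 < p ^ 2 := by positivity
    linarith
  calc η / (1 - β) * (N * (mainRow β η G t).1 ^ 2) ≤ η / (1 - β) * (N * (3 * p ^ 2)) := by
        gcongr
    _ = 3 * (η / (1 - β)) * (N * p ^ 2) := by ring
    _ ≤ 3 * (η / (1 - β)) * (4 * ω) := by gcongr
    _ = 12 * (η / (1 - β) * ω) := by ring
    _ ≤ 1 := by linarith

lemma cross_le : N * |(mainRow β η G t).1| * ‖transversal u (mainRow β η G t).2‖
    ≤ 64 * ω * ε * Θ := by
  have hε := H.ε_pos
  have hN := H.N_pos
  have hΘ := H.one_le_Θ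
  have hNp := hI.upper
  have hp1 := hI.one_le
  have hb1 := (H.mainRow_bounds hτ hI).1
  have hκ := H.transversal_le hτ hI
  set p := growing u (mainRow β η G t)
  calc N * |(mainRow β η G t).1| * ‖transversal u (mainRow β η G t).2‖
      ≤ N * (2 * p) * (8 * ε * Θ * p) := by gcongr
    _ = 16 * ε * Θ * (N * p ^ 2) := by ring
    _ ≤ 16 * ε * Θ * (4 * ω) := by gcongr
    _ = _ := by ring

lemma resid_bounds (htT : t ≤ T) :
    |inner ℝ u (G t) - (ω - N * (growing u (mainRow β η G t) ^ 2
      - decaying u (mainRow β η G t) ^ 2) / 4)| ≤ ε ∧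
    ‖transversal u (G t)‖ ≤ 64 * ω * ε * Θ + ε ∧ ‖G t‖ ≤ 3 * ω := by
  have hN := H.N_pos
  have hη' : 0 < η / (1 - β) := div_pos H.η_pos H.one_sub_pos
  -- Only the statements about the residual are wanted here, so the step is taken without error.
  obtain ⟨s1, s2, -, -, -⟩ := planar_step H.hu (err := 0) (e := 0) hη'.le (H.resid_error hτ hI htT)
    (le_of_eq norm_zero) rfl hN.le (H.step_main_le hτ hI)
  have hcross := H.cross_le hτ hI
  have hGt : ‖transversal u (G t)‖ ≤ 64 * ω * ε * Θ + ε := by linarith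
  refine ⟨s1, hGt, ?_⟩
  have h1 := norm_le_decomp H.hu (G t)
  have h2 := abs_le.1 s1
  have h3 := H.decaying_sq_le hτ hI
  have hNp := hI.upper
  have h4 : 0 ≤ N * growing u (mainRow β η G t) ^ 2 := by positivity
  have h5 := H.hf₀
  have h6 := H.small'
  have h7 := H.ε_le
  have h8 := H.one_le_ω
  have h9 : 0 ≤ N * decaying u (mainRow β η G t) ^ 2 := by positivity
  have h6 : |inner ℝ u (G t)| ≤ 2 * ω := by
    rw [abs_le]; constructor <;> linarith [h2.1, h2.2]
  linarith

lemma row_step {x₀ : ℝ × E} (htT : t ≤ T)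
    (hv : ‖(rowMomentum β η G x₀ t).2‖
      ≤ 12 * η * ω / (1 - β) * ‖corrected β (rowMomentum β η G x₀ t)‖) :
    ‖(rowMomentum β η G x₀ (t + 1)).2‖
      ≤ 12 * η * ω / (1 - β) * ‖corrected β (rowMomentum β η G x₀ (t + 1))‖ ∧
    ∃ e : ℝ × E, ‖e‖ ≤ ε / 4 * ‖corrected β (rowMomentum β η G x₀ t)‖ ∧
      corrected β (rowMomentum β η G x₀ (t + 1)) = corrected β (rowMomentum β η G x₀ t)
        + (η / (1 - β)) • (rowOp (G t) (corrected β (rowMomentum β η G x₀ t)) + e) := by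
  have hu := H.one_sub_pos
  have hμeq : 12 * η * ω / (1 - β) * (1 - β) = 4 * η * (3 * ω) := by
    have := hu.ne'
    field_simp; ring
  obtain ⟨m1, -, err, herr, m3⟩ := momentum_step H.β_pos.le H.β_lt H.η_pos.le hμeq H.mom H.μ_nonneg
    (H.resid_bounds hτ hI htT).2.2 hv
  refine ⟨m1, err, herr.trans ?_, m3⟩
  have h1 := H.mom'
  have e : 3 * ω * (12 * η * ω / (1 - β)) / (1 - β) = 144 * η * ω ^ 2 / (1 - β) ^ 2 / 4 := by
    have := hu.ne'
    field_simp; ring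
  rw [e]
  gcongr

/-- The three sources of error, namely the residual, the momentum and the feedback of the
transversal part, are each at most a multiple of `ε` times the growing coordinate. For the last this
is the condition `small`. -/
lemma main_step (htT : t ≤ T) :
    |growing u (mainRow β η G (t + 1))
        - (1 + η / (1 - β) * inner ℝ u (G t)) * growing u (mainRow β η G t)|
      ≤ η / (1 - β) * (3 * ε * growing u (mainRow β η G t)) ∧
    |decaying u (mainRow β η G (t + 1))
        - (1 - η / (1 - β) * inner ℝ u (G t)) * decaying u (mainRow β η G t)|
      ≤ η / (1 - β) * (3 * ε * growing u (mainRow β η G t)) ∧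
    ‖transversal u (mainRow β η G (t + 1)).2‖ ≤ ‖transversal u (mainRow β η G t).2‖
      + η / (1 - β) * (3 * ε * growing u (mainRow β η G t)) := by
  have hN := H.N_pos
  have hε := H.ε_pos
  have hω := H.ω_pos
  have hΘ := H.one_le_Θ
  have hη' : 0 < η / (1 - β) := div_pos H.η_pos H.one_sub_pos
  obtain ⟨-, err, herr, hx⟩ := H.row_step hτ hI htT hI.vel
  change mainRow β η G (t + 1) = mainRow β η G t + (η / (1 - β)) • (rowOp (G t) (mainRow β η G t)
    + err) at hx
  have hb := H.mainRow_bounds hτ hI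
  have herr' : ‖err‖ ≤ ε / 2 * growing u (mainRow β η G t) := by
    refine herr.trans ?_
    have h1 : ε / 4 * ‖mainRow β η G t‖ ≤ ε / 4 * (2 * growing u (mainRow β η G t)) := by
      have := hb.2.2
      gcongr
    change ε / 4 * ‖mainRow β η G t‖ ≤ _
    linarith
  obtain ⟨-, -, s3, s4, s5⟩ := planar_step H.hu hη'.le (H.resid_error hτ hI htT) herr' hx hN.le
    (H.step_main_le hτ hI)
  have hp1 := hI.one_le
  have hκ := H.transversal_le hτ hI
  have hcross := H.cross_le hτ hI
  have hsmall := H.small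
  have hδ := H.δ_le
  set p := growing u (mainRow β η G t)
  have hεp : 0 < ε * p := by positivity
  have hcr2 : (N * |(mainRow β η G t).1| * ‖transversal u (mainRow β η G t).2‖ + ε)
      * ‖transversal u (mainRow β η G t).2‖ + 2 * (ε / 2 * p) ≤ 3 * ε * p := by
    have h1 : (N * |(mainRow β η G t).1| * ‖transversal u (mainRow β η G t).2‖ + ε)
      * ‖transversal u (mainRow β η G t).2‖ ≤ (64 * ω * ε * Θ + ε) * (8 * ε * Θ * p) := by gcongr
    have h2 : (64 * ω * ε * Θ + ε) * (8 * ε * Θ * p)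
        = (512 * ω * ε * Θ ^ 2 + 8 * ε * Θ) * (ε * p) := by ring
    have h3 : (512 * ω * ε * Θ ^ 2 + 8 * ε * Θ) * (ε * p) ≤ 1 * (ε * p) := by
      refine mul_le_mul_of_nonneg_right ?_ hεp.le
      linarith
    linarith
  refine ⟨s3.trans (mul_le_mul_of_nonneg_left hcr2 hη'.le),
    s4.trans (mul_le_mul_of_nonneg_left hcr2 hη'.le),
    s5.trans (add_le_add_right (mul_le_mul_of_nonneg_left ?_ hη'.le) _)⟩
  have : |(mainRow β η G t).1| * ε ≤ 2 * p * ε := mul_le_mul_of_nonneg_right hb.1 hε.le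
  linarith

end bounds

end SGDRun

end sgd

end DiagGeometry

namespace DiagGeometry

/-! ### Propagation of the invariants, stopping time and size of the rows for SGD+M. -/

section sgd

variable {E : Type*} [NormedAddCommGroup E] [InnerProductSpace ℝ E] {ι : Type*} [Fintype ι]

lemma norm_smul_add_bounds {F : Type*} [NormedAddCommGroup F] [NormedSpace ℝ F] {p z V : ℝ}
    (a r : F) (ha1 : p / 4 ≤ ‖a‖) (ha2 : ‖a‖ ≤ p) (hr : ‖r‖ ≤ p * (4 * V)) :
    p * (|z| / 4 - 4 * V) ≤ ‖z • a + r‖ ∧ ‖z • a + r‖ ≤ p * (|z| + 4 * V) := by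
  have h1 := norm_add_le (z • a) r
  have h2 := norm_sub_le (z • a + r) r
  rw [add_sub_cancel_right] at h2
  rw [norm_smul, Real.norm_eq_abs] at h1 h2
  have h3 : |z| * (p / 4) ≤ |z| * ‖a‖ := by gcongr
  have h4 : |z| * ‖a‖ ≤ |z| * p := by gcongr
  constructor <;> linarith

namespace SGDRun

variable {β η ω N ε f₀ Θ V₀ ν : ℝ} {T : ℕ} {u : E} {z : ι → ℝ} {v : ι → E} {G : ℕ → E}
  (H : SGDRun β η ω N ε f₀ Θ V₀ ν T u z v G)
include H

omit [Fintype ι] H in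
lemma mainRow_zero : mainRow β η G 0 = (1, (0 : E)) := by
  simp [mainRow, corrected, rowMomentum]

omit H in
lemma growing_mainRow_zero (u : E) : growing u (mainRow β η G 0) = 1 := by
  simp [mainRow_zero, growing]

lemma inv_zero : SGDInv β η ω N ε Θ u v G 0 where
  one_le := by simp [mainRow_zero, growing]
  upper := by
    have := H.hN; have := H.hf₀; have := H.one_le_ω
    simp [mainRow_zero, growing]; linarith
  decay := by simp [mainRow_zero, decaying]
  trans := by simp [mainRow_zero, transversal]
  rows i := by
    have : restRow β η G (v i) 0 = (0, v i) := by simp [restRow, corrected, rowMomentum]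
    rw [this, growing_mainRow_zero, Prod.norm_def]
    simp
  vel := by
    have := H.μ_nonneg
    have e : (rowMomentum β η G (1, 0) 0).2 = 0 := rfl
    rw [e, norm_zero]; positivity
  velRows i := by
    have := H.μ_nonneg
    have e : (rowMomentum β η G (0, v i) 0).2 = 0 := rfl
    rw [e, norm_zero]; positivity

lemma ε_le_f₀ : 64 * ε ≤ f₀ := by
  have h1 := H.small'
  have h2 : 1 ≤ ω * Θ := one_le_mul_of_one_le_of_one_le H.one_le_ω H.one_le_Θ
  have h3 := H.ε_pos
  nlinarith

lemma abs_add_step_le {a b τ p p' : ℝ} (ha : a ≤ b + 8 * ε * τ * p) (hp : p ≤ p') (hp0 : 0 ≤ p)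
    (hτ0 : 0 ≤ τ) : a + η / (1 - β) * (3 * ε * p) ≤ b + 8 * ε * (τ + η / (1 - β)) * p' := by
  have hη' : 0 < η / (1 - β) := div_pos H.η_pos H.one_sub_pos
  have hε := H.ε_pos
  have h1 : 8 * ε * (τ + η / (1 - β)) * p ≤ 8 * ε * (τ + η / (1 - β)) * p' := by gcongr
  have h2 : 0 ≤ η / (1 - β) * (5 * ε * p) := by positivity
  linarith

section succ

variable {t : ℕ} (hτ : η / (1 - β) * t ≤ Θ) (hI : SGDInv β η ω N ε Θ u v G t) (htT : t ≤ T)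
  (hf : f₀ ≤ ω - N * growing u (mainRow β η G t) ^ 2 / 4)
include hτ hI htT

lemma inner_le : inner ℝ u (G t) + 3 * ε ≤ 2 * ω := by
  have h1 := abs_le.1 (H.resid_bounds hτ hI htT).1
  have h2 := H.decaying_sq_le hτ hI
  have h3 := H.hf₀
  have h4 := H.ε_le
  have h5 := H.one_le_ω
  have h6 := H.N_pos
  have h7 : 0 ≤ N * growing u (mainRow β η G t) ^ 2 := by positivity
  linarith [h1.2]

lemma growing_succ_le : growing u (mainRow β η G (t + 1))
    ≤ (1 + 2 * (η / (1 - β) * ω)) * growing u (mainRow β η G t) := by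
  have h1 := (abs_le.1 (H.main_step hτ hI htT).1).2
  have h2 := H.inner_le hτ hI htT
  have hη' : 0 < η / (1 - β) := div_pos H.η_pos H.one_sub_pos
  have hp := hI.one_le
  have h3 : η / (1 - β) * growing u (mainRow β η G t) * (inner ℝ u (G t) + 3 * ε)
      ≤ η / (1 - β) * growing u (mainRow β η G t) * (2 * ω) := by gcongr
  linarith

include hf

lemma le_inner : f₀ / 2 ≤ inner ℝ u (G t) - 3 * ε := by
  have h1 := abs_le.1 (H.resid_bounds hτ hI htT).1
  have h6 := H.N_pos
  have h7 : 0 ≤ N * decaying u (mainRow β η G t) ^ 2 := by positivity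
  have := H.ε_le_f₀
  have := H.f₀_pos
  linarith [h1.1]

lemma le_growing_succ : (1 + η / (1 - β) * (inner ℝ u (G t) - 3 * ε))
    * growing u (mainRow β η G t) ≤ growing u (mainRow β η G (t + 1)) := by
  have h1 := (abs_le.1 (H.main_step hτ hI htT).1).1
  linarith

lemma le_growing_succ' : (1 + η / (1 - β) * (f₀ / 2))
    * growing u (mainRow β η G t) ≤ growing u (mainRow β η G (t + 1)) := by
  refine le_trans ?_ (H.le_growing_succ hτ hI htT hf)
  have h2 := H.le_inner hτ hI htT hf
  have hη' : 0 < η / (1 - β) := div_pos H.η_pos H.one_sub_pos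
  have hp := hI.one_le
  gcongr

lemma growing_mono_succ : growing u (mainRow β η G t) ≤ growing u (mainRow β η G (t + 1)) := by
  refine le_trans ?_ (H.le_growing_succ' hτ hI htT hf)
  have hη' : 0 < η / (1 - β) := div_pos H.η_pos H.one_sub_pos
  have hp := hI.one_le
  have hf0 := H.f₀_pos
  have : 0 ≤ η / (1 - β) * (f₀ / 2) * growing u (mainRow β η G t) := by positivity
  linarith

/-- Before the step `N p² ≤ 4 (ω - f₀)`, and the condition `step` makes the relative growth in one
step too small to cross the remaining gap `4 f₀`. -/
lemma upper_succ : N * growing u (mainRow β η G (t + 1)) ^ 2 ≤ 4 * ω := by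
  have h1 := H.growing_succ_le hτ hI htT
  have h2 := H.growing_mono_succ hτ hI htT hf
  have hp := hI.one_le
  have hN := H.N_pos
  have hst := H.step
  have hst' := H.step_mul_le
  have hω := H.ω_pos
  have hη' : 0 < η / (1 - β) := div_pos H.η_pos H.one_sub_pos
  have hf0 := H.f₀_pos
  set x := η / (1 - β) * ω with hx
  have hx0 : 0 < x := by positivity
  have hx2 : 6 * (ω * x) ≤ f₀ := by rw [hx]; linarith
  calc N * growing u (mainRow β η G (t + 1)) ^ 2
      ≤ N * ((1 + 2 * x) * growing u (mainRow β η G t)) ^ 2 := by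
        have := hp.trans h2
        gcongr
    _ = (N * growing u (mainRow β η G t) ^ 2) * (1 + 4 * x + 4 * x ^ 2) := by ring
    _ ≤ (4 * (ω - f₀)) * (1 + 4 * x + 4 * x ^ 2) :=
        mul_le_mul_of_nonneg_right (by linarith) (by positivity)
    _ = 4 * (ω - f₀) + 16 * (ω * x) + 16 * (ω * x) * x - 16 * f₀ * x * (1 + x) := by ring
    _ ≤ 4 * (ω - f₀) + 16 * (ω * x) + 16 * (ω * x) * (1 / 12) - 0 := by
        have : 0 ≤ 16 * f₀ * x * (1 + x) := by positivity
        gcongr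
    _ ≤ 4 * ω := by linarith

/-- A remainder grows at most by the factor `1 + η' ‖G‖`, and `‖G‖` exceeds the growth rate of the
main direction only by a multiple of `ω ε Θ`. Over the total time `Θ` this excess is absorbed by the
factor `1 + τ / Θ ≤ 2`. -/
lemma rows_succ (i : ι) : ‖restRow β η G (v i) (t + 1)‖
    ≤ ‖v i‖ * growing u (mainRow β η G (t + 1)) * (1 + η / (1 - β) * (t + 1 : ℕ) / Θ) := by
  obtain ⟨-, err, herr, hx⟩ := H.row_step hτ hI htT (hI.velRows i)
  change restRow β η G (v i) (t + 1) = restRow β η G (v i) t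
    + (η / (1 - β)) • (rowOp (G t) (restRow β η G (v i) t) + err) at hx
  change ‖err‖ ≤ ε / 4 * ‖restRow β η G (v i) t‖ at herr
  have hη' : 0 < η / (1 - β) := div_pos H.η_pos H.one_sub_pos
  have hε := H.ε_pos
  have hΘ := H.one_le_Θ
  have hω := H.ω_pos
  have h1 := H.le_growing_succ hτ hI htT hf
  have h2 := H.le_inner hτ hI htT hf
  have hf0 := H.f₀_pos
  have hr := hI.rows i
  have hp1 := hI.one_le
  set p := growing u (mainRow β η G t)
  set p' := growing u (mainRow β η G (t + 1))
  set ρ := restRow β η G (v i) t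
  set g : ℝ := inner ℝ u (G t)
  set η' := η / (1 - β)
  have hG : ‖G t‖ ≤ g + (64 * ω * ε * Θ + ε) := by
    have h3 := norm_le_decomp H.hu (G t)
    have h4 := (H.resid_bounds hτ hI htT).2.1
    change ‖G t‖ ≤ |g| + _ at h3
    rw [abs_of_nonneg (by linarith)] at h3
    linarith
  have h5 : ‖restRow β η G (v i) (t + 1)‖
      ≤ ‖ρ‖ * (1 + η' * (g + (64 * ω * ε * Θ + 2 * ε))) := by
    rw [hx]
    refine (norm_add_le _ _).trans ?_
    rw [norm_smul, Real.norm_of_nonneg hη'.le]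
    have h6 : ‖rowOp (G t) ρ + err‖ ≤ (g + (64 * ω * ε * Θ + 2 * ε)) * ‖ρ‖ := by
      refine (norm_add_le _ _).trans ?_
      have h7 := norm_rowOp_le (G t) ρ
      have h8 : ‖G t‖ * ‖ρ‖ ≤ (g + (64 * ω * ε * Θ + ε)) * ‖ρ‖ := by gcongr
      have h9 : 0 ≤ ε * ‖ρ‖ := by positivity
      linarith
    have h10 : η' * ‖rowOp (G t) ρ + err‖ ≤ η' * ((g + (64 * ω * ε * Θ + 2 * ε)) * ‖ρ‖) := by gcongr
    linarith
  have hτ0 : 0 ≤ η' * t := by positivity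
  have hτ1 : η' * t / Θ ≤ 1 := by rw [div_le_one (by linarith)]; exact hτ
  have e2 : η' * ((t + 1 : ℕ) : ℝ) / Θ = η' * t / Θ + η' / Θ := by push_cast; ring
  set σ := η' * t / Θ
  have hσ0 : 0 ≤ σ := by positivity
  have key : (1 + σ) * (1 + η' * (g + (64 * ω * ε * Θ + 2 * ε)))
      ≤ (1 + η' * (g - 3 * ε)) * (1 + (σ + η' / Θ)) := by
    have h11 : (1 + σ) * (η' * (64 * ω * ε * Θ + 5 * ε)) ≤ 2 * (η' * (64 * ω * ε * Θ + 5 * ε)) := by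
      gcongr; linarith
    have h12 : 2 * (η' * (64 * ω * ε * Θ + 5 * ε)) ≤ η' / Θ := by
      rw [le_div_iff₀ (by linarith)]
      have h13 : 2 * (64 * ω * ε * Θ + 5 * ε) * Θ ≤ 1 := by
        have := H.small
        have := H.δ_le
        linarith
      calc 2 * (η' * (64 * ω * ε * Θ + 5 * ε)) * Θ
          = η' * (2 * (64 * ω * ε * Θ + 5 * ε) * Θ) := by ring
        _ ≤ η' * 1 := by gcongr
        _ = η' := mul_one _
    have h14 : 0 ≤ η' * (g - 3 * ε) * (η' / Θ) := by
      have : 0 ≤ g - 3 * ε := by linarith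
      positivity
    linarith
  have h15 : 0 ≤ 1 + η' * (g + (64 * ω * ε * Θ + 2 * ε)) := by
    have : 0 ≤ g := by linarith
    positivity
  rw [e2]
  calc ‖restRow β η G (v i) (t + 1)‖ ≤ ‖ρ‖ * (1 + η' * (g + (64 * ω * ε * Θ + 2 * ε))) := h5
    _ ≤ ‖v i‖ * p * (1 + σ) * (1 + η' * (g + (64 * ω * ε * Θ + 2 * ε))) := by gcongr
    _ = ‖v i‖ * p * ((1 + σ) * (1 + η' * (g + (64 * ω * ε * Θ + 2 * ε)))) := by ring
    _ ≤ ‖v i‖ * p * ((1 + η' * (g - 3 * ε)) * (1 + (σ + η' / Θ))) := by gcongr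
    _ = ‖v i‖ * ((1 + η' * (g - 3 * ε)) * p) * (1 + (σ + η' / Θ)) := by ring
    _ ≤ ‖v i‖ * p' * (1 + (σ + η' / Θ)) := by
        have : 0 ≤ 1 + (σ + η' / Θ) := by positivity
        gcongr

lemma inv_succ : SGDInv β η ω N ε Θ u v G (t + 1) := by
  have hmono := H.growing_mono_succ hτ hI htT hf
  have hp1 := hI.one_le
  have hη' : 0 < η / (1 - β) := div_pos H.η_pos H.one_sub_pos
  have hτ0 : 0 ≤ η / (1 - β) * t := by positivity
  have e : η / (1 - β) * ((t + 1 : ℕ) : ℝ) = η / (1 - β) * t + η / (1 - β) := by push_cast; ring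
  obtain ⟨-, s2, s3⟩ := H.main_step hτ hI htT
  have hg1 := H.inner_le hτ hI htT
  have hg2 := H.le_inner hτ hI htT hf
  have hf0 := H.f₀_pos
  have hε := H.ε_pos
  refine ⟨hp1.trans hmono, H.upper_succ hτ hI htT hf, ?_, ?_, H.rows_succ hτ hI htT hf,
    (H.row_step hτ hI htT hI.vel).1, fun i => (H.row_step hτ hI htT (hI.velRows i)).1⟩
  · rw [e]
    refine le_trans ?_ (H.abs_add_step_le hI.decay hmono (by linarith) hτ0)
    have h1 : |1 - η / (1 - β) * inner ℝ u (G t)| ≤ 1 := by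
      have h2 : 0 ≤ η / (1 - β) * inner ℝ u (G t) := mul_nonneg hη'.le (by linarith)
      have h3 : η / (1 - β) * inner ℝ u (G t) ≤ η / (1 - β) * (2 * ω) := by gcongr; linarith
      have h4 := H.step_mul_le
      rw [abs_le]; constructor <;> linarith
    have h5 : |(1 - η / (1 - β) * inner ℝ u (G t)) * decaying u (mainRow β η G t)|
        ≤ 1 * |decaying u (mainRow β η G t)| := by rw [abs_mul]; gcongr
    have h6 := abs_add_le (decaying u (mainRow β η G (t + 1))
        - (1 - η / (1 - β) * inner ℝ u (G t)) * decaying u (mainRow β η G t))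
        ((1 - η / (1 - β) * inner ℝ u (G t)) * decaying u (mainRow β η G t))
    rw [sub_add_cancel] at h6
    linarith
  · rw [e]
    have h1 := hI.trans
    rw [← zero_add (8 * ε * _ * _)] at h1
    have := H.abs_add_step_le h1 hmono (by linarith) hτ0
    rw [zero_add] at this
    exact s3.trans this

end succ

/-- The phases of the run: at `t₂` the residual has become small, and up to then the invariants
hold. -/
lemma exists_time {n : ℕ} (hnT : n ≤ T) (hnΘ : η / (1 - β) * n ≤ Θ)
    (hn : 4 * ω < N * (1 + η / (1 - β) * (f₀ / 2)) ^ (2 * n)) :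
    ∃ t₁ t₂ : ℕ, t₁ ≤ t₂ ∧ t₂ ≤ n ∧ (∀ t ≤ t₂, SGDInv β η ω N ε Θ u v G t) ∧
      growing u (mainRow β η G t₁) ≤ 8 ∧
      (∀ t, t₁ ≤ t → t ≤ t₂ → 4 ≤ growing u (mainRow β η G t)) ∧
      ω - N * growing u (mainRow β η G t₂) ^ 2 / 4 < f₀ := by
  classical
  have hη' : 0 < η / (1 - β) := div_pos H.η_pos H.one_sub_pos
  have hN := H.N_pos
  have hf0 := H.f₀_pos
  have hτ : ∀ t ≤ n, η / (1 - β) * t ≤ Θ := fun t ht => by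
    refine le_trans ?_ hnΘ
    gcongr
  have hrun : ∀ m ≤ n, (∀ t < m, f₀ ≤ ω - N * growing u (mainRow β η G t) ^ 2 / 4) →
      ∀ t ≤ m, SGDInv β η ω N ε Θ u v G t := by
    intro m hm hfm t
    induction t with
    | zero => exact fun _ => H.inv_zero
    | succ t ih =>
      intro ht
      exact H.inv_succ (hτ t (by omega)) (ih (by omega)) (by omega) (hfm t (by omega))
  -- Otherwise the growing coordinate would increase geometrically for all `n` steps and violate its
  -- own upper bound.
  have hex : ∃ t, t ≤ n ∧ ω - N * growing u (mainRow β η G t) ^ 2 / 4 < f₀ := by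
    by_contra! hcon
    have hinv := hrun n le_rfl fun t ht => hcon t ht.le
    have hgrow : ∀ t ≤ n, (1 + η / (1 - β) * (f₀ / 2)) ^ t ≤ growing u (mainRow β η G t) := by
      intro t
      induction t with
      | zero => intro _; rw [growing_mainRow_zero]; simp
      | succ t ih =>
        intro ht
        refine le_trans ?_ (H.le_growing_succ' (hτ t (by omega)) (hinv t (by omega)) (by omega)
          (hcon t (by omega)))
        rw [pow_succ']
        have := ih (by omega)
        gcongr
    have h1 := hgrow n le_rfl
    have h2 := (hinv n le_rfl).upper
    have h3 : N * (1 + η / (1 - β) * (f₀ / 2)) ^ (2 * n)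
        ≤ N * growing u (mainRow β η G n) ^ 2 := by
      rw [mul_comm 2 n, pow_mul]
      gcongr
    linarith
  set t₂ := Nat.find hex with ht₂
  obtain ⟨ht₂n, hlast⟩ := Nat.find_spec hex
  have hbefore : ∀ t < t₂, f₀ ≤ ω - N * growing u (mainRow β η G t) ^ 2 / 4 := by
    intro t ht
    have := Nat.find_min hex ht
    by_contra! hc
    exact this ⟨by omega, hc⟩
  have hinv := hrun t₂ ht₂n hbefore
  have hmono1 : ∀ t < t₂, growing u (mainRow β η G t) ≤ growing u (mainRow β η G (t + 1)) :=
    fun t ht => H.growing_mono_succ (hτ t (by omega)) (hinv t ht.le) (by omega) (hbefore t ht)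
  have hmono : ∀ s t, s ≤ t → t ≤ t₂ →
      growing u (mainRow β η G s) ≤ growing u (mainRow β η G t) := by
    intro s t hst
    induction t, hst using Nat.le_induction with
    | base => exact fun _ => le_rfl
    | succ t _ ih => exact fun ht => (ih (by omega)).trans (hmono1 t (by omega))
  -- When the residual is below `f₀ ≤ 1 / 2`, `N p²` is of order `ω ≥ 1` while `N` is tiny, so `p`
  -- has passed `4` by then. From `4` on the growing coordinate dominates the decaying one.
  have hex4 : ∃ t, 4 ≤ growing u (mainRow β η G t) := by
    refine ⟨t₂, ?_⟩
    have h1 := (hinv t₂ le_rfl).one_le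
    have h2 := H.hf₀
    have h3 := H.hN
    have h4 := H.one_le_ω
    by_contra! hc
    have h5 : growing u (mainRow β η G t₂) ^ 2 ≤ 4 ^ 2 := by gcongr
    have h6 : N * growing u (mainRow β η G t₂) ^ 2 ≤ N * 4 ^ 2 := by gcongr
    change ω - N * growing u (mainRow β η G t₂) ^ 2 / 4 < f₀ at hlast
    linarith
  set t₁ := Nat.find hex4 with ht₁
  have h4 := Nat.find_spec hex4
  have ht12 : t₁ ≤ t₂ := by
    refine Nat.find_min' hex4 ?_
    obtain ⟨t, ht⟩ := hex4
    have h1 := (hinv t₂ le_rfl).one_le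
    have h2 := H.hf₀
    have h3 := H.hN
    have h4 := H.one_le_ω
    by_contra! hc
    have h5 : growing u (mainRow β η G t₂) ^ 2 ≤ 4 ^ 2 := by gcongr
    have h6 : N * growing u (mainRow β η G t₂) ^ 2 ≤ N * 4 ^ 2 := by gcongr
    change ω - N * growing u (mainRow β η G t₂) ^ 2 / 4 < f₀ at hlast
    linarith
  refine ⟨t₁, t₂, ht12, ht₂n, hinv, ?_, fun t ht htt => h4.trans (hmono _ _ ht htt), hlast⟩
  -- The growing coordinate starts at `1`, so there is a step before `t₁` with value below `4`; one
  -- step multiplies it by at most `7 / 6`.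
  have hpos : t₁ ≠ 0 := by
    intro h0
    have h5 : 4 ≤ growing u (mainRow β η G t₁) := h4
    rw [h0, growing_mainRow_zero] at h5
    norm_num at h5
  obtain ⟨s, hs⟩ := Nat.exists_eq_succ_of_ne_zero hpos
  have h5 : growing u (mainRow β η G s) < 4 := by
    by_contra! hc
    exact Nat.find_min hex4 (m := s) (by omega) hc
  have h6 := H.growing_succ_le (hτ s (by omega)) (hinv s (by omega)) (by omega)
  have h7 := H.step_mul_le
  have h8 := (hinv s (by omega)).one_le
  rw [hs]
  have h9 : (1 + 2 * (η / (1 - β) * ω)) * growing u (mainRow β η G s)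
      ≤ (1 + 2 * (1 / 12)) * 4 := by gcongr
  linarith

section output

variable {t : ℕ} (hτ : η / (1 - β) * t ≤ Θ) (hI : SGDInv β η ω N ε Θ u v G t)
include hτ hI

/-- While `p ≤ 8` the product of the layers is at most of order `N`, negligible against `ω`, so the
loss is still of order `ω²`. -/
lemma norm_resid_early (hp : growing u (mainRow β η G t) ≤ 8) :
    |‖ω • u - ∑ i, (rowMomentum β η G (z i, v i) t).1.1 •
      (rowMomentum β η G (z i, v i) t).1.2‖ - ω| ≤ ω / 2 := by
  have h1 := H.product_error hτ hI
  have h2 := H.main_product_le hτ hI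
  have h3 := hI.one_le
  have hω := H.one_le_ω
  have hN := H.N_pos
  set P := ∑ i, (rowMomentum β η G (z i, v i) t).1.1 • (rowMomentum β η G (z i, v i) t).1.2
  set M := (N * (mainRow β η G t).1) • (mainRow β η G t).2
  have h4 : N * growing u (mainRow β η G t) ^ 2 ≤ N * 8 ^ 2 := by gcongr
  have h5 := norm_add_le (P - M) M
  rw [sub_add_cancel] at h5
  have hu' : ‖ω • u‖ = ω := by rw [norm_smul, H.hu, Real.norm_of_nonneg H.ω_pos.le, mul_one]
  have h6 := abs_norm_sub_norm_le (ω • u - P) (ω • u)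
  rw [sub_sub_cancel_left, norm_neg, hu'] at h6
  have := H.hN
  have := H.hf₀
  have := H.ε_le
  linarith

/-- At the stopping time the component of the residual along `u` is below `f₀` up to small terms,
and it is not too negative because `N p² ≤ 4 ω`. The transversal part is bounded by `cross_le`. -/
lemma norm_resid_late (hlast : ω - N * growing u (mainRow β η G t) ^ 2 / 4 < f₀) :
    ‖ω • u - ∑ i, (rowMomentum β η G (z i, v i) t).1.1 •
      (rowMomentum β η G (z i, v i) t).1.2‖ ≤ 3 * f₀ := by
  have h1 := H.product_error hτ hI
  have hN := H.N_pos
  have hη' : 0 < η / (1 - β) := div_pos H.η_pos H.one_sub_pos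
  set P := ∑ i, (rowMomentum β η G (z i, v i) t).1.1 • (rowMomentum β η G (z i, v i) t).1.2
  set M := (N * (mainRow β η G t).1) • (mainRow β η G t).2 with hM
  obtain ⟨s1, s2, -, -, -⟩ := planar_step H.hu (G := ω • u - M) (ε := 0) (err := 0) (e := 0) hη'.le
    (by rw [hM, sub_self, norm_zero]) (le_of_eq norm_zero) rfl hN.le (H.step_main_le hτ hI)
  have h2 := H.cross_le hτ hI
  have h3 := H.decaying_sq_le hτ hI
  have h4 := abs_le.1 s1
  have h5 := hI.upper
  have h6 := H.small'
  have h7 := H.ε_le_f₀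
  have h8 := H.f₀_pos
  have h9 : 0 ≤ N * decaying u (mainRow β η G t) ^ 2 := by positivity
  have h10 : |inner ℝ u (ω • u - M)| ≤ f₀ + f₀ / 256 := by
    rw [abs_le]; constructor <;> linarith [h4.1, h4.2]
  have h11 := norm_le_decomp H.hu (ω • u - M)
  have h12 := norm_sub_le (ω • u - M) (P - M)
  have e : ω • u - M - (P - M) = ω • u - P := by abel
  rw [e] at h12
  linarith

/-- In the second phase every row is close to a fixed multiple of its initial entry of the second
layer. -/
lemma row_bounds (hp : 4 ≤ growing u (mainRow β η G t)) (i : ι) :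
    (growing u (mainRow β η G t) * (|z i| / 4 - 4 * V₀) ≤ |(rowMomentum β η G (z i, v i) t).1.1| ∧
      |(rowMomentum β η G (z i, v i) t).1.1| ≤ growing u (mainRow β η G t) * (|z i| + 4 * V₀)) ∧
    (growing u (mainRow β η G t) * (|z i| / 4 - 4 * V₀) ≤ ‖(rowMomentum β η G (z i, v i) t).1.2‖ ∧
      ‖(rowMomentum β η G (z i, v i) t).1.2‖
        ≤ growing u (mainRow β η G t) * (|z i| + 4 * V₀)) := by
  obtain ⟨hd, hρ⟩ := H.position_bounds hτ hI
  have hδ := H.eτ_le hτ hI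
  have h2 := hI.decay
  have h3 := hI.trans
  have hμ := H.μ_div_le
  have hv : ‖v i‖ ≤ V₀ := by
    refine abs_le_of_sq_le_sq' ?_ H.V₀_nonneg |>.2
    exact (Finset.single_le_sum (f := fun i => ‖v i‖ ^ 2) (fun i _ => by positivity)
      (Finset.mem_univ i)).trans H.sum_v
  rw [H.row_eq i t]
  have e1 : (mainRow β η G t).1
      = (growing u (mainRow β η G t) + decaying u (mainRow β η G t)) / 2 := by
    unfold growing decaying; ring
  have e2 : inner ℝ u (mainRow β η G t).2
      = (growing u (mainRow β η G t) - decaying u (mainRow β η G t)) / 2 := by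
    unfold growing decaying; ring
  set p := growing u (mainRow β η G t)
  set q := decaying u (mainRow β η G t)
  set φ := (rowMomentum β η G (1, 0) t).1 with hφ
  set φh := mainRow β η G t with hφh
  have hr := hρ i
  set ρ := (rowMomentum β η G (0, v i) t).1 with hρdef
  have hp0 : 0 < p := by linarith
  have h5 : 8 * ε * (η / (1 - β) * t) * p ≤ 1 / 128 * p := by gcongr
  have h6 := abs_le.1 h2
  have h7 : 12 * η * ω / (1 - β) / (1 - β) * (2 * p) ≤ 1 / 96 * (2 * p) := by gcongr
  have hd1 : |φ.1 - φh.1| ≤ p / 48 := ((norm_fst_le (φ - φh)).trans hd).trans (by linarith)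
  have hd2 : ‖φ.2 - φh.2‖ ≤ p / 48 := ((norm_snd_le (φ - φh)).trans hd).trans (by linarith)
  have hr' : ‖ρ‖ ≤ p * (4 * V₀) := by
    have : 4 * p * ‖v i‖ ≤ 4 * p * V₀ := by gcongr
    linarith
  -- The second-layer entry is half the sum, and its partner along `u` half the difference, of the
  -- growing and decaying coordinates. With `p ≥ 4` and `|q| ≤ 1 + p / 128`, both exceed `p / 4`
  -- even after the momentum correction.
  have hφ1 : p / 4 ≤ |φ.1| ∧ |φ.1| ≤ p := by
    have h8 := abs_le.1 hd1
    rw [e1] at h8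
    rw [abs_of_nonneg (by linarith [h8.1, h6.1])]
    constructor <;> linarith [h8.1, h8.2, h6.1, h6.2]
  have hφ2 : p / 4 ≤ ‖φ.2‖ ∧ ‖φ.2‖ ≤ p := by
    have h8 := norm_le_decomp H.hu φh.2
    have h9 := abs_inner_unit_le H.hu φh.2
    rw [e2, abs_of_nonneg (by linarith)] at h8 h9
    have h10 := norm_add_le (φ.2 - φh.2) φh.2
    have h11 := norm_sub_le φ.2 (φ.2 - φh.2)
    rw [sub_add_cancel] at h10
    rw [sub_sub_cancel] at h11
    constructor <;> linarith [h6.1, h6.2]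
  exact ⟨norm_smul_add_bounds φ.1 ρ.1 hφ1.1 hφ1.2 ((norm_fst_le ρ).trans hr'),
    norm_smul_add_bounds φ.2 ρ.2 hφ2.1 hφ2.2 ((norm_snd_le ρ).trans hr')⟩

end output

end SGDRun

end sgd

end DiagGeometry

namespace DiagGeometry

/-! ### From rows of the network to the Hessian ratios under SGD+M. -/

section sgdNetwork

variable {d m : ℕ}

/-- A vector of coordinates as a point of Euclidean space. -/
abbrev toE (x : Fin d → ℝ) : EuclideanSpace ℝ (Fin d) := WithLp.toLp 2 x

/-- The `i`-th hidden unit: its weight in the second layer and its row of the first one. -/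
def rowOf (w : Params d) (i : Fin d) : ℝ × EuclideanSpace ℝ (Fin d) :=
  (w (Sum.inr i), toE fun j => w (Sum.inl (i, j)))

lemma rowOf_add (w w' : Params d) (i : Fin d) : rowOf (w + w') i = rowOf w i + rowOf w' i := rfl

lemma rowOf_smul (a : ℝ) (w : Params d) (i : Fin d) : rowOf (a • w) i = a • rowOf w i := rfl

lemma rowOf_grad {b : ℕ} (X : Matrix (Fin d) (Fin b) ℝ) (Y : Fin b → ℝ) (w : Params d)
    (i : Fin d) : rowOf (grad (loss X Y) w) i = -rowOp (toE (negResid X Y w)) (rowOf w i) := by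
  ext1
  · change grad (loss X Y) w (Sum.inr i) = -inner ℝ (toE (negResid X Y w)) (rowOf w i).2
    rw [grad_loss_inr, PiLp.inner_apply]
    simp [rowOf, mul_comm]
  · change (rowOf (grad (loss X Y) w) i).2 = -((rowOf w i).1 • toE (negResid X Y w))
    ext j
    simp [rowOf, grad_loss_inl]

lemma toE_endToEnd (w : Params d) : toE (endToEnd w) = ∑ i, (rowOf w i).1 • (rowOf w i).2 := by
  ext j
  simp [rowOf, endToEnd_apply]

lemma lossBar_eq_norm (A : Fin d → ℝ) (w : Params d) :
    lossBar A w = 1 / 2 * ‖toE A - toE (endToEnd w)‖ ^ 2 := by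
  rw [EuclideanSpace.norm_sq_eq, lossBar]
  congr 1
  refine Finset.sum_congr rfl fun j _ => ?_
  simp only [PiLp.sub_apply, Real.norm_eq_abs, sq_abs]
  ring

lemma norm_toE_sq (x : Fin d → ℝ) : ‖toE x‖ ^ 2 = ∑ j, x j ^ 2 := by
  rw [EuclideanSpace.norm_sq_eq]; simp

lemma sum_abs_le_norm (x : Fin d → ℝ) : ∑ j, |x j| ≤ √d * ‖toE x‖ := by
  have h := Real.sum_mul_le_sqrt_mul_sqrt Finset.univ (fun _ => (1 : ℝ)) fun j => |x j|
  simp only [one_mul, sq_abs, one_pow, Finset.sum_const, Finset.card_univ, Fintype.card_fin,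
    nsmul_eq_mul, mul_one] at h
  rwa [← norm_toE_sq, Real.sqrt_sq (norm_nonneg _)] at h

lemma norm_toE_le {x : Fin d → ℝ} {c : ℝ} (hc : 0 ≤ c) (h : ∀ j, |x j| ≤ c) :
    ‖toE x‖ ≤ √d * c := by
  refine abs_le_of_sq_le_sq' ?_ (by positivity) |>.2
  rw [norm_toE_sq, mul_pow, Real.sq_sqrt (Nat.cast_nonneg d)]
  calc ∑ j, x j ^ 2 ≤ ∑ _j : Fin d, c ^ 2 := by
        refine Finset.sum_le_sum fun j _ => ?_
        rw [← sq_abs]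
        have := h j
        gcongr
    _ = _ := by simp

lemma norm_negResid_sub_le {b : ℕ} {X : Matrix (Fin d) (Fin b) ℝ} {Y : Fin b → ℝ}
    {A : Fin d → ℝ} {ν : ℝ} (hν : 0 ≤ ν)
    (hΛ : ∀ i j, |covXX X i j - (1 : Matrix (Fin d) (Fin d) ℝ) i j| ≤ ν)
    (hA : ∀ j, |corrYX X Y j - A j| ≤ ν) (w : Params d) :
    ‖toE (negResid X Y w) - (toE A - toE (endToEnd w))‖ ≤ d * ν * (1 + ‖toE (endToEnd w)‖) := by
  have h1 : toE (negResid X Y w) - (toE A - toE (endToEnd w))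
      = toE fun j => negResid X Y w j - (A j - endToEnd w j) := rfl
  have h2 := sum_abs_le_norm (endToEnd w)
  have hd : √(d : ℝ) ≤ d := by
    rcases Nat.eq_zero_or_pos d with h | h
    · simp [h]
    · have : (1 : ℝ) ≤ d := by exact_mod_cast h
      rw [Real.sqrt_le_left (by linarith)]
      nlinarith
  rw [h1]
  refine (norm_toE_le (c := ν * (1 + √d * ‖toE (endToEnd w)‖)) (by positivity) fun j =>
    (abs_negResid_sub_le hΛ hA w j).trans (by gcongr)).trans ?_
  have e : √(d : ℝ) * (ν * (1 + √d * ‖toE (endToEnd w)‖))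
      = √d * ν + (√d * √d) * ν * ‖toE (endToEnd w)‖ := by ring
  rw [e, Real.mul_self_sqrt (Nat.cast_nonneg d)]
  have : √(d : ℝ) * ν ≤ d * ν := by gcongr
  linarith

/-- Each hidden unit follows the abstract row dynamics. Its residuals depend on all the weights, but
they are the same for every unit, so linearity applies. The velocity is the momentum buffer times
`-η`. -/
lemma rowOf_sgdm {b : ℕ} (β η : ℝ) (X : Matrix (Fin d) (Fin m) ℝ) (Y : Fin m → ℝ)
    (B : ℕ → Fin b → Fin m) (w₀ : Params d) (i : Fin d) (t : ℕ) :
    let g := fun t => batchGrad X Y (B t)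
    let G := fun t => toE (negResid (batchX X (B t)) (batchY Y (B t)) (sgdm β η g w₀ t))
    (rowOf (sgdm β η g w₀ t) i, (-η) • rowOf (sgdmState β η g w₀ t).2 i)
      = rowMomentum β η G (rowOf w₀ i) t := by
  intro g G
  induction t with
  | zero =>
    have : rowOf (0 : Params d) i = 0 := rfl
    simp [sgdm, sgdmState, rowMomentum, this]
  | succ t ih =>
    have hg : rowOf (g t (sgdm β η g w₀ t)) i = -rowOp (G t) (rowOf (sgdm β η g w₀ t) i) :=
      rowOf_grad _ _ _ i
    have hu : (sgdmState β η g w₀ (t + 1)).2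
        = β • (sgdmState β η g w₀ t).2 + g t (sgdm β η g w₀ t) := rfl
    have hw : sgdm β η g w₀ (t + 1)
        = sgdm β η g w₀ t + (-η) • (sgdmState β η g w₀ (t + 1)).2 := by
      rw [neg_smul, ← sub_eq_add_neg]; rfl
    have hvel : (-η) • rowOf (sgdmState β η g w₀ (t + 1)).2 i
        = β • ((-η) • rowOf (sgdmState β η g w₀ t).2 i)
          + η • rowOp (G t) (rowOf (sgdm β η g w₀ t) i) := by
      rw [hu, rowOf_add, rowOf_smul, hg]; module
    rw [hw, rowOf_add, rowOf_smul, hvel, rowMomentum, ← ih]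

lemma card_filter_fst_prod (P : Fin d → Prop) [DecidablePred P] :
    (Finset.univ.filter fun ij : Fin d × Fin d => P ij.1).card
      = (Finset.univ.filter P).card * d := by
  have : (Finset.univ.filter fun ij : Fin d × Fin d => P ij.1)
      = (Finset.univ.filter P) ×ˢ (Finset.univ : Finset (Fin d)) := by
    ext ⟨i, j⟩; simp
  rw [this, Finset.card_product, Finset.card_univ, Fintype.card_fin]

/-- If the diagonal is comparable to the squares of widely spread numbers, its ratio is large. -/
lemma ratio_lower {ι : Type*} [Fintype ι] {D : ι → ℝ} {y z : ι → ℝ} {p s l V : ℝ} (hp : 0 < p)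
    (hs : 0 < s) (hV : V ≤ s / 1000) (hl : 1 ≤ l) (hD : ∀ i, D i = y i ^ 2) (hy : ∀ i, 0 ≤ y i)
    (hyl : ∀ i, p * (|z i| / 4 - 4 * V) ≤ y i) (hyu : ∀ i, y i ≤ p * (|z i| + 4 * V))
    (hlow : 2 * (Finset.univ.filter fun i => |z i| < s / 10).card < Fintype.card ι)
    (hup : 2 * (Finset.univ.filter fun i => 10 * s < |z i|).card < Fintype.card ι)
    {i₀ : ι} (hi₀ : l * s ≤ |z i₀|) : (l / 55) ^ 2 ≤ maxOverMedian D := by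
  have habs : ∀ i, |D i| = y i ^ 2 := fun i => by rw [hD, abs_of_nonneg (by positivity)]
  have h1 : (p * s * l / 5) ^ 2 ≤ |D i₀| := by
    rw [habs]
    have h2 := hyl i₀
    have h3 : p * (s * l / 5) ≤ p * (|z i₀| / 4 - 4 * V) := by
      have : s ≤ l * s := le_mul_of_one_le_left hs.le hl
      gcongr
      linarith
    have h4 : p * s * l / 5 ≤ y i₀ := by linarith
    gcongr
  -- The `11` comes from `10 s + 4 V` and the `1 / 50` from `(s / 10) / 4 - 4 V`. With the `5` for
  -- the outlier this makes `55`.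
  have h2 := le_maxOverMedian (D := D) (B := (11 * p * s) ^ 2) (b := (p * s / 50) ^ 2)
    (by positivity) h1 (by
      refine lt_of_le_of_lt ?_ hup
      refine Nat.mul_le_mul_left 2 (Finset.card_le_card ?_)
      intro i hi
      simp only [Finset.mem_filter, Finset.mem_univ, true_and] at hi ⊢
      rw [habs] at hi
      have h3 := abs_lt_of_sq_lt_sq hi (hy i)
      rw [abs_of_pos (by positivity)] at h3
      have h4 : p * (11 * s) < p * (|z i| + 4 * V) := by linarith [hyu i]
      have h5 := lt_of_mul_lt_mul_left h4 hp.le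
      linarith) (by
      refine lt_of_le_of_lt ?_ hlow
      refine Nat.mul_le_mul_left 2 (Finset.card_le_card ?_)
      intro i hi
      simp only [Finset.mem_filter, Finset.mem_univ, true_and] at hi ⊢
      rw [habs] at hi
      have h3 := abs_lt_of_sq_lt_sq hi (by positivity)
      rw [abs_of_nonneg (hy i)] at h3
      have h4 : p * (|z i| / 4 - 4 * V) < p * (s / 50) := by linarith [hyl i]
      have h5 := lt_of_mul_lt_mul_left h4 hp.le
      linarith)
  have e : (p * s * l / 5) ^ 2 / (11 * p * s) ^ 2 = (l / 55) ^ 2 := by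
    rw [← div_pow]
    congr 1
    field_simp
    norm_num
  rwa [e] at h2

/-- Gradient descent with momentum from a small initialization whose entries in the second layer
are spread keeps the diagonal of the Hessian non-uniform. -/
theorem sgdm_nonuniform {b : ℕ} {X : Matrix (Fin d) (Fin m) ℝ} {Y : Fin m → ℝ}
    (hX : covXX X = 1) {B : ℕ → Fin b → Fin m} {w₀ : Params d} {β η ε f₀ Θ V₀ ν s l : ℝ} {n : ℕ}
    (hν : 0 ≤ ν)
    (hP : SGDParams β η ‖toE (corrYX X Y)‖ (∑ i, w₀ (Sum.inr i) ^ 2) ε f₀ Θ V₀ (d * ν))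
    (hV : ∑ i, ∑ j, w₀ (Sum.inl (i, j)) ^ 2 ≤ V₀ ^ 2)
    (hnΘ : η / (1 - β) * n ≤ Θ)
    (hn : 4 * ‖toE (corrYX X Y)‖
      < (∑ i, w₀ (Sum.inr i) ^ 2) * (1 + η / (1 - β) * (f₀ / 2)) ^ (2 * n))
    (hΛ : ∀ t ≤ n, ∀ i j, |covXX (batchX X (B t)) i j - covXX X i j| ≤ ν)
    (hA : ∀ t ≤ n, ∀ j, |corrYX (batchX X (B t)) (batchY Y (B t)) j - corrYX X Y j| ≤ ν)
    (hs : 0 < s) (hVs : V₀ ≤ s / 1000) (hl : 1 ≤ l)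
    (hlow : 2 * (Finset.univ.filter fun i => |w₀ (Sum.inr i)| < s / 10).card < d)
    (hup : 2 * (Finset.univ.filter fun i => 10 * s < |w₀ (Sum.inr i)|).card < d)
    {i₀ : Fin d} (hi₀ : l * s ≤ |w₀ (Sum.inr i₀)|) :
    ∃ t₁ t₂ : ℕ, t₁ ≤ t₂ ∧
      let W := sgdm β η (fun t => batchGrad X Y (B t)) w₀
      (‖toE (corrYX X Y)‖ ^ 2 / 8 ≤ lossBar (corrYX X Y) (W t₁) ∧
        lossBar (corrYX X Y) (W t₁) ≤ 2 * ‖toE (corrYX X Y)‖ ^ 2) ∧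
      lossBar (corrYX X Y) (W t₂) ≤ 5 * f₀ ^ 2 ∧
      ∀ t ∈ Set.Icc t₁ t₂, (l / 55) ^ 2 ≤ RMed1 (loss X Y) (W t) ∧
        (l / 55) ^ 2 ≤ RMed2 (loss X Y) (W t) := by
  set W := sgdm β η (fun t => batchGrad X Y (B t)) w₀ with hW
  set ω := ‖toE (corrYX X Y)‖ with hω
  set u := ω⁻¹ • toE (corrYX X Y) with hu
  set G := fun t => toE (negResid (batchX X (B t)) (batchY Y (B t)) (W t)) with hG
  set z : Fin d → ℝ := fun i => w₀ (Sum.inr i)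
  set v : Fin d → EuclideanSpace ℝ (Fin d) := fun i => toE fun j => w₀ (Sum.inl (i, j)) with hv
  have hω1 := hP.one_le_ω
  have hωu : ω • u = toE (corrYX X Y) := by
    rw [hu, smul_smul, mul_inv_cancel₀ (by linarith), one_smul]
  have hrow : ∀ t i, (rowMomentum β η G (z i, v i) t).1 = rowOf (W t) i := fun t i =>
    (congrArg Prod.fst (rowOf_sgdm β η X Y B w₀ i t)).symm
  have hprod : ∀ t, ∑ i, (rowMomentum β η G (z i, v i) t).1.1 •
      (rowMomentum β η G (z i, v i) t).1.2 = toE (endToEnd (W t)) := fun t => by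
    rw [toE_endToEnd]
    exact Finset.sum_congr rfl fun i _ => by rw [hrow]
  have H : SGDRun β η ω (∑ i, w₀ (Sum.inr i) ^ 2) ε f₀ Θ V₀ (d * ν) n u z v G :=
    { hP with
      hu := by rw [hu, norm_smul, norm_inv, norm_norm, inv_mul_cancel₀ (by rw [← hω]; linarith)]
      sum_z := rfl
      sum_v := by
        simp only [hv, norm_toE_sq]
        exact hV
      resid := fun t ht => by
        rw [hprod, hωu]
        refine norm_negResid_sub_le hν (fun i j => ?_) (hA t ht) (W t)
        rw [← hX]
        exact hΛ t ht i j }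
  obtain ⟨t₁, t₂, h12, ht₂n, hinv, hp8, hp4, hlast⟩ := H.exists_time le_rfl hnΘ hn
  have hτ : ∀ t ≤ t₂, η / (1 - β) * t ≤ Θ := fun t ht => by
    refine le_trans ?_ hnΘ
    have := H.η_pos
    have := H.one_sub_pos
    gcongr
    exact ht.trans ht₂n
  refine ⟨t₁, t₂, h12, ?_, ?_, ?_⟩
  · have h1 := abs_le.1 (H.norm_resid_early (hτ t₁ h12) (hinv t₁ h12) hp8)
    rw [hprod, hωu] at h1
    rw [lossBar_eq_norm]
    have h2 : ω / 2 ≤ ‖toE (corrYX X Y) - toE (endToEnd (W t₁))‖ := by linarith [h1.1]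
    have h3 : ‖toE (corrYX X Y) - toE (endToEnd (W t₁))‖ ≤ 2 * ω := by linarith [h1.2]
    have h4 : (ω / 2) ^ 2 ≤ ‖toE (corrYX X Y) - toE (endToEnd (W t₁))‖ ^ 2 := by gcongr
    have h5 : ‖toE (corrYX X Y) - toE (endToEnd (W t₁))‖ ^ 2 ≤ (2 * ω) ^ 2 := by gcongr
    constructor <;> linarith
  · have h1 := H.norm_resid_late (hτ t₂ le_rfl) (hinv t₂ le_rfl) hlast
    rw [hprod, hωu] at h1
    rw [lossBar_eq_norm]
    have h2 : ‖toE (corrYX X Y) - toE (endToEnd (W t₂))‖ ^ 2 ≤ (3 * f₀) ^ 2 := by gcongr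
    have h3 : 0 ≤ f₀ ^ 2 := by positivity
    linarith
  · intro t ht
    have hp := hp4 t ht.1 ht.2
    have hb := H.row_bounds (hτ t ht.2) (hinv t ht.2) hp
    have hp0 : 0 < growing u (mainRow β η G t) := by linarith
    have hd : Fintype.card (Fin d) = d := Fintype.card_fin d
    have hdpos : 0 < d := by omega
    simp only [hrow] at hb
    constructor
    · refine ratio_lower (D := fun ij : Fin d × Fin d => hessDiag (loss X Y) (W t) (Sum.inl ij))
        (y := fun ij => |W t (Sum.inr ij.1)|) (z := fun ij => z ij.1) hp0 hs hVs hl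
        (fun ij => ?_) (fun ij => abs_nonneg _) (fun ij => (hb ij.1).1.1) (fun ij => (hb ij.1).1.2)
        ?_ ?_ (i₀ := (i₀, i₀)) hi₀
      · rw [hessDiag_loss_inl hX, sq_abs]
      · rw [card_filter_fst_prod fun i => |z i| < s / 10, Fintype.card_prod, hd, ← mul_assoc]
        exact Nat.mul_lt_mul_of_pos_right hlow hdpos
      · rw [card_filter_fst_prod fun i => 10 * s < |z i|, Fintype.card_prod, hd, ← mul_assoc]
        exact Nat.mul_lt_mul_of_pos_right hup hdpos
    · refine ratio_lower (D := fun i : Fin d => hessDiag (loss X Y) (W t) (Sum.inr i))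
        (y := fun i => ‖(rowOf (W t) i).2‖) (z := z) hp0 hs hVs hl
        (fun i => ?_) (fun i => norm_nonneg _) (fun i => (hb i).2.1) (fun i => (hb i).2.2)
        (by rw [hd]; exact hlow) (by rw [hd]; exact hup) hi₀
      rw [hessDiag_loss_inr hX, rowOf, norm_toE_sq]

end sgdNetwork

end DiagGeometry

namespace DiagGeometry

/-! ### Estimates for Gaussian variables -/

section gaussian

variable {Ω : Type*} [MeasurableSpace Ω] {μ : Measure Ω} [IsProbabilityMeasure μ]

lemma measureReal_le_of_markov {f : Ω → ℝ} (hf : Integrable (fun ω => f ω ^ 2) μ) {c V : ℝ}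
    (hc : 0 < c) (hV : ∫ ω, f ω ^ 2 ∂μ ≤ V) : μ.real {ω | c ≤ |f ω|} ≤ V / c ^ 2 := by
  have h1 := mul_meas_ge_le_integral_of_nonneg (μ := μ) (f := fun ω => f ω ^ 2)
    (Filter.Eventually.of_forall fun ω => sq_nonneg (f ω)) hf (c ^ 2)
  have h2 : {ω | c ^ 2 ≤ f ω ^ 2} = {ω | c ≤ |f ω|} := by
    ext ω
    simp only [Set.mem_setOf_eq]
    rw [← sq_abs (f ω), pow_le_pow_iff_left₀ hc.le (abs_nonneg _) two_ne_zero]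
  rw [h2] at h1
  rw [le_div_iff₀ (by positivity), mul_comm]
  exact h1.trans hV

variable {s : ℝ} (hs : 0 < s) {X : Ω → ℝ} (hX : Measurable X)
  (hlaw : μ.map X = gaussianReal 0 (s ^ 2).toNNReal)
include hs

lemma gaussianPDFReal_eq (x : ℝ) : gaussianPDFReal 0 (s ^ 2).toNNReal x
    = (√(2 * Real.pi))⁻¹ * s⁻¹ * Real.exp (-x ^ 2 / (2 * s ^ 2)) := by
  rw [gaussianPDFReal, Real.coe_toNNReal _ (by positivity), Real.sqrt_mul (by positivity),
    Real.sqrt_sq hs.le, mul_inv, sub_zero]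

lemma toNNReal_sq_ne_zero : (s ^ 2).toNNReal ≠ 0 := by
  rw [ne_eq, Real.toNNReal_eq_zero, not_le]; positivity

include hX hlaw

lemma measure_preimage_gaussian {S : Set ℝ} (hS : MeasurableSet S) :
    μ (X ⁻¹' S) = ∫⁻ x in S, gaussianPDF 0 (s ^ 2).toNNReal x := by
  rw [← Measure.map_apply hX hS, hlaw, gaussianReal_apply 0 (toNNReal_sq_ne_zero hs)]

/-- The density is at most `1 / (2s)`, and the interval has length `2t`. -/
lemma measureReal_abs_lt_le {t : ℝ} (ht : 0 ≤ t) : μ.real {ω | |X ω| < t} ≤ t / s := by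
  have e : {ω | |X ω| < t} = X ⁻¹' (Metric.ball 0 t) := by
    ext ω; simp
  have h1 : μ {ω | |X ω| < t} ≤ ENNReal.ofReal (t / s) := by
    rw [e, measure_preimage_gaussian hs hX hlaw measurableSet_ball]
    calc ∫⁻ x in Metric.ball 0 t, gaussianPDF 0 (s ^ 2).toNNReal x
        ≤ ∫⁻ _x in Metric.ball (0 : ℝ) t, ENNReal.ofReal (2⁻¹ * s⁻¹) := by
          refine lintegral_mono fun x => ?_
          rw [gaussianPDF, gaussianPDFReal_eq hs]
          refine ENNReal.ofReal_le_ofReal ?_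
          have h2 : (2 : ℝ) ≤ √(2 * Real.pi) := by
            rw [Real.le_sqrt (by norm_num) (by positivity)]
            linarith [Real.pi_gt_three]
          have h3 : (√(2 * Real.pi))⁻¹ ≤ 2⁻¹ := by gcongr
          have h4 : Real.exp (-x ^ 2 / (2 * s ^ 2)) ≤ 1 := by
            rw [Real.exp_le_one_iff, neg_div]
            have : 0 ≤ x ^ 2 / (2 * s ^ 2) := by positivity
            linarith
          calc (√(2 * Real.pi))⁻¹ * s⁻¹ * Real.exp (-x ^ 2 / (2 * s ^ 2))
              ≤ 2⁻¹ * s⁻¹ * 1 := by gcongr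
            _ = _ := mul_one _
      _ = ENNReal.ofReal (t / s) := by
          rw [setLIntegral_const, Real.volume_ball, ← ENNReal.ofReal_mul (by positivity)]
          congr 1
          field_simp
  rw [measureReal_def]
  exact ENNReal.toReal_le_of_le_ofReal (by positivity) h1

lemma measureReal_le_abs_le {t : ℝ} (ht : 0 < t) :
    μ.real {ω | t ≤ |X ω|} ≤ s ^ 2 / t ^ 2 := by
  have hmem : MemLp id 2 (μ.map X) := by
    rw [hlaw]; exact memLp_id_gaussianReal' 2 (by norm_num)
  have hmemX : MemLp X 2 μ := by
    have := (memLp_map_measure_iff (by fun_prop) hX.aemeasurable).1 hmem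
    simpa using this
  have hint : ∫ ω, X ω ∂μ = 0 := by
    have h1 := integral_map (μ := μ) hX.aemeasurable (f := fun x : ℝ => x) (by fun_prop)
    rw [← h1, hlaw, integral_id_gaussianReal]
  have hvar : Var[X; μ] = s ^ 2 := by
    have h1 := variance_map (μ := μ) (X := id) (Y := X) (by fun_prop) hX.aemeasurable
    rw [hlaw, variance_id_gaussianReal] at h1
    rw [Function.id_comp] at h1
    rw [← h1, Real.coe_toNNReal _ (by positivity)]
  have h2 := variance_eq_sub hmemX
  rw [hint, hvar] at h2
  refine measureReal_le_of_markov hmemX.integrable_sq ht ?_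
  simp only [Pi.pow_apply] at h2
  linarith

/-- The mass of the single interval `[l s, l s + s]` is enough, with the density bounded below by
its value at the right end. -/
lemma le_measureReal_le_abs {l : ℝ} (hl : 0 ≤ l) :
    Real.exp (-(l + 1) ^ 2 / 2) / 3 ≤ μ.real {ω | l * s ≤ |X ω|} := by
  have h1 : ENNReal.ofReal (Real.exp (-(l + 1) ^ 2 / 2) / 3) ≤ μ {ω | l * s ≤ |X ω|} := by
    have hsub : X ⁻¹' (Set.Icc (l * s) (l * s + s)) ⊆ {ω | l * s ≤ |X ω|} :=
      fun ω hω => hω.1.trans (le_abs_self _)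
    refine le_trans ?_ (measure_mono hsub)
    rw [measure_preimage_gaussian hs hX hlaw measurableSet_Icc]
    calc ENNReal.ofReal (Real.exp (-(l + 1) ^ 2 / 2) / 3)
        = ∫⁻ _x in Set.Icc (l * s) (l * s + s),
            ENNReal.ofReal (3⁻¹ * s⁻¹ * Real.exp (-(l + 1) ^ 2 / 2)) := by
          rw [setLIntegral_const, Real.volume_Icc, ← ENNReal.ofReal_mul (by positivity)]
          congr 1
          have := hs.ne'
          field_simp
          ring
      _ ≤ _ := by
          refine setLIntegral_mono' measurableSet_Icc fun x hx => ?_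
          rw [gaussianPDF, gaussianPDFReal_eq hs]
          refine ENNReal.ofReal_le_ofReal ?_
          have h2 : √(2 * Real.pi) ≤ 3 := by
            rw [Real.sqrt_le_left (by norm_num)]
            linarith [Real.pi_lt_d2]
          have h3 : 3⁻¹ ≤ (√(2 * Real.pi))⁻¹ := by
            have : 0 < √(2 * Real.pi) := by positivity
            gcongr
          have hx0 : 0 ≤ x := le_trans (by positivity) hx.1
          have h4 : -(l + 1) ^ 2 / 2 ≤ -x ^ 2 / (2 * s ^ 2) := by
            rw [neg_div, neg_div, neg_le_neg_iff, div_le_div_iff₀ (by positivity) (by norm_num)]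
            have h5 : x ≤ (l + 1) * s := by linarith [hx.2]
            have h6 : x ^ 2 ≤ ((l + 1) * s) ^ 2 := by gcongr
            linarith
          gcongr
  rw [measureReal_def]
  exact (ENNReal.ofReal_le_iff_le_toReal (measure_ne_top _ _)).1 h1

end gaussian

/-! ### Counting independent variables in a set: few in an unlikely one, some in a likely one. -/

section counting

variable {Ω : Type*} [MeasurableSpace Ω] {μ : Measure Ω} [IsProbabilityMeasure μ] {d : ℕ}
  {f : Fin d → Ω → ℝ} (hf : ∀ i, Measurable (f i)) (hind : iIndepFun f μ)
include hf hind

/-- Few of many independent variables fall into a set of small probability. -/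
lemma measureReal_card_le (hd : 0 < d) {S : Set ℝ} [DecidablePred (· ∈ S)] (hS : MeasurableSet S)
    (hp : ∀ i, μ.real (f i ⁻¹' S) ≤ 1 / 10) :
    μ.real {ω | ¬ 2 * (Finset.univ.filter fun i => f i ω ∈ S).card < d} ≤ 1 / d := by
  set Z : Fin d → Ω → ℝ := fun i => S.indicator 1 ∘ f i with hZ
  have hZm : ∀ i, Measurable (Z i) := fun i =>
    (measurable_one.indicator hS).comp (hf i)
  have hZb : ∀ i ω, ‖Z i ω‖ ≤ 1 := fun i ω => by
    simp only [hZ, Function.comp, Set.indicator_apply]; split_ifs <;> simp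
  have hZp : ∀ i, MemLp (Z i) 2 μ := fun i =>
    MemLp.of_bound (hZm i).aestronglyMeasurable 1 (Filter.Eventually.of_forall (hZb i))
  have hZe : ∀ i, Z i = (f i ⁻¹' S).indicator 1 := fun i => by
    funext ω; by_cases h : f i ω ∈ S <;> simp [hZ, h]
  have hZi : ∀ i, ∫ ω, Z i ω ∂μ = μ.real (f i ⁻¹' S) := fun i => by
    rw [hZe]; exact integral_indicator_one ((hf i) hS)
  have hZsq : ∀ i, (Z i) ^ 2 = Z i := fun i => by
    ext ω
    simp only [hZ, Function.comp, Pi.pow_apply, Set.indicator_apply]; split_ifs <;> simp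
  have hZv : ∀ i, Var[Z i; μ] ≤ 1 / 10 := fun i => by
    refine (variance_le_expectation_sq (hZm i).aestronglyMeasurable).trans ?_
    rw [hZsq, hZi]
    exact hp i
  have hindZ : iIndepFun Z μ := hind.comp (fun _ => S.indicator 1) fun _ =>
    measurable_one.indicator hS
  have hvar : Var[∑ i, Z i; μ] ≤ d * (1 / 10) := by
    rw [IndepFun.variance_sum (fun i _ => hZp i) fun i _ j _ hij => hindZ.indepFun hij]
    refine (Finset.sum_le_sum fun i _ => hZv i).trans ?_
    simp
  have hmem : MemLp (∑ i, Z i) 2 μ := memLp_finsetSum' _ fun i _ => hZp i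
  have hint : ∫ ω, (∑ i, Z i) ω ∂μ ≤ d * (1 / 10) := by
    simp only [Finset.sum_apply]
    rw [integral_finsetSum _ fun i _ => (hZp i).integrable (by norm_num)]
    refine (Finset.sum_le_sum fun i _ => (hZi i).le.trans (hp i)).trans ?_
    simp
  have hd' : (0 : ℝ) < d := by exact_mod_cast hd
  -- Chebyshev: the mean count is at most `d / 10`, so half of all variables in `S` is a deviation
  -- of at least `2 d / 5`, with variance at most `d / 10`.
  have h1 := meas_ge_le_variance_div_sq hmem (c := d * (2 / 5)) (by positivity)
  have h2 : μ.real {ω | d * (2 / 5) ≤ |(∑ i, Z i) ω - ∫ ω, (∑ i, Z i) ω ∂μ|}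
      ≤ Var[∑ i, Z i; μ] / (d * (2 / 5)) ^ 2 := by
    rw [measureReal_def]
    exact ENNReal.toReal_le_of_le_ofReal (by have := variance_nonneg (∑ i, Z i) μ; positivity) h1
  refine le_trans (measureReal_mono ?_) (h2.trans ?_)
  · intro ω hω
    simp only [Set.mem_setOf_eq, not_lt] at hω ⊢
    have hcard : (∑ i, Z i) ω = ((Finset.univ.filter fun i => f i ω ∈ S).card : ℝ) := by
      simp [hZ, Set.indicator_apply]
    rw [hcard]
    have h3 : (d : ℝ) ≤ 2 * ((Finset.univ.filter fun i => f i ω ∈ S).card : ℝ) := by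
      exact_mod_cast hω
    refine le_trans ?_ (le_abs_self _)
    linarith
  · calc Var[∑ i, Z i; μ] / ((d : ℝ) * (2 / 5)) ^ 2
        ≤ (d * (1 / 10) : ℝ) / ((d : ℝ) * (2 / 5)) ^ 2 := by gcongr
      _ = (5 / 8) * (1 / (d : ℝ)) := by field_simp; norm_num
      _ ≤ 1 * (1 / (d : ℝ)) := by gcongr; norm_num
      _ = _ := one_mul _

/-- Among many independent variables one falls into a set of not too small probability. -/
lemma measureReal_forall_notMem_le {S : Set ℝ} (hS : MeasurableSet S) {q : ℝ}
    (hq : ∀ i, q ≤ μ.real (f i ⁻¹' S)) :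
    μ.real {ω | ∀ i, f i ω ∉ S} ≤ Real.exp (-(q * d)) := by
  have e : {ω | ∀ i, f i ω ∉ S} = ⋂ i ∈ (Finset.univ : Finset (Fin d)), f i ⁻¹' Sᶜ := by
    ext ω; simp
  have h1 : μ.real {ω | ∀ i, f i ω ∉ S} = ∏ i, μ.real (f i ⁻¹' Sᶜ) := by
    rw [e, measureReal_def, hind.measure_inter_preimage_eq_mul Finset.univ fun i _ => hS.compl,
      ENNReal.toReal_prod]
    rfl
  have h2 : ∀ i, μ.real (f i ⁻¹' Sᶜ) ≤ Real.exp (-q) := fun i => by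
    rw [Set.preimage_compl, probReal_compl_eq_one_sub ((hf i) hS)]
    have := Real.add_one_le_exp (-q)
    linarith [hq i]
  rw [h1]
  calc ∏ i, μ.real (f i ⁻¹' Sᶜ) ≤ ∏ _i : Fin d, Real.exp (-q) :=
        Finset.prod_le_prod (fun i _ => measureReal_nonneg) fun i _ => h2 i
    _ = _ := by rw [Finset.prod_const, ← Real.exp_nat_mul]; simp; ring

end counting

end DiagGeometry

namespace DiagGeometry

/-! ### Events of high probability -/

section events

variable {Ω : Type*} [MeasurableSpace Ω] {μ : Measure Ω} [IsProbabilityMeasure μ]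

lemma measureReal_not_and_le (P Q : Ω → Prop) :
    μ.real {ω | ¬ (P ω ∧ Q ω)} ≤ μ.real {ω | ¬ P ω} + μ.real {ω | ¬ Q ω} := by
  refine (measureReal_mono fun ω hω => ?_).trans (measureReal_union_le _ _)
  simp only [Set.mem_setOf_eq, Set.mem_union] at hω ⊢
  tauto

lemma measureReal_not_forall_mem_le {ι : Type*} (S : Finset ι) {P : ι → Ω → Prop} {c : ℝ}
    (h : ∀ i ∈ S, μ.real {ω | ¬ P i ω} ≤ c) :
    μ.real {ω | ¬ ∀ i ∈ S, P i ω} ≤ S.card * c := by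
  have e : {ω | ¬ ∀ i ∈ S, P i ω} = ⋃ i ∈ S, {ω | ¬ P i ω} := by
    ext ω; simp
  rw [e]
  refine (measureReal_biUnion_finset_le S _).trans ((Finset.sum_le_sum h).trans ?_)
  simp

lemma measureReal_not_forall_le {ι : Type*} [Fintype ι] {P : ι → Ω → Prop} {c : ℝ}
    (h : ∀ i, μ.real {ω | ¬ P i ω} ≤ c) :
    μ.real {ω | ¬ ∀ i, P i ω} ≤ Fintype.card ι * c := by
  have := measureReal_not_forall_mem_le (μ := μ) Finset.univ (P := P) fun i _ => h i
  simpa using this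

section init

variable {d : ℕ} {α : ℝ} {w₀ : Ω → Params d} (hw : GaussianInit μ α w₀) (hd : 0 < d)
include hw hd

lemma law_inr (i : Fin d) : μ.map (fun ω => w₀ ω (Sum.inr i))
    = gaussianReal 0 (((d : ℝ) ^ (-α)) ^ 2).toNNReal := by
  have hd' : (0 : ℝ) < d := by exact_mod_cast hd
  rw [hw.law, initVar, ← Real.rpow_natCast, ← Real.rpow_mul hd'.le]
  congr 4
  push_cast; ring

lemma law_inl (i j : Fin d) : μ.map (fun ω => w₀ ω (Sum.inl (i, j)))
    = gaussianReal 0 ((((d : ℝ) ^ (-α)) ^ 2) ^ 2).toNNReal := by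
  have hd' : (0 : ℝ) < d := by exact_mod_cast hd
  rw [hw.law, initVar, ← pow_mul, ← Real.rpow_natCast, ← Real.rpow_mul hd'.le]
  congr 4
  push_cast; ring

omit [IsProbabilityMeasure μ] hd in
lemma measurable_entry (i : Idx d) : Measurable fun ω => w₀ ω i :=
  (measurable_pi_apply i).comp hw.measurable

lemma rpow_neg_pos : 0 < (d : ℝ) ^ (-α) := by
  have hd' : (0 : ℝ) < d := by exact_mod_cast hd
  positivity

lemma measureReal_inr_gt {b : ℝ} (hb : 0 < b) :
    μ.real {ω | ¬ ∀ i, |w₀ ω (Sum.inr i)| ≤ b} ≤ d * (((d : ℝ) ^ (-α)) ^ 2 / b ^ 2) := by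
  refine (measureReal_not_forall_le (c := ((d : ℝ) ^ (-α)) ^ 2 / b ^ 2) fun i => ?_).trans_eq
    (by simp)
  refine (measureReal_mono fun ω hω => ?_).trans
    (measureReal_le_abs_le (rpow_neg_pos hw hd) (measurable_entry hw _) (law_inr hw hd i) hb)
  exact (not_le.1 hω).le

lemma measureReal_inl_gt {b : ℝ} (hb : 0 < b) :
    μ.real {ω | ¬ ∀ i j, |w₀ ω (Sum.inl (i, j))| ≤ b}
      ≤ (d : ℝ) ^ 2 * ((((d : ℝ) ^ (-α)) ^ 2) ^ 2 / b ^ 2) := by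
  have hs := rpow_neg_pos hw hd
  refine (measureReal_not_forall_le (c := d * ((((d : ℝ) ^ (-α)) ^ 2) ^ 2 / b ^ 2))
    fun i => (measureReal_not_forall_le (c := (((d : ℝ) ^ (-α)) ^ 2) ^ 2 / b ^ 2)
      fun j => ?_).trans_eq (by simp)).trans_eq (by simp; ring)
  refine (measureReal_mono fun ω hω => ?_).trans
    (measureReal_le_abs_le (by positivity) (measurable_entry hw _) (law_inl hw hd i j) hb)
  exact (not_le.1 hω).le

lemma measureReal_inr_lt {a : ℝ} (ha : 0 ≤ a) :
    μ.real {ω | ¬ ∀ i, a ≤ |w₀ ω (Sum.inr i)|} ≤ d * (a / (d : ℝ) ^ (-α)) := by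
  refine (measureReal_not_forall_le (c := a / (d : ℝ) ^ (-α)) fun i => ?_).trans_eq
    (by simp)
  refine (measureReal_mono fun ω hω => ?_).trans
    (measureReal_abs_lt_le (rpow_neg_pos hw hd) (measurable_entry hw _) (law_inr hw hd i) ha)
  exact not_le.1 hω

omit hd [IsProbabilityMeasure μ] in
lemma iIndepFun_inr : iIndepFun (fun (i : Fin d) ω => w₀ ω (Sum.inr i)) μ :=
  hw.indep.precomp (g := Sum.inr) Sum.inr_injective

lemma measureReal_few_small : μ.real {ω | ¬ 2 * (Finset.univ.filter fun i =>
    |w₀ ω (Sum.inr i)| < (d : ℝ) ^ (-α) / 10).card < d} ≤ 1 / d := by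
  classical
  have hs := rpow_neg_pos hw hd
  have hS : MeasurableSet {x : ℝ | |x| < (d : ℝ) ^ (-α) / 10} :=
    measurableSet_lt (by fun_prop) measurable_const
  have h := measureReal_card_le (μ := μ) (f := fun i ω => w₀ ω (Sum.inr i))
    (fun i => measurable_entry hw _) (iIndepFun_inr hw) hd hS fun i => by
      refine (measureReal_abs_lt_le hs (measurable_entry hw _) (law_inr hw hd i)
        (by positivity)).trans_eq ?_
      field_simp
  simpa using h

lemma measureReal_few_large : μ.real {ω | ¬ 2 * (Finset.univ.filter fun i =>
    10 * (d : ℝ) ^ (-α) < |w₀ ω (Sum.inr i)|).card < d} ≤ 1 / d := by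
  classical
  have hs := rpow_neg_pos hw hd
  have hS : MeasurableSet {x : ℝ | 10 * (d : ℝ) ^ (-α) < |x|} :=
    measurableSet_lt measurable_const (by fun_prop)
  have h := measureReal_card_le (μ := μ) (f := fun i ω => w₀ ω (Sum.inr i))
    (fun i => measurable_entry hw _) (iIndepFun_inr hw) hd hS fun i => by
      have h1 := measureReal_le_abs_le hs (measurable_entry hw _) (law_inr hw hd i)
        (t := 10 * (d : ℝ) ^ (-α)) (by positivity)
      refine le_trans (measureReal_mono ?_) (h1.trans ?_)
      · intro ω hω
        change 10 * (d : ℝ) ^ (-α) < |w₀ ω (Sum.inr i)| at hω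
        exact hω.le
      rw [mul_pow, div_le_iff₀ (by positivity)]
      have : 0 < ((d : ℝ) ^ (-α)) ^ 2 := by positivity
      linarith
  simpa using h

lemma measureReal_no_outlier {l : ℝ} (hl : 0 ≤ l) :
    μ.real {ω | ¬ ∃ i, l * (d : ℝ) ^ (-α) ≤ |w₀ ω (Sum.inr i)|}
      ≤ Real.exp (-(Real.exp (-(l + 1) ^ 2 / 2) / 3 * d)) := by
  have hs := rpow_neg_pos hw hd
  have hS : MeasurableSet {x : ℝ | l * (d : ℝ) ^ (-α) ≤ |x|} :=
    measurableSet_le measurable_const (by fun_prop)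
  have h := measureReal_forall_notMem_le (μ := μ) (f := fun i ω => w₀ ω (Sum.inr i))
    (fun i => measurable_entry hw _) (iIndepFun_inr hw) hS fun i =>
      le_measureReal_le_abs hs (measurable_entry hw _) (law_inr hw hd i) hl
  refine (measureReal_mono fun ω hω => ?_).trans h
  simpa using hω

/-- The initialization used for gradient descent with momentum. -/
lemma measureReal_init_sgd {l : ℝ} (hl : 0 ≤ l) :
    μ.real {ω | ¬ (2 * (Finset.univ.filter fun i =>
        |w₀ ω (Sum.inr i)| < (d : ℝ) ^ (-α) / 10).card < d ∧
      2 * (Finset.univ.filter fun i => 10 * (d : ℝ) ^ (-α) < |w₀ ω (Sum.inr i)|).card < d ∧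
      (∃ i, l * (d : ℝ) ^ (-α) ≤ |w₀ ω (Sum.inr i)|) ∧
      (∀ i, |w₀ ω (Sum.inr i)| ≤ d * (d : ℝ) ^ (-α)) ∧
      ∀ i j, |w₀ ω (Sum.inl (i, j))| ≤ (d : ℝ) ^ 2 * ((d : ℝ) ^ (-α)) ^ 2)}
    ≤ 4 / d + Real.exp (-(Real.exp (-(l + 1) ^ 2 / 2) / 3 * d)) := by
  have hd' : (1 : ℝ) ≤ d := by exact_mod_cast hd
  have hs := rpow_neg_pos hw hd
  have h4 := measureReal_inr_gt hw hd (b := d * (d : ℝ) ^ (-α)) (by positivity)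
  have h5 := measureReal_inl_gt hw hd (b := (d : ℝ) ^ 2 * ((d : ℝ) ^ (-α)) ^ 2) (by positivity)
  have e4 : d * (((d : ℝ) ^ (-α)) ^ 2 / (d * (d : ℝ) ^ (-α)) ^ 2) = 1 / d := by field_simp
  have e5 : (d : ℝ) ^ 2 * ((((d : ℝ) ^ (-α)) ^ 2) ^ 2 / ((d : ℝ) ^ 2 * ((d : ℝ) ^ (-α)) ^ 2) ^ 2)
      ≤ 1 / d := by
    have : (d : ℝ) ^ 2 * ((((d : ℝ) ^ (-α)) ^ 2) ^ 2 / ((d : ℝ) ^ 2 * ((d : ℝ) ^ (-α)) ^ 2) ^ 2)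
        = 1 / (d : ℝ) ^ 2 := by field_simp
    rw [this]
    gcongr
    nlinarith
  have e : (4 : ℝ) / d = 1 / d + 1 / d + 1 / d + 1 / d := by ring
  refine (measureReal_not_and_le _ _).trans ?_
  have h1 := measureReal_few_small hw hd
  refine (add_le_add h1 ((measureReal_not_and_le _ _).trans
    (add_le_add (measureReal_few_large hw hd) ((measureReal_not_and_le _ _).trans
      (add_le_add (measureReal_no_outlier hw hd hl) ((measureReal_not_and_le _ _).trans
        (add_le_add (h4.trans e4.le) (h5.trans e5)))))))).trans ?_
  linarith

/-- The initialization used for Adam. -/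
lemma measureReal_init_adam {a b c : ℝ} (ha : 0 ≤ a) (hb : 0 < b) (hc : 0 < c) :
    μ.real {ω | ¬ ((∀ i, a ≤ |w₀ ω (Sum.inr i)|) ∧ (∀ i, |w₀ ω (Sum.inr i)| ≤ b) ∧
      ∀ i j, |w₀ ω (Sum.inl (i, j))| ≤ c)}
    ≤ d * (a / (d : ℝ) ^ (-α)) + (d * (((d : ℝ) ^ (-α)) ^ 2 / b ^ 2)
      + (d : ℝ) ^ 2 * ((((d : ℝ) ^ (-α)) ^ 2) ^ 2 / c ^ 2)) :=
  (measureReal_not_and_le _ _).trans (add_le_add (measureReal_inr_lt hw hd ha)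
    ((measureReal_not_and_le _ _).trans
      (add_le_add (measureReal_inr_gt hw hd hb) (measureReal_inl_gt hw hd hc))))

end init

/-- With high probability all the mini-batches up to a given time are close to the data. -/
lemma measureReal_batches {d m b : ℕ} {X : Matrix (Fin d) (Fin m) ℝ} {Y : Fin m → ℝ} {σ : ℝ}
    {B : ℕ → Ω → Fin b → Fin m} (hB : LargeBatch μ X Y σ B) (hd : 0 < d) {ν : ℝ} (hν : 0 < ν)
    (n : ℕ) :
    μ.real {ω | ¬ ∀ t ≤ n,
      (∀ i j, |covXX (batchX X (B t ω)) i j - covXX X i j| ≤ ν) ∧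
      ∀ j, |corrYX (batchX X (B t ω)) (batchY Y (B t ω)) j - corrYX X Y j| ≤ ν}
    ≤ (n + 1) * (2 * (d : ℝ) ^ 2 * (σ ^ 2 / ν ^ 2)) := by
  have hd' : (1 : ℝ) ≤ d := by exact_mod_cast hd
  -- There are finitely many mini-batches, so every function of them is bounded.
  have hint : ∀ (F : (Fin b → Fin m) → ℝ) t, Integrable (fun ω => F (B t ω) ^ 2) μ := by
    intro F t
    have hm : Measurable fun ω => F (B t ω) ^ 2 :=
      (measurable_of_finite fun x => F x ^ 2).comp (hB.measurable t)
    obtain ⟨C, hC⟩ := (Set.finite_range fun x => |F x ^ 2|).bddAbove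
    exact Integrable.of_bound hm.aestronglyMeasurable C
      (Filter.Eventually.of_forall fun ω => hC ⟨B t ω, rfl⟩)
  have hone : ∀ (F : (Fin b → Fin m) → ℝ) t, ∫ ω, F (B t ω) ^ 2 ∂μ ≤ σ ^ 2 →
      μ.real {ω | ¬ |F (B t ω)| ≤ ν} ≤ σ ^ 2 / ν ^ 2 := fun F t h =>
    (measureReal_mono fun ω hω => (not_le.1 hω).le).trans
      (measureReal_le_of_markov (hint F t) hν h)
  have hcov : ∀ t, μ.real {ω | ¬ ∀ i j, |covXX (batchX X (B t ω)) i j - covXX X i j| ≤ ν}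
      ≤ d * (d * (σ ^ 2 / ν ^ 2)) := fun t =>
    (measureReal_not_forall_le fun i => (measureReal_not_forall_le fun j =>
      hone (fun x => covXX (batchX X x) i j - covXX X i j) t (hB.var_cov t i j))).trans_eq (by simp)
  have hcorr : ∀ t, μ.real {ω | ¬ ∀ j,
      |corrYX (batchX X (B t ω)) (batchY Y (B t ω)) j - corrYX X Y j| ≤ ν}
      ≤ d * (σ ^ 2 / ν ^ 2) := fun t =>
    (measureReal_not_forall_le fun j => hone
      (fun x => corrYX (batchX X x) (batchY Y x) j - corrYX X Y j) t (hB.var_corr t j)).trans_eq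
      (by simp)
  have h := measureReal_not_forall_mem_le (μ := μ) (Finset.range (n + 1))
    (P := fun t ω => (∀ i j, |covXX (batchX X (B t ω)) i j - covXX X i j| ≤ ν) ∧
      ∀ j, |corrYX (batchX X (B t ω)) (batchY Y (B t ω)) j - corrYX X Y j| ≤ ν)
    (c := 2 * (d : ℝ) ^ 2 * (σ ^ 2 / ν ^ 2)) fun t _ => by
      refine (measureReal_not_and_le _ _).trans ((add_le_add (hcov t) (hcorr t)).trans ?_)
      have h1 : 0 ≤ σ ^ 2 / ν ^ 2 := by positivity
      have h2 : d * (σ ^ 2 / ν ^ 2) ≤ d * d * (σ ^ 2 / ν ^ 2) := by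
        gcongr
        nlinarith
      linarith
  simp only [Finset.mem_range, Nat.lt_succ_iff, Finset.card_range] at h
  exact_mod_cast h

end events

end DiagGeometry

namespace DiagGeometry

/-! ### Choice of the parameters for gradient descent with momentum -/

section sgdParams

/-- The intended scales are `f = d^(-p/2)`, `g = d^(-1/4)`, `s = d^(-α)`, so powers of `g` stand for
negative powers of `d`: `V₀ = d³ s²` and the noise level is `d η`. All conditions become comparisons
of monomials in `f` and `g`, with constants absorbed by `K⁸ g ≤ 1`. The time `Θ = 1 / (f g)` exceeds
the time scale `1 / f` of the slowest growth by the factor `d^(1/4)`. -/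
lemma sgdParams_of_small {β η ω N K g f s : ℝ} (hβ : 0 < β ∧ β < 1) (hK : 2000 ≤ K)
    (hr : 1 / (1 - β) ≤ K) (hg : 0 < g) (hKg : K ^ 8 * g ≤ 1) (hf : 0 < f) (hf2 : f ≤ 1 / 2)
    (hω : 1 ≤ ω) (hωg : ω * g ^ 2 ≤ K) (hη : 0 < η) (hηle : η ≤ K * (f ^ 16 * g ^ 72)) (hs : 0 < s)
    (hsle : s ≤ f ^ 8 * g ^ 32) (hNs : s ^ 2 ≤ N) (hN : N * g ^ 12 ≤ s ^ 2) :
    SGDParams β η ω N (f ^ 2 * g ^ 6) f (1 / (f * g)) (s ^ 2 / g ^ 12) (η / g ^ 4) := by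
  have hK1 : 1 ≤ K := by linarith
  have hK0 : 0 < K := by linarith
  have hu : 0 < 1 - β := by linarith [hβ.2]
  have hpow : ∀ j ≤ 8, K ^ j * g ≤ 1 := fun j hj => by
    refine le_trans ?_ hKg
    have := pow_le_pow_right₀ hK1 hj
    gcongr
  have hg1 : g ≤ 1 := by simpa using hpow 0 (by norm_num)
  have hf1 : f ≤ 1 := by linarith
  have hgp : ∀ j k, k ≤ j → g ^ j ≤ g ^ k := fun j k h => pow_le_pow_of_le_one hg.le hg1 h
  have hfp : ∀ j k, k ≤ j → f ^ j ≤ f ^ k := fun j k h => pow_le_pow_of_le_one hf.le hf1 h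
  have hN0 : 0 < N := lt_of_lt_of_le (by positivity) hNs
  have hω0 : 0 < ω := by linarith
  have hsq : s ≤ √N := by rw [Real.le_sqrt hs.le hN0.le]; exact hNs
  have hηω : η * ω ≤ K ^ 2 * (f ^ 16 * g ^ 70) := by
    calc η * ω ≤ K * (f ^ 16 * g ^ 72) * ω := by gcongr
      _ = K * (f ^ 16 * g ^ 70) * (ω * g ^ 2) := by ring
      _ ≤ K * (f ^ 16 * g ^ 70) * K := by gcongr
      _ = _ := by ring
  have hηω2 : η * ω ^ 2 ≤ K ^ 3 * (f ^ 16 * g ^ 68) := by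
    calc η * ω ^ 2 = (η * ω) * ω := by ring
      _ ≤ K ^ 2 * (f ^ 16 * g ^ 70) * ω := by gcongr
      _ = K ^ 2 * (f ^ 16 * g ^ 68) * (ω * g ^ 2) := by ring
      _ ≤ K ^ 2 * (f ^ 16 * g ^ 68) * K := by gcongr
      _ = _ := by ring
  have hmono : ∀ j k, 2 ≤ j → 7 ≤ k → f ^ j * g ^ k ≤ f ^ 2 * (g ^ 6 * g) := fun j k hj hk => by
    rw [← pow_succ]
    exact mul_le_mul (hfp j 2 hj) (hgp k 7 hk) (by positivity) (by positivity)
  -- Any monomial with at least two factors `f` and seven factors `g` is below `ε = f² g⁶`, even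
  -- with a constant up to `K⁸`.
  have hconst : ∀ j ≤ 8, ∀ C : ℝ, 0 ≤ C → C ≤ K ^ j → ∀ i k, 2 ≤ i → 7 ≤ k →
      C * (f ^ i * g ^ k) ≤ f ^ 2 * g ^ 6 := fun j hj C hC hCK i k hi hk => by
    calc C * (f ^ i * g ^ k) ≤ K ^ j * (f ^ 2 * (g ^ 6 * g)) := by
          have := hmono i k hi hk
          gcongr
      _ = f ^ 2 * g ^ 6 * (K ^ j * g) := by ring
      _ ≤ f ^ 2 * g ^ 6 * 1 := by have := hpow j hj; gcongr
      _ = _ := mul_one _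
  have hε1 : f ^ 2 * g ^ 6 ≤ f := by
    calc f ^ 2 * g ^ 6 ≤ f ^ 1 * g ^ 0 := by
          have := hfp 2 1 (by norm_num); have := hgp 6 0 (by norm_num); gcongr
      _ = f := by ring
  have hmom : 144 * η * ω ^ 2 / (1 - β) ^ 2 ≤ K ^ 6 * (f ^ 16 * g ^ 68) := by
    calc 144 * η * ω ^ 2 / (1 - β) ^ 2 = 144 * (η * ω ^ 2) * (1 / (1 - β)) ^ 2 := by
          field_simp
      _ ≤ K * (K ^ 3 * (f ^ 16 * g ^ 68)) * K ^ 2 := by gcongr; linarith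
      _ = _ := by ring
  have hμ : 12 * η * ω / (1 - β) / (1 - β) ≤ 12 * K ^ 4 * (f ^ 16 * g ^ 70) := by
    calc 12 * η * ω / (1 - β) / (1 - β) = 12 * (η * ω) * (1 / (1 - β)) ^ 2 := by
          field_simp
      _ ≤ 12 * (K ^ 2 * (f ^ 16 * g ^ 70)) * K ^ 2 := by gcongr
      _ = _ := by ring
  refine ⟨hβ.1, hβ.2, hη, hω, hN0, ?_, hf2, by positivity, ?_, ?_, ?_, ?_, ?_, ?_, by positivity,
    ?_, by positivity, ?_⟩
  · have h1 : N ≤ s ^ 2 / g ^ 12 := by rw [le_div_iff₀ (by positivity)]; exact hN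
    have h2 : s ^ 2 / g ^ 12 ≤ (f ^ 8 * g ^ 32) ^ 2 / g ^ 12 := by gcongr
    have h3 : (f ^ 8 * g ^ 32) ^ 2 / g ^ 12 = f ^ 16 * g ^ 52 := by field_simp
    have h4 := hconst 1 (by norm_num) 1024 (by norm_num) (by linarith) 16 52 (by norm_num)
      (by norm_num)
    linarith
  · rw [le_div_iff₀ (by positivity), one_mul]
    exact mul_le_one₀ hf1 hg.le hg1
  · calc 1024 * ω * (f ^ 2 * g ^ 6) * (1 / (f * g)) ^ 2 = 1024 * (ω * g ^ 2) * g * g := by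
          field_simp
      _ ≤ K * K * g * 1 := by gcongr; linarith
      _ = K ^ 2 * g := by ring
      _ ≤ 1 := hpow 2 (by norm_num)
  · calc 64 * ω * (f ^ 2 * g ^ 6) * (1 / (f * g)) = 64 * (ω * g ^ 2) * g * (g ^ 2 * f) := by
          field_simp
      _ ≤ K * K * g * (1 * f) := by
          have := hgp 2 0 (by norm_num)
          rw [pow_zero] at this
          gcongr; linarith
      _ = (K ^ 2 * g) * f := by ring
      _ ≤ 1 * f := by have := hpow 2 (by norm_num); gcongr
      _ = f := one_mul f
  · rw [← div_le_one hu]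
    refine hμ.trans ?_
    have h4 := hconst 5 (by norm_num) (12 * K ^ 4) (by positivity)
      (by rw [pow_succ' K 4]; gcongr; linarith) 16 70 (by norm_num) (by norm_num)
    linarith
  · exact hmom.trans (hconst 6 (by norm_num) (K ^ 6) (by positivity) le_rfl 16 68 (by norm_num)
      (by norm_num))
  · calc 6 * (η / (1 - β)) * ω ^ 2 = 6 * (η * ω ^ 2) * (1 / (1 - β)) := by field_simp
      _ ≤ K * (K ^ 3 * (f ^ 16 * g ^ 68)) * K := by gcongr; linarith
      _ = K ^ 5 * (f ^ 16 * g ^ 68) := by ring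
      _ ≤ f ^ 2 * g ^ 6 := hconst 5 (by norm_num) _ (by positivity) le_rfl 16 68 (by norm_num)
          (by norm_num)
      _ ≤ f := hε1
  · have h1 : s ^ 2 / g ^ 12 / √N ≤ f ^ 8 * g ^ 20 := by
      rw [div_le_iff₀ (lt_of_lt_of_le hs hsq), div_le_iff₀ (by positivity)]
      calc s ^ 2 = s * s := by ring
        _ ≤ f ^ 8 * g ^ 32 * √N := by gcongr
        _ = _ := by ring
    have h2 : ω * (384 * (s ^ 2 / g ^ 12 / √N)) ≤ 384 * K * (f ^ 8 * g ^ 18) := by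
      calc ω * (384 * (s ^ 2 / g ^ 12 / √N)) ≤ ω * (384 * (f ^ 8 * g ^ 20)) := by gcongr
        _ = 384 * (ω * g ^ 2) * (f ^ 8 * g ^ 18) := by ring
        _ ≤ _ := by gcongr
    have h3 : ω * (96 * (12 * η * ω / (1 - β) / (1 - β))) ≤ 1152 * K ^ 5 * (f ^ 16 * g ^ 68) := by
      calc ω * (96 * (12 * η * ω / (1 - β) / (1 - β)))
          ≤ ω * (96 * (12 * K ^ 4 * (f ^ 16 * g ^ 70))) := by gcongr
        _ = 1152 * (ω * g ^ 2) * K ^ 4 * (f ^ 16 * g ^ 68) := by ring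
        _ ≤ 1152 * K * K ^ 4 * (f ^ 16 * g ^ 68) := by gcongr
        _ = _ := by ring
    have h4 := hconst 2 (by norm_num) (2 * 384 * K) (by positivity)
      (by rw [pow_two]; gcongr; linarith) 8 18 (by norm_num) (by norm_num)
    have h5 := hconst 7 (by norm_num) (2 * 1152 * K ^ 5) (by positivity)
      (by
        have : (2 * 1152 : ℝ) ≤ K * K := by nlinarith
        calc 2 * 1152 * K ^ 5 ≤ K * K * K ^ 5 := by gcongr
          _ = K ^ 7 := by ring) 16 68 (by norm_num) (by norm_num)
    linarith
  · calc 36 * ω * (η / g ^ 4) = 36 * (η * ω) / g ^ 4 := by ring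
      _ ≤ 36 * (K ^ 2 * (f ^ 16 * g ^ 70)) / g ^ 4 := by gcongr
      _ = 36 * K ^ 2 * (f ^ 16 * g ^ 66) := by field_simp
      _ ≤ _ := hconst 3 (by norm_num) _ (by positivity)
        (by rw [pow_succ' K 2]; gcongr; linarith) 16 66 (by norm_num) (by norm_num)

/-- Enough steps for the growth of the main direction. -/
lemma growth_of_steps {y f Θ : ℝ} (hy : 0 < y) (hf : 0 < f) (hyf : y * (f / 2) ≤ 1) : Real.exp (f * Θ / 2 - 1) ≤ (1 + y * (f / 2)) ^ (2 * ⌊Θ / y⌋₊) := by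
  set n := ⌊Θ / y⌋₊
  have h1 : Θ / y < n + 1 := Nat.lt_floor_add_one _
  rw [div_lt_iff₀ hy] at h1
  set c := y * (f / 2) with hc
  have hc0 : 0 < c := by positivity
  -- Valid because `c ≤ 1`. The missing fraction of a step in the floor costs the `1` in the
  -- exponent.
  have h2 : Real.exp (c / 2) ≤ 1 + c := by
    have h3 := Real.one_sub_le_exp_neg (c / 2)
    have h4 : Real.exp (c / 2) * Real.exp (-(c / 2)) = 1 := by rw [← Real.exp_add]; simp
    have h5 := Real.exp_pos (c / 2)
    have h6 : Real.exp (c / 2) * (1 - c / 2) ≤ 1 :=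
      (mul_le_mul_of_nonneg_left h3 h5.le).trans_eq h4
    by_contra! hcon
    nlinarith
  calc Real.exp (f * Θ / 2 - 1) ≤ Real.exp ((2 * n : ℕ) * (c / 2)) := by
        refine Real.exp_le_exp.2 ?_
        have h3 : Θ * (f / 2) ≤ (n + 1) * y * (f / 2) := by gcongr
        push_cast
        nlinarith
    _ = Real.exp (c / 2) ^ (2 * n) := by rw [Real.exp_nat_mul]
    _ ≤ _ := by gcongr

end sgdParams

end DiagGeometry

namespace DiagGeometry

open Filter Topology

/-! ### SGD+M at the scales given by powers of the dimension. -/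

section sgdFinal

lemma eventually_mul_rpow_le (C : ℝ) {a : ℝ} (ha : 0 < a) :
    ∀ᶠ d : ℕ in atTop, C * (d : ℝ) ^ (-a) ≤ 1 := by
  have h := ((tendsto_rpow_neg_atTop ha).comp (tendsto_natCast_atTop_atTop (R := ℝ))).const_mul C
  rw [mul_zero] at h
  exact (h.eventually (gt_mem_nhds one_pos)).mono fun d hd => le_of_lt hd

lemma eventually_mul_rpow_lt_exp (C a : ℝ) {b c : ℝ} (hb : 0 < b) (hc : 0 < c) :
    ∀ᶠ d : ℕ in atTop, C * (d : ℝ) ^ a < Real.exp (c * (d : ℝ) ^ b) := by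
  have h1 : Tendsto (fun d : ℕ => (d : ℝ) ^ b) atTop atTop :=
    (tendsto_rpow_atTop hb).comp tendsto_natCast_atTop_atTop
  have h2 := (isLittleO_rpow_exp_pos_mul_atTop (a / b) hc).comp_tendsto h1
  have h3 := h2.def (c := 1 / (|C| + 1)) (by positivity)
  filter_upwards [h3, eventually_gt_atTop 0] with d hd hd0
  have hd0' : (0 : ℝ) < d := by exact_mod_cast hd0
  simp only [Function.comp, Real.norm_eq_abs, Real.abs_exp] at hd
  rw [← Real.rpow_mul hd0'.le, mul_div_cancel₀ _ hb.ne', abs_of_pos (by positivity)] at hd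
  have h4 : 0 < (d : ℝ) ^ a := by positivity
  have h5 : (|C| + 1) * (d : ℝ) ^ a ≤ Real.exp (c * (d : ℝ) ^ b) := by
    calc (|C| + 1) * (d : ℝ) ^ a ≤ (|C| + 1) * (1 / (|C| + 1) * Real.exp (c * (d : ℝ) ^ b)) := by
          gcongr
      _ = _ := by field_simp
  refine lt_of_lt_of_le ?_ h5
  have := le_abs_self C
  gcongr
  linarith

/-- The quantities used for gradient descent with momentum, for large dimension. -/
structure SGDScale (p α aLo K : ℝ) (d : ℕ) : Prop where
  d_pos : 0 < d
  hKg : K ^ 8 * (d : ℝ) ^ (-(1 / 4) : ℝ) ≤ 1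
  hf : (d : ℝ) ^ (-(p / 2)) ≤ 1 / 2
  aLo_le : 1 ≤ aLo * √d
  log_le : 4 ≤ Real.log d
  tail : Real.exp (-(√d / 3)) ≤ 1 / d
  growth : 4 * K * √d * (d : ℝ) ^ (2 * α) < Real.exp ((d : ℝ) ^ (1 / 4 : ℝ) / 2 - 1)

lemma sgdScale_eventually {p α aLo K : ℝ} (hp : 0 < p) (haLo : 0 < aLo) :
    ∀ᶠ d : ℕ in atTop, SGDScale p α aLo K d := by
  have h1 := eventually_mul_rpow_le (K ^ 8) (a := 1 / 4) (by norm_num)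
  have h2 := eventually_mul_rpow_le 2 (a := p / 2) (by positivity)
  have h3 : ∀ᶠ d : ℕ in atTop, 1 / aLo ≤ √(d : ℝ) :=
    (Real.tendsto_sqrt_atTop.comp tendsto_natCast_atTop_atTop).eventually_ge_atTop _
  have h4 : ∀ᶠ d : ℕ in atTop, 4 ≤ Real.log (d : ℝ) :=
    (Real.tendsto_log_atTop.comp tendsto_natCast_atTop_atTop).eventually_ge_atTop _
  have h5 := eventually_mul_rpow_lt_exp 1 1 (b := 1 / 2) (c := 1 / 3) (by norm_num) (by norm_num)
  have h6 := eventually_mul_rpow_lt_exp (4 * K * Real.exp 1) (1 / 2 + 2 * α) (b := 1 / 4)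
    (c := 1 / 2) (by norm_num) (by norm_num)
  filter_upwards [eventually_gt_atTop 0, h1, h2, h3, h4, h5, h6] with d hd h1 h2 h3 h4 h5 h6
  have hd' : (0 : ℝ) < d := by exact_mod_cast hd
  refine ⟨hd, h1, by linarith, ?_, h4, ?_, ?_⟩
  · rwa [div_le_iff₀' haLo] at h3
  · rw [one_mul, Real.rpow_one, ← Real.sqrt_eq_rpow] at h5
    rw [Real.exp_neg, one_div]
    have e : 1 / 3 * √(d : ℝ) = √d / 3 := by ring
    rw [e] at h5
    gcongr
  · rw [Real.exp_sub, lt_div_iff₀ (Real.exp_pos 1), Real.sqrt_eq_rpow]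
    rw [Real.rpow_add hd'] at h6
    have e : (d : ℝ) ^ (1 / 4 : ℝ) / 2 = 1 / 2 * (d : ℝ) ^ (1 / 4 : ℝ) := by ring
    rw [e]
    refine lt_of_eq_of_lt ?_ h6
    ring

namespace SGDScale

variable {p α aLo K : ℝ} {d : ℕ} (S : SGDScale p α aLo K d)
include S

lemma cast_pos : (0 : ℝ) < d := by exact_mod_cast S.d_pos

lemma one_le : (1 : ℝ) ≤ d := by exact_mod_cast S.d_pos

lemma f_pow (n : ℕ) : ((d : ℝ) ^ (-(p / 2))) ^ n = (d : ℝ) ^ (-(p / 2) * n) := by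
  rw [← Real.rpow_natCast, ← Real.rpow_mul S.cast_pos.le]

lemma g_pow (n : ℕ) : ((d : ℝ) ^ (-(1 / 4) : ℝ)) ^ n = (d : ℝ) ^ (-(1 / 4) * n : ℝ) := by
  rw [← Real.rpow_natCast, ← Real.rpow_mul S.cast_pos.le]

lemma g_pow_four : ((d : ℝ) ^ (-(1 / 4) : ℝ)) ^ 4 = 1 / d := by
  rw [S.g_pow]
  norm_num
  exact Real.rpow_neg_one _

/-- The right side is `d^(-4p-8)`, so the bound is equivalent in exponents to `α ≥ 4 (p + 2)`. -/
lemma s_le (hα : 4 * (p + 2) ≤ α) : (d : ℝ) ^ (-α)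
    ≤ ((d : ℝ) ^ (-(p / 2))) ^ 8 * ((d : ℝ) ^ (-(1 / 4) : ℝ)) ^ 32 := by
  rw [S.f_pow, S.g_pow, ← Real.rpow_add S.cast_pos]
  refine Real.rpow_le_rpow_of_exponent_le S.one_le ?_
  push_cast; linarith

/-- The powers `16` and `72` give `d^(-8p-18)`, which is the bound on the learning rate at the
extreme case `α = 4 (p + 2)` and `ε = d^(-p)`. -/
lemma η_le {ε η C : ℝ} (hα : 4 * (p + 2) ≤ α) (hε0 : 0 < ε)
    (hε : ε < 1 / (d : ℝ) ^ p) (hη : η ≤ C * (ε / (d : ℝ) ^ (7 * α / 4 + 4))) (hCK : C ≤ K)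
    (hK : 0 ≤ K) :
    η ≤ K * (((d : ℝ) ^ (-(p / 2))) ^ 16 * ((d : ℝ) ^ (-(1 / 4) : ℝ)) ^ 72) := by
  have hd := S.cast_pos
  refine hη.trans ?_
  have h1 : ε / (d : ℝ) ^ (7 * α / 4 + 4)
      ≤ ((d : ℝ) ^ (-(p / 2))) ^ 16 * ((d : ℝ) ^ (-(1 / 4) : ℝ)) ^ 72 := by
    rw [S.f_pow, S.g_pow, ← Real.rpow_add hd]
    have e : 1 / (d : ℝ) ^ p / (d : ℝ) ^ (7 * α / 4 + 4) = (d : ℝ) ^ (-p - (7 * α / 4 + 4)) := by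
      rw [Real.rpow_sub hd, Real.rpow_neg hd.le, one_div]
    calc ε / (d : ℝ) ^ (7 * α / 4 + 4) ≤ 1 / (d : ℝ) ^ p / (d : ℝ) ^ (7 * α / 4 + 4) := by gcongr
      _ = (d : ℝ) ^ (-p - (7 * α / 4 + 4)) := e
      _ ≤ _ := by
        refine Real.rpow_le_rpow_of_exponent_le S.one_le ?_
        push_cast; linarith
  have h2 : 0 ≤ ε / (d : ℝ) ^ (7 * α / 4 + 4) := by positivity
  gcongr

end SGDScale

variable {d m : ℕ}

lemma norm_corrYX_bounds {aLo aHi : ℝ} (haLo : 0 < aLo) {X : Matrix (Fin d) (Fin m) ℝ}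
    {Y : Fin m → ℝ} (hd : 0 < d) (h : DataSetup aLo aHi X Y) :
    aLo * √d ≤ ‖toE (corrYX X Y)‖ ∧ ‖toE (corrYX X Y)‖ ≤ aHi * √d := by
  have haHi : 0 < aHi :=
    haLo.trans_le ((h.coord_lower ⟨0, hd⟩).trans (h.coord_upper ⟨0, hd⟩))
  constructor
  · refine abs_le_of_sq_le_sq' ?_ (norm_nonneg _) |>.2
    rw [norm_toE_sq, mul_pow, Real.sq_sqrt (Nat.cast_nonneg d)]
    calc aLo ^ 2 * d = ∑ _j : Fin d, aLo ^ 2 := by simp [mul_comm]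
      _ ≤ _ := Finset.sum_le_sum fun j _ => by
        have := h.coord_lower j
        gcongr
  · rw [mul_comm]
    refine norm_toE_le haHi.le fun j => ?_
    rw [abs_of_nonneg (haLo.le.trans (h.coord_lower j))]
    exact h.coord_upper j

/-- The number of steps of gradient descent with momentum that are considered. -/
def sgdHorizon (p β η : ℝ) (d : ℕ) : ℕ :=
  ⌊1 / ((d : ℝ) ^ (-(p / 2)) * (d : ℝ) ^ (-(1 / 4) : ℝ)) / (η / (1 - β))⌋₊

set_option maxHeartbeats 1000000 in
/-- The conclusion for gradient descent with momentum, from a typical initialization. -/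
theorem sgdm_of_typical {p α β aLo aHi K η : ℝ} (hα : 4 * (p + 2) ≤ α) (hβ : 0 < β ∧ β < 1)
    (haLo : 0 < aLo) (hK : 2000 ≤ K) (hr : 1 / (1 - β) ≤ K) (haHi : aHi ≤ K)
    (S : SGDScale p α aLo K d) {X : Matrix (Fin d) (Fin m) ℝ} {Y : Fin m → ℝ}
    (hXY : DataSetup aLo aHi X Y) (hη : 0 < η)
    (hηle : η ≤ K * (((d : ℝ) ^ (-(p / 2))) ^ 16 * ((d : ℝ) ^ (-(1 / 4) : ℝ)) ^ 72))
    {b : ℕ} {B : ℕ → Fin b → Fin m} {w₀ : Params d}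
    (hinit : 2 * (Finset.univ.filter fun i =>
        |w₀ (Sum.inr i)| < (d : ℝ) ^ (-α) / 10).card < d ∧
      2 * (Finset.univ.filter fun i => 10 * (d : ℝ) ^ (-α) < |w₀ (Sum.inr i)|).card < d ∧
      (∃ i, (√(Real.log d) - 1) * (d : ℝ) ^ (-α) ≤ |w₀ (Sum.inr i)|) ∧
      (∀ i, |w₀ (Sum.inr i)| ≤ d * (d : ℝ) ^ (-α)) ∧
      ∀ i j, |w₀ (Sum.inl (i, j))| ≤ (d : ℝ) ^ 2 * ((d : ℝ) ^ (-α)) ^ 2)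
    (hbatch : ∀ t ≤ sgdHorizon p β η d,
      (∀ i j, |covXX (batchX X (B t)) i j - covXX X i j| ≤ η) ∧
      ∀ j, |corrYX (batchX X (B t)) (batchY Y (B t)) j - corrYX X Y j| ≤ η) :
    ∃ t₁ t₂ : ℕ, t₁ ≤ t₂ ∧
      let W := sgdm β η (fun t => batchGrad X Y (B t)) w₀
      (aLo ^ 2 / 8 * d ≤ lossBar (corrYX X Y) (W t₁) ∧
        lossBar (corrYX X Y) (W t₁) ≤ 2 * K ^ 2 * d) ∧
      lossBar (corrYX X Y) (W t₂) ≤ 5 / (d : ℝ) ^ p ∧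
      ∀ t ∈ Set.Icc t₁ t₂, 1 / 12100 * Real.log d ≤ RMed1 (loss X Y) (W t) ∧
        1 / 12100 * Real.log d ≤ RMed2 (loss X Y) (W t) := by
  obtain ⟨hlow, hup, ⟨i₀, hi₀⟩, hz, hv⟩ := hinit
  have hd := S.cast_pos
  have hd1 := S.one_le
  have hg4 := S.g_pow_four
  have hs_le := S.s_le hα
  have hf_sq : ((d : ℝ) ^ (-(p / 2))) ^ 2 = 1 / (d : ℝ) ^ p := by
    rw [S.f_pow, one_div, ← Real.rpow_neg hd.le]; congr 1; push_cast; ring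
  have hginv : 1 / (d : ℝ) ^ (-(1 / 4) : ℝ) = (d : ℝ) ^ (1 / 4 : ℝ) := by
    rw [one_div, ← Real.rpow_neg hd.le, neg_neg]
  have hsinv : ((d : ℝ) ^ (-α)) ^ 2 * (d : ℝ) ^ (2 * α) = 1 := by
    rw [← Real.rpow_natCast, ← Real.rpow_mul hd.le, ← Real.rpow_add hd]
    have : -α * ((2 : ℕ) : ℝ) + 2 * α = 0 := by push_cast; ring
    rw [this, Real.rpow_zero]
  have hs : 0 < (d : ℝ) ^ (-α) := by positivity
  have hf0 : 0 < (d : ℝ) ^ (-(p / 2)) := by positivity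
  have hg0 : 0 < (d : ℝ) ^ (-(1 / 4) : ℝ) := by positivity
  have hgrow := S.growth
  have hfle := S.hf
  have hKg := S.hKg
  unfold sgdHorizon at hbatch
  set s := (d : ℝ) ^ (-α)
  set f := (d : ℝ) ^ (-(p / 2))
  set g := (d : ℝ) ^ (-(1 / 4) : ℝ)
  have hωb := norm_corrYX_bounds haLo S.d_pos hXY
  have hω1 : 1 ≤ ‖toE (corrYX X Y)‖ := S.aLo_le.trans hωb.1
  have hK0 : 0 < K := by linarith
  have hωK : ‖toE (corrYX X Y)‖ ≤ K * √d := hωb.2.trans (by gcongr)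
  have hg2 : √(d : ℝ) * g ^ 2 = 1 := by
    have h1 : (√(d : ℝ) * g ^ 2) ^ 2 = 1 := by
      rw [mul_pow, Real.sq_sqrt hd.le, ← pow_mul, hg4]; field_simp
    exact (pow_eq_one_iff_of_nonneg (by positivity) two_ne_zero).1 h1
  have hg12 : g ^ 12 = 1 / (d : ℝ) ^ 3 := by
    rw [show 12 = 4 * 3 from rfl, pow_mul, hg4, one_div_pow]
  have hg1 : g ≤ 1 := by
    have : 1 * g ≤ K ^ 8 * g := by gcongr; exact one_le_pow₀ (by linarith)
    linarith
  have hl2 : 2 ≤ √(Real.log d) := by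
    rw [Real.le_sqrt (by norm_num) (by linarith [S.log_le])]
    linarith [S.log_le]
  have hl1 : 1 ≤ √(Real.log d) - 1 := by linarith
  set N := ∑ i, w₀ (Sum.inr i) ^ 2
  have hNs : s ^ 2 ≤ N := by
    have h1 : s ≤ |w₀ (Sum.inr i₀)| := by
      refine le_trans ?_ hi₀
      exact le_mul_of_one_le_left hs.le hl1
    calc s ^ 2 ≤ |w₀ (Sum.inr i₀)| ^ 2 := by gcongr
      _ = w₀ (Sum.inr i₀) ^ 2 := sq_abs _
      _ ≤ N := Finset.single_le_sum (f := fun i => w₀ (Sum.inr i) ^ 2)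
        (fun i _ => sq_nonneg _) (Finset.mem_univ i₀)
  have hN : N * g ^ 12 ≤ s ^ 2 := by
    have h1 : N ≤ ∑ _i : Fin d, (d * s) ^ 2 := Finset.sum_le_sum fun i _ => by
      rw [← sq_abs]
      have := hz i
      gcongr
    rw [hg12, mul_one_div, div_le_iff₀ (by positivity)]
    refine h1.trans_eq ?_
    simp only [Finset.sum_const, Finset.card_univ, Fintype.card_fin, nsmul_eq_mul]
    ring
  have hP := sgdParams_of_small (N := N) hβ hK hr hg0 hKg hf0 hfle hω1 (by
    calc ‖toE (corrYX X Y)‖ * g ^ 2 ≤ K * √d * g ^ 2 := by gcongr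
      _ = K * (√d * g ^ 2) := by ring
      _ = K := by rw [hg2, mul_one]) hη hηle hs hs_le hNs hN
  have hηd : η / g ^ 4 = d * η := by rw [hg4]; field_simp
  have hV₀ : s ^ 2 / g ^ 12 = (d : ℝ) ^ 3 * s ^ 2 := by rw [hg12]; field_simp
  rw [hηd] at hP
  have hV : ∑ i, ∑ j, w₀ (Sum.inl (i, j)) ^ 2 ≤ (s ^ 2 / g ^ 12) ^ 2 := by
    have h1 : ∑ i, ∑ j, w₀ (Sum.inl (i, j)) ^ 2
        ≤ ∑ _i : Fin d, ∑ _j : Fin d, ((d : ℝ) ^ 2 * s ^ 2) ^ 2 :=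
      Finset.sum_le_sum fun i _ => Finset.sum_le_sum fun j _ => by
        rw [← sq_abs]
        have := hv i j
        gcongr
    refine h1.trans_eq ?_
    simp only [Finset.sum_const, Finset.card_univ, Fintype.card_fin, nsmul_eq_mul]
    rw [hV₀]
    ring
  have hVs : s ^ 2 / g ^ 12 ≤ s / 1000 := by
    have h1 : s * 1000 ≤ g ^ 12 := by
      have hf8 : f ^ 8 ≤ 1 := pow_le_one₀ hf0.le (by linarith)
      have hg19 : g ^ 19 ≤ 1 := pow_le_one₀ hg0.le hg1
      calc s * 1000 ≤ f ^ 8 * g ^ 32 * K := by gcongr; linarith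
        _ = f ^ 8 * g ^ 19 * (K ^ 1 * g) * g ^ 12 := by ring
        _ ≤ 1 * 1 * (K ^ 8 * g) * g ^ 12 := by
          gcongr
          · linarith
          · norm_num
        _ ≤ 1 * 1 * 1 * g ^ 12 := by gcongr
        _ = g ^ 12 := by ring
    rw [div_le_div_iff₀ (by positivity) (by norm_num)]
    calc s ^ 2 * 1000 = s * (s * 1000) := by ring
      _ ≤ s * g ^ 12 := by gcongr
  have hy : 0 < η / (1 - β) := div_pos hη (by linarith [hβ.2])
  have hstep : η / (1 - β) * (f / 2) ≤ 1 := by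
    have h1 := hP.step
    have h2 := hP.hf₀
    have h3 : η / (1 - β) * 1 ≤ η / (1 - β) * ‖toE (corrYX X Y)‖ ^ 2 := by
      have := one_le_pow₀ hω1 (n := 2)
      gcongr
    nlinarith
  have hexp := growth_of_steps (Θ := 1 / (f * g)) hy hf0 hstep
  have e1 : f * (1 / (f * g)) / 2 - 1 = (d : ℝ) ^ (1 / 4 : ℝ) / 2 - 1 := by
    rw [← hginv]; field_simp
  rw [e1] at hexp
  have hn : 4 * ‖toE (corrYX X Y)‖
      < N * (1 + η / (1 - β) * (f / 2)) ^ (2 * ⌊1 / (f * g) / (η / (1 - β))⌋₊) := by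
    calc 4 * ‖toE (corrYX X Y)‖ ≤ 4 * (K * √d) := by gcongr
      _ = s ^ 2 * (4 * K * √d * (d : ℝ) ^ (2 * α)) := by
        calc 4 * (K * √d) = 4 * (K * √d) * (s ^ 2 * (d : ℝ) ^ (2 * α)) := by rw [hsinv, mul_one]
          _ = _ := by ring
      _ < s ^ 2 * Real.exp ((d : ℝ) ^ (1 / 4 : ℝ) / 2 - 1) := by gcongr
      _ ≤ _ := by gcongr
  have hnΘ : η / (1 - β) * (⌊1 / (f * g) / (η / (1 - β))⌋₊ : ℝ) ≤ 1 / (f * g) := by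
    have := Nat.floor_le (a := 1 / (f * g) / (η / (1 - β))) (by positivity)
    rw [le_div_iff₀ hy] at this
    linarith
  obtain ⟨t₁, t₂, h12, ⟨c1, c2⟩, c3, c4⟩ := sgdm_nonuniform hXY.whitened hη.le hP hV hnΘ hn
    (fun t ht => (hbatch t ht).1) (fun t ht => (hbatch t ht).2) hs hVs hl1 hlow hup hi₀
  -- The outlier is of size `√(log d) - 1`, at least half of `√(log d)`, and `12100 = 110²`.
  have hlog : 1 / 12100 * Real.log d ≤ ((√(Real.log d) - 1) / 55) ^ 2 := by
    have h1 : √(Real.log d) / 110 ≤ (√(Real.log d) - 1) / 55 := by linarith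
    calc 1 / 12100 * Real.log d = (√(Real.log d) / 110) ^ 2 := by
          rw [div_pow, Real.sq_sqrt (by linarith [S.log_le])]; ring
      _ ≤ _ := by gcongr
  have hsqd : √(d : ℝ) ^ 2 = d := Real.sq_sqrt hd.le
  refine ⟨t₁, t₂, h12, ⟨le_trans ?_ c1, c2.trans ?_⟩, c3.trans_eq ?_,
    fun t ht => ⟨hlog.trans (c4 t ht).1, hlog.trans (c4 t ht).2⟩⟩
  · calc aLo ^ 2 / 8 * d = (aLo * √d) ^ 2 / 8 := by rw [mul_pow, hsqd]; ring
      _ ≤ _ := by have := hωb.1; gcongr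
  · calc 2 * ‖toE (corrYX X Y)‖ ^ 2 ≤ 2 * (K * √d) ^ 2 := by gcongr
      _ = 2 * K ^ 2 * d := by rw [mul_pow, hsqd]; ring
  · rw [hf_sq]; ring

end sgdFinal

end DiagGeometry

namespace DiagGeometry

open Filter Topology

/-! ### Conclusions with high probability for the two algorithms separately. -/

section whp

variable {Ω : Type*} [MeasurableSpace Ω] {μ : Measure Ω} [IsProbabilityMeasure μ] {d m : ℕ}

/-- The conclusion for gradient descent with momentum, with high probability. -/
theorem sgdm_whp {p α β aLo aHi K C ε η σ : ℝ} (hα : 4 * (p + 2) ≤ α)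
    (hβ : 0 < β ∧ β < 1) (haLo : 0 < aLo) (hK : 2000 ≤ K) (hr : 1 / (1 - β) ≤ K) (haHi : aHi ≤ K)
    (hCK : C ≤ K) (S : SGDScale p α aLo K d) {X : Matrix (Fin d) (Fin m) ℝ} {Y : Fin m → ℝ}
    (hXY : DataSetup aLo aHi X Y) (hε0 : 0 < ε) (hε : ε < 1 / (d : ℝ) ^ p) (hη0 : 0 < η)
    (hη : η ≤ C * (ε / (d : ℝ) ^ (7 * α / 4 + 4))) (hσ0 : 0 ≤ σ)
    (hσ : σ ≤ η ^ (3 / 2 : ℝ) / (d : ℝ) ^ (α / 2 + 1)) {w₀ : Ω → Params d}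
    (hw : GaussianInit μ α w₀) {b : ℕ} {B : ℕ → Ω → Fin b → Fin m} (hB : LargeBatch μ X Y σ B) :
    μ.real {ω | ¬ ∃ t₁ t₂ : ℕ, t₁ ≤ t₂ ∧
      let W := sgdm β η (fun t => batchGrad X Y (B t ω)) (w₀ ω)
      (aLo ^ 2 / 8 * d ≤ lossBar (corrYX X Y) (W t₁) ∧
        lossBar (corrYX X Y) (W t₁) ≤ 2 * K ^ 2 * d) ∧
      lossBar (corrYX X Y) (W t₂) ≤ 5 / (d : ℝ) ^ p ∧
      ∀ t ∈ Set.Icc t₁ t₂, 1 / 12100 * Real.log d ≤ RMed1 (loss X Y) (W t) ∧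
        1 / 12100 * Real.log d ≤ RMed2 (loss X Y) (W t)} ≤ 6 / d := by
  have hd := S.cast_pos
  have hK0 : 0 < K := by linarith
  have hηle := S.η_le hα hε0 hε hη hCK hK0.le
  have hlog := S.log_le
  have hinit := measureReal_init_sgd hw S.d_pos (l := √(Real.log d) - 1) (by
    have : 1 ≤ √(Real.log d) := by rw [Real.one_le_sqrt]; linarith
    linarith)
  -- For `l + 1 = √(log d)` one entry is an outlier with probability at least `1 / (3 √d)`, so that
  -- all `d` fail to be one has probability at most `exp (-√d / 3)`.
  have htail : Real.exp (-(Real.exp (-(√(Real.log d) - 1 + 1) ^ 2 / 2) / 3 * d)) ≤ 1 / d := by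
    refine le_trans (le_of_eq ?_) S.tail
    have h1 : Real.exp (-(√(Real.log d) - 1 + 1) ^ 2 / 2) = 1 / √d := by
      rw [sub_add_cancel, Real.sq_sqrt (by linarith), neg_div, Real.exp_neg, Real.sqrt_eq_rpow,
        Real.rpow_def_of_pos hd, one_div]
      congr 2; ring
    rw [h1]
    congr 2
    have h2 : √(d : ℝ) * √d = d := Real.mul_self_sqrt hd.le
    have h3 : √(d : ℝ) ≠ 0 := by positivity
    field_simp
    linarith
  have hbatch := measureReal_batches hB S.d_pos hη0 (sgdHorizon p β η d)
  -- The number of steps is of order `1 / (f g η)` and each batch fails with probability of order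
  -- `d² σ² / η²`. With `σ² ≤ η³ s / d²` the powers of `η` cancel, and the small `s` makes the total
  -- at most `1 / d`.
  have hbound : ((sgdHorizon p β η d : ℕ) + 1 : ℝ) * (2 * (d : ℝ) ^ 2 * (σ ^ 2 / η ^ 2))
      ≤ 1 / d := by
    have hs_le := S.s_le hα
    have hg4 := S.g_pow_four
    have hσ2 : σ ^ 2 ≤ η ^ 3 * (d : ℝ) ^ (-α) / (d : ℝ) ^ 2 := by
      calc σ ^ 2 ≤ (η ^ (3 / 2 : ℝ) / (d : ℝ) ^ (α / 2 + 1)) ^ 2 := by gcongr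
        _ = η ^ 3 * (d : ℝ) ^ (-α) / (d : ℝ) ^ 2 := by
          rw [div_pow, ← Real.rpow_natCast (η ^ (3 / 2 : ℝ)), ← Real.rpow_mul hη0.le,
            ← Real.rpow_natCast ((d : ℝ) ^ (α / 2 + 1)), ← Real.rpow_mul hd.le,
            show ((3 / 2 : ℝ) * ((2 : ℕ) : ℝ)) = ((3 : ℕ) : ℝ) by norm_num, Real.rpow_natCast,
            show ((α / 2 + 1) * ((2 : ℕ) : ℝ)) = α + ((2 : ℕ) : ℝ) by push_cast; ring,
            Real.rpow_add hd, Real.rpow_natCast, Real.rpow_neg hd.le]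
          field_simp
    have hf0 : 0 < (d : ℝ) ^ (-(p / 2)) := by have := hd; positivity
    have hg0 : 0 < (d : ℝ) ^ (-(1 / 4) : ℝ) := by have := hd; positivity
    have hs0 : 0 < (d : ℝ) ^ (-α) := by have := hd; positivity
    have hfle := S.hf
    have hKg := S.hKg
    have hn : (sgdHorizon p β η d : ℝ)
        ≤ 1 / ((d : ℝ) ^ (-(p / 2)) * (d : ℝ) ^ (-(1 / 4) : ℝ)) / (η / (1 - β)) :=
      Nat.floor_le (by have := hβ.2; have : 0 < 1 - β := by linarith
                       positivity)
    set f := (d : ℝ) ^ (-(p / 2))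
    set g := (d : ℝ) ^ (-(1 / 4) : ℝ)
    set s := (d : ℝ) ^ (-α)
    have hg1 : K ^ 1 * g ≤ 1 := by
      refine le_trans ?_ hKg
      have : K ^ 1 ≤ K ^ 8 := pow_le_pow_right₀ (by linarith) (by norm_num)
      gcongr
    have hgK : 2000 * g ≤ 1 := by
      have : 2000 * g ≤ K ^ 1 * g := by rw [pow_one]; gcongr
      linarith
    have hg1' : g ≤ 1 := by linarith
    have hf1 : f ≤ 1 := by linarith
    have hη1 : η ≤ 1 := by
      calc η ≤ K * (f ^ 16 * g ^ 72) := hηle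
        _ = f ^ 16 * g ^ 71 * (K ^ 1 * g) := by ring
        _ ≤ 1 * 1 * 1 := by
          have := pow_le_one₀ hf0.le hf1 (n := 16)
          have := pow_le_one₀ hg0.le hg1' (n := 71)
          gcongr
        _ = 1 := by norm_num
    have hfgη : f * g * η ≤ 1 := mul_le_one₀ (mul_le_one₀ hf1 hg0.le hg1') hη0.le hη1
    have hn1 : (sgdHorizon p β η d : ℝ) + 1 ≤ 2 / (f * g * η) := by
      have h1 : 1 / (f * g) / (η / (1 - β)) ≤ 1 / (f * g * η) := by
        have e : 1 / (f * g) / (η / (1 - β)) = (1 - β) / (f * g * η) := by field_simp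
        rw [e]
        gcongr
        linarith [hβ.1]
      have h2 : 1 ≤ 1 / (f * g * η) := by
        rw [le_div_iff₀ (by positivity)]; linarith
      have e : 2 / (f * g * η) = 1 / (f * g * η) + 1 / (f * g * η) := by ring
      linarith
    calc ((sgdHorizon p β η d : ℕ) + 1 : ℝ) * (2 * (d : ℝ) ^ 2 * (σ ^ 2 / η ^ 2))
        ≤ 2 / (f * g * η) * (2 * (d : ℝ) ^ 2 * ((η ^ 3 * s / (d : ℝ) ^ 2) / η ^ 2)) := by gcongr
      _ = 4 * s / (f * g) := by field_simp; norm_num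
      _ ≤ 4 * (f ^ 8 * g ^ 32) / (f * g) := by gcongr
      _ = f ^ 7 * g ^ 26 * (4 * g) * g ^ 4 := by field_simp
      _ ≤ 1 * 1 * 1 * g ^ 4 := by
          have := pow_le_one₀ hf0.le hf1 (n := 7)
          have := pow_le_one₀ hg0.le hg1' (n := 26)
          gcongr
          linarith
      _ = 1 / d := by rw [hg4]; ring
  refine le_trans (measureReal_mono ?_) ((measureReal_not_and_le _ _).trans
    ((add_le_add (hinit.trans (add_le_add_right htail _)) (hbatch.trans hbound)).trans ?_))
  · intro ω hω hgood
    exact hω (sgdm_of_typical hα hβ haLo hK hr haHi S hXY hη0 hηle hgood.1 hgood.2)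
  · have e : (6 : ℝ) / d = 4 / d + 1 / d + 1 / d := by ring
    linarith

/-- The requirements on the dimension for Adam. -/
structure AdamScale (α K : ℝ) (d : ℕ) : Prop where
  d_pos : 0 < d
  hKh : K ^ 40 * (d : ℝ) ^ (-(α / 16)) ≤ 1
  hKD : 4 * K ≤ √d

lemma adamScale_eventually {α K : ℝ} (hα : 0 < α) : ∀ᶠ d : ℕ in atTop, AdamScale α K d := by
  have h3 : ∀ᶠ d : ℕ in atTop, 4 * K ≤ √(d : ℝ) :=
    (Real.tendsto_sqrt_atTop.comp tendsto_natCast_atTop_atTop).eventually_ge_atTop _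
  filter_upwards [eventually_gt_atTop 0, eventually_mul_rpow_le (K ^ 40) (a := α / 16)
    (by positivity), h3] with d hd h1 h3 using ⟨hd, h1, h3⟩

set_option maxHeartbeats 1000000 in
/-- The conclusion for Adam, with high probability. -/
theorem adam_whp {p α b aLo aHi K C η ξ σ : ℝ} (hp : 0 < p) (hα : 4 * (p + 2) ≤ α)
    (hb : 0 < b ∧ b < 1) (haLo : 0 < aLo) (hK : 100 ≤ K) (hr : 1 / (1 - b) ≤ K)
    (sign_le : 6 / (1 - b) ^ 4 ≤ K) (incr_le : 12 / (b * (1 - b) ^ 3) ≤ K)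
    (haLoK : 1 / aLo ≤ K) (haHi : aHi ≤ K) (hCK : C ≤ K) (S : AdamScale α K d)
    {X : Matrix (Fin d) (Fin m) ℝ} {Y : Fin m → ℝ} (hXY : DataSetup aLo aHi X Y) (hη0 : 0 < η)
    (hη : η ≤ C * (1 / (d : ℝ) ^ (3 * α))) (hξ0 : 0 < ξ) (hξ : ξ ≤ √(η / (d : ℝ) ^ (3 * α - 1)))
    (hσ0 : 0 ≤ σ) (hσ : σ ≤ η ^ (3 / 2 : ℝ) * ξ ^ 2 / (d : ℝ) ^ (13 / 4 : ℝ))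
    {w₀ : Ω → Params d} (hw : GaussianInit μ α w₀) {bA : ℕ} {B : ℕ → Ω → Fin bA → Fin m}
    (hB : LargeBatch μ X Y σ B) :
    μ.real {ω | ¬ ∃ t₁ t₂ : ℕ, t₁ ≤ t₂ ∧
      let W := adam b (b ^ 2) η ξ (fun t => batchGrad X Y (B t ω)) (w₀ ω)
      (1 / (8 * K ^ 2) * d ≤ lossBar (corrYX X Y) (W t₁) ∧
        lossBar (corrYX X Y) (W t₁) ≤ 2 * K ^ 2 * d) ∧
      lossBar (corrYX X Y) (W t₂) ≤ 1 / (d : ℝ) ^ p ∧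
      ∀ t ∈ Set.Icc t₁ t₂, |RMed1 (loss X Y) (W t) - 1| ≤ K ^ 7 * (1 / (d : ℝ) ^ (α / 2 - 1 / 4)) ∧
        |RMed2 (loss X Y) (W t) - 1| ≤ K ^ 7 * (1 / (d : ℝ) ^ (α / 2 - 1 / 4))} ≤ 4 / d := by
  have hd : (0 : ℝ) < d := by exact_mod_cast S.d_pos
  have hd1 : (1 : ℝ) ≤ d := by exact_mod_cast S.d_pos
  have hK0 : 0 < K := by linarith
  have hK1 : 1 ≤ K := by linarith
  have hα8 : 8 ≤ α := by linarith
  have hpow : ∀ n : ℕ, ((d : ℝ) ^ (-(α / 16))) ^ n = (d : ℝ) ^ (-(α / 16) * n) := fun n => by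
    rw [← Real.rpow_natCast, ← Real.rpow_mul hd.le]
  have hh0 : 0 < (d : ℝ) ^ (-(α / 16)) := by positivity
  -- With `h = d^(-α/16)` the initial scale of the second layer is `h¹⁶` and that of the first
  -- `h³²`. The ranges `[h²⁰, h¹⁴]` and `h²⁸` used for Adam leave powers of `h` for the union
  -- bounds.
  have hs : (d : ℝ) ^ (-α) = ((d : ℝ) ^ (-(α / 16))) ^ 16 := by
    rw [hpow]; congr 1; push_cast; ring
  have h48 : 1 / (d : ℝ) ^ (3 * α) = ((d : ℝ) ^ (-(α / 16))) ^ 48 := by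
    rw [hpow, one_div, ← Real.rpow_neg hd.le]; congr 1; push_cast; ring
  have h47 : 1 / (d : ℝ) ^ (3 * α - 1) = ((d : ℝ) ^ (-(α / 16))) ^ 48 * d := by
    rw [hpow, one_div, ← Real.rpow_neg hd.le]
    nth_rewrite 3 [← Real.rpow_one (d : ℝ)]
    rw [← Real.rpow_add hd]; congr 1; push_cast; ring
  have h4p : d * ((d : ℝ) ^ (-(α / 16))) ^ 4 ≤ 1 / (d : ℝ) ^ p := by
    rw [hpow, one_div, ← Real.rpow_neg hd.le]
    nth_rewrite 1 [← Real.rpow_one (d : ℝ)]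
    rw [← Real.rpow_add hd]
    refine Real.rpow_le_rpow_of_exponent_le hd1 ?_
    push_cast; linarith
  have h2 : ((d : ℝ) ^ (-(α / 16))) ^ 2 ≤ 1 / d := by
    rw [hpow, one_div, ← Real.rpow_neg_one]
    refine Real.rpow_le_rpow_of_exponent_le hd1 ?_
    push_cast; linarith
  have h8 : ((d : ℝ) ^ (-(α / 16))) ^ 8 ≤ 1 / (d : ℝ) ^ (α / 2 - 1 / 4) := by
    rw [hpow, one_div, ← Real.rpow_neg hd.le]
    refine Real.rpow_le_rpow_of_exponent_le hd1 ?_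
    push_cast; linarith
  have hKh := S.hKh
  rw [h48] at hη
  rw [div_eq_mul_one_div, h47] at hξ
  have hinit := measureReal_init_adam hw S.d_pos (a := ((d : ℝ) ^ (-(α / 16))) ^ 20)
    (b := ((d : ℝ) ^ (-(α / 16))) ^ 14) (c := ((d : ℝ) ^ (-(α / 16))) ^ 28) (by positivity)
    (by positivity) (by positivity)
  rw [hs] at hinit
  set h := (d : ℝ) ^ (-(α / 16))
  have hKj : ∀ j ≤ 40, K ^ j * h ≤ 1 := fun j hj => by
    refine le_trans ?_ hKh
    have := pow_le_pow_right₀ hK1 hj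
    gcongr
  have hh1 : h ≤ 1 := by simpa using hKj 0 (by norm_num)
  have hhp : ∀ j k, k ≤ j → h ^ j ≤ h ^ k := fun j k hjk => pow_le_pow_of_le_one hh0.le hh1 hjk
  have hDh : √(d : ℝ) * h ≤ 1 := by
    refine abs_le_of_sq_le_sq' ?_ zero_le_one |>.2
    rw [mul_pow, Real.sq_sqrt hd.le]
    calc d * h ^ 2 ≤ d * (1 / d) := by gcongr
      _ = 1 ^ 2 := by field_simp
  have hη46 : η ≤ h ^ 46 := by
    calc η ≤ C * h ^ 48 := hη
      _ ≤ K * h ^ 48 := by gcongr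
      _ = h ^ 46 * (K ^ 1 * h) * h := by ring
      _ ≤ h ^ 46 * 1 * 1 := by have := hKj 1 (by norm_num); gcongr
      _ = h ^ 46 := by ring
  have hdh2 : d * h ^ 2 ≤ 1 := by
    calc d * h ^ 2 ≤ d * (1 / d) := by gcongr
      _ = 1 := by field_simp
  have hξ40 : ξ ≤ h ^ 40 := by
    refine hξ.trans ?_
    rw [Real.sqrt_le_left (by positivity)]
    calc η * (h ^ 48 * d) ≤ h ^ 46 * (h ^ 48 * d) := by gcongr
      _ = h ^ 92 * (d * h ^ 2) := by ring
      _ ≤ h ^ 80 * 1 := by have := hhp 92 80 (by norm_num); gcongr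
      _ = (h ^ 40) ^ 2 := by ring
  have hη1 : η ≤ 1 := hη46.trans (pow_le_one₀ hh0.le hh1)
  have hinit' : d * (h ^ 20 / h ^ 16) + (d * ((h ^ 16) ^ 2 / (h ^ 14) ^ 2)
      + (d : ℝ) ^ 2 * (((h ^ 16) ^ 2) ^ 2 / (h ^ 28) ^ 2)) ≤ 3 / d := by
    have e1 : h ^ 20 / h ^ 16 = h ^ 4 := by field_simp
    have e2 : (h ^ 16) ^ 2 / (h ^ 14) ^ 2 = h ^ 4 := by field_simp
    have e3 : ((h ^ 16) ^ 2) ^ 2 / (h ^ 28) ^ 2 = h ^ 8 := by field_simp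
    rw [e1, e2, e3]
    have h5 : d * h ^ 4 ≤ 1 / d := by
      calc d * h ^ 4 = (d * h ^ 2) * h ^ 2 := by ring
        _ ≤ 1 * (1 / (d : ℝ)) := by gcongr
        _ = 1 / (d : ℝ) := one_mul _
    have h6 : (d : ℝ) ^ 2 * h ^ 8 ≤ 1 / d := by
      calc (d : ℝ) ^ 2 * h ^ 8 = (d * h ^ 2) ^ 2 * (h ^ 2 * h ^ 2) := by ring
        _ ≤ 1 ^ 2 * (h ^ 2 * 1) := by have := pow_le_one₀ hh0.le hh1 (n := 2); gcongr
        _ ≤ 1 / (d : ℝ) := by linarith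
    have e : (3 : ℝ) / d = 1 / d + 1 / d + 1 / d := by ring
    linarith
  have hD1 : 1 ≤ √(d : ℝ) := Real.one_le_sqrt.2 hd1
  have hbatch := measureReal_batches hB S.d_pos (ν := η / d) (by positivity)
    (adamHorizon K (√d) η)
  -- There are at most `4K / η` steps, and the tolerance is `η / d` per entry. The factors `η³` in
  -- `σ²` cancel, and `ξ⁴` absorbs the constants.
  have hbound : ((adamHorizon K (√d) η : ℕ) + 1 : ℝ) * (2 * (d : ℝ) ^ 2 * (σ ^ 2 / (η / d) ^ 2))
      ≤ 1 / d := by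
    have hn : (adamHorizon K (√d) η : ℝ) + 1 ≤ 4 * K / η := by
      have h1 : ((⌊2 * K / √d / η⌋₊ : ℕ) : ℝ) ≤ 2 * K / √d / η := Nat.floor_le (by positivity)
      have h3 : 2 * K / √d / η ≤ 2 * K / η := by
        gcongr
        exact div_le_self (by positivity) hD1
      have h4 : 2 ≤ 2 * K / η := by
        rw [le_div_iff₀ hη0]; nlinarith
      have e : 4 * K / η = 2 * K / η + 2 * K / η := by ring
      unfold adamHorizon
      push_cast
      linarith
    have hσ2 : σ ^ 2 ≤ η ^ 3 * ξ ^ 4 / (d : ℝ) ^ 6 := by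
      calc σ ^ 2 ≤ (η ^ (3 / 2 : ℝ) * ξ ^ 2 / (d : ℝ) ^ (13 / 4 : ℝ)) ^ 2 := by gcongr
        _ = η ^ 3 * ξ ^ 4 / (d : ℝ) ^ (13 / 2 : ℝ) := by
          rw [div_pow, mul_pow, ← Real.rpow_natCast (η ^ (3 / 2 : ℝ)), ← Real.rpow_mul hη0.le,
            ← Real.rpow_natCast ((d : ℝ) ^ (13 / 4 : ℝ)), ← Real.rpow_mul hd.le,
            show ((3 / 2 : ℝ) * ((2 : ℕ) : ℝ)) = ((3 : ℕ) : ℝ) by norm_num, Real.rpow_natCast,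
            show ((13 / 4 : ℝ) * ((2 : ℕ) : ℝ)) = 13 / 2 by norm_num]
          ring
        _ ≤ _ := by
          have h1 : (d : ℝ) ^ 6 ≤ (d : ℝ) ^ (13 / 2 : ℝ) := by
            rw [← Real.rpow_natCast]
            exact Real.rpow_le_rpow_of_exponent_le hd1 (by norm_num)
          gcongr
    have hξ4 : ξ ^ 4 ≤ h * h := by
      calc ξ ^ 4 ≤ (h ^ 40) ^ 4 := by gcongr
        _ = h ^ 160 := by ring
        _ ≤ h ^ 2 := hhp 160 2 (by norm_num)
        _ = h * h := by ring
    calc ((adamHorizon K (√d) η : ℕ) + 1 : ℝ) * (2 * (d : ℝ) ^ 2 * (σ ^ 2 / (η / d) ^ 2))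
        ≤ 4 * K / η * (2 * (d : ℝ) ^ 2 * ((η ^ 3 * ξ ^ 4 / (d : ℝ) ^ 6) / (η / d) ^ 2)) := by
          gcongr
      _ = 8 * K * ξ ^ 4 * (1 / (d : ℝ) ^ 2) := by
          have := hd.ne'
          clear * - this hη0
          field_simp; ring
      _ ≤ K * K * (h * h) * (1 / d) := by
          have h1 : 1 / (d : ℝ) ^ 2 ≤ 1 / d := by
            gcongr; nlinarith
          gcongr
          linarith
      _ = (K ^ 1 * h) ^ 2 * (1 / d) := by ring
      _ ≤ 1 ^ 2 * (1 / (d : ℝ)) := by have := hKj 1 (by norm_num); gcongr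
      _ = 1 / (d : ℝ) := by ring
  refine le_trans (measureReal_mono ?_) ((measureReal_not_and_le _ _).trans
    ((add_le_add (hinit.trans hinit') (hbatch.trans hbound)).trans ?_))
  · intro ω hω hgood
    obtain ⟨⟨hw1, hw2, hv⟩, hnoise⟩ := hgood
    obtain ⟨t₁, t₂, h12, c1, c2, c3⟩ := adam_uniform hb.1 hb.2 hK hr sign_le incr_le hh0 hKh S.hKD
      hDh (Real.sq_sqrt hd.le).symm hη0 hη46 hξ0 hξ40 hXY.whitened
      (fun j => le_trans (by rw [one_div_le hK0 haLo]; exact haLoK) (hXY.coord_lower j))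
      (fun j => (hXY.coord_upper j).trans haHi)
      (fun t ht i j => by rw [← hXY.whitened]; exact (hnoise t ht).1 i j)
      (fun t ht => (hnoise t ht).2) hw1 hw2 hv
    have h9 : K ^ 7 * h ^ 8 ≤ K ^ 7 * (1 / (d : ℝ) ^ (α / 2 - 1 / 4)) := by gcongr
    exact hω ⟨t₁, t₂, h12, c1, c2.trans h4p, fun t ht =>
      ⟨(c3 t ht.1 ht.2).1.trans h9, (c3 t ht.1 ht.2).2.trans h9⟩⟩
  · have e : (4 : ℝ) / d = 3 / d + 1 / d := by ring
    linarith

end whp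

end DiagGeometry

end

/-! ### Combination of the two algorithms. -/

theorem corollary1
    (p α β β₁ β₂ aLo aHi CS CA : ℝ)
    (hp : 0 < p) (hαS : 4 * (p + 2) ≤ α) (hαA : (p + 4) / 3 ≤ α)
    (hβ : 0 < β ∧ β < 1) (hβ₁ : 0 < β₁ ∧ β₁ < 1) (hβ₂ : β₂ = β₁ ^ 2) (haLo : 0 < aLo) :
    ∃ κ > (0 : ℝ), ∃ c > (0 : ℝ), ∃ K > (0 : ℝ), ∃ k d₀ : ℕ,
      ∀ d : ℕ, d₀ ≤ d →
      -- the data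
      ∀ (m : ℕ) (X : Matrix (Fin d) (Fin m) ℝ) (Y : Fin m → ℝ),
      DiagGeometry.DataSetup aLo aHi X Y →
      -- the hyperparameters and the noise level of SGD with momentum
      ∀ ε ηS σS : ℝ, 0 < ε → ε < 1 / (d : ℝ) ^ p →
      0 < ηS → ηS ≤ CS * (ε / (d : ℝ) ^ (7 * α / 4 + 4)) →
      0 ≤ σS → σS ≤ ηS ^ (3 / 2 : ℝ) / (d : ℝ) ^ (α / 2 + 1) →
      -- the hyperparameters and the noise level of Adam
      ∀ ηA ξ σA : ℝ, 0 < ηA → ηA ≤ CA * (1 / (d : ℝ) ^ (3 * α)) →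
      0 < ξ → ξ ≤ √(ηA / (d : ℝ) ^ (3 * α - 1)) →
      0 ≤ σA → σA ≤ ηA ^ (3 / 2 : ℝ) * ξ ^ 2 / (d : ℝ) ^ (13 / 4 : ℝ) →
      -- the initializations and the mini-batches of the two algorithms
      ∀ (Ω : Type*) [MeasurableSpace Ω] (μ : MeasureTheory.Measure Ω)
        [MeasureTheory.IsProbabilityMeasure μ]
        (wS wA : Ω → DiagGeometry.Params d) (bS bA : ℕ)
        (BS : ℕ → Ω → Fin bS → Fin m) (BA : ℕ → Ω → Fin bA → Fin m),
      DiagGeometry.GaussianInit μ α wS → DiagGeometry.GaussianInit μ α wA →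
      DiagGeometry.LargeBatch μ X Y σS BS → DiagGeometry.LargeBatch μ X Y σA BA →
      -- the iterates
      ∀ WS WA : Ω → ℕ → DiagGeometry.Params d,
      (∀ ω, WS ω = DiagGeometry.sgdm β ηS
        (fun t => DiagGeometry.batchGrad X Y (BS t ω)) (wS ω)) →
      (∀ ω, WA ω = DiagGeometry.adam β₁ β₂ ηA ξ
        (fun t => DiagGeometry.batchGrad X Y (BA t ω)) (wA ω)) →
      ∀ Lbar : DiagGeometry.Params d → ℝ,
      Lbar = DiagGeometry.lossBar (DiagGeometry.corrYX X Y) →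
      -- with high probability
      μ {ω | ¬ ∃ TS1 TS2 TA1 TA2 : ℕ, TS1 ≤ TS2 ∧ TA1 ≤ TA2 ∧
          -- the losses at the ends of the two intervals
          (c * d ≤ Lbar (WS ω TS1) ∧ Lbar (WS ω TS1) ≤ K * d) ∧
          Lbar (WS ω TS2) ≤ K * Real.log d ^ k / (d : ℝ) ^ p ∧
          (c * d ≤ Lbar (WA ω TA1) ∧ Lbar (WA ω TA1) ≤ K * d) ∧
          Lbar (WA ω TA2) ≤ K * Real.log d ^ k / (d : ℝ) ^ p ∧
          -- the two intervals
          (∀ t ∈ Set.Icc TS1 TS2,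
            c * Real.log d ≤ DiagGeometry.RMed1 (DiagGeometry.loss X Y) (WS ω t) ∧
            c * Real.log d ≤ DiagGeometry.RMed2 (DiagGeometry.loss X Y) (WS ω t)) ∧
          (∀ t' ∈ Set.Icc TA1 TA2,
            |DiagGeometry.RMed1 (DiagGeometry.loss X Y) (WA ω t') - 1| ≤
              K * Real.log d ^ k *
                (ηA ^ (1 / 4 : ℝ) + 1 / (d : ℝ) ^ (α / 2 - 1 / 4)) ∧
            |DiagGeometry.RMed2 (DiagGeometry.loss X Y) (WA ω t') - 1| ≤
              K * Real.log d ^ k *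
                (ηA ^ (1 / 4 : ℝ) + 1 / (d : ℝ) ^ (α / 2 - 1 / 4))) ∧
          -- the comparison at equal loss
          (∀ t ∈ Set.Icc TS1 TS2, ∀ t' ∈ Set.Icc TA1 TA2,
            Lbar (WS ω t) = Lbar (WA ω t') →
            (c * Real.log d ≤ DiagGeometry.RMed1 (DiagGeometry.loss X Y) (WS ω t) ∧
              c * Real.log d ≤ DiagGeometry.RMed2 (DiagGeometry.loss X Y) (WS ω t)) ∧
            (|DiagGeometry.RMed1 (DiagGeometry.loss X Y) (WA ω t') - 1| ≤
                K * Real.log d ^ k *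
                  (ηA ^ (1 / 4 : ℝ) + 1 / (d : ℝ) ^ (α / 2 - 1 / 4)) ∧
              |DiagGeometry.RMed2 (DiagGeometry.loss X Y) (WA ω t') - 1| ≤
                K * Real.log d ^ k *
                  (ηA ^ (1 / 4 : ℝ) + 1 / (d : ℝ) ^ (α / 2 - 1 / 4))))} ≤
        ENNReal.ofReal (1 / (d : ℝ) ^ κ) := by
  subst hβ₂
  -- A sum of nonnegative terms that dominates every constant required by either algorithm.
  obtain ⟨K, hKdef⟩ : ∃ K : ℝ, K = 2000 + 1 / (1 - β) + 1 / (1 - β₁) + 6 / (1 - β₁) ^ 4 + 12 / (β₁ * (1 - β₁) ^ 3)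
    + 1 / aLo + |aHi| + |CS| + |CA| := ⟨_, rfl⟩
  have hb0 : 0 < 1 - β := by linarith [hβ.2]
  have hb1 : 0 < 1 - β₁ := by linarith [hβ₁.2]
  have hb2 := hβ₁.1
  have k1 : 0 ≤ 1 / (1 - β) := by positivity
  have k2 : 0 ≤ 1 / (1 - β₁) := by positivity
  have k3 : 0 ≤ 6 / (1 - β₁) ^ 4 := by positivity
  have k4 : 0 ≤ 12 / (β₁ * (1 - β₁) ^ 3) := by positivity
  have k5 : 0 ≤ 1 / aLo := by positivity
  have k6 := abs_nonneg aHi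
  have k7 := abs_nonneg CS
  have k8 := abs_nonneg CA
  have l6 := le_abs_self aHi
  have l7 := le_abs_self CS
  have l8 := le_abs_self CA
  have hK : 2000 ≤ K := by linarith
  have hα0 : 0 < α := by linarith
  obtain ⟨d₀, hd₀⟩ := Filter.eventually_atTop.1
    ((DiagGeometry.sgdScale_eventually (α := α) (K := K) hp haLo).and
      ((DiagGeometry.adamScale_eventually (α := α) (K := K) hα0).and
        (Filter.eventually_ge_atTop 100)))
  have hK0 : 0 < K := by linarith
  -- No logarithms are lost, so their power is `0`. The exponent `κ = 1 / 2` comes from the total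
  -- failure probability `10 / d`, at most `1 / √d` once `d ≥ 100`.
  refine ⟨1 / 2, by norm_num, min (min (aLo ^ 2 / 8) (1 / 12100)) (1 / (8 * K ^ 2)),
    by positivity, 5 + 2 * K ^ 2 + K ^ 7, by positivity, 0, d₀, ?_⟩
  intro d hd m X Y hXY ε ηS σS hε0 hε hηS0 hηS hσS0 hσS ηA ξ σA hηA0 hηA hξ0 hξ hσA0 hσA
    Ω _ μ _ wS wA bS bA BS BA hwS hwA hBS hBA WS WA hWS hWA Lbar hLbar
  obtain ⟨hS, hA, h100⟩ := hd₀ d hd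
  have hdpos : (0 : ℝ) < d := hS.cast_pos
  have h100' : (100 : ℝ) ≤ d := by exact_mod_cast h100
  generalize hc : min (min (aLo ^ 2 / 8) (1 / 12100)) (1 / (8 * K ^ 2)) = c
  have hc1 : c ≤ aLo ^ 2 / 8 := hc ▸ (min_le_left _ _).trans (min_le_left _ _)
  have hc2 : c ≤ 1 / 12100 := hc ▸ (min_le_left _ _).trans (min_le_right _ _)
  have hc3 : c ≤ 1 / (8 * K ^ 2) := hc ▸ min_le_right _ _
  have hsgd := DiagGeometry.sgdm_whp (C := CS) hαS hβ haLo hK (by linarith) (by linarith)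
    (by linarith) hS hXY hε0 hε hηS0 hηS hσS0 hσS hwS hBS
  have hadam := DiagGeometry.adam_whp (K := K) (C := CA) hp hαS hβ₁ haLo (by linarith)
    (by linarith) (by linarith) (by linarith) (by linarith) (by linarith) (by linarith) hA hXY
    hηA0 hηA hξ0 hξ hσA0 hσA hwA hBA
  have hlog : 0 ≤ Real.log d := by linarith [hS.log_le]
  have hdp : (0 : ℝ) < (d : ℝ) ^ p := by positivity
  have hKsq : 0 < K ^ 2 := by positivity
  have hK7 : 0 < K ^ 7 := by positivity
  refine (ENNReal.le_ofReal_iff_toReal_le (MeasureTheory.measure_ne_top μ _)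
    (by positivity)).2 ?_
  change μ.real _ ≤ _
  -- A union bound over the two algorithms, so their joint distribution does not matter. The
  -- comparison at equal loss follows from the two bounds on the intervals.
  refine le_trans (MeasureTheory.measureReal_mono ?_)
    ((DiagGeometry.measureReal_not_and_le _ _).trans ((add_le_add hsgd hadam).trans ?_))
  · intro ω hω hgood
    apply hω
    obtain ⟨⟨t₁, t₂, h12, ⟨a1, a2⟩, a3, a4⟩, ⟨n₁, n₂, h34, ⟨b1, b2⟩, b3, b4⟩⟩ := hgood
    rw [← hWS] at a1 a2 a3 a4
    rw [← hWA] at b1 b2 b3 b4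
    have hR : ∀ t ∈ Set.Icc t₁ t₂,
        c * Real.log d ≤ DiagGeometry.RMed1 (DiagGeometry.loss X Y) (WS ω t) ∧
        c * Real.log d ≤ DiagGeometry.RMed2 (DiagGeometry.loss X Y) (WS ω t) := fun t ht => by
      have : c * Real.log d ≤ 1 / 12100 * Real.log d := by gcongr
      exact ⟨this.trans (a4 t ht).1, this.trans (a4 t ht).2⟩
    have hRA : ∀ t' ∈ Set.Icc n₁ n₂,
        |DiagGeometry.RMed1 (DiagGeometry.loss X Y) (WA ω t') - 1| ≤
          (5 + 2 * K ^ 2 + K ^ 7) * Real.log d ^ 0 *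
            (ηA ^ (1 / 4 : ℝ) + 1 / (d : ℝ) ^ (α / 2 - 1 / 4)) ∧
        |DiagGeometry.RMed2 (DiagGeometry.loss X Y) (WA ω t') - 1| ≤
          (5 + 2 * K ^ 2 + K ^ 7) * Real.log d ^ 0 *
            (ηA ^ (1 / 4 : ℝ) + 1 / (d : ℝ) ^ (α / 2 - 1 / 4)) := fun t ht => by
      have h1 : 0 ≤ ηA ^ (1 / 4 : ℝ) := by positivity
      have h2 : 0 ≤ 1 / (d : ℝ) ^ (α / 2 - 1 / 4) := by positivity
      have h3 : K ^ 7 * (1 / (d : ℝ) ^ (α / 2 - 1 / 4)) ≤ (5 + 2 * K ^ 2 + K ^ 7)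
          * Real.log d ^ 0 * (ηA ^ (1 / 4 : ℝ) + 1 / (d : ℝ) ^ (α / 2 - 1 / 4)) := by
        rw [pow_zero, mul_one]
        exact mul_le_mul (by linarith) (by linarith) h2 (by positivity)
      exact ⟨(b4 t ht).1.trans h3, (b4 t ht).2.trans h3⟩
    subst hLbar
    refine ⟨t₁, t₂, n₁, n₂, h12, h34, ⟨le_trans ?_ a1, a2.trans ?_⟩, a3.trans ?_,
      ⟨le_trans ?_ b1, b2.trans ?_⟩, b3.trans ?_, hR, hRA,
      fun t ht t' ht' _ => ⟨hR t ht, hRA t' ht'⟩⟩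
    · gcongr
    · gcongr; linarith
    · rw [pow_zero, mul_one]; gcongr; linarith
    · gcongr
    · gcongr; linarith
    · rw [pow_zero, mul_one]; gcongr; linarith
  · have hsq : √(d : ℝ) * √d = d := Real.mul_self_sqrt hdpos.le
    have h10 : 10 ≤ √(d : ℝ) := by
      rw [Real.le_sqrt (by norm_num) hdpos.le]; linarith
    rw [← Real.sqrt_eq_rpow, ← add_div, div_le_div_iff₀ hdpos (by positivity)]
    have h11 := mul_le_mul_of_nonneg_right h10 (Real.sqrt_nonneg d)
    clear hsgd hadam
    linarith only [h11, hsq]
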